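/- **Conventions.** All vector spaces are over $\mathbb{Q}$, and all graded objects are graded by $\mathbb{Z}_{\ge 0}$. A *graded commutative algebra* $H^*$ satisfies $xy=(-1)^{ij}yx$ for $x\in H^i$, $y\in H^j$; a *DGA* $(\mathcal{A},d)$ is a graded commutative algebra with a differential $d$ of degree $+1$, $d^2=0$, satisfying the graded Leibniz rule. $H^*(\mathcal A)$ denotes its cohomology algebra. A graded algebra or DGA $\mathcal{A}$ is *$(n-1)$-connected* if $\mathcal{A}^0=\mathbb{Q}$ and $\mathcal{A}^k=0$ for $1\le k\le n-1$. A graded commutative algebra $H^*$ is *$m$-dimensional Poincaré* if it is finite dimensional and there is a linear map $\alpha:H^m\to\mathbb{Q}$ such that $H^i\to (H^{m-i})^\vee$, $x\mapsto (y\mapsto\alpha(xy))$, is an isomorphism for all $i$; a DGA is $m$-dimensional Poincaré if its cohomology algebra is. A *minimal Sullivan algebra* is a DGA $\mathcal{M}$ that is free as a graded commutative algebra, $\mathcal{M}\cong\Lambda V$ with $V$ in positive degrees, such that $V$ has a well-ordered homogeneous basis $(v_\alpha)$ with $dv_\alpha$ in the subalgebra generated by $\{v_\beta:\beta<\alpha\}$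 for all $\alpha$, and $\deg v_\alpha\le\deg v_\beta$ whenever $\alpha\le\beta$. For a graded vector space $V$, let $\mathcal{G}^kV$ be the quotient of $V^{\otimes k}$ by the relations of graded commutativity. For a graded commutative algebra $H^*$, let $E^*\subseteq\mathcal{G}^2H^*$ be the kernel of the product map $\mathcal{G}^2H^*\to H^*$, and let $\mathcal{B}^*(H^*)\subseteq\mathcal{G}^2E^*$ be the kernel of the symmetrisation map $\mathcal{G}^2E^*\to\mathcal{G}^4H^*$, $(xy)(zw)\mapsto xyzw$. An algebra isomorphism $G:H^*\to H'^*$ (preserving degrees) induces $G:\mathcal{B}^*(H^*)\to\mathcal{B}^*(H'^*)$. For a DGA $\mathcal{A}$ with closed subspace $\mathcal{Z}^*=\ker d$, write $E^*$ and $\mathcal{B}^*(\mathcal{A})$ for the spaces above with $H^*=H^*(\mathcal{A})$. Choose a degree-preserving linear right inverse $\alpha:H^*(\mathcal{A})\to\mathcal{Z}^*$ of the projection to cohomology; let $\alpha^2:\mathcal{G}^2H^*(\mathcal{A})\to\mathcal{Z}^*$ be given by $xy\mapsto\alpha(x)\alpha(y)$, and choose a linear map $\gamma:E^*\to\mathcal{A}^{*-1}$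 with $d\gamma=\alpha^2$ on $E^*$. The map $\mathcal{G}^2E^*\to\mathcal{A}^{*-1}$ given for $e\in E^p$ and $e'\in E^q$ by $ee'\mapsto\frac12\big(\gamma(e)\alpha^2(e')+(-1)^{pq}\gamma(e')\alpha^2(e)\big)$ takes closed values on $\mathcal{B}^*(\mathcal{A})$. The induced linear map $\mathcal{F}:\mathcal{B}^*(\mathcal{A})\to H^{*-1}(\mathcal{A})$ does not depend on the choices and is the *Bianchi–Massey tensor* of $\mathcal{A}$. **Theorem 3.1.** Let $n\ge 2$. (i) Let $m\le 5n-2$. For every $(n-1)$-connected $m$-dimensional Poincaré algebra $H^*$ and every linear map $F:\mathcal{B}^{m+1}(H^*)\to H^m$, there exist an $(n-1)$-connected minimal Sullivan algebra $\mathcal{M}$ and an isomorphism of graded algebras $e:H^*(\mathcal{M})\to H^*$ that carries the Bianchi–Massey tensor $\mathcal{F}:\mathcal{B}^{m+1}(\mathcal{M})\to H^m(\mathcal{M})$ to $F$, i.e. $e\circ\mathcal{F}=F\circ e$ on $\mathcal{B}^{m+1}(\mathcal{M})$. (ii) Let $m\le 5n-3$. Let $\mathcal{M}_1$ and $\mathcal{M}_2$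 be $(n-1)$-connected $m$-dimensional Poincaré minimal Sullivan algebras with Bianchi–Massey tensors $\mathcal{F}_1$ and $\mathcal{F}_2$, and let $G:H^*(\mathcal{M}_1)\to H^*(\mathcal{M}_2)$ be an isomorphism of graded algebras. Then there is a DGA isomorphism $\phi:\mathcal{M}_1\to\mathcal{M}_2$ with induced map $\phi_\#=G$ on cohomology if and only if $G\circ\mathcal{F}_1=\mathcal{F}_2\circ G$ as maps $\mathcal{B}^{m+1}(\mathcal{M}_1)\to H^m(\mathcal{M}_2)$. -/

import Mathlib

open scoped TensorProduct

universe u v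

/-! ## Graded commutative algebras over `ℚ` -/

/-- A (non-negatively) graded algebra `H = ⨁ Hⁱ` over `ℚ` that is graded commutative:
`x y = (-1)^{ij} y x` for `x ∈ Hⁱ`, `y ∈ Hʲ`. -/
structure GCAlg where
  carrier : Type u
  [ring : Ring carrier]
  [algebra : Algebra ℚ carrier]
  deg : ℕ → Submodule ℚ carrier
  [graded : GradedAlgebra deg]
  comm : ∀ {i j : ℕ} {x y : carrier}, x ∈ deg i → y ∈ deg j →
    x * y = (-1 : ℚ) ^ (i * j) • (y * x)

attribute [instance] GCAlg.ring GCAlg.algebra GCAlg.graded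

namespace GCAlg

/-- `H` is `j`-connected: `H⁰ = ℚ` and `Hᵏ = 0` for `1 ≤ k ≤ j`. -/
def IsConnected (H : GCAlg.{u}) (j : ℕ) : Prop :=
  Nontrivial H.carrier ∧ H.deg 0 = Submodule.span ℚ {1} ∧
    ∀ k, 1 ≤ k → k ≤ j → H.deg k = ⊥

/-- The map `α ∩ : Hⁱ → (Hʲ)^∨`, `x ↦ (y ↦ α (x y))`, for `α ∈ (Hᵐ)^∨` and `i + j = m`. -/
def cap (H : GCAlg.{u}) {m : ℕ} (α : H.deg m →ₗ[ℚ] ℚ) {i j : ℕ} (h : i + j = m) :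
    H.deg i →ₗ[ℚ] H.deg j →ₗ[ℚ] ℚ :=
  LinearMap.mk₂ ℚ
    (fun x y => α ⟨(x : H.carrier) * y, h ▸ SetLike.mul_mem_graded x.2 y.2⟩)
    (fun x x' y => by rw [← map_add]; congr 1; ext; simp [add_mul])
    (fun c x y => by rw [← map_smul]; congr 1; ext; simp)
    (fun x y y' => by rw [← map_add]; congr 1; ext; simp [mul_add])
    (fun c x y => by rw [← map_smul]; congr 1; ext; simp)

/-- `α ∈ (Hᵐ)^∨` is a Poincaré class: `α ∩ : Hⁱ → (H^{m-i})^∨` is an isomorphism for all `i`.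
For `i > m` the target is zero, so the condition says `Hⁱ = 0`. -/
def IsPoincareClass (H : GCAlg.{u}) {m : ℕ} (α : H.deg m →ₗ[ℚ] ℚ) : Prop :=
  (∀ (i j : ℕ) (h : i + j = m), Function.Bijective (H.cap α h)) ∧
    ∀ i, m < i → H.deg i = ⊥

/-- `H` is `m`-dimensional Poincaré: finite dimensional, and it has a Poincaré class. -/
def IsPoincare (H : GCAlg.{u}) (m : ℕ) : Prop :=
  FiniteDimensional ℚ H.carrier ∧ ∃ α : H.deg m →ₗ[ℚ] ℚ, H.IsPoincareClass α

/-- Homomorphisms of graded algebras. -/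
structure Hom (H : GCAlg.{u}) (K : GCAlg.{v}) extends H.carrier →ₐ[ℚ] K.carrier where
  map_deg : ∀ {i : ℕ} {x : H.carrier}, x ∈ H.deg i → toFun x ∈ K.deg i

/-- Isomorphisms of graded algebras. -/
structure Iso (H : GCAlg.{u}) (K : GCAlg.{v}) extends H.carrier ≃ₐ[ℚ] K.carrier where
  map_deg_iff : ∀ {i : ℕ} {x : H.carrier}, toFun x ∈ K.deg i ↔ x ∈ H.deg i

/-- The homomorphism underlying an isomorphism. -/
def Iso.hom {H : GCAlg.{u}} {K : GCAlg.{v}} (f : Iso H K) : Hom H K where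
  toAlgHom := f.toAlgEquiv.toAlgHom
  map_deg := fun hx => f.map_deg_iff.2 hx

/-- The degree `k` component of a homomorphism of graded algebras. -/
def Hom.degMap {H : GCAlg.{u}} {K : GCAlg.{v}} (f : Hom H K) (k : ℕ) :
    H.deg k →ₗ[ℚ] K.deg k :=
  f.toAlgHom.toLinearMap.restrict fun _ hx => f.map_deg hx

/-- The sign involution `ε`, acting as `(-1)ⁱ` on `Hⁱ`. -/
def sgn (H : GCAlg.{u}) : H.carrier →ₗ[ℚ] H.carrier :=
  (DirectSum.toModule ℚ ℕ H.carrier fun i => ((-1 : ℚ) ^ i) • (H.deg i).subtype) ∘ₗ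
    (DirectSum.decomposeLinearEquiv H.deg).toLinearMap

theorem sgn_of_mem (H : GCAlg.{u}) {i : ℕ} {x : H.carrier} (hx : x ∈ H.deg i) :
    H.sgn x = (-1 : ℚ) ^ i • x := by
  simp [sgn, DirectSum.decompose_of_mem _ hx, ← DirectSum.lof_eq_of ℚ,
    DirectSum.decomposeLinearEquiv_apply]

end GCAlg

/-! ## Differential graded algebras and their cohomology -/

/-- A (graded commutative) differential graded algebra over `ℚ`. -/
structure DGA extends GCAlg.{u} where
  d : carrier →ₗ[ℚ] carrier
  d_mem : ∀ {i : ℕ} {x : carrier}, x ∈ deg i → d x ∈ deg (i + 1)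
  d_d : ∀ x : carrier, d (d x) = 0
  leibniz : ∀ {i : ℕ} {x : carrier} (y : carrier), x ∈ deg i →
    d (x * y) = d x * y + (-1 : ℚ) ^ i • (x * d y)

namespace DGA

variable (A : DGA.{u})

theorem leibniz_sgn (x y : A.carrier) : A.d (x * y) = A.d x * y + A.sgn x * A.d y := by
  induction x using DirectSum.Decomposition.inductionOn A.deg with
  | zero => simp
  | homogeneous x => rw [A.leibniz y x.2, A.sgn_of_mem x.2, smul_mul_assoc]
  | add a b ha hb => simp only [add_mul, map_add, ha, hb]; abel

theorem d_sgn (x : A.carrier) : A.d (A.sgn x) = -A.sgn (A.d x) := by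
  induction x using DirectSum.Decomposition.inductionOn A.deg with
  | zero => simp
  | homogeneous x =>
    rw [A.sgn_of_mem x.2, A.sgn_of_mem (A.d_mem x.2), map_smul, pow_succ]; simp
  | add a b ha hb => simp only [map_add, ha, hb]; abel

theorem sgn_sgn (x : A.carrier) : A.sgn (A.sgn x) = x := by
  induction x using DirectSum.Decomposition.inductionOn A.deg with
  | zero => simp
  | homogeneous x =>
    rw [A.sgn_of_mem x.2, map_smul, A.sgn_of_mem x.2, smul_smul, ← mul_pow]; simp
  | add a b ha hb => simp only [map_add, ha, hb]

theorem d_one : A.d 1 = 0 := by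
  have h := A.leibniz (1 : A.carrier) (SetLike.one_mem_graded A.deg)
  simpa using h

/-- `d` commutes with the projections to the homogeneous components. -/
theorem proj_d (x : A.carrier) (i : ℕ) :
    GradedAlgebra.proj A.deg (i + 1) (A.d x) = A.d (GradedAlgebra.proj A.deg i x) := by
  induction x using DirectSum.Decomposition.inductionOn A.deg with
  | zero => simp
  | @homogeneous j x =>
    simp only [GradedAlgebra.proj_apply]
    by_cases h : j = i
    · subst h
      rw [DirectSum.decompose_of_mem_same _ x.2, DirectSum.decompose_of_mem_same _ (A.d_mem x.2)]
    · rw [DirectSum.decompose_of_mem_ne _ x.2 h,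
        DirectSum.decompose_of_mem_ne _ (A.d_mem x.2) (by omega), map_zero]
  | add a b ha hb => simp only [map_add, ha, hb]

theorem proj_zero_d (x : A.carrier) : GradedAlgebra.proj A.deg 0 (A.d x) = 0 := by
  induction x using DirectSum.Decomposition.inductionOn A.deg with
  | zero => simp
  | homogeneous x =>
    rw [GradedAlgebra.proj_apply, DirectSum.decompose_of_mem_ne _ (A.d_mem x.2) (by omega)]
  | add a b ha hb => simp only [map_add, ha, hb, add_zero]

/-- The subalgebra `Z = ker d` of closed elements. -/
def closed : Subalgebra ℚ A.carrier where
  carrier := {x | A.d x = 0}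
  mul_mem' {x y} hx hy := by
    simp only [Set.mem_ofPred_eq] at *
    rw [leibniz_sgn, hx, hy]; simp
  add_mem' {x y} hx hy := by
    simp only [Set.mem_ofPred_eq] at *
    rw [map_add, hx, hy, add_zero]
  algebraMap_mem' c := by
    simp only [Set.mem_ofPred_eq]
    rw [Algebra.algebraMap_eq_smul_one, map_smul, A.d_one, smul_zero]

theorem mem_closed {x : A.carrier} : x ∈ A.closed ↔ A.d x = 0 := Iff.rfl

/-- The two-sided ideal of exact elements in the algebra of closed elements. -/
def exact : Ideal A.closed where
  carrier := {z | ∃ y, A.d y = z}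
  zero_mem' := ⟨0, by simp⟩
  add_mem' := by
    rintro a b ⟨y, hy⟩ ⟨y', hy'⟩
    exact ⟨y + y', by simp [hy, hy']⟩
  smul_mem' := by
    rintro c x ⟨y, hy⟩
    have hc : A.d (c : A.carrier) = 0 := c.2
    refine ⟨A.sgn c * y, ?_⟩
    rw [leibniz_sgn, d_sgn, hc, sgn_sgn, hy]; simp

theorem mem_exact {z : A.closed} : z ∈ A.exact ↔ ∃ y, A.d y = z := Iff.rfl

instance : A.exact.IsTwoSided where
  mul_mem_of_left := by
    rintro a b ⟨y, hy⟩
    have hb : A.d (b : A.carrier) = 0 := b.2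
    refine ⟨y * b, ?_⟩
    rw [leibniz_sgn, hb, hy]; simp

/-- The underlying algebra `ker d / im d` of the cohomology. -/
abbrev Coh : Type u := A.closed ⧸ A.exact

/-- The quotient map onto `ker d / im d`. -/
def cls : A.closed →ₐ[ℚ] A.Coh := Ideal.Quotient.mkₐ ℚ A.exact

theorem cls_surjective : Function.Surjective A.cls := Ideal.Quotient.mkₐ_surjective ℚ A.exact

theorem cls_eq_zero {z : A.closed} : A.cls z = 0 ↔ ∃ y, A.d y = z := by
  rw [← A.mem_exact]; exact Ideal.Quotient.eq_zero_iff_mem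

/-- The degree `k` part of the cohomology: classes of closed elements of degree `k`. -/
def cohDeg (k : ℕ) : Submodule ℚ A.Coh :=
  ((A.deg k).comap A.closed.val.toLinearMap).map A.cls.toLinearMap

theorem mem_cohDeg {k : ℕ} {x : A.Coh} :
    x ∈ A.cohDeg k ↔ ∃ z : A.closed, (z : A.carrier) ∈ A.deg k ∧ A.cls z = x := Iff.rfl

/-- The homogeneous components of a closed element are closed. -/
def closedProj (k : ℕ) (z : A.closed) : A.closed :=
  ⟨GradedAlgebra.proj A.deg k (z : A.carrier), by
    have hz : A.d (z : A.carrier) = 0 := z.2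
    rw [mem_closed, ← proj_d, hz, map_zero]⟩

theorem closedProj_mem (k : ℕ) (z : A.closed) :
    (A.closedProj k z : A.carrier) ∈ A.deg k := by
  simp [closedProj, GradedAlgebra.proj_apply]

theorem sum_closedProj (z : A.closed) :
    ∃ s : Finset ℕ, ∑ k ∈ s, A.closedProj k z = z := by
  classical
  refine ⟨(DirectSum.decompose A.deg (z : A.carrier)).support, Subtype.ext ?_⟩
  rw [AddSubmonoidClass.coe_finsetSum]
  exact DirectSum.sum_support_decompose A.deg (z : A.carrier)

theorem coh_isInternal : DirectSum.IsInternal A.cohDeg := by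
  classical
  apply DirectSum.isInternal_submodule_of_iSupIndep_of_iSup_eq_top
  · rw [iSupIndep_iff_finsetSum_eq_zero_imp_eq_zero]
    intro s x hx hsum i hi
    choose! z hz hzx using fun i hi => A.mem_cohDeg.1 (hx i hi)
    have h0 : A.cls (∑ j ∈ s, z j) = 0 := by
      rw [map_sum, ← hsum]; exact Finset.sum_congr rfl fun j hj => hzx j hj
    obtain ⟨y, hy⟩ := A.cls_eq_zero.1 h0
    rw [← hzx i hi, A.cls_eq_zero]
    have hp : GradedAlgebra.proj A.deg i (A.d y) = z i := by
      rw [hy, AddSubmonoidClass.coe_finsetSum, map_sum, Finset.sum_eq_single i]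
      · rw [GradedAlgebra.proj_apply, DirectSum.decompose_of_mem_same _ (hz i hi)]
      · intro j hj hji
        rw [GradedAlgebra.proj_apply, DirectSum.decompose_of_mem_ne _ (hz j hj) hji]
      · exact fun h => absurd hi h
    cases i with
    | zero => exact ⟨0, by rw [← hp, proj_zero_d, map_zero]⟩
    | succ i => exact ⟨GradedAlgebra.proj A.deg i y, by rw [← hp, proj_d]⟩
  · rw [eq_top_iff]
    intro x _
    obtain ⟨z, rfl⟩ := A.cls_surjective x
    obtain ⟨s, hs⟩ := A.sum_closedProj z
    rw [← hs, map_sum]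
    exact Submodule.sum_mem _ fun k _ => Submodule.mem_iSup_of_mem k
      (A.mem_cohDeg.2 ⟨_, A.closedProj_mem k z, rfl⟩)

instance cohGradedMonoid : SetLike.GradedMonoid A.cohDeg where
  one_mem := A.mem_cohDeg.2 ⟨1, SetLike.one_mem_graded A.deg, map_one _⟩
  mul_mem := by
    rintro i j _ _ ⟨x, hx, rfl⟩ ⟨y, hy, rfl⟩
    exact A.mem_cohDeg.2 ⟨x * y, SetLike.mul_mem_graded hx hy, map_mul _ _ _⟩

/-- The cohomology algebra `H(A) = ker d / im d` of a DGA, a graded commutative algebra. -/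
noncomputable def cohomology : GCAlg.{u} where
  carrier := A.Coh
  deg := A.cohDeg
  graded := A.coh_isInternal.gradedAlgebra
  comm := by
    rintro i j _ _ ⟨x, hx, rfl⟩ ⟨y, hy, rfl⟩
    have h : x * y = (-1 : ℚ) ^ (i * j) • (y * x) := Subtype.ext (A.comm hx hy)
    have h' := congrArg A.cls h
    rw [map_smul, map_mul, map_mul] at h'
    exact h'

/-- The projection `Z → H(A)`, `z ↦ [z]`, from closed elements to cohomology classes. -/
noncomputable def toCoh : A.closed →ₐ[ℚ] A.cohomology.carrier := A.cls

theorem toCoh_surjective : Function.Surjective A.toCoh := A.cls_surjective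

theorem toCoh_eq_zero {z : A.closed} : A.toCoh z = 0 ↔ ∃ y, A.d y = z := A.cls_eq_zero

theorem mem_cohomology_deg {k : ℕ} {x : A.cohomology.carrier} :
    x ∈ A.cohomology.deg k ↔ ∃ z : A.closed, (z : A.carrier) ∈ A.deg k ∧ A.toCoh z = x := Iff.rfl

/-- Homomorphisms of DGAs. -/
structure Hom (A : DGA.{u}) (B : DGA.{v}) extends GCAlg.Hom A.toGCAlg B.toGCAlg where
  map_d : ∀ x : A.carrier, toFun (A.d x) = B.d (toFun x)

/-- Isomorphisms of DGAs. -/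
structure Iso (A : DGA.{u}) (B : DGA.{v}) extends GCAlg.Iso A.toGCAlg B.toGCAlg where
  map_d : ∀ x : A.carrier, toFun (A.d x) = B.d (toFun x)

/-- The homomorphism underlying an isomorphism. -/
def Iso.hom {A : DGA.{u}} {B : DGA.{v}} (f : Iso A B) : Hom A B where
  toHom := f.toIso.hom
  map_d := f.map_d

/-- The restriction of a DGA homomorphism to closed elements. -/
def Hom.closedMap {A : DGA.{u}} {B : DGA.{v}} (f : Hom A B) : A.closed →ₐ[ℚ] B.closed :=
  (f.toAlgHom.comp A.closed.val).codRestrict B.closed fun z => by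
    have hz : A.d (z : A.carrier) = 0 := z.2
    have h : f.toAlgHom (A.d (z : A.carrier)) = B.d (f.toAlgHom (z : A.carrier)) := f.map_d z
    rw [hz, map_zero] at h
    exact h.symm

/-- The homomorphism `φ_#` induced by a DGA homomorphism `φ` on cohomology, `[z] ↦ [φ z]`. -/
noncomputable def Hom.cohMap {A : DGA.{u}} {B : DGA.{v}} (f : Hom A B) :
    GCAlg.Hom A.cohomology B.cohomology where
  toAlgHom := Ideal.Quotient.liftₐ A.exact (B.cls.comp f.closedMap) (by
    rintro z ⟨y, hy⟩
    refine B.cls_eq_zero.2 ⟨f.toAlgHom y, ?_⟩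
    have h : f.toAlgHom (A.d y) = B.d (f.toAlgHom y) := f.map_d y
    rw [← h, hy]; rfl)
  map_deg := by
    rintro i _ ⟨z, hz, rfl⟩
    exact B.mem_cohDeg.2 ⟨f.closedMap z, f.map_deg hz, rfl⟩

end DGA

/-! ## Graded symmetric powers -/

section GradedPowers

variable {V : Type u} [AddCommGroup V] [Module ℚ V] (𝒱 : ℕ → Submodule ℚ V)

/-- The relations of graded symmetry in `V ⊗ V`. -/
def G2Rel : Submodule ℚ (V ⊗[ℚ] V) :=
  Submodule.span ℚ {t | ∃ i j, ∃ x ∈ 𝒱 i, ∃ y ∈ 𝒱 j,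
    t = x ⊗ₜ[ℚ] y - (-1 : ℚ) ^ (i * j) • (y ⊗ₜ[ℚ] x)}

/-- The graded symmetric square `𝒢²V` of a graded vector space `V = ⨁ 𝒱 i`. -/
abbrev G2 : Type u := (V ⊗[ℚ] V) ⧸ G2Rel 𝒱

/-- The product `V × V → 𝒢²V`. -/
def G2.mk : V →ₗ[ℚ] V →ₗ[ℚ] G2 𝒱 :=
  (TensorProduct.mk ℚ V V).compr₂ (G2Rel 𝒱).mkQ

/-- The grading of `𝒢²V`: degree `k` is spanned by the `x y` with `deg x + deg y = k`. -/
def G2.deg (k : ℕ) : Submodule ℚ (G2 𝒱) :=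
  Submodule.span ℚ {t | ∃ i j, i + j = k ∧ ∃ x ∈ 𝒱 i, ∃ y ∈ 𝒱 j, t = G2.mk 𝒱 x y}

theorem G2.mk_comm {i j : ℕ} {x y : V} (hx : x ∈ 𝒱 i) (hy : y ∈ 𝒱 j) :
    G2.mk 𝒱 x y = (-1 : ℚ) ^ (i * j) • G2.mk 𝒱 y x := by
  rw [← sub_eq_zero]
  change (G2Rel 𝒱).mkQ (x ⊗ₜ[ℚ] y - (-1 : ℚ) ^ (i * j) • (y ⊗ₜ[ℚ] x)) = 0
  rw [Submodule.mkQ_apply, Submodule.Quotient.mk_eq_zero]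
  exact Submodule.subset_span ⟨i, j, x, hx, y, hy, rfl⟩

/-- The linear map `𝒢²V → W` induced by a graded symmetric bilinear map. -/
def G2.lift {W : Type v} [AddCommGroup W] [Module ℚ W] (f : V →ₗ[ℚ] V →ₗ[ℚ] W)
    (hf : ∀ i j, ∀ x ∈ 𝒱 i, ∀ y ∈ 𝒱 j, f x y = (-1 : ℚ) ^ (i * j) • f y x) :
    G2 𝒱 →ₗ[ℚ] W :=
  (G2Rel 𝒱).liftQ (TensorProduct.lift f) (by
    rw [G2Rel, Submodule.span_le]
    rintro _ ⟨i, j, x, hx, y, hy, rfl⟩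
    simp [hf i j x hx y hy])

@[simp]
theorem G2.lift_mk {W : Type v} [AddCommGroup W] [Module ℚ W] (f : V →ₗ[ℚ] V →ₗ[ℚ] W)
    (hf : ∀ i j, ∀ x ∈ 𝒱 i, ∀ y ∈ 𝒱 j, f x y = (-1 : ℚ) ^ (i * j) • f y x) (x y : V) :
    G2.lift 𝒱 f hf (G2.mk 𝒱 x y) = f x y := rfl

theorem G2.hom_ext {W : Type v} [AddCommGroup W] [Module ℚ W] {f g : G2 𝒱 →ₗ[ℚ] W}
    (h : ∀ x y, f (G2.mk 𝒱 x y) = g (G2.mk 𝒱 x y)) : f = g := by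
  apply Submodule.linearMap_qext
  exact TensorProduct.ext' h

/-- The map `𝒢²V → 𝒢²W` induced by a degree preserving linear map `V → W`. -/
def G2.map {W : Type v} [AddCommGroup W] [Module ℚ W] (𝒲 : ℕ → Submodule ℚ W)
    (f : V →ₗ[ℚ] W) (hf : ∀ i, ∀ x ∈ 𝒱 i, f x ∈ 𝒲 i) : G2 𝒱 →ₗ[ℚ] G2 𝒲 :=
  G2.lift 𝒱 ((G2.mk 𝒲).compl₁₂ f f) fun i j x hx y hy =>
    G2.mk_comm 𝒲 (hf i x hx) (hf j y hy)

@[simp]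
theorem G2.map_mk {W : Type v} [AddCommGroup W] [Module ℚ W] (𝒲 : ℕ → Submodule ℚ W)
    (f : V →ₗ[ℚ] W) (hf : ∀ i, ∀ x ∈ 𝒱 i, f x ∈ 𝒲 i) (x y : V) :
    G2.map 𝒱 𝒲 f hf (G2.mk 𝒱 x y) = G2.mk 𝒲 (f x) (f y) := rfl

theorem G2.map_mem {W : Type v} [AddCommGroup W] [Module ℚ W] (𝒲 : ℕ → Submodule ℚ W)
    (f : V →ₗ[ℚ] W) (hf : ∀ i, ∀ x ∈ 𝒱 i, f x ∈ 𝒲 i) (k : ℕ) :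
    ∀ t ∈ G2.deg 𝒱 k, G2.map 𝒱 𝒲 f hf t ∈ G2.deg 𝒲 k := by
  intro t ht
  have : G2.deg 𝒱 k ≤ (G2.deg 𝒲 k).comap (G2.map 𝒱 𝒲 f hf) := by
    rw [G2.deg, Submodule.span_le]
    rintro _ ⟨i, j, hij, x, hx, y, hy, rfl⟩
    exact Submodule.subset_span ⟨i, j, hij, _, hf i x hx, _, hf j y hy, rfl⟩
  exact this ht

/-- The relations of graded symmetry in `V^{⊗4}`, generated by transpositions of
neighbouring factors. -/
def G4Rel : Submodule ℚ ((V ⊗[ℚ] V) ⊗[ℚ] (V ⊗[ℚ] V)) :=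
  Submodule.span ℚ
    ({t | ∃ i j, ∃ x ∈ 𝒱 i, ∃ y ∈ 𝒱 j, ∃ z w : V,
        t = (x ⊗ₜ[ℚ] y) ⊗ₜ[ℚ] (z ⊗ₜ[ℚ] w) -
          (-1 : ℚ) ^ (i * j) • ((y ⊗ₜ[ℚ] x) ⊗ₜ[ℚ] (z ⊗ₜ[ℚ] w))} ∪
     {t | ∃ j k, ∃ y ∈ 𝒱 j, ∃ z ∈ 𝒱 k, ∃ x w : V,
        t = (x ⊗ₜ[ℚ] y) ⊗ₜ[ℚ] (z ⊗ₜ[ℚ] w) -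
          (-1 : ℚ) ^ (j * k) • ((x ⊗ₜ[ℚ] z) ⊗ₜ[ℚ] (y ⊗ₜ[ℚ] w))} ∪
     {t | ∃ k l, ∃ z ∈ 𝒱 k, ∃ w ∈ 𝒱 l, ∃ x y : V,
        t = (x ⊗ₜ[ℚ] y) ⊗ₜ[ℚ] (z ⊗ₜ[ℚ] w) -
          (-1 : ℚ) ^ (k * l) • ((x ⊗ₜ[ℚ] y) ⊗ₜ[ℚ] (w ⊗ₜ[ℚ] z))})

/-- The fourth graded symmetric power `𝒢⁴V`. -/
abbrev G4 : Type u := ((V ⊗[ℚ] V) ⊗[ℚ] (V ⊗[ℚ] V)) ⧸ G4Rel 𝒱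

/-- The product `x y z w ∈ 𝒢⁴V`. -/
def G4.mk (x y z w : V) : G4 𝒱 := (G4Rel 𝒱).mkQ ((x ⊗ₜ[ℚ] y) ⊗ₜ[ℚ] (z ⊗ₜ[ℚ] w))

theorem G4.swap12 {i j : ℕ} {x y : V} (hx : x ∈ 𝒱 i) (hy : y ∈ 𝒱 j) (z w : V) :
    G4.mk 𝒱 x y z w = (-1 : ℚ) ^ (i * j) • G4.mk 𝒱 y x z w := by
  rw [← sub_eq_zero, G4.mk, G4.mk, ← map_smul, ← map_sub, Submodule.mkQ_apply,
    Submodule.Quotient.mk_eq_zero]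
  exact Submodule.subset_span (Or.inl (Or.inl ⟨i, j, x, hx, y, hy, z, w, rfl⟩))

theorem G4.swap23 {j k : ℕ} {y z : V} (hy : y ∈ 𝒱 j) (hz : z ∈ 𝒱 k) (x w : V) :
    G4.mk 𝒱 x y z w = (-1 : ℚ) ^ (j * k) • G4.mk 𝒱 x z y w := by
  rw [← sub_eq_zero, G4.mk, G4.mk, ← map_smul, ← map_sub, Submodule.mkQ_apply,
    Submodule.Quotient.mk_eq_zero]
  exact Submodule.subset_span (Or.inl (Or.inr ⟨j, k, y, hy, z, hz, x, w, rfl⟩))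

theorem G4.swap34 {k l : ℕ} {z w : V} (hz : z ∈ 𝒱 k) (hw : w ∈ 𝒱 l) (x y : V) :
    G4.mk 𝒱 x y z w = (-1 : ℚ) ^ (k * l) • G4.mk 𝒱 x y w z := by
  rw [← sub_eq_zero, G4.mk, G4.mk, ← map_smul, ← map_sub, Submodule.mkQ_apply,
    Submodule.Quotient.mk_eq_zero]
  exact Submodule.subset_span (Or.inr ⟨k, l, z, hz, w, hw, x, y, rfl⟩)

/-- The multiplication `𝒢²V × 𝒢²V → 𝒢⁴V`, `(x y, z w) ↦ x y z w`. -/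
def G2.mulG4 : G2 𝒱 →ₗ[ℚ] G2 𝒱 →ₗ[ℚ] G4 𝒱 :=
  ((G2Rel 𝒱).liftQ
    ((G2Rel 𝒱).liftQ (TensorProduct.curry (G4Rel 𝒱).mkQ) (by
      rw [G2Rel, Submodule.span_le]
      rintro _ ⟨i, j, x, hx, y, hy, rfl⟩
      rw [SetLike.mem_coe, LinearMap.mem_ker]
      refine TensorProduct.ext' fun z w => ?_
      have h := G4.swap12 𝒱 hx hy z w
      simp only [map_sub, map_smul, LinearMap.sub_apply, LinearMap.smul_apply,
        TensorProduct.curry_apply, LinearMap.zero_apply]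
      exact sub_eq_zero.2 h)).flip (by
    refine Submodule.span_le.2 ?_
    rintro _ ⟨k, l, z, hz, w, hw, rfl⟩
    rw [SetLike.mem_coe, LinearMap.mem_ker]
    apply Submodule.linearMap_qext
    refine TensorProduct.ext' fun x y => ?_
    have h := G4.swap34 𝒱 hz hw x y
    simp only [map_sub, map_smul, LinearMap.sub_apply, LinearMap.smul_apply,
      LinearMap.comp_apply, LinearMap.zero_apply]
    exact sub_eq_zero.2 h)).flip

@[simp]
theorem G2.mulG4_mk (x y z w : V) :
    G2.mulG4 𝒱 (G2.mk 𝒱 x y) (G2.mk 𝒱 z w) = G4.mk 𝒱 x y z w := rfl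

theorem G2.mulG4_comm (p q : ℕ) : ∀ e ∈ G2.deg 𝒱 p, ∀ e' ∈ G2.deg 𝒱 q,
    G2.mulG4 𝒱 e e' = (-1 : ℚ) ^ (p * q) • G2.mulG4 𝒱 e' e := by
  intro e he e' he'
  induction he, he' using Submodule.span_induction₂ with
  | mem_mem a b ha hb =>
    obtain ⟨i, j, rfl, x, hx, y, hy, rfl⟩ := ha
    obtain ⟨k, l, rfl, z, hz, w, hw, rfl⟩ := hb
    rw [G2.mulG4_mk, G2.mulG4_mk, G4.swap23 𝒱 hy hz, G4.swap12 𝒱 hx hz, G4.swap34 𝒱 hy hw,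
      G4.swap23 𝒱 hx hw, smul_smul, smul_smul, smul_smul, ← pow_add, ← pow_add, ← pow_add]
    congr 2; ring
  | zero_left b hb => simp
  | zero_right a ha => simp
  | add_left a b c _ _ _ h1 h2 => simp [h1, h2]
  | add_right a b c _ _ _ h1 h2 => simp [h1, h2]
  | smul_left r a b _ _ h => simp only [map_smul, LinearMap.smul_apply, h]; rw [smul_comm]
  | smul_right r a b _ _ h => simp only [map_smul, LinearMap.smul_apply, h]; rw [smul_comm]

/-- The full graded symmetrisation `𝒢²𝒢²V → 𝒢⁴V`, `(x y)(z w) ↦ x y z w`. -/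
def symmetrise : G2 (G2.deg 𝒱) →ₗ[ℚ] G4 𝒱 :=
  G2.lift (G2.deg 𝒱) (G2.mulG4 𝒱) (G2.mulG4_comm 𝒱)

/-- The map `𝒢⁴V → 𝒢⁴W` induced by a degree preserving linear map `V → W`. -/
def G4.map {W : Type v} [AddCommGroup W] [Module ℚ W] (𝒲 : ℕ → Submodule ℚ W)
    (f : V →ₗ[ℚ] W) (hf : ∀ i, ∀ x ∈ 𝒱 i, f x ∈ 𝒲 i) : G4 𝒱 →ₗ[ℚ] G4 𝒲 :=
  (G4Rel 𝒱).liftQ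
    ((G4Rel 𝒲).mkQ ∘ₗ TensorProduct.map (TensorProduct.map f f) (TensorProduct.map f f)) (by
    rw [G4Rel, Submodule.span_le]
    rintro _ ((⟨i, j, x, hx, y, hy, z, w, rfl⟩ | ⟨i, j, x, hx, y, hy, z, w, rfl⟩) |
      ⟨i, j, x, hx, y, hy, z, w, rfl⟩) <;>
    rw [SetLike.mem_coe, LinearMap.mem_ker, map_sub, map_smul, sub_eq_zero]
    · exact G4.swap12 𝒲 (hf i x hx) (hf j y hy) _ _
    · exact G4.swap23 𝒲 (hf i x hx) (hf j y hy) _ _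
    · exact G4.swap34 𝒲 (hf i x hx) (hf j y hy) _ _)

theorem symmetrise_map {W : Type v} [AddCommGroup W] [Module ℚ W] (𝒲 : ℕ → Submodule ℚ W)
    (f : V →ₗ[ℚ] W) (hf : ∀ i, ∀ x ∈ 𝒱 i, f x ∈ 𝒲 i) (t : G2 (G2.deg 𝒱)) :
    symmetrise 𝒲 (G2.map (G2.deg 𝒱) (G2.deg 𝒲) (G2.map 𝒱 𝒲 f hf) (G2.map_mem 𝒱 𝒲 f hf) t) =
      G4.map 𝒱 𝒲 f hf (symmetrise 𝒱 t) := by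
  have h : (G2.mulG4 𝒲).compl₁₂ (G2.map 𝒱 𝒲 f hf) (G2.map 𝒱 𝒲 f hf) =
      (G2.mulG4 𝒱).compr₂ (G4.map 𝒱 𝒲 f hf) := by
    apply G2.hom_ext
    intro x y
    apply G2.hom_ext
    intro z w
    rfl
  refine LinearMap.congr_fun (f := symmetrise 𝒲 ∘ₗ _) (g := G4.map 𝒱 𝒲 f hf ∘ₗ symmetrise 𝒱)
    (G2.hom_ext _ fun e e' => ?_) t
  exact LinearMap.congr_fun₂ h e e'

end GradedPowers

/-! ## The space `ℬ(H)` -/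

namespace GCAlg

/-- The map `𝒢²H → H` induced by the product of `H`. -/
def cup (H : GCAlg.{u}) : G2 H.deg →ₗ[ℚ] H.carrier :=
  G2.lift H.deg (LinearMap.mul ℚ H.carrier) fun _ _ _ hx _ hy => H.comm hx hy

/-- `E ⊆ 𝒢²H`, the kernel of the product map. -/
def E (H : GCAlg.{u}) : Submodule ℚ (G2 H.deg) := LinearMap.ker H.cup

/-- The grading of `E` inherited from `𝒢²H`. -/
def eDeg (H : GCAlg.{u}) (k : ℕ) : Submodule ℚ H.E := (G2.deg H.deg k).comap H.E.subtype

/-- The map `𝒢²E → 𝒢²𝒢²H` induced by the inclusion `E ⊆ 𝒢²H`. -/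
def g2E (H : GCAlg.{u}) : G2 H.eDeg →ₗ[ℚ] G2 (G2.deg H.deg) :=
  G2.map H.eDeg (G2.deg H.deg) H.E.subtype fun _ _ hx => hx

/-- `ℬ(H) = K[𝒢²E]`, the kernel of the full graded symmetrisation `𝒢²E → 𝒢⁴H`. -/
def B (H : GCAlg.{u}) : Submodule ℚ (G2 H.eDeg) :=
  LinearMap.ker (symmetrise H.deg ∘ₗ H.g2E)

/-- The degree `k` part `ℬᵏ(H)`. -/
def bDeg (H : GCAlg.{u}) (k : ℕ) : Submodule ℚ (G2 H.eDeg) := H.B ⊓ G2.deg H.eDeg k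

section Functoriality

variable {H : GCAlg.{u}} {K : GCAlg.{v}} (f : Hom H K)

/-- The map `𝒢²H → 𝒢²K` induced by a homomorphism `H → K`. -/
def Hom.g2 : G2 H.deg →ₗ[ℚ] G2 K.deg :=
  G2.map H.deg K.deg f.toAlgHom.toLinearMap fun _ _ hx => f.map_deg hx

theorem Hom.cup_g2 (t : G2 H.deg) : K.cup (f.g2 t) = f.toAlgHom (H.cup t) :=
  LinearMap.congr_fun (f := K.cup ∘ₗ f.g2) (g := f.toAlgHom.toLinearMap ∘ₗ H.cup)
    (G2.hom_ext _ fun x y => (map_mul f.toAlgHom x y).symm) t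

/-- The map `E(H) → E(K)` induced by a homomorphism `H → K`. -/
def Hom.eMap : H.E →ₗ[ℚ] K.E :=
  f.g2.restrict fun t ht => by
    have ht' : H.cup t = 0 := ht
    change K.cup (f.g2 t) = 0
    rw [f.cup_g2, ht', map_zero]

theorem Hom.eMap_mem (k : ℕ) : ∀ e ∈ H.eDeg k, f.eMap e ∈ K.eDeg k :=
  fun e he => G2.map_mem H.deg K.deg _ (fun _ _ hx => f.map_deg hx) k (e : G2 H.deg) he

/-- The map `𝒢²E(H) → 𝒢²E(K)` induced by a homomorphism `H → K`. -/
def Hom.g2eMap : G2 H.eDeg →ₗ[ℚ] G2 K.eDeg := G2.map H.eDeg K.eDeg f.eMap f.eMap_mem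

theorem Hom.g2eMap_mem_B {t : G2 H.eDeg} (ht : t ∈ H.B) : f.g2eMap t ∈ K.B := by
  have ht' : symmetrise H.deg (H.g2E t) = 0 := ht
  change symmetrise K.deg (K.g2E (f.g2eMap t)) = 0
  have h : K.g2E (f.g2eMap t) = G2.map (G2.deg H.deg) (G2.deg K.deg) f.g2
      (G2.map_mem H.deg K.deg _ fun _ _ hx => f.map_deg hx) (H.g2E t) :=
    LinearMap.congr_fun (f := K.g2E ∘ₗ f.g2eMap) (g := G2.map (G2.deg H.deg) (G2.deg K.deg) f.g2
      (G2.map_mem H.deg K.deg _ fun _ _ hx => f.map_deg hx) ∘ₗ H.g2E)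
      (G2.hom_ext _ fun e e' => rfl) t
  rw [h]
  exact (symmetrise_map H.deg K.deg _ _ _).trans (by rw [ht', map_zero])

/-- The map `ℬᵏ(H) → ℬᵏ(K)` induced by a homomorphism `H → K`. -/
def Hom.bMap (k : ℕ) : H.bDeg k →ₗ[ℚ] K.bDeg k :=
  f.g2eMap.restrict fun t ht =>
    ⟨f.g2eMap_mem_B ht.1, G2.map_mem H.eDeg K.eDeg _ f.eMap_mem k t ht.2⟩

end Functoriality

end GCAlg

/-! ## The Bianchi–Massey tensor -/

namespace DGA

/-- A degree preserving linear right inverse `α : H(A) → Z` of the projection to cohomology. -/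
structure PreChoice (A : DGA.{u}) where
  α : A.cohomology.carrier →ₗ[ℚ] A.closed
  α_mem : ∀ {k : ℕ} {x : A.cohomology.carrier}, x ∈ A.cohomology.deg k → (α x : A.carrier) ∈ A.deg k
  toCoh_α : ∀ x : A.cohomology.carrier, A.toCoh (α x) = x

/-- The map `α² : 𝒢²H(A) → Z`, `x y ↦ α x α y`. -/
noncomputable def PreChoice.sq {A : DGA.{u}} (c : PreChoice A) :
    G2 A.cohomology.deg →ₗ[ℚ] A.closed :=
  G2.lift A.cohomology.deg ((LinearMap.mul ℚ A.closed).compl₁₂ c.α c.α)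
    fun _ _ _ hx _ hy => Subtype.ext (A.comm (c.α_mem hx) (c.α_mem hy))

/-- The choices in the definition of the Bianchi–Massey tensor of `A`: a right inverse `α` as above
and a linear map `γ : E → A` of degree `-1` such that `d γ = α²` on `E`. -/
structure BMChoice (A : DGA.{u}) extends PreChoice A where
  γ : A.cohomology.E →ₗ[ℚ] A.carrier
  γ_zero : ∀ {e : A.cohomology.E}, e ∈ A.cohomology.eDeg 0 → γ e = 0
  γ_mem : ∀ {k : ℕ} {e : A.cohomology.E}, e ∈ A.cohomology.eDeg (k + 1) → γ e ∈ A.deg k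
  d_γ : ∀ e : A.cohomology.E, A.d (γ e) = (toPreChoice.sq (e : G2 A.cohomology.deg) : A.carrier)

section

variable {A : DGA.{u}}

theorem PreChoice.sq_mem (c : PreChoice A) {k : ℕ} {t : G2 A.cohomology.deg}
    (ht : t ∈ G2.deg A.cohomology.deg k) : (c.sq t : A.carrier) ∈ A.deg k := by
  have : G2.deg A.cohomology.deg k ≤
      (A.deg k).comap (A.closed.val.toLinearMap ∘ₗ c.sq) := by
    refine Submodule.span_le.2 ?_
    rintro _ ⟨i, j, rfl, x, hx, y, hy, rfl⟩
    exact SetLike.mul_mem_graded (c.α_mem hx) (c.α_mem hy)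
  exact this ht

theorem PreChoice.toCoh_sq (c : PreChoice A) (t : G2 A.cohomology.deg) :
    A.toCoh (c.sq t) = A.cohomology.cup t := by
  refine LinearMap.congr_fun (f := A.toCoh.toLinearMap ∘ₗ c.sq) (g := A.cohomology.cup)
    (G2.hom_ext _ fun x y => ?_) t
  change A.toCoh (c.α x * c.α y) = x * y
  rw [map_mul, c.toCoh_α, c.toCoh_α]

/-- Such choices exist. -/
theorem nonempty_preChoice (A : DGA.{u}) : Nonempty (PreChoice A) := by
  obtain ⟨s, hs⟩ := A.toCoh.toLinearMap.exists_rightInverse_of_surjective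
    (LinearMap.range_eq_top.2 A.toCoh_surjective)
  have hs' : ∀ x, A.toCoh (s x) = x := fun x => LinearMap.congr_fun hs x
  let P (i : ℕ) : A.closed →ₗ[ℚ] A.closed :=
    { toFun := A.closedProj i
      map_add' := fun x y => Subtype.ext (by simp [closedProj])
      map_smul' := fun c x => Subtype.ext (by simp [closedProj]) }
  let α : A.cohomology.carrier →ₗ[ℚ] A.closed :=
    (DirectSum.toModule ℚ ℕ A.closed fun i => P i ∘ₗ s ∘ₗ (A.cohomology.deg i).subtype) ∘ₗ
      (DirectSum.decomposeLinearEquiv A.cohomology.deg).toLinearMap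
  have hα : ∀ {i : ℕ} {x : A.cohomology.carrier}, x ∈ A.cohomology.deg i → α x = A.closedProj i (s x) := by
    intro i x hx
    have h1 : DirectSum.decompose A.cohomology.deg x = DirectSum.lof ℚ ℕ _ i ⟨x, hx⟩ :=
      DirectSum.decompose_of_mem _ hx
    change DirectSum.toModule ℚ ℕ A.closed _ (DirectSum.decompose A.cohomology.deg x) = _
    rw [h1, DirectSum.toModule_lof]
    rfl
  refine ⟨⟨α, fun hx => by rw [hα hx]; exact A.closedProj_mem _ _, fun x => ?_⟩⟩
  induction x using DirectSum.Decomposition.inductionOn A.cohomology.deg with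
  | zero => exact (congrArg A.toCoh (map_zero α)).trans (map_zero _)
  | @homogeneous i x =>
    obtain ⟨z, hz, hzx⟩ := A.mem_cohomology_deg.1 x.2
    rw [hα x.2]
    have h0 : A.toCoh (s (x : A.cohomology.carrier) - z) = 0 := by rw [map_sub, hs', hzx, sub_self]
    obtain ⟨y, hy⟩ := A.toCoh_eq_zero.1 h0
    have h2 : A.toCoh (A.closedProj i (s (x : A.cohomology.carrier)) - z) = 0 := by
      rw [A.toCoh_eq_zero]
      have h3 : ((A.closedProj i (s (x : A.cohomology.carrier)) - z : A.closed) : A.carrier) =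
          GradedAlgebra.proj A.deg i (A.d y) := by
        rw [hy]
        have : GradedAlgebra.proj A.deg i (z : A.carrier) = z := by
          rw [GradedAlgebra.proj_apply, DirectSum.decompose_of_mem_same _ hz]
        simp only [AddSubgroupClass.coe_sub, map_sub, this, closedProj]
      rw [h3]
      cases i with
      | zero => exact ⟨0, by rw [proj_zero_d, map_zero]⟩
      | succ i => exact ⟨_, (A.proj_d y i).symm⟩
    rw [map_sub, sub_eq_zero] at h2
    exact h2.trans hzx
  | add a b ha hb =>
    exact (congrArg A.toCoh (map_add α a b)).trans ((map_add _ _ _).trans (congrArg₂ _ ha hb))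

/-- The choices in the definition of the Bianchi–Massey tensor exist. -/
theorem nonempty_bmChoice (A : DGA.{u}) : Nonempty (BMChoice A) := by
  obtain ⟨c⟩ := nonempty_preChoice A
  obtain ⟨s, hs⟩ := A.d.rangeRestrict.exists_rightInverse_of_surjective A.d.range_rangeRestrict
  obtain ⟨h, hh⟩ := s.exists_extend
  have hd : ∀ x, A.d (h (A.d x)) = A.d x := by
    intro x
    have h1 : h (A.d x) = s (A.d.rangeRestrict x) := LinearMap.congr_fun hh (A.d.rangeRestrict x)
    have h2 : A.d.rangeRestrict (s (A.d.rangeRestrict x)) = A.d.rangeRestrict x :=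
      LinearMap.congr_fun hs (A.d.rangeRestrict x)
    rw [h1]
    exact congrArg Subtype.val h2
  let S (i : ℕ) : A.deg i →ₗ[ℚ] A.carrier := match i with
    | 0 => 0
    | j + 1 => GradedAlgebra.proj A.deg j ∘ₗ h ∘ₗ (A.deg (j + 1)).subtype
  let T : A.carrier →ₗ[ℚ] A.carrier :=
    (DirectSum.toModule ℚ ℕ A.carrier S) ∘ₗ (DirectSum.decomposeLinearEquiv A.deg).toLinearMap
  have hT : ∀ {i : ℕ} {x : A.carrier} (hx : x ∈ A.deg i), T x = S i ⟨x, hx⟩ := by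
    intro i x hx
    have h1 : DirectSum.decompose A.deg x = DirectSum.lof ℚ ℕ _ i ⟨x, hx⟩ :=
      DirectSum.decompose_of_mem _ hx
    change DirectSum.toModule ℚ ℕ A.carrier _ (DirectSum.decompose A.deg x) = _
    rw [h1, DirectSum.toModule_lof]
  have hdT : ∀ x, A.d (T (A.d x)) = A.d x := by
    intro x
    induction x using DirectSum.Decomposition.inductionOn A.deg with
    | zero => simp
    | @homogeneous i x =>
      rw [hT (A.d_mem x.2)]
      change A.d (GradedAlgebra.proj A.deg i (h (A.d x))) = _
      rw [← proj_d, hd, GradedAlgebra.proj_apply,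
        DirectSum.decompose_of_mem_same _ (A.d_mem x.2)]
    | add a b ha hb => simp only [map_add, ha, hb]
  refine ⟨⟨c, T ∘ₗ A.closed.val.toLinearMap ∘ₗ c.sq ∘ₗ A.cohomology.E.subtype, ?_, ?_, ?_⟩⟩
  · intro e he
    exact hT (c.sq_mem he)
  · intro k e he
    refine (congrArg (· ∈ A.deg k) (hT (c.sq_mem he))).mpr ?_
    change GradedAlgebra.proj A.deg k _ ∈ A.deg k
    rw [GradedAlgebra.proj_apply]
    exact SetLike.coe_mem _
  · intro e
    have he : A.cohomology.cup (e : G2 A.cohomology.deg) = 0 := e.2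
    obtain ⟨y, hy⟩ := A.toCoh_eq_zero.1 ((c.toCoh_sq _).trans he)
    change A.d (T (c.sq (e : G2 A.cohomology.deg) : A.carrier)) = _
    rw [← hy, hdT]

namespace BMChoice

variable (c : BMChoice A)

/-- The restriction of `α²` to `E`, with values in `A`. -/
noncomputable def sqE : A.cohomology.E →ₗ[ℚ] A.carrier :=
  A.closed.val.toLinearMap ∘ₗ c.sq ∘ₗ A.cohomology.E.subtype

theorem d_sqE (e : A.cohomology.E) : A.d (c.sqE e) = 0 :=
  (c.sq (e : G2 A.cohomology.deg)).2

theorem sqE_mem {k : ℕ} {e : A.cohomology.E} (he : e ∈ A.cohomology.eDeg k) :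
    c.sqE e ∈ A.deg k :=
  c.sq_mem he

/-- The graded symmetrisation
`(e, e') ↦ ½ (γ e · α² e' + (-1)^p α² e · γ e')` (for `e ∈ Eᵖ`) of `(e, e') ↦ γ e · α² e'`. -/
noncomputable def bilin : A.cohomology.E →ₗ[ℚ] A.cohomology.E →ₗ[ℚ] A.carrier :=
  (1 / 2 : ℚ) • ((LinearMap.mul ℚ A.carrier).compl₁₂ c.γ c.sqE +
    (LinearMap.mul ℚ A.carrier).compl₁₂ (A.sgn ∘ₗ c.sqE) c.γ)

theorem bilin_apply (e e' : A.cohomology.E) :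
    c.bilin e e' = (1 / 2 : ℚ) • (c.γ e * c.sqE e' + A.sgn (c.sqE e) * c.γ e') := rfl

theorem γ_mul_sqE (p q : ℕ) (e : A.cohomology.E) (he : e ∈ A.cohomology.eDeg p)
    (e' : A.cohomology.E) (he' : e' ∈ A.cohomology.eDeg q) :
    c.γ e * c.sqE e' = (-1 : ℚ) ^ (p * q) • (A.sgn (c.sqE e') * c.γ e) := by
  rw [A.sgn_of_mem (c.sqE_mem he'), smul_mul_assoc, smul_smul, ← pow_add]
  cases p with
  | zero => rw [c.γ_zero he]; simp
  | succ p =>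
    rw [A.comm (c.γ_mem he) (c.sqE_mem he')]
    congr 1
    rw [show (p + 1) * q + q = p * q + 2 * q by ring, pow_add, pow_mul]
    simp

theorem bilin_comm (p q : ℕ) (e : A.cohomology.E) (he : e ∈ A.cohomology.eDeg p)
    (e' : A.cohomology.E) (he' : e' ∈ A.cohomology.eDeg q) :
    c.bilin e e' = (-1 : ℚ) ^ (p * q) • c.bilin e' e := by
  have h1 := c.γ_mul_sqE p q e he e' he'
  have h2 := c.γ_mul_sqE q p e' he' e he
  rw [bilin_apply, bilin_apply, h1, h2, mul_comm q p]
  rcases neg_one_pow_eq_or ℚ (p * q) with h | h <;> rw [h] <;> module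

/-- The map `γ · α² : 𝒢²E → A`. -/
noncomputable def form : G2 A.cohomology.eDeg →ₗ[ℚ] A.carrier :=
  G2.lift A.cohomology.eDeg c.bilin c.bilin_comm

theorem form_mem {k : ℕ} {t : G2 A.cohomology.eDeg}
    (ht : t ∈ G2.deg A.cohomology.eDeg (k + 1)) : c.form t ∈ A.deg k := by
  have : G2.deg A.cohomology.eDeg (k + 1) ≤ (A.deg k).comap c.form := by
    refine Submodule.span_le.2 ?_
    rintro _ ⟨p, q, hpq, e, he, e', he', rfl⟩
    change c.bilin e e' ∈ A.deg k
    rw [bilin_apply]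
    refine Submodule.smul_mem _ _ (Submodule.add_mem _ ?_ ?_)
    · cases p with
      | zero => rw [c.γ_zero he, zero_mul]; exact Submodule.zero_mem _
      | succ p =>
        have h := SetLike.mul_mem_graded (c.γ_mem he) (c.sqE_mem he')
        rwa [show p + q = k by omega] at h
    · rw [A.sgn_of_mem (c.sqE_mem he), smul_mul_assoc]
      refine Submodule.smul_mem _ _ ?_
      cases q with
      | zero => rw [c.γ_zero he', mul_zero]; exact Submodule.zero_mem _
      | succ q =>
        have h := SetLike.mul_mem_graded (c.sqE_mem he) (c.γ_mem he')
        rwa [show p + q = k by omega] at h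
  exact this ht

/-- The map `𝒢⁴H(A) → A`, `x y z w ↦ α x α y α z α w`. -/
noncomputable def fourth : G4 A.cohomology.deg →ₗ[ℚ] A.carrier :=
  (G4Rel A.cohomology.deg).liftQ
    (A.closed.val.toLinearMap ∘ₗ LinearMap.mul' ℚ A.closed ∘ₗ TensorProduct.map
      (LinearMap.mul' ℚ A.closed ∘ₗ TensorProduct.map c.α c.α)
      (LinearMap.mul' ℚ A.closed ∘ₗ TensorProduct.map c.α c.α)) (by
    have key : ∀ {i j : ℕ} {x y : A.cohomology.carrier}, x ∈ A.cohomology.deg i → y ∈ A.cohomology.deg j →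
        c.α x * c.α y = (-1 : ℚ) ^ (i * j) • (c.α y * c.α x) :=
      fun hx hy => Subtype.ext (A.comm (c.α_mem hx) (c.α_mem hy))
    refine Submodule.span_le.2 ?_
    rintro _ ((⟨i, j, x, hx, y, hy, z, w, rfl⟩ | ⟨i, j, y, hy, z, hz, x, w, rfl⟩) |
      ⟨i, j, z, hz, w, hw, x, y, rfl⟩) <;>
    rw [SetLike.mem_coe, LinearMap.mem_ker, map_sub, map_smul, sub_eq_zero]
    · have h : c.α x * c.α y * (c.α z * c.α w) =
          (-1 : ℚ) ^ (i * j) • (c.α y * c.α x * (c.α z * c.α w)) := by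
        rw [key hx hy, smul_mul_assoc]
      exact congrArg A.closed.val.toLinearMap h
    · have h : c.α x * c.α y * (c.α z * c.α w) =
          (-1 : ℚ) ^ (i * j) • (c.α x * c.α z * (c.α y * c.α w)) := by
        rw [mul_assoc, ← mul_assoc (c.α y), key hy hz, smul_mul_assoc, mul_smul_comm]
        simp only [mul_assoc]
      exact congrArg A.closed.val.toLinearMap h
    · have h : c.α x * c.α y * (c.α z * c.α w) =
          (-1 : ℚ) ^ (i * j) • (c.α x * c.α y * (c.α w * c.α z)) := by
        rw [key hz hw, mul_smul_comm]
      exact congrArg A.closed.val.toLinearMap h)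

theorem fourth_mulG4 (t t' : G2 A.cohomology.deg) :
    c.fourth (G2.mulG4 A.cohomology.deg t t') = (c.sq t : A.carrier) * c.sq t' := by
  have h : (G2.mulG4 A.cohomology.deg).compr₂ c.fourth =
      (LinearMap.mul ℚ A.carrier).compl₁₂ (A.closed.val.toLinearMap ∘ₗ c.sq)
        (A.closed.val.toLinearMap ∘ₗ c.sq) := by
    apply G2.hom_ext
    intro x y
    apply G2.hom_ext
    intro z w
    rfl
  exact LinearMap.congr_fun₂ h t t'

/-- `d (γ · α²)` factors through the full graded symmetrisation. -/
theorem d_form (t : G2 A.cohomology.eDeg) :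
    A.d (c.form t) = c.fourth (symmetrise A.cohomology.deg (A.cohomology.g2E t)) := by
  refine LinearMap.congr_fun (f := A.d ∘ₗ c.form)
    (g := c.fourth ∘ₗ symmetrise A.cohomology.deg ∘ₗ A.cohomology.g2E)
    (G2.hom_ext _ fun e e' => ?_) t
  change A.d (c.bilin e e') = c.fourth (G2.mulG4 A.cohomology.deg e e')
  have h1 : A.d (c.γ e * c.sqE e') = c.sqE e * c.sqE e' := by
    rw [leibniz_sgn, d_sqE, c.d_γ]; simp [sqE]
  have h2 : A.d (A.sgn (c.sqE e) * c.γ e') = c.sqE e * c.sqE e' := by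
    rw [leibniz_sgn, d_sgn, d_sqE, sgn_sgn, c.d_γ]; simp [sqE]
  rw [fourth_mulG4, bilin_apply, map_smul, map_add, h1, h2, ← two_smul ℚ, smul_smul]
  norm_num
  rfl

/-- The map `ℬᵏ⁺¹(A) → Hᵏ(A)` induced by `γ · α²`, which takes closed values on `ℬ(A)`. -/
noncomputable def tensor (k : ℕ) :
    A.cohomology.bDeg (k + 1) →ₗ[ℚ] A.cohomology.deg k :=
  LinearMap.codRestrict (A.cohomology.deg k)
    (A.toCoh.toLinearMap ∘ₗ LinearMap.codRestrict (Subalgebra.toSubmodule A.closed)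
      (c.form ∘ₗ (A.cohomology.bDeg (k + 1)).subtype) (fun t => by
        have ht : symmetrise A.cohomology.deg (A.cohomology.g2E t) = 0 := t.2.1
        exact (c.d_form t).trans (by rw [ht, map_zero])))
    (fun t => A.mem_cohomology_deg.2 ⟨_, c.form_mem t.2.2, rfl⟩)

end BMChoice

end

/-- The component `ℱ : ℬᵏ⁺¹(A) → Hᵏ(A)` of the Bianchi–Massey tensor of a DGA `A`, defined by
making a choice of `α` and `γ`. -/
noncomputable def bianchiMassey (A : DGA.{u}) (k : ℕ) :
    A.cohomology.bDeg (k + 1) →ₗ[ℚ] A.cohomology.deg k :=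
  (Classical.choice (nonempty_bmChoice A)).tensor k

end DGA

/-! ## Minimal Sullivan algebras -/

/-- The relations of graded commutativity between generators `v a` of degree `w a`. -/
inductive FreeGCRel {ι : Type u} (w : ι → ℕ) : FreeAlgebra ℚ ι → FreeAlgebra ℚ ι → Prop
  | swap (a b : ι) : FreeGCRel w (FreeAlgebra.ι ℚ a * FreeAlgebra.ι ℚ b)
      ((-1 : ℚ) ^ (w a * w b) • (FreeAlgebra.ι ℚ b * FreeAlgebra.ι ℚ a))

/-- The free graded commutative algebra `ΛV` on a graded vector space `V` with basis indexed by
`ι`, the basis vector with index `a` having degree `w a`. -/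
abbrev FreeGC {ι : Type u} (w : ι → ℕ) : Type u := RingQuot (FreeGCRel w)

/-- The homomorphism `ΛV → H` determined by homogeneous elements `v a` of degree `w a`. -/
def GCAlg.freeLift (H : GCAlg.{v}) {ι : Type u} (w : ι → ℕ) (x : ι → H.carrier)
    (hx : ∀ a, x a ∈ H.deg (w a)) : FreeGC w →ₐ[ℚ] H.carrier :=
  RingQuot.liftAlgHom ℚ ⟨FreeAlgebra.lift ℚ x, by
    rintro _ _ ⟨a, b⟩
    simp [H.comm (hx a) (hx b)]⟩

/-- `A` is a minimal Sullivan algebra: as a graded algebra it is free, `A ≅ ΛV`, and `V` has a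
well-ordered homogeneous basis `(x a)` (of elements of positive degree) such that `d (x a)` lies in
the subalgebra generated by the `x b` with `b < a`, and `a ≤ b` implies `deg (x a) ≤ deg (x b)`. -/
def DGA.IsMinimalSullivan (A : DGA.{u}) : Prop :=
  ∃ (ι : Type u) (_ : LinearOrder ι) (_ : WellFoundedLT ι) (w : ι → ℕ) (x : ι → A.carrier)
    (hx : ∀ a, x a ∈ A.deg (w a)),
    Function.Bijective (A.freeLift w x hx) ∧ (∀ a, 1 ≤ w a) ∧ Monotone w ∧
      ∀ a, A.d (x a) ∈ Algebra.adjoin ℚ (x '' Set.Iio a)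

/-!
The Bianchi–Massey tensor is natural under DGA homomorphisms and independent of the choices
(`DGA.BMChoice.tensor_natural`): along a homotopy `a + s (a' - a)` between two choices of
representatives, the derivative of `γ · α²` is exact on `ℬ`, because up to exact terms it factors
through `𝒢⁴` of the cohomology. The form is a polynomial in `s`, so Simpson's rule replaces the
integral over `s`. This gives one direction of the uniqueness statement.

*Realisation.* Given a Poincaré algebra `H` and a functional on `ℬ^{m+1}(H)`, there is a DGA with
underlying graded vector space `H ⊕ W ⊕ W[-1]`, where `W` is a copy of `E` and the differential maps
`W[-1]` identically to `W` (`BMExt`). The product of `x, y ∈ H` of degrees between `n` and `2n - 1`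
deviates from that of `H` by their class in `E ≅ W`; the product of `W[-1]` and `W` is given by the
functional, and Poincaré duality then forces the products of `H` and `W[-1]`. The acyclic part does
not change the cohomology, and for `m ≤ 5n - 2` the Bianchi–Massey tensor is the given functional
(`BMExt.cohIso_tensor`, `GCAlg.exists_bmExt`). A minimal model of this DGA
(`DGA.exists_minimalModel`) has the same tensor by naturality.

*Uniqueness.* Quasi-isomorphisms between simply connected minimal Sullivan algebras are bijective
(`DGA.Hom.IsQuasiIso.bijective`), so `M₁` may be replaced by a minimal model `S` of it, and it
suffices to realise an isomorphism `G` of cohomology algebras by a DGA homomorphism `S → M₂`. This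
is constructed by degree (`DGA.Comparison.Stage`), keeping the condition that it preserves the
integrals of closed elements of degree `m`.

In degrees at most `3n - 3` the generators of `S` are closed ones, together with generators in
degrees at least `2n - 1` whose differentials are quadratic in the closed ones. Since `m ≤ 5n - 3`, a
closed element of degree `m` in the algebra they generate has the form `z + ∑ x_b p_b`, with `z`
and `p_b` in the algebra of the closed generators (`DGA.ModelGens.exists_decomp_closed`). The
difference of the integrals in `S` and `M₂` is a functional of the family `(p_b)`. If all `p_b` are
exact, `∑ x_b p_b` is an evaluation of the Bianchi–Massey tensor, and the difference vanishes as `G`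
respects the tensors (`DGA.Comparison.defect_eq_zero`). Hence it is a functional of the classes of
the `p_b`, and by Poincaré duality it can be cancelled by adding closed elements to the images of
the `x_b`. In higher degrees the obstructions to extending the map pair trivially with the
cohomology in the complementary degrees, because integrals are preserved, so they vanish by
duality; the condition on integrals is restored in the same way
(`DGA.Comparison.Stage.exists_succ`). The map induces `G` in degrees at most `3n - 3` by
construction, and in the complementary degrees because it preserves integrals
(`DGA.Comparison.exists_hom`).
-/

universe w

/-! ### Invariance of the Bianchi–Massey tensor -/

/-- The tensor square of a vector space. -/
abbrev TensorSq (V : Type u) [AddCommGroup V] [Module ℚ V] : Type u := V ⊗[ℚ] V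

/-- The projection `V ⊗ V → 𝒢²V`. -/
def G2.ofTensor {V : Type u} [AddCommGroup V] [Module ℚ V] (𝒱 : ℕ → Submodule ℚ V) :
    TensorSq V →ₗ[ℚ] G2 𝒱 :=
  (G2Rel 𝒱).mkQ

theorem G2.ofTensor_surjective {V : Type u} [AddCommGroup V] [Module ℚ V]
    (𝒱 : ℕ → Submodule ℚ V) : Function.Surjective (G2.ofTensor 𝒱) :=
  (G2Rel 𝒱).mkQ_surjective

namespace GCAlg

theorem sgn_mul (A : GCAlg.{u}) (x y : A.carrier) : A.sgn (x * y) = A.sgn x * A.sgn y := by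
  induction x using DirectSum.Decomposition.inductionOn A.deg with
  | zero => simp
  | @homogeneous i x =>
    induction y using DirectSum.Decomposition.inductionOn A.deg with
    | zero => simp
    | @homogeneous j y =>
      rw [A.sgn_of_mem x.2, A.sgn_of_mem y.2, A.sgn_of_mem (SetLike.mul_mem_graded x.2 y.2)]
      rw [smul_mul_smul_comm, ← pow_add]
    | add a b ha hb => simp only [mul_add, map_add, ha, hb]
  | add a b ha hb => simp only [add_mul, map_add, ha, hb]

end GCAlg

namespace DGA

open GCAlg (sgn_mul)

/-- A homogeneous linear map `T` of degree `-1` that picks a primitive of each exact element. -/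
theorem exists_primitive (A : DGA.{u}) : ∃ T : A.carrier →ₗ[ℚ] A.carrier,
    (∀ x, A.d (T (A.d x)) = A.d x) ∧ (∀ x ∈ A.deg 0, T x = 0) ∧
      ∀ i, ∀ x ∈ A.deg (i + 1), T x ∈ A.deg i := by
  obtain ⟨s, hs⟩ := A.d.rangeRestrict.exists_rightInverse_of_surjective A.d.range_rangeRestrict
  obtain ⟨h, hh⟩ := s.exists_extend
  have hd : ∀ x, A.d (h (A.d x)) = A.d x := by
    intro x
    have h1 : h (A.d x) = s (A.d.rangeRestrict x) := LinearMap.congr_fun hh (A.d.rangeRestrict x)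
    have h2 : A.d.rangeRestrict (s (A.d.rangeRestrict x)) = A.d.rangeRestrict x :=
      LinearMap.congr_fun hs (A.d.rangeRestrict x)
    rw [h1]
    exact congrArg Subtype.val h2
  let S (i : ℕ) : A.deg i →ₗ[ℚ] A.carrier := match i with
    | 0 => 0
    | j + 1 => GradedAlgebra.proj A.deg j ∘ₗ h ∘ₗ (A.deg (j + 1)).subtype
  let T : A.carrier →ₗ[ℚ] A.carrier :=
    (DirectSum.toModule ℚ ℕ A.carrier S) ∘ₗ (DirectSum.decomposeLinearEquiv A.deg).toLinearMap
  have hT : ∀ {i : ℕ} {x : A.carrier} (hx : x ∈ A.deg i), T x = S i ⟨x, hx⟩ := by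
    intro i x hx
    have h1 : DirectSum.decompose A.deg x = DirectSum.lof ℚ ℕ _ i ⟨x, hx⟩ :=
      DirectSum.decompose_of_mem _ hx
    change DirectSum.toModule ℚ ℕ A.carrier _ (DirectSum.decompose A.deg x) = _
    rw [h1, DirectSum.toModule_lof]
  refine ⟨T, fun x => ?_, fun x hx => hT hx, fun i x hx => ?_⟩
  · induction x using DirectSum.Decomposition.inductionOn A.deg with
    | zero => simp
    | @homogeneous i x =>
      rw [hT (A.d_mem x.2)]
      change A.d (GradedAlgebra.proj A.deg i (h (A.d x))) = _
      rw [← proj_d, hd, GradedAlgebra.proj_apply,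
        DirectSum.decompose_of_mem_same _ (A.d_mem x.2)]
    | add a b ha hb => simp only [map_add, ha, hb]
  · rw [hT hx]
    change GradedAlgebra.proj A.deg i _ ∈ A.deg i
    rw [GradedAlgebra.proj_apply]
    exact SetLike.coe_mem _

section Forms

variable (B : DGA.{v}) {E : Type u} [AddCommGroup E] [Module ℚ E]

/-- The form `e ⊗ e' ↦ ½ (g e · s e' + (-1)^{|e|} s e · g e')`, the sign being that of `s e`. -/
def symForm (g s : E →ₗ[ℚ] B.carrier) : TensorSq E →ₗ[ℚ] B.carrier :=
  TensorProduct.lift ((1 / 2 : ℚ) • ((LinearMap.mul ℚ B.carrier).compl₁₂ g s +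
    (LinearMap.mul ℚ B.carrier).compl₁₂ (B.sgn ∘ₗ s) g))

theorem symForm_tmul (g s : E →ₗ[ℚ] B.carrier) (e e' : E) :
    B.symForm g s (e ⊗ₜ e') = (1 / 2 : ℚ) • (g e * s e' + B.sgn (s e) * g e') := rfl

theorem mem_range_d_of_tmul (f : TensorSq E →ₗ[ℚ] B.carrier)
    (h : ∀ e e', f (e ⊗ₜ e') ∈ LinearMap.range B.d) (t : TensorSq E) :
    f t ∈ LinearMap.range B.d := by
  induction t using TensorProduct.induction_on with
  | zero => rw [map_zero]; exact Submodule.zero_mem _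
  | tmul e e' => exact h e e'
  | add a b ha hb => rw [map_add]; exact Submodule.add_mem _ ha hb

theorem symForm_closed_left (k g : E →ₗ[ℚ] B.carrier) (hk : ∀ e, B.d (k e) = 0) (t : TensorSq E) :
    B.symForm k (B.d ∘ₗ g) t ∈ LinearMap.range B.d := by
  refine B.mem_range_d_of_tmul _ (fun e e' => ?_) t
  refine ⟨(1 / 2 : ℚ) • (B.sgn (k e) * g e' - B.sgn (g e) * k e'), ?_⟩
  rw [symForm_tmul, map_smul, map_sub, leibniz_sgn, leibniz_sgn, d_sgn, d_sgn, sgn_sgn, sgn_sgn,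
    hk, hk]
  simp

theorem symForm_swap (g k : E →ₗ[ℚ] B.carrier) (t : TensorSq E) :
    B.symForm g (B.d ∘ₗ k) t - B.symForm k (B.d ∘ₗ g) t ∈ LinearMap.range B.d := by
  rw [← LinearMap.sub_apply]
  refine B.mem_range_d_of_tmul _ (fun e e' => ?_) t
  refine ⟨(1 / 2 : ℚ) • (B.sgn (g e) * k e' - B.sgn (k e) * g e'), ?_⟩
  rw [LinearMap.sub_apply, symForm_tmul, symForm_tmul, map_smul, map_sub, leibniz_sgn,
    leibniz_sgn, d_sgn, d_sgn, sgn_sgn, sgn_sgn]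
  simp only [LinearMap.comp_apply, neg_mul]
  module

/-- Simpson's rule along the quadratic paths `g + s m₁ + s² m₂` and `σ + s δ₁ + s² δ₂`: the
derivative of the form is a cubic polynomial in the parameter `s`. -/
theorem symForm_simpson (g m₁ m₂ σ δ₁ δ₂ : E →ₗ[ℚ] B.carrier) :
    B.symForm (g + m₁ + m₂) (σ + δ₁ + δ₂) - B.symForm g σ =
      (1 / 6 : ℚ) • ((B.symForm m₁ σ + B.symForm g δ₁) +
        (4 : ℚ) • (B.symForm (m₁ + m₂) (σ + (1 / 2 : ℚ) • δ₁ + (1 / 4 : ℚ) • δ₂) +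
          B.symForm (g + (1 / 2 : ℚ) • m₁ + (1 / 4 : ℚ) • m₂) (δ₁ + δ₂)) +
        (B.symForm (m₁ + (2 : ℚ) • m₂) (σ + δ₁ + δ₂) +
          B.symForm (g + m₁ + m₂) (δ₁ + (2 : ℚ) • δ₂))) := by
  refine TensorProduct.ext' fun e e' => ?_
  simp only [symForm_tmul, LinearMap.add_apply, LinearMap.smul_apply, LinearMap.sub_apply,
    map_add, map_smul, mul_add, add_mul, smul_mul_assoc, mul_smul_comm]
  module

theorem symForm_sub_left (g k σ : E →ₗ[ℚ] B.carrier) :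
    B.symForm (g - k) σ = B.symForm g σ - B.symForm k σ := by
  refine TensorProduct.ext' fun e e' => ?_
  simp only [symForm_tmul, LinearMap.sub_apply, mul_sub, sub_mul]
  module

end Forms

section Homotopy

variable {H : GCAlg.{u}} {B : DGA.{v}}

/-- The map `𝒢²H → B`, `x y ↦ a x · a y`, for a degree preserving linear map `a`. -/
def sqMap (a : H.carrier →ₗ[ℚ] B.carrier) (ha : ∀ i, ∀ x ∈ H.deg i, a x ∈ B.deg i) :
    G2 H.deg →ₗ[ℚ] B.carrier :=
  G2.lift H.deg ((LinearMap.mul ℚ B.carrier).compl₁₂ a a)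
    fun i j x hx y hy => B.comm (ha i x hx) (ha j y hy)

theorem sqMap_mk (a : H.carrier →ₗ[ℚ] B.carrier) (ha : ∀ i, ∀ x ∈ H.deg i, a x ∈ B.deg i)
    (x y : H.carrier) : sqMap a ha (G2.mk H.deg x y) = a x * a y := rfl

/-- `b` has degree `-1`. -/
def IsDegNegOne (H : GCAlg.{u}) (B : DGA.{v}) (b : H.carrier →ₗ[ℚ] B.carrier) : Prop :=
  (∀ x ∈ H.deg 0, b x = 0) ∧ ∀ i, ∀ x ∈ H.deg (i + 1), b x ∈ B.deg i

theorem IsDegNegOne.mul_comm {a b : H.carrier →ₗ[ℚ] B.carrier}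
    (ha : ∀ i, ∀ x ∈ H.deg i, a x ∈ B.deg i) (hb : IsDegNegOne H B b) {i j : ℕ} {x y : H.carrier}
    (hx : x ∈ H.deg i) (hy : y ∈ H.deg j) :
    b x * a y = (-1 : ℚ) ^ (i * j) • (B.sgn (a y) * b x) := by
  rw [B.sgn_of_mem (ha j y hy), smul_mul_assoc, smul_smul, ← pow_add]
  cases i with
  | zero => rw [hb.1 x hx]; simp
  | succ i =>
    rw [B.comm (hb.2 i x hx) (ha j y hy)]
    congr 1
    rw [show (i + 1) * j + j = i * j + 2 * j by ring, pow_add, pow_mul]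
    simp

/-- The derivative `x y ↦ b x · a y + (-1)^{|x|} a x · b y` of `x y ↦ a x · a y` in the direction
of a map `b` of degree `-1`. -/
def sqDeriv (a b : H.carrier →ₗ[ℚ] B.carrier) (ha : ∀ i, ∀ x ∈ H.deg i, a x ∈ B.deg i)
    (hb : IsDegNegOne H B b) : G2 H.deg →ₗ[ℚ] B.carrier :=
  G2.lift H.deg ((LinearMap.mul ℚ B.carrier).compl₁₂ b a +
      (LinearMap.mul ℚ B.carrier).compl₁₂ (B.sgn ∘ₗ a) b) fun i j x hx y hy => by
    change b x * a y + B.sgn (a x) * b y = (-1 : ℚ) ^ (i * j) • (b y * a x + B.sgn (a y) * b x)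
    rw [hb.mul_comm ha hx hy, hb.mul_comm ha hy hx, _root_.mul_comm j i]
    rcases neg_one_pow_eq_or ℚ (i * j) with h | h <;> rw [h] <;> module

theorem sqDeriv_mk (a b : H.carrier →ₗ[ℚ] B.carrier) (ha : ∀ i, ∀ x ∈ H.deg i, a x ∈ B.deg i)
    (hb : IsDegNegOne H B b) (x y : H.carrier) :
    sqDeriv a b ha hb (G2.mk H.deg x y) = b x * a y + B.sgn (a x) * b y := rfl

theorem d_sqDeriv (a b : H.carrier →ₗ[ℚ] B.carrier) (ha : ∀ i, ∀ x ∈ H.deg i, a x ∈ B.deg i)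
    (hb : IsDegNegOne H B b) (hd : ∀ x, B.d (a x) = 0) (x y : H.carrier) :
    B.d (sqDeriv a b ha hb (G2.mk H.deg x y)) = B.d (b x) * a y + a x * B.d (b y) := by
  rw [sqDeriv_mk, map_add, leibniz_sgn, leibniz_sgn, d_sgn, hd, hd, sgn_sgn]
  simp

/-- The map `𝒢⁴H → B` given by the derivative of `x y z w ↦ a x · a y · a z · a w`. -/
def fourthDeriv (a b : H.carrier →ₗ[ℚ] B.carrier) (ha : ∀ i, ∀ x ∈ H.deg i, a x ∈ B.deg i)
    (hb : IsDegNegOne H B b) : G4 H.deg →ₗ[ℚ] B.carrier :=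
  (G4Rel H.deg).liftQ (TensorProduct.lift
    ((LinearMap.mul ℚ B.carrier).compl₁₂ (sqDeriv a b ha hb ∘ₗ (G2Rel H.deg).mkQ)
        (sqMap a ha ∘ₗ (G2Rel H.deg).mkQ) +
      (LinearMap.mul ℚ B.carrier).compl₁₂ (B.sgn ∘ₗ sqMap a ha ∘ₗ (G2Rel H.deg).mkQ)
        (sqDeriv a b ha hb ∘ₗ (G2Rel H.deg).mkQ))) (by
    have key : ∀ x y z w : H.carrier, TensorProduct.lift
        ((LinearMap.mul ℚ B.carrier).compl₁₂ (sqDeriv a b ha hb ∘ₗ (G2Rel H.deg).mkQ)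
            (sqMap a ha ∘ₗ (G2Rel H.deg).mkQ) +
          (LinearMap.mul ℚ B.carrier).compl₁₂ (B.sgn ∘ₗ sqMap a ha ∘ₗ (G2Rel H.deg).mkQ)
            (sqDeriv a b ha hb ∘ₗ (G2Rel H.deg).mkQ)) ((x ⊗ₜ[ℚ] y) ⊗ₜ[ℚ] (z ⊗ₜ[ℚ] w)) =
        sqDeriv a b ha hb (G2.mk H.deg x y) * sqMap a ha (G2.mk H.deg z w) +
          B.sgn (sqMap a ha (G2.mk H.deg x y)) * sqDeriv a b ha hb (G2.mk H.deg z w) :=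
      fun x y z w => rfl
    refine Submodule.span_le.2 ?_
    rintro _ ((⟨i, j, x, hx, y, hy, z, w, rfl⟩ | ⟨i, j, y, hy, z, hz, x, w, rfl⟩) |
      ⟨i, j, z, hz, w, hw, x, y, rfl⟩) <;>
    rw [SetLike.mem_coe, LinearMap.mem_ker, map_sub, map_smul, sub_eq_zero, key, key]
    · rw [G2.mk_comm H.deg hx hy]; simp [smul_add]
    · simp only [sqDeriv_mk, sqMap_mk, sgn_mul]
      have h1 := B.comm (ha i y hy) (ha j z hz)
      have h2 : B.sgn (a y) * B.sgn (a z) = (-1 : ℚ) ^ (i * j) • (B.sgn (a z) * B.sgn (a y)) := by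
        rw [← sgn_mul, ← sgn_mul, h1, map_smul]
      have h3 := hb.mul_comm ha hy hz
      have h4 : B.sgn (a y) * b z = (-1 : ℚ) ^ (i * j) • (b z * a y) := by
        have h5 := hb.mul_comm ha hz hy
        rw [_root_.mul_comm j i] at h5
        rw [h5, smul_smul, ← mul_pow]; simp
      have e1 : b x * a y * (a z * a w) = (-1 : ℚ) ^ (i * j) • (b x * a z * (a y * a w)) := by
        rw [mul_assoc (b x), ← mul_assoc (a y), h1]; simp [mul_assoc]
      have e2 : B.sgn (a x) * b y * (a z * a w) =
          (-1 : ℚ) ^ (i * j) • (B.sgn (a x) * B.sgn (a z) * (b y * a w)) := by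
        rw [mul_assoc (B.sgn (a x)), ← mul_assoc (b y), h3]; simp [mul_assoc]
      have e3 : B.sgn (a x) * B.sgn (a y) * (b z * a w) =
          (-1 : ℚ) ^ (i * j) • (B.sgn (a x) * b z * (a y * a w)) := by
        rw [mul_assoc (B.sgn (a x)), ← mul_assoc (B.sgn (a y)), h4]; simp [mul_assoc]
      have e4 : B.sgn (a x) * B.sgn (a y) * (B.sgn (a z) * b w) =
          (-1 : ℚ) ^ (i * j) • (B.sgn (a x) * B.sgn (a z) * (B.sgn (a y) * b w)) := by
        rw [mul_assoc (B.sgn (a x)), ← mul_assoc (B.sgn (a y)), h2]; simp [mul_assoc]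
      rw [add_mul, mul_add, add_mul, mul_add, e1, e2, e3, e4]
      module
    · rw [G2.mk_comm H.deg hz hw]; simp [smul_add])

theorem fourthDeriv_mulG4 (a b : H.carrier →ₗ[ℚ] B.carrier)
    (ha : ∀ i, ∀ x ∈ H.deg i, a x ∈ B.deg i) (hb : IsDegNegOne H B b) (t t' : G2 H.deg) :
    fourthDeriv a b ha hb (G2.mulG4 H.deg t t') =
      sqDeriv a b ha hb t * sqMap a ha t' + B.sgn (sqMap a ha t) * sqDeriv a b ha hb t' := by
  have h : (G2.mulG4 H.deg).compr₂ (fourthDeriv a b ha hb) =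
      (LinearMap.mul ℚ B.carrier).compl₁₂ (sqDeriv a b ha hb) (sqMap a ha) +
        (LinearMap.mul ℚ B.carrier).compl₁₂ (B.sgn ∘ₗ sqMap a ha) (sqDeriv a b ha hb) := by
    apply G2.hom_ext
    intro x y
    apply G2.hom_ext
    intro z w
    rfl
  exact LinearMap.congr_fun₂ h t t'

/-- On `ℬ(H)` the form `sqDeriv · sqMap` vanishes, since it factors through `𝒢⁴H`. -/
theorem symForm_sqDeriv_eq_zero (a b : H.carrier →ₗ[ℚ] B.carrier)
    (ha : ∀ i, ∀ x ∈ H.deg i, a x ∈ B.deg i) (hb : IsDegNegOne H B b) (t : TensorSq H.E)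
    (ht : symmetrise H.deg (H.g2E (G2.ofTensor H.eDeg t)) = 0) :
    B.symForm (sqDeriv a b ha hb ∘ₗ H.E.subtype) (sqMap a ha ∘ₗ H.E.subtype) t = 0 := by
  have h : B.symForm (sqDeriv a b ha hb ∘ₗ H.E.subtype) (sqMap a ha ∘ₗ H.E.subtype) =
      (1 / 2 : ℚ) • (fourthDeriv a b ha hb ∘ₗ symmetrise H.deg ∘ₗ H.g2E ∘ₗ G2.ofTensor H.eDeg) := by
    refine TensorProduct.ext' fun e e' => ?_
    exact congrArg ((1 / 2 : ℚ) • ·) (fourthDeriv_mulG4 a b ha hb (e : G2 H.deg) e').symm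
  rw [h]
  simp [ht]

/-- The derivative of `symForm γ α²` along a homotopy is exact on `ℬ(H)`. -/
theorem symForm_deriv_mem_range (a b : H.carrier →ₗ[ℚ] B.carrier)
    (ha : ∀ i, ∀ x ∈ H.deg i, a x ∈ B.deg i) (hb : IsDegNegOne H B b)
    (g : H.E →ₗ[ℚ] B.carrier) (hg : B.d ∘ₗ g = sqMap a ha ∘ₗ H.E.subtype)
    (t : TensorSq H.E) (ht : symmetrise H.deg (H.g2E (G2.ofTensor H.eDeg t)) = 0) :
    B.symForm (sqDeriv a b ha hb ∘ₗ H.E.subtype) (sqMap a ha ∘ₗ H.E.subtype) t +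
      B.symForm g (B.d ∘ₗ sqDeriv a b ha hb ∘ₗ H.E.subtype) t ∈ LinearMap.range B.d := by
  have h0 := symForm_sqDeriv_eq_zero a b ha hb t ht
  have h1 := B.symForm_swap g (sqDeriv a b ha hb ∘ₗ H.E.subtype) t
  rw [hg, h0, sub_zero] at h1
  rwa [h0, zero_add]

/-- The class of `symForm γ α²` on `ℬ(H)` does not depend on `γ` and only depends on the
cohomology classes of the values of `α`. -/
theorem symForm_cohomologous (a a' : H.carrier →ₗ[ℚ] B.carrier)
    (ha : ∀ i, ∀ x ∈ H.deg i, a x ∈ B.deg i) (ha' : ∀ i, ∀ x ∈ H.deg i, a' x ∈ B.deg i)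
    (hd : ∀ x, B.d (a x) = 0) (haa' : ∀ x, a' x - a x ∈ LinearMap.range B.d)
    (g g' : H.E →ₗ[ℚ] B.carrier) (hg : B.d ∘ₗ g = sqMap a ha ∘ₗ H.E.subtype)
    (hg' : B.d ∘ₗ g' = sqMap a' ha' ∘ₗ H.E.subtype)
    (t : TensorSq H.E) (ht : symmetrise H.deg (H.g2E (G2.ofTensor H.eDeg t)) = 0) :
    B.symForm g' (sqMap a' ha' ∘ₗ H.E.subtype) t - B.symForm g (sqMap a ha ∘ₗ H.E.subtype) t ∈
      LinearMap.range B.d := by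
  obtain ⟨T, hT, hT0, hTs⟩ := B.exists_primitive
  set b : H.carrier →ₗ[ℚ] B.carrier := T ∘ₗ (a' - a) with hbdef
  have hdb : ∀ x, B.d (b x) = a' x - a x := by
    intro x
    obtain ⟨y, hy⟩ := haa' x
    change B.d (T (a' x - a x)) = _
    rw [← hy, hT]
  have hb : IsDegNegOne H B b :=
    ⟨fun x hx => hT0 _ (Submodule.sub_mem _ (ha' 0 x hx) (ha 0 x hx)),
      fun i x hx => hTs i _ (Submodule.sub_mem _ (ha' _ x hx) (ha _ x hx))⟩
  have hc : ∀ i, ∀ x ∈ H.deg i, (a' - a) x ∈ B.deg i :=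
    fun i x hx => Submodule.sub_mem _ (ha' i x hx) (ha i x hx)
  -- the homotopy `a + s (a' - a)` and the corresponding primitives
  have hs : ∀ s : ℚ, ∀ i, ∀ x ∈ H.deg i, (a + s • (a' - a)) x ∈ B.deg i :=
    fun s i x hx => Submodule.add_mem _ (ha i x hx) (Submodule.smul_mem _ s (hc i x hx))
  set m₁ := sqDeriv a b ha hb ∘ₗ H.E.subtype with hm₁
  set m₂ := (1 / 2 : ℚ) • (sqDeriv (a' - a) b hc hb ∘ₗ H.E.subtype) with hm₂
  set σ := sqMap a ha ∘ₗ H.E.subtype with hσ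
  have hm : ∀ s : ℚ, sqDeriv (a + s • (a' - a)) b (hs s) hb ∘ₗ H.E.subtype =
      m₁ + (2 * s) • m₂ := by
    intro s
    have : sqDeriv (a + s • (a' - a)) b (hs s) hb =
        sqDeriv a b ha hb + s • sqDeriv (a' - a) b hc hb := by
      apply G2.hom_ext
      intro x y
      simp only [sqDeriv_mk, LinearMap.add_apply, LinearMap.smul_apply, mul_add, add_mul, map_add,
        map_smul, mul_smul_comm, smul_mul_assoc]
      module
    rw [this, hm₁, hm₂, LinearMap.add_comp, LinearMap.smul_comp]
    module
  have hsq : ∀ s : ℚ, sqMap (a + s • (a' - a)) (hs s) ∘ₗ H.E.subtype =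
      σ + s • (B.d ∘ₗ m₁) + (s * s) • (B.d ∘ₗ m₂) := by
    intro s
    have : sqMap (a + s • (a' - a)) (hs s) = sqMap a ha + s • (B.d ∘ₗ sqDeriv a b ha hb) +
        (s * s / 2) • (B.d ∘ₗ sqDeriv (a' - a) b hc hb) := by
      apply G2.hom_ext
      intro x y
      have hd' : ∀ x, B.d ((a' - a) x) = 0 := fun x => by
        change B.d (a' x - a x) = 0
        rw [← hdb, B.d_d]
      simp only [LinearMap.add_apply, LinearMap.smul_apply, LinearMap.comp_apply,
        d_sqDeriv a b ha hb hd, d_sqDeriv (a' - a) b hc hb hd', hdb, sqMap_mk,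
        LinearMap.sub_apply, mul_add, add_mul, mul_sub, sub_mul, mul_smul_comm, smul_mul_assoc,
        smul_sub]
      module
    rw [this, hσ, hm₁, hm₂, LinearMap.add_comp, LinearMap.add_comp, LinearMap.smul_comp,
      LinearMap.smul_comp, LinearMap.comp_smul, smul_smul]
    congr 2
    ring
  have hgs : ∀ s : ℚ, B.d ∘ₗ (g + s • m₁ + (s * s) • m₂) =
      sqMap (a + s • (a' - a)) (hs s) ∘ₗ H.E.subtype := by
    intro s
    rw [hsq, LinearMap.comp_add, LinearMap.comp_add, hg, LinearMap.comp_smul, LinearMap.comp_smul]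
  have h1 : sqMap a' ha' ∘ₗ H.E.subtype = σ + B.d ∘ₗ m₁ + B.d ∘ₗ m₂ := by
    have h := hsq 1
    simp only [one_smul, one_mul] at h
    rw [← h]
    congr 2
    abel
  have hX : ∀ s : ℚ, B.symForm (m₁ + (2 * s) • m₂)
      (σ + s • (B.d ∘ₗ m₁) + (s * s) • (B.d ∘ₗ m₂)) t +
      B.symForm (g + s • m₁ + (s * s) • m₂) (B.d ∘ₗ m₁ + (2 * s) • (B.d ∘ₗ m₂)) t ∈
        LinearMap.range B.d := by
    intro s
    have h := symForm_deriv_mem_range (a + s • (a' - a)) b (hs s) hb _ (hgs s) t ht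
    rwa [hm, hsq, LinearMap.comp_add, LinearMap.comp_smul B.d (2 * s) m₂] at h
  -- the part of `g'` not accounted for by the homotopy is closed
  have hk : ∀ e, B.d ((g' - (g + m₁ + m₂)) e) = 0 := by
    intro e
    have e1 := LinearMap.congr_fun (hg'.trans h1) e
    have e2 := LinearMap.congr_fun hg e
    simp only [LinearMap.comp_apply, LinearMap.add_apply, LinearMap.sub_apply, map_sub,
      map_add] at e1 e2 ⊢
    rw [e1, e2, hσ]
    simp
  have hK := B.symForm_closed_left _ g' hk t
  rw [hg', h1, symForm_sub_left, LinearMap.sub_apply] at hK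
  rw [h1]
  have hS := LinearMap.congr_fun (B.symForm_simpson g m₁ m₂ σ (B.d ∘ₗ m₁) (B.d ∘ₗ m₂)) t
  simp only [LinearMap.sub_apply, LinearMap.add_apply, LinearMap.smul_apply] at hS
  have h00 := hX 0
  have h05 := hX (1 / 2)
  have h10 := hX 1
  norm_num only [zero_smul, add_zero, mul_zero, one_smul] at h00 h05 h10
  have hfin := Submodule.add_mem _ hK (Submodule.smul_mem _ (1 / 6 : ℚ) (Submodule.add_mem _
    (Submodule.add_mem _ h00 (Submodule.smul_mem _ (4 : ℚ) h05)) h10))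
  rw [← hS] at hfin
  convert hfin using 1
  abel

end Homotopy

theorem Hom.map_sgn {A : DGA.{u}} {B : DGA.{v}} (f : Hom A B) (x : A.carrier) :
    f.toAlgHom (A.sgn x) = B.sgn (f.toAlgHom x) := by
  induction x using DirectSum.Decomposition.inductionOn A.deg with
  | zero => simp
  | homogeneous x =>
    rw [A.sgn_of_mem x.2, map_smul]
    exact (B.sgn_of_mem (f.map_deg x.2)).symm
  | add a b ha hb => simp only [map_add, ha, hb]

theorem Hom.cohMap_toCoh {A : DGA.{u}} {B : DGA.{v}} (f : Hom A B) (z : A.closed) :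
    f.cohMap.toAlgHom (A.toCoh z) = B.toCoh (f.closedMap z) := rfl

namespace BMChoice

theorem form_ofTensor {A : DGA.{u}} (c : BMChoice A) (t : TensorSq A.cohomology.E) :
    c.form (G2.ofTensor A.cohomology.eDeg t) = A.symForm c.γ c.sqE t := rfl

/-- The map `γ · α²` of a DGA `B`, pulled back along a map into the cohomology of `B`, computed on
tensors. -/
theorem form_g2eMap_ofTensor {H : GCAlg.{u}} {B : DGA.{v}} (c : BMChoice B)
    (f : GCAlg.Hom H B.cohomology) (t : TensorSq H.E) :
    c.form (f.g2eMap (G2.ofTensor H.eDeg t)) =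
      B.symForm (c.γ ∘ₗ f.eMap) (c.sqE ∘ₗ f.eMap) t := by
  have h : c.form ∘ₗ f.g2eMap ∘ₗ G2.ofTensor H.eDeg =
      B.symForm (c.γ ∘ₗ f.eMap) (c.sqE ∘ₗ f.eMap) := TensorProduct.ext' fun e e' => rfl
  exact LinearMap.congr_fun h t

theorem coe_tensor {A : DGA.{u}} (c : BMChoice A) (k : ℕ) (t : A.cohomology.bDeg (k + 1)) :
    ∃ h : A.d (c.form t) = 0, (c.tensor k t : A.cohomology.carrier) = A.toCoh ⟨c.form t, h⟩ :=
  ⟨(c.d_form t).trans (by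
    have ht : symmetrise A.cohomology.deg (A.cohomology.g2E t) = 0 := t.2.1
    rw [ht, map_zero]), rfl⟩

/-- The Bianchi–Massey tensor is natural, and in particular independent of the choices. -/
theorem tensor_natural {A : DGA.{u}} {B : DGA.{v}} (f : Hom A B) (cA : BMChoice A)
    (cB : BMChoice B) (k : ℕ) :
    f.cohMap.degMap k ∘ₗ cA.tensor k = cB.tensor k ∘ₗ f.cohMap.bMap (k + 1) := by
  refine LinearMap.ext fun t => Subtype.ext ?_
  obtain ⟨hA, eA⟩ := cA.coe_tensor k t
  obtain ⟨hB, eB⟩ := cB.coe_tensor k (f.cohMap.bMap (k + 1) t)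
  change f.cohMap.toAlgHom (cA.tensor k t : A.cohomology.carrier) =
    (cB.tensor k (f.cohMap.bMap (k + 1) t) : B.cohomology.carrier)
  rw [eA, eB, f.cohMap_toCoh, eq_comm, ← sub_eq_zero, ← map_sub, toCoh_eq_zero]
  obtain ⟨t', ht'⟩ := G2.ofTensor_surjective A.cohomology.eDeg t.1
  have ht : symmetrise A.cohomology.deg (A.cohomology.g2E t) = 0 := t.2.1
  rw [← ht'] at ht
  let a : A.cohomology.carrier →ₗ[ℚ] B.carrier :=
    f.toAlgHom.toLinearMap ∘ₗ A.closed.val.toLinearMap ∘ₗ cA.α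
  let a' : A.cohomology.carrier →ₗ[ℚ] B.carrier :=
    B.closed.val.toLinearMap ∘ₗ cB.α ∘ₗ f.cohMap.toAlgHom.toLinearMap
  have ha : ∀ i, ∀ x ∈ A.cohomology.deg i, a x ∈ B.deg i :=
    fun i x hx => f.map_deg (cA.α_mem hx)
  have ha' : ∀ i, ∀ x ∈ A.cohomology.deg i, a' x ∈ B.deg i :=
    fun i x hx => cB.α_mem (f.cohMap.map_deg hx)
  have hd : ∀ x, B.d (a x) = 0 := fun x => (f.closedMap (cA.α x)).2
  have haa' : ∀ x, a' x - a x ∈ LinearMap.range B.d := by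
    intro x
    have h : B.toCoh (cB.α (f.cohMap.toAlgHom x) - f.closedMap (cA.α x)) = 0 := by
      rw [map_sub, cB.toCoh_α, ← f.cohMap_toCoh, cA.toCoh_α, sub_self]
    exact B.toCoh_eq_zero.1 h
  have hsq : sqMap a ha ∘ₗ A.cohomology.E.subtype = f.toAlgHom.toLinearMap ∘ₗ cA.sqE := by
    have h : sqMap a ha = f.toAlgHom.toLinearMap ∘ₗ A.closed.val.toLinearMap ∘ₗ cA.sq :=
      G2.hom_ext _ fun x y => (map_mul f.toAlgHom _ _).symm
    rw [h]
    rfl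
  have hsq' : sqMap a' ha' ∘ₗ A.cohomology.E.subtype = cB.sqE ∘ₗ f.cohMap.eMap := by
    have h : sqMap a' ha' = B.closed.val.toLinearMap ∘ₗ cB.sq ∘ₗ f.cohMap.g2 :=
      G2.hom_ext _ fun x y => rfl
    rw [h]
    rfl
  have hg : B.d ∘ₗ f.toAlgHom.toLinearMap ∘ₗ cA.γ = sqMap a ha ∘ₗ A.cohomology.E.subtype := by
    rw [hsq]
    refine LinearMap.ext fun e => ?_
    exact (f.map_d _).symm.trans (congrArg f.toAlgHom (cA.d_γ e))
  have hg' : B.d ∘ₗ cB.γ ∘ₗ f.cohMap.eMap = sqMap a' ha' ∘ₗ A.cohomology.E.subtype := by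
    rw [hsq']
    exact LinearMap.ext fun e => cB.d_γ _
  obtain ⟨y, hy⟩ := symForm_cohomologous a a' ha ha' hd haa' _ _ hg hg' t' ht
  refine ⟨y, hy.trans ?_⟩
  have e1 : B.symForm (f.toAlgHom.toLinearMap ∘ₗ cA.γ)
      (sqMap a ha ∘ₗ A.cohomology.E.subtype) t' = f.toAlgHom (cA.form t) := by
    rw [hsq, ← ht', cA.form_ofTensor]
    refine LinearMap.congr_fun (f := B.symForm _ _)
      (g := f.toAlgHom.toLinearMap ∘ₗ A.symForm cA.γ cA.sqE)
      (TensorProduct.ext' fun e e' => ?_) t'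
    simp only [symForm_tmul, LinearMap.comp_apply, AlgHom.toLinearMap_apply, map_smul, map_add,
      map_mul, f.map_sgn]
  have e2 : B.symForm (cB.γ ∘ₗ f.cohMap.eMap) (sqMap a' ha' ∘ₗ A.cohomology.E.subtype) t' =
      cB.form (f.cohMap.bMap (k + 1) t) := by
    rw [hsq', ← form_g2eMap_ofTensor, ht']
    rfl
  rw [e1, e2]
  rfl

end BMChoice

theorem bianchiMassey_natural {A : DGA.{u}} {B : DGA.{v}} (f : Hom A B) (k : ℕ) :
    f.cohMap.degMap k ∘ₗ A.bianchiMassey k = B.bianchiMassey k ∘ₗ f.cohMap.bMap (k + 1) :=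
  BMChoice.tensor_natural f _ _ k

end DGA

/-! ### Free graded commutative algebras -/

namespace FreeGC

variable {ι : Type u} (w : ι → ℕ)

/-- The generator of `ΛV` with index `a`. -/
def gen (a : ι) : FreeGC w := RingQuot.mkAlgHom ℚ (FreeGCRel w) (FreeAlgebra.ι ℚ a)

theorem gen_mul_gen (a b : ι) :
    gen w a * gen w b = (-1 : ℚ) ^ (w a * w b) • (gen w b * gen w a) := by
  have h := RingQuot.mkAlgHom_rel ℚ (FreeGCRel.swap (w := w) a b)
  rwa [map_mul, map_smul, map_mul] at h

section Lift

variable {R : Type v} [Semiring R] [Algebra ℚ R]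

/-- The homomorphism from `ΛV` determined by elements with the commutation relations of the
generators. -/
def lift (r : ι → R) (h : ∀ a b, r a * r b = (-1 : ℚ) ^ (w a * w b) • (r b * r a)) :
    FreeGC w →ₐ[ℚ] R :=
  RingQuot.liftAlgHom ℚ ⟨FreeAlgebra.lift ℚ r, by
    rintro _ _ ⟨a, b⟩
    simp [h a b]⟩

@[simp]
theorem lift_gen (r : ι → R) (h : ∀ a b, r a * r b = (-1 : ℚ) ^ (w a * w b) • (r b * r a))
    (a : ι) : lift w r h (gen w a) = r a := by
  simp [lift, gen]

variable {w}

theorem algHom_ext {f g : FreeGC w →ₐ[ℚ] R} (h : ∀ a, f (gen w a) = g (gen w a)) : f = g := by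
  apply RingQuot.ringQuot_ext'
  apply FreeAlgebra.hom_ext
  exact funext h

end Lift

@[simp]
theorem _root_.GCAlg.freeLift_gen (H : GCAlg.{v}) (x : ι → H.carrier)
    (hx : ∀ a, x a ∈ H.deg (w a)) (a : ι) : H.freeLift w x hx (gen w a) = x a := by
  simp [GCAlg.freeLift, gen]

theorem adjoin_range_gen : Algebra.adjoin ℚ (Set.range (gen w)) = ⊤ := by
  have h1 : Set.range (gen w) =
      RingQuot.mkAlgHom ℚ (FreeGCRel w) '' Set.range (FreeAlgebra.ι ℚ) := by
    rw [← Set.range_comp]; rfl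
  rw [h1, ← AlgHom.map_adjoin, FreeAlgebra.adjoin_range_ι, Algebra.map_top]
  exact (AlgHom.range_eq_top _).2 (RingQuot.mkAlgHom_surjective ℚ _)

variable {w} in
/-- Induction by multiplication with generators from the left. -/
theorem induction_left {p : FreeGC w → Prop} (one : p 1) (gen_mul : ∀ a x, p x → p (gen w a * x))
    (add : ∀ x y, p x → p y → p (x + y)) (smul : ∀ (c : ℚ) x, p x → p (c • x)) (x : FreeGC w) :
    p x := by
  have hx : x ∈ Subalgebra.toSubmodule (Algebra.adjoin ℚ (Set.range (gen w))) := by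
    rw [adjoin_range_gen]; trivial
  rw [Algebra.adjoin_eq_span] at hx
  induction hx using Submodule.span_induction with
  | mem x hx =>
    induction hx using Submonoid.closure_induction_left with
    | one => exact one
    | mul_left x hx y _ hy =>
      obtain ⟨a, rfl⟩ := hx
      exact gen_mul a y hy
  | zero => simpa using smul 0 1 one
  | add x y _ _ hx hy => exact add x y hx hy
  | smul c x _ hx => exact smul c x hx

/-- A monomial in the generators. -/
def mon (l : List ι) : FreeGC w := (l.map (gen w)).prod

@[simp] theorem mon_nil : mon w [] = 1 := rfl

@[simp] theorem mon_cons (a : ι) (l : List ι) : mon w (a :: l) = gen w a * mon w l := by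
  simp [mon]

theorem mon_append (l l' : List ι) : mon w (l ++ l') = mon w l * mon w l' := by
  simp [mon]

/-- The grading of `ΛV`: degree `k` is spanned by the monomials of degree `k`. -/
def deg (k : ℕ) : Submodule ℚ (FreeGC w) :=
  Submodule.span ℚ {t | ∃ l : List ι, (l.map w).sum = k ∧ t = mon w l}

theorem mon_mem (l : List ι) : mon w l ∈ deg w (l.map w).sum :=
  Submodule.subset_span ⟨l, rfl, rfl⟩

theorem gen_mem (a : ι) : gen w a ∈ deg w (w a) := by
  simpa using mon_mem w [a]

instance : SetLike.GradedMonoid (deg w) where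
  one_mem := mon_mem w []
  mul_mem := by
    intro i j x y hx hy
    induction hx, hy using Submodule.span_induction₂ with
    | mem_mem a b ha hb =>
      obtain ⟨l, rfl, rfl⟩ := ha
      obtain ⟨l', rfl, rfl⟩ := hb
      rw [← mon_append, ← List.sum_append, ← List.map_append]
      exact mon_mem w _
    | zero_left b hb => simp
    | zero_right a ha => simp
    | add_left a b c _ _ _ h1 h2 => rw [add_mul]; exact Submodule.add_mem _ h1 h2
    | add_right a b c _ _ _ h1 h2 => rw [mul_add]; exact Submodule.add_mem _ h1 h2
    | smul_left r a b _ _ h => rw [smul_mul_assoc]; exact Submodule.smul_mem _ r h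
    | smul_right r a b _ _ h => rw [mul_smul_comm]; exact Submodule.smul_mem _ r h

theorem of_eq_smul_of {i j : ℕ} (h : i = j) (x : deg w i) (y : deg w j) (c : ℚ)
    (hxy : (x : FreeGC w) = c • (y : FreeGC w)) :
    DirectSum.of (fun k => deg w k) i x = c • DirectSum.of (fun k => deg w k) j y := by
  subst h
  rw [show x = c • y from Subtype.ext hxy, ← DirectSum.lof_eq_of ℚ, ← DirectSum.lof_eq_of ℚ,
    map_smul]

instance : GradedAlgebra (deg w) :=
  GradedAlgebra.ofAlgHom (deg w)
    (lift w (fun a => DirectSum.of (fun k => deg w k) (w a) ⟨gen w a, gen_mem w a⟩) fun a b => by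
      rw [DirectSum.of_mul_of, DirectSum.of_mul_of]
      exact of_eq_smul_of w (add_comm _ _) _ _ _ (gen_mul_gen w a b))
    (algHom_ext fun a => by simp)
    (by
      have key : ∀ l : List ι, lift w (fun a => DirectSum.of (fun k => deg w k) (w a)
          ⟨gen w a, gen_mem w a⟩) (fun a b => by
            rw [DirectSum.of_mul_of, DirectSum.of_mul_of]
            exact of_eq_smul_of w (add_comm _ _) _ _ _ (gen_mul_gen w a b)) (mon w l) =
          DirectSum.of (fun k => deg w k) (l.map w).sum ⟨mon w l, mon_mem w l⟩ := by
        intro l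
        induction l with
        | nil => exact map_one _
        | cons a l ih =>
          refine (congrArg _ (mon_cons w a l)).trans ?_
          rw [map_mul, ih, lift_gen, DirectSum.of_mul_of]
          exact (of_eq_smul_of w (by simp) _ _ 1
            ((mon_cons w a l).symm.trans (one_smul _ _).symm)).trans (one_smul _ _)
      rintro i ⟨x, hx⟩
      change lift w _ _ x = _
      induction hx using Submodule.span_induction with
      | mem x hx =>
        obtain ⟨l, rfl, rfl⟩ := hx
        exact key l
      | zero => rw [map_zero]; exact (map_zero _).symm
      | add x y hx' hy' h1 h2 =>
        rw [map_add, h1, h2, ← map_add]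
        rfl
      | smul c x hx' h =>
        rw [map_smul, h]
        exact (of_eq_smul_of w rfl _ _ c rfl).symm)

theorem mon_mul_mon (l l' : List ι) :
    mon w l * mon w l' = (-1 : ℚ) ^ ((l.map w).sum * (l'.map w).sum) • (mon w l' * mon w l) := by
  have h1 : ∀ (a : ι) (l : List ι),
      gen w a * mon w l = (-1 : ℚ) ^ (w a * (l.map w).sum) • (mon w l * gen w a) := by
    intro a l
    induction l with
    | nil => simp
    | cons b l ih =>
      rw [mon_cons, ← mul_assoc, gen_mul_gen, smul_mul_assoc, mul_assoc, ih, mul_smul_comm,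
        smul_smul, ← pow_add, mul_assoc]
      simp [mul_add]
  induction l with
  | nil => simp
  | cons a l ih =>
    rw [mon_cons, mul_assoc, ih, mul_smul_comm, ← mul_assoc, h1, smul_mul_assoc, smul_smul,
      ← pow_add, mul_assoc]
    simp only [List.map_cons, List.sum_cons]
    ring_nf

/-- The free graded commutative algebra `ΛV`. -/
abbrev alg : GCAlg.{u} where
  carrier := FreeGC w
  deg := deg w
  comm := by
    intro i j x y hx hy
    induction hx, hy using Submodule.span_induction₂ with
    | mem_mem a b ha hb =>
      obtain ⟨l, rfl, rfl⟩ := ha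
      obtain ⟨l', rfl, rfl⟩ := hb
      exact mon_mul_mon w l l'
    | zero_left b hb => simp
    | zero_right a ha => simp
    | add_left a b c _ _ _ h1 h2 => simp [add_mul, mul_add, h1, h2]
    | add_right a b c _ _ _ h1 h2 => simp [add_mul, mul_add, h1, h2]
    | smul_left r a b _ _ h => rw [smul_mul_assoc, h, mul_smul_comm, smul_comm]
    | smul_right r a b _ _ h => rw [mul_smul_comm, h, smul_mul_assoc, smul_comm]

theorem _root_.GCAlg.freeLift_mem (H : GCAlg.{v}) (x : ι → H.carrier)
    (hx : ∀ a, x a ∈ H.deg (w a)) {k : ℕ} {y : FreeGC w} (hy : y ∈ deg w k) :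
    H.freeLift w x hx y ∈ H.deg k := by
  induction hy using Submodule.span_induction with
  | mem y hy =>
    obtain ⟨l, rfl, rfl⟩ := hy
    induction l with
    | nil => rw [mon_nil, map_one]; exact SetLike.one_mem_graded _
    | cons a l ih =>
      rw [mon_cons, map_mul, H.freeLift_gen]
      simp only [List.map_cons, List.sum_cons]
      exact SetLike.mul_mem_graded (hx a) ih
  | zero => rw [map_zero]; exact Submodule.zero_mem _
  | add x y _ _ h1 h2 => rw [map_add]; exact Submodule.add_mem _ h1 h2
  | smul c x _ h => rw [map_smul]; exact Submodule.smul_mem _ c h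

/-! ### Derivations of free algebras -/

section Derivation

variable {R : Type v} [Ring R] [Algebra ℚ R]

/-- Twisted derivations `D (x y) = σ x · D y + D x · τ y` are freely determined on generators, up
to the commutation relation. They are the off-diagonal entries of homomorphisms to `2 × 2`
matrices. -/
theorem exists_derivation (σ τ : FreeGC w →ₐ[ℚ] R) (δ : ι → R)
    (h : ∀ a b, σ (gen w a) * δ b + δ a * τ (gen w b) =
      (-1 : ℚ) ^ (w a * w b) • (σ (gen w b) * δ a + δ b * τ (gen w a))) :
    ∃ D : FreeGC w →ₗ[ℚ] R, (∀ a, D (gen w a) = δ a) ∧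
      ∀ x y, D (x * y) = σ x * D y + D x * τ y := by
  have hσ : ∀ a b, σ (gen w a) * σ (gen w b) =
      (-1 : ℚ) ^ (w a * w b) • (σ (gen w b) * σ (gen w a)) := fun a b => by
    rw [← map_mul, gen_mul_gen, map_smul, map_mul]
  have hτ : ∀ a b, τ (gen w a) * τ (gen w b) =
      (-1 : ℚ) ^ (w a * w b) • (τ (gen w b) * τ (gen w a)) := fun a b => by
    rw [← map_mul, gen_mul_gen, map_smul, map_mul]
  let Φ : FreeGC w →ₐ[ℚ] Matrix (Fin 2) (Fin 2) R :=
    lift w (fun a => !![σ (gen w a), δ a; 0, τ (gen w a)]) fun a b => by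
      ext i j
      fin_cases i <;> fin_cases j <;> simp [Matrix.mul_apply, Fin.sum_univ_two, hσ a b, hτ a b, h a b]
  have hΦ : ∀ x, Φ x 0 0 = σ x ∧ Φ x 1 1 = τ x ∧ Φ x 1 0 = 0 := by
    intro x
    induction x using induction_left with
    | one => simp
    | gen_mul a x hx =>
      have hg : Φ (gen w a) = !![σ (gen w a), δ a; 0, τ (gen w a)] := lift_gen w _ _ a
      simp [Matrix.mul_apply, Fin.sum_univ_two, hg, hx.1, hx.2.1, hx.2.2]
    | add x y hx hy => simp [hx.1, hx.2.1, hx.2.2, hy.1, hy.2.1, hy.2.2]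
    | smul c x hx => simp [hx.1, hx.2.1, hx.2.2]
  refine ⟨{ toFun := fun x => Φ x 0 1, map_add' := by simp, map_smul' := by simp }, ?_, ?_⟩
  · intro a
    change Φ (gen w a) 0 1 = _
    rw [lift_gen]
    rfl
  · intro x y
    change Φ (x * y) 0 1 = σ x * Φ y 0 1 + Φ x 0 1 * τ y
    rw [map_mul, Matrix.mul_apply, Fin.sum_univ_two, (hΦ x).1, (hΦ y).2.1]

end Derivation

end FreeGC

namespace GCAlg

theorem sgn_one (H : GCAlg.{u}) : H.sgn 1 = 1 := by
  rw [H.sgn_of_mem (SetLike.one_mem_graded H.deg)]; simp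

/-- The sign involution as an algebra homomorphism. -/
def sgnHom (H : GCAlg.{u}) : H.carrier →ₐ[ℚ] H.carrier :=
  AlgHom.ofLinearMap H.sgn H.sgn_one H.sgn_mul

theorem sgn_sgn (H : GCAlg.{u}) (x : H.carrier) : H.sgn (H.sgn x) = x := by
  induction x using DirectSum.Decomposition.inductionOn H.deg with
  | zero => simp
  | homogeneous x =>
    rw [H.sgn_of_mem x.2, map_smul, H.sgn_of_mem x.2, smul_smul, ← mul_pow]; simp
  | add a b ha hb => simp only [map_add, ha, hb]

theorem map_sgn_of_degree_one (H : GCAlg.{u}) (d : H.carrier →ₗ[ℚ] H.carrier)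
    (hd : ∀ {i : ℕ} {x : H.carrier}, x ∈ H.deg i → d x ∈ H.deg (i + 1)) (x : H.carrier) :
    d (H.sgn x) = -H.sgn (d x) := by
  induction x using DirectSum.Decomposition.inductionOn H.deg with
  | zero => simp
  | homogeneous x =>
    rw [H.sgn_of_mem x.2, H.sgn_of_mem (hd x.2), map_smul, pow_succ]; simp
  | add a b ha hb => simp only [map_add, ha, hb]; abel

/-- The square of a derivation of degree one is a derivation. -/
theorem sq_derivation (H : GCAlg.{u}) (d : H.carrier →ₗ[ℚ] H.carrier)
    (hd : ∀ {i : ℕ} {x : H.carrier}, x ∈ H.deg i → d x ∈ H.deg (i + 1))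
    (hmul : ∀ x y, d (x * y) = H.sgn x * d y + d x * y) (x y : H.carrier) :
    d (d (x * y)) = x * d (d y) + d (d x) * y := by
  rw [hmul, map_add, hmul, hmul, sgn_sgn, H.map_sgn_of_degree_one d hd]
  simp

end GCAlg

namespace FreeGC

variable {ι : Type u} {w : ι → ℕ} (D : ∀ a, deg w (w a + 1))

theorem exists_der : ∃ d : (alg w).carrier →ₗ[ℚ] (alg w).carrier, (∀ a, d (gen w a) = D a) ∧
    ∀ x y, d (x * y) = (alg w).sgn x * d y + d x * y := by
  refine exists_derivation w (R := (alg w).carrier) (alg w).sgnHom (AlgHom.id ℚ _)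
    (fun a => (D a : FreeGC w)) fun a b => ?_
  have h1 : ∀ a, (alg w).sgnHom (gen w a) = (-1 : ℚ) ^ w a • gen w a :=
    fun a => (alg w).sgn_of_mem (gen_mem w a)
  have h2 : ∀ a b, (gen w a : FreeGC w) * D b =
      (-1 : ℚ) ^ (w a * (w b + 1)) • ((D b : FreeGC w) * gen w a) :=
    fun a b => (alg w).comm (gen_mem w a) (D b).2
  have h3 : ∀ a b, (alg w).sgnHom (gen w a) * (D b : FreeGC w) =
      (-1 : ℚ) ^ (w a * w b) • ((D b : FreeGC w) * gen w a) := by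
    intro a b
    rw [h1]
    refine (smul_mul_assoc ((-1 : ℚ) ^ w a) (gen w a) (D b : FreeGC w)).trans ?_
    rw [h2, smul_smul, ← pow_add, show w a + w a * (w b + 1) = w a * w b + 2 * w a by ring, pow_add,
      pow_mul]
    simp
  refine (congrArg₂ (· + ·) (h3 a b) rfl).trans ?_
  refine Eq.trans ?_ (congrArg (fun z => (-1 : ℚ) ^ (w a * w b) • (z + (D b : FreeGC w) * gen w a))
    (h3 b a).symm)
  rw [mul_comm (w b) (w a)]
  change (-1 : ℚ) ^ (w a * w b) • ((D b : FreeGC w) * gen w a) + (D a : FreeGC w) * gen w b = _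
  rcases neg_one_pow_eq_or ℚ (w a * w b) with h | h <;> rw [h] <;> module

/-- The derivation of `ΛV` of degree `1` with given values on generators. -/
noncomputable def der : (alg w).carrier →ₗ[ℚ] (alg w).carrier := (exists_der D).choose

@[simp]
theorem der_gen (a : ι) : der D (gen w a) = (D a : FreeGC w) := (exists_der D).choose_spec.1 a

theorem der_mul (x y : (alg w).carrier) :
    der D (x * y) = (alg w).sgn x * der D y + der D x * y := (exists_der D).choose_spec.2 x y

theorem der_one : der D (1 : (alg w).carrier) = 0 := by
  have h := der_mul D 1 1
  rw [GCAlg.sgn_one] at h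
  simpa using h

theorem der_mem {k : ℕ} {x : (alg w).carrier} (hx : x ∈ (alg w).deg k) :
    der D x ∈ (alg w).deg (k + 1) := by
  induction hx using Submodule.span_induction with
  | mem x hx =>
    obtain ⟨l, rfl, rfl⟩ := hx
    induction l with
    | nil => rw [mon_nil]; erw [der_one]; exact Submodule.zero_mem _
    | cons a l ih =>
      rw [mon_cons]
      erw [der_mul]
      refine Submodule.add_mem _ ?_ ?_
      · rw [(alg w).sgn_of_mem (gen_mem w a), smul_mul_assoc]
        refine Submodule.smul_mem _ _ ?_
        have := SetLike.mul_mem_graded (A := (alg w).deg) (gen_mem w a) ih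
        simpa [add_assoc] using this
      · rw [der_gen]
        have := SetLike.mul_mem_graded (A := (alg w).deg) (D a).2 (mon_mem w l)
        simpa [add_assoc, add_comm, add_left_comm] using this
  | zero => rw [map_zero]; exact Submodule.zero_mem _
  | add x y _ _ h1 h2 => rw [map_add]; exact Submodule.add_mem _ h1 h2
  | smul c x _ h => rw [map_smul]; exact Submodule.smul_mem _ c h

/-- The square of a derivation of degree `1` vanishes if it does so on generators. -/
theorem der_der (hD : ∀ a, der D (D a : FreeGC w) = 0) (x : (alg w).carrier) :
    der D (der D x) = 0 := by
  have key := (alg w).sq_derivation (der D) (der_mem D) (der_mul D)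
  induction x using induction_left with
  | one => erw [der_one]; exact map_zero _
  | gen_mul a x hx =>
    refine (key (gen w a) x).trans ?_
    rw [hx, der_gen, hD, mul_zero, zero_mul, add_zero]
  | add x y hx hy => erw [map_add, map_add, hx, hy, add_zero]
  | smul c x hx => erw [map_smul, map_smul, hx, smul_zero]

/-- The DGA with underlying algebra `ΛV` and given differential of the generators. -/
noncomputable abbrev dga (hD : ∀ a, der D (D a : FreeGC w) = 0) : DGA.{u} where
  toGCAlg := alg w
  d := der D
  d_mem := der_mem D
  d_d := der_der D hD
  leibniz := by
    intro i x y hx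
    rw [der_mul, (alg w).sgn_of_mem hx, smul_mul_assoc, add_comm]

end FreeGC

/-! ### Subalgebras generated by homogeneous elements -/

namespace GCAlg

section Adjoin

variable (H : GCAlg.{u}) {ι : Type v} {w : ι → ℕ} {x : ι → H.carrier}

variable {H} in
theorem adjoin_induction_left {T : Set ι} {p : H.carrier → Prop} (one : p 1)
    (mul : ∀ a ∈ T, ∀ y ∈ Algebra.adjoin ℚ (x '' T), p y → p (x a * y))
    (add : ∀ y z, p y → p z → p (y + z)) (smul : ∀ (c : ℚ) y, p y → p (c • y))
    {y : H.carrier} (hy : y ∈ Algebra.adjoin ℚ (x '' T)) : p y := by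
  rw [← Subalgebra.mem_toSubmodule, Algebra.adjoin_eq_span] at hy
  have h2 : ∀ z ∈ Submonoid.closure (x '' T), z ∈ Algebra.adjoin ℚ (x '' T) := fun z hz => by
    rw [← Subalgebra.mem_toSubmodule, Algebra.adjoin_eq_span]
    exact Submodule.subset_span hz
  induction hy using Submodule.span_induction with
  | mem y hy =>
    induction hy using Submonoid.closure_induction_left with
    | one => exact one
    | mul_left z hz y hy ih =>
      obtain ⟨a, ha, rfl⟩ := hz
      exact mul a ha y (h2 y hy) ih
  | zero => simpa using smul 0 1 one
  | add y z _ _ hy hz => exact add y z hy hz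
  | smul c y _ hy => exact smul c y hy

/-- The projection to degree `k`. -/
abbrev pr (k : ℕ) : H.carrier →ₗ[ℚ] H.carrier := GradedAlgebra.proj H.deg k

variable {H}

theorem pr_mem (k : ℕ) (y : H.carrier) : H.pr k y ∈ H.deg k := by
  rw [pr, GradedAlgebra.proj_apply]; exact SetLike.coe_mem _

theorem pr_of_mem {k : ℕ} {y : H.carrier} (hy : y ∈ H.deg k) : H.pr k y = y := by
  rw [pr, GradedAlgebra.proj_apply, DirectSum.decompose_of_mem_same _ hy]

theorem pr_of_mem_ne {k l : ℕ} {y : H.carrier} (hy : y ∈ H.deg k) (h : k ≠ l) :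
    H.pr l y = 0 := by
  rw [pr, GradedAlgebra.proj_apply, DirectSum.decompose_of_mem_ne _ hy h]

theorem eq_zero_of_mem_of_mem {k l : ℕ} {y : H.carrier} (hy : y ∈ H.deg k) (hy' : y ∈ H.deg l)
    (h : k ≠ l) : y = 0 := by
  rw [← pr_of_mem hy', pr_of_mem_ne hy h]

theorem pr_mul_of_le {k i : ℕ} {a : H.carrier} (ha : a ∈ H.deg i) (y : H.carrier) (h : i ≤ k) :
    H.pr k (a * y) = a * H.pr (k - i) y := by
  rw [pr, pr, GradedAlgebra.proj_apply, GradedAlgebra.proj_apply,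
    DirectSum.coe_decompose_mul_of_left_mem_of_le _ ha h]

theorem pr_mul_of_lt {k i : ℕ} {a : H.carrier} (ha : a ∈ H.deg i) (y : H.carrier) (h : k < i) :
    H.pr k (a * y) = 0 := by
  rw [pr, GradedAlgebra.proj_apply,
    DirectSum.coe_decompose_mul_of_left_mem_of_not_le _ ha (not_le.2 h)]

theorem pr_mem_adjoin (hx : ∀ a, x a ∈ H.deg (w a)) {T : Set ι} {y : H.carrier}
    (hy : y ∈ Algebra.adjoin ℚ (x '' T)) (k : ℕ) : H.pr k y ∈ Algebra.adjoin ℚ (x '' T) := by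
  refine adjoin_induction_left (p := fun y => ∀ k, H.pr k y ∈ Algebra.adjoin ℚ (x '' T))
    (fun k => ?_) (fun a ha y _ ih k => ?_) (fun y z hy hz k => ?_) (fun c y hy k => ?_) hy k
  · by_cases h : 0 = k
    · subst h
      rw [pr_of_mem (SetLike.one_mem_graded H.deg)]; exact one_mem _
    · rw [pr_of_mem_ne (SetLike.one_mem_graded H.deg) h]; exact zero_mem _
  · rcases le_or_gt (w a) k with h | h
    · rw [pr_mul_of_le (hx a) y h]
      exact mul_mem (Algebra.subset_adjoin ⟨a, ha, rfl⟩) (ih _)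
    · rw [pr_mul_of_lt (hx a) y h]; exact zero_mem _
  · rw [map_add]; exact add_mem (hy k) (hz k)
  · rw [map_smul]; exact Subalgebra.smul_mem _ (hy k) c

/-- An element of degree `i < 3q` of the subalgebra generated by two sets of homogeneous elements,
the second one in degrees at least `q`, is at most quadratic in the elements of the second set. -/
theorem exists_decomp_quadratic (hx : ∀ a, x a ∈ H.deg (w a)) {T T' : Set ι} {q i : ℕ}
    (hq : ∀ a ∈ T', q ≤ w a) (hi : i < 3 * q) {y : H.carrier}
    (hy : y ∈ Algebra.adjoin ℚ (x '' (T ∪ T'))) (hyi : y ∈ H.deg i) :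
    ∃ z ∈ Algebra.adjoin ℚ (x '' T), z ∈ H.deg i ∧
      ∃ p : ι →₀ H.carrier, (∀ a, p a ∈ Algebra.adjoin ℚ (x '' T)) ∧
        (∀ a, p a ∈ H.deg (i - w a)) ∧ (∀ a, ¬(a ∈ T' ∧ w a ≤ i) → p a = 0) ∧
      ∃ r : ι × ι →₀ H.carrier, (∀ c, r c ∈ Algebra.adjoin ℚ (x '' T)) ∧
        (∀ c, r c ∈ H.deg (i - (w c.1 + w c.2))) ∧
        (∀ c, ¬(c.1 ∈ T' ∧ c.2 ∈ T' ∧ w c.1 + w c.2 ≤ i) → r c = 0) ∧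
        y = z + (p.sum fun a b => x a * b) + r.sum fun c b => x c.1 * x c.2 * b := by
  classical
  set S : Subalgebra ℚ H.carrier := Algebra.adjoin ℚ (x '' T) with hS
  set P1 : Submodule ℚ H.carrier := Submodule.span ℚ {t | ∃ a ∈ T', ∃ c ∈ S, t = x a * c} with hP1
  set P2 : Submodule ℚ H.carrier :=
    Submodule.span ℚ {t | ∃ a ∈ T', ∃ b ∈ T', ∃ c ∈ S, t = x a * x b * c} with hP2
  set P3 : Submodule ℚ H.carrier :=
    Submodule.span ℚ {t | ∃ a ∈ T', ∃ b ∈ T', ∃ c ∈ T', ∃ e, t = x a * x b * x c * e} with hP3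
  have comm : ∀ a b c, x a * (x b * c) = (-1 : ℚ) ^ (w a * w b) • (x b * (x a * c)) := by
    intro a b c
    rw [← mul_assoc, H.comm (hx a) (hx b), smul_mul_assoc, mul_assoc]
  have hmem : ∀ a ∈ T, x a ∈ S := fun a ha => Algebra.subset_adjoin ⟨a, ha, rfl⟩
  have hall : y ∈ Subalgebra.toSubmodule S ⊔ P1 ⊔ P2 ⊔ P3 := by
    refine adjoin_induction_left (p := fun y => y ∈ Subalgebra.toSubmodule S ⊔ P1 ⊔ P2 ⊔ P3)
      ?_ (fun a ha y _ ih => ?_) (fun y z hy hz => Submodule.add_mem _ hy hz)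
      (fun c y hy => Submodule.smul_mem _ c hy) hy
    · exact Submodule.mem_sup_left (Submodule.mem_sup_left (Submodule.mem_sup_left (one_mem S)))
    · have h0 : Subalgebra.toSubmodule S ≤ Subalgebra.toSubmodule S ⊔ P1 ⊔ P2 ⊔ P3 :=
        le_sup_left.trans (le_sup_left.trans le_sup_left)
      have h1 : P1 ≤ Subalgebra.toSubmodule S ⊔ P1 ⊔ P2 ⊔ P3 :=
        le_sup_right.trans (le_sup_left.trans le_sup_left)
      have h2 : P2 ≤ Subalgebra.toSubmodule S ⊔ P1 ⊔ P2 ⊔ P3 :=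
        le_sup_right.trans le_sup_left
      have h3 : P3 ≤ Subalgebra.toSubmodule S ⊔ P1 ⊔ P2 ⊔ P3 := le_sup_right
      have hle : Subalgebra.toSubmodule S ⊔ P1 ⊔ P2 ⊔ P3 ≤
          (Subalgebra.toSubmodule S ⊔ P1 ⊔ P2 ⊔ P3).comap (LinearMap.mulLeft ℚ (x a)) := by
        have h3' : P3 ≤ (Subalgebra.toSubmodule S ⊔ P1 ⊔ P2 ⊔ P3).comap
            (LinearMap.mulLeft ℚ (x a)) := by
          refine Submodule.span_le.2 ?_
          rintro _ ⟨b, hb, c, hc, d, hd, e, rfl⟩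
          change x a * (x b * x c * x d * e) ∈ Subalgebra.toSubmodule S ⊔ P1 ⊔ P2 ⊔ P3
          rw [mul_assoc, mul_assoc, comm, comm a c, comm a d]
          simp only [mul_smul_comm]
          refine Submodule.smul_mem _ _ (Submodule.smul_mem _ _ (Submodule.smul_mem _ _
            (h3 (Submodule.subset_span ⟨b, hb, c, hc, d, hd, x a * e, ?_⟩))))
          simp only [mul_assoc]
        rcases ha with ha | ha
        · refine sup_le (sup_le (sup_le ?_ ?_) ?_) h3'
          · intro c hc
            exact h0 (S.mul_mem (hmem a ha) hc)
          · refine Submodule.span_le.2 ?_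
            rintro _ ⟨b, hb, c, hc, rfl⟩
            change x a * (x b * c) ∈ Subalgebra.toSubmodule S ⊔ P1 ⊔ P2 ⊔ P3
            rw [comm]
            exact Submodule.smul_mem _ _ (h1 (Submodule.subset_span
              ⟨b, hb, x a * c, mul_mem (hmem a ha) hc, rfl⟩))
          · refine Submodule.span_le.2 ?_
            rintro _ ⟨b, hb, c, hc, d, hd, rfl⟩
            change x a * (x b * x c * d) ∈ Subalgebra.toSubmodule S ⊔ P1 ⊔ P2 ⊔ P3
            rw [mul_assoc, comm, comm a c]
            simp only [mul_smul_comm]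
            refine Submodule.smul_mem _ _ (Submodule.smul_mem _ _ (h2 (Submodule.subset_span
              ⟨b, hb, c, hc, x a * d, mul_mem (hmem a ha) hd, ?_⟩)))
            simp only [mul_assoc]
        · refine sup_le (sup_le (sup_le ?_ ?_) ?_) h3'
          · intro c hc
            exact h1 (Submodule.subset_span ⟨a, ha, c, hc, rfl⟩)
          · refine Submodule.span_le.2 ?_
            rintro _ ⟨b, hb, c, hc, rfl⟩
            refine h2 (Submodule.subset_span ⟨a, ha, b, hb, c, hc, ?_⟩)
            rw [LinearMap.mulLeft_apply, mul_assoc]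
          · refine Submodule.span_le.2 ?_
            rintro _ ⟨b, hb, c, hc, d, hd, rfl⟩
            refine h3 (Submodule.subset_span ⟨a, ha, b, hb, c, hc, d, ?_⟩)
            simp only [LinearMap.mulLeft_apply, mul_assoc]
      exact hle ih
  -- the components of degree `i` of elements of `P1`, `P2` and `P3`
  have k1 : ∀ y ∈ P1, ∃ p : ι →₀ H.carrier, (∀ a, p a ∈ S) ∧
      (∀ a, p a ∈ H.deg (i - w a)) ∧ (∀ a, ¬(a ∈ T' ∧ w a ≤ i) → p a = 0) ∧
      H.pr i y = p.sum fun a b => x a * b := by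
    intro y hy
    induction hy using Submodule.span_induction with
    | mem y hy =>
      obtain ⟨a, ha, c, hc, rfl⟩ := hy
      rcases le_or_gt (w a) i with h | h
      · refine ⟨Finsupp.single a (H.pr (i - w a) c), fun b => ?_, fun b => ?_, fun b hb => ?_, ?_⟩
        · rw [Finsupp.single_apply]; split_ifs
          · exact pr_mem_adjoin hx hc _
          · exact zero_mem _
        · rw [Finsupp.single_apply]; split_ifs with hab
          · rw [← hab]; exact pr_mem _ _
          · exact zero_mem _
        · rw [Finsupp.single_apply, if_neg]
          rintro rfl; exact hb ⟨ha, h⟩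
        · rw [pr_mul_of_le (hx a) c h, Finsupp.sum_single_index (mul_zero _)]
      · exact ⟨0, fun b => zero_mem _, fun b => zero_mem _, fun b _ => rfl, by
          rw [pr_mul_of_lt (hx a) c h, Finsupp.sum_zero_index]⟩
    | zero => exact ⟨0, fun b => zero_mem _, fun b => zero_mem _, fun b _ => rfl, by
          rw [map_zero, Finsupp.sum_zero_index]⟩
    | add y z _ _ hy hz =>
      obtain ⟨p, p1, p2, p3, p4⟩ := hy
      obtain ⟨q, q1, q2, q3, q4⟩ := hz
      refine ⟨p + q, fun a => add_mem (p1 a) (q1 a), fun a => add_mem (p2 a) (q2 a), fun a ha => ?_,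
        ?_⟩
      · rw [Finsupp.add_apply, p3 a ha, q3 a ha, add_zero]
      · rw [map_add, p4, q4, Finsupp.sum_add_index' (fun a => mul_zero _)
          (fun a b c => mul_add _ _ _)]
    | smul c y _ hy =>
      obtain ⟨p, p1, p2, p3, p4⟩ := hy
      refine ⟨c • p, fun a => Subalgebra.smul_mem _ (p1 a) c,
        fun a => Submodule.smul_mem _ c (p2 a), fun a ha => ?_, ?_⟩
      · rw [Finsupp.smul_apply, p3 a ha, smul_zero]
      · rw [map_smul, p4, Finsupp.sum_smul_index' (fun a => mul_zero _), Finsupp.smul_sum]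
        simp only [mul_smul_comm]
  have k2 : ∀ y ∈ P2, ∃ p : ι × ι →₀ H.carrier, (∀ a, p a ∈ S) ∧
      (∀ c, p c ∈ H.deg (i - (w c.1 + w c.2))) ∧
      (∀ c, ¬(c.1 ∈ T' ∧ c.2 ∈ T' ∧ w c.1 + w c.2 ≤ i) → p c = 0) ∧
      H.pr i y = p.sum fun c b => x c.1 * x c.2 * b := by
    intro y hy
    induction hy using Submodule.span_induction with
    | mem y hy =>
      obtain ⟨a, ha, b, hb, c, hc, rfl⟩ := hy
      have hab : x a * x b ∈ H.deg (w a + w b) := SetLike.mul_mem_graded (hx a) (hx b)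
      rcases le_or_gt (w a + w b) i with h | h
      · refine ⟨Finsupp.single (a, b) (H.pr (i - (w a + w b)) c), fun e => ?_, fun e => ?_,
          fun e he => ?_, ?_⟩
        · rw [Finsupp.single_apply]; split_ifs
          · exact pr_mem_adjoin hx hc _
          · exact zero_mem _
        · rw [Finsupp.single_apply]; split_ifs with hab
          · rw [← hab]; exact pr_mem _ _
          · exact zero_mem _
        · rw [Finsupp.single_apply, if_neg]
          rintro rfl; exact he ⟨ha, hb, h⟩
        · rw [pr_mul_of_le hab c h, Finsupp.sum_single_index (mul_zero _)]
      · exact ⟨0, fun b => zero_mem _, fun b => zero_mem _, fun b _ => rfl, by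
          rw [pr_mul_of_lt hab c h, Finsupp.sum_zero_index]⟩
    | zero => exact ⟨0, fun b => zero_mem _, fun b => zero_mem _, fun b _ => rfl, by
          rw [map_zero, Finsupp.sum_zero_index]⟩
    | add y z _ _ hy hz =>
      obtain ⟨p, p1, p2, p3, p4⟩ := hy
      obtain ⟨q, q1, q2, q3, q4⟩ := hz
      refine ⟨p + q, fun a => add_mem (p1 a) (q1 a), fun a => add_mem (p2 a) (q2 a), fun a ha => ?_,
        ?_⟩
      · rw [Finsupp.add_apply, p3 a ha, q3 a ha, add_zero]
      · rw [map_add, p4, q4, Finsupp.sum_add_index' (fun a => mul_zero _)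
          (fun a b c => mul_add _ _ _)]
    | smul c y _ hy =>
      obtain ⟨p, p1, p2, p3, p4⟩ := hy
      refine ⟨c • p, fun a => Subalgebra.smul_mem _ (p1 a) c,
        fun a => Submodule.smul_mem _ c (p2 a), fun a ha => ?_, ?_⟩
      · rw [Finsupp.smul_apply, p3 a ha, smul_zero]
      · rw [map_smul, p4, Finsupp.sum_smul_index' (fun a => mul_zero _), Finsupp.smul_sum]
        simp only [mul_smul_comm]
  have k3 : ∀ y ∈ P3, H.pr i y = 0 := by
    intro y hy
    induction hy using Submodule.span_induction with
    | mem y hy =>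
      obtain ⟨a, ha, b, hb, c, hc, e, rfl⟩ := hy
      refine pr_mul_of_lt (SetLike.mul_mem_graded (SetLike.mul_mem_graded (hx a) (hx b)) (hx c)) e ?_
      have := hq a ha; have := hq b hb; have := hq c hc
      omega
    | zero => exact map_zero _
    | add y z _ _ hy hz => rw [map_add, hy, hz, add_zero]
    | smul c y _ hy => rw [map_smul, hy, smul_zero]
  obtain ⟨y012, hy012, y3, hy3, rfl⟩ := Submodule.mem_sup.1 hall
  obtain ⟨y01, hy01, y2, hy2, rfl⟩ := Submodule.mem_sup.1 hy012
  obtain ⟨y0, hy0, y1, hy1, rfl⟩ := Submodule.mem_sup.1 hy01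
  obtain ⟨p, p1, p2, p3, p4⟩ := k1 y1 hy1
  obtain ⟨r, r1, r2, r3, r4⟩ := k2 y2 hy2
  refine ⟨H.pr i y0, pr_mem_adjoin hx hy0 i, pr_mem _ _, p, p1, p2, p3, r, r1, r2, r3, ?_⟩
  have h0 := pr_of_mem hyi
  rw [map_add, map_add, map_add, p4, r4, k3 y3 hy3, add_zero] at h0
  exact h0.symm

/-- An element of degree `i < 2q` is at most linear in the elements of the second set. -/
theorem exists_decomp_linear (hx : ∀ a, x a ∈ H.deg (w a)) {T T' : Set ι} {q i : ℕ}
    (hq : ∀ a ∈ T', q ≤ w a) (hi : i < 2 * q) {y : H.carrier}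
    (hy : y ∈ Algebra.adjoin ℚ (x '' (T ∪ T'))) (hyi : y ∈ H.deg i) :
    ∃ z ∈ Algebra.adjoin ℚ (x '' T), z ∈ H.deg i ∧
      ∃ p : ι →₀ H.carrier, (∀ a, p a ∈ Algebra.adjoin ℚ (x '' T)) ∧
        (∀ a, p a ∈ H.deg (i - w a)) ∧ (∀ a, ¬(a ∈ T' ∧ w a ≤ i) → p a = 0) ∧
        y = z + p.sum fun a b => x a * b := by
  obtain ⟨z, hz, hzi, p, p1, p2, p3, r, -, -, r3, rfl⟩ :=
    exists_decomp_quadratic hx hq (by omega) hy hyi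
  have hr : r = 0 := Finsupp.ext fun c => r3 c fun ⟨h1, h2, h3⟩ => by
    have := hq _ h1; have := hq _ h2; omega
  exact ⟨z, hz, hzi, p, p1, p2, p3, by rw [hr, Finsupp.sum_zero_index, add_zero]⟩

/-- An element of degree `i < q` does not involve the elements of the second set. -/
theorem mem_adjoin_of_lt (hx : ∀ a, x a ∈ H.deg (w a)) {T T' : Set ι} {q i : ℕ}
    (hq : ∀ a ∈ T', q ≤ w a) (hi : i < q) {y : H.carrier}
    (hy : y ∈ Algebra.adjoin ℚ (x '' (T ∪ T'))) (hyi : y ∈ H.deg i) :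
    y ∈ Algebra.adjoin ℚ (x '' T) := by
  obtain ⟨z, hz, hzi, p, -, -, p3, rfl⟩ := exists_decomp_linear hx hq (by omega) hy hyi
  have hp : p = 0 := Finsupp.ext fun c => p3 c fun ⟨h1, h2⟩ => by
    have := hq _ h1; omega
  rwa [hp, Finsupp.sum_zero_index, add_zero]

end Adjoin

end GCAlg

namespace FreeGC

variable {ι : Type u} {w : ι → ℕ}

/-- The generators outside `T` are linearly independent over the subalgebra generated by `T`. -/
theorem eq_zero_of_sum_gen_mul {T : Set ι} {z : FreeGC w}
    (hz : z ∈ Algebra.adjoin ℚ (gen w '' T)) (p : ι →₀ FreeGC w)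
    (hp : ∀ a, p a ∈ Algebra.adjoin ℚ (gen w '' T)) (hpT : ∀ a ∈ T, p a = 0)
    (h : z + (p.sum fun a b => gen w a * b) = 0) : p = 0 := by
  classical
  ext b
  by_cases hb : b ∈ T
  · rw [hpT b hb]; rfl
  -- the partial derivative with respect to the generator `b`
  obtain ⟨D, hD, hmul⟩ := exists_derivation w
    (lift w (fun a => (-1 : ℚ) ^ (w a * w b) • gen w a) fun a c => by
      rw [smul_mul_smul_comm, smul_mul_smul_comm, gen_mul_gen w a c, smul_smul, smul_smul]
      congr 1; ring)
    (AlgHom.id ℚ (FreeGC w)) (fun a => if a = b then 1 else 0) (fun a c => by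
      simp only [lift_gen, AlgHom.id_apply]
      have h2 : ∀ k : ℕ, (-1 : ℚ) ^ k * (-1 : ℚ) ^ k = 1 := fun k => by rw [← mul_pow]; simp
      rcases eq_or_ne a b with h1 | h1 <;> rcases eq_or_ne c b with h3 | h3
      · subst h1 h3
        simp [smul_add, smul_smul, ← mul_pow, add_comm]
      · subst h1
        simp [h3, smul_smul, mul_comm (w c), h2]
      · subst h3
        simp [h1]
      · simp [h1, h3])
  have hT : ∀ y ∈ Algebra.adjoin ℚ (gen w '' T), D y = 0 := by
    intro y hy
    have h1 : D 1 = 0 := by simpa using hmul 1 1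
    refine GCAlg.adjoin_induction_left (H := alg w) (p := fun y => D y = 0) h1
      (fun a ha y _ ih => ?_) (fun y z hy hz => ?_) (fun c y hy => ?_) hy
    · have hab : a ≠ b := fun h => hb (h ▸ ha)
      change D (gen w a * y) = 0
      rw [hmul, ih, hD, if_neg hab, mul_zero, zero_mul, add_zero]
    · exact (map_add D y z).trans (by rw [hy, hz, add_zero])
    · exact (map_smul D c y).trans (by rw [hy, smul_zero])
  have h' := congrArg D h
  rw [map_add, hT z hz, map_zero, zero_add, map_finsuppSum] at h'
  have h3 : ∀ a ∈ p.support, D (gen w a * p a) = if a = b then p a else 0 := by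
    intro a _
    rw [hmul, hT _ (hp a), hD, mul_zero, zero_add, AlgHom.id_apply, ite_mul, one_mul, zero_mul]
  rw [Finsupp.sum, Finset.sum_congr rfl h3, Finset.sum_ite_eq'] at h'
  by_cases hbs : b ∈ p.support
  · rw [if_pos hbs] at h'; exact h'
  · exact Finsupp.notMem_support_iff.1 hbs

/-- Linear maps on `ΛV` are given by functions on words, compatible with transpositions of
neighbouring letters. -/
theorem exists_linearMap_of_words {W : Type v} [AddCommGroup W] [Module ℚ W] (f : List ι → W)
    (hf : ∀ l l' a b, f (l ++ a :: b :: l') = (-1 : ℚ) ^ (w a * w b) • f (l ++ b :: a :: l')) :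
    ∃ L : FreeGC w →ₗ[ℚ] W, ∀ l, L (mon w l) = f l := by
  classical
  let m : List ι → FreeAlgebra ℚ ι := fun l => (l.map (FreeAlgebra.ι ℚ)).prod
  let bas : Module.Basis (FreeMonoid ι) ℚ (FreeAlgebra ℚ ι) := FreeAlgebra.basisFreeMonoid ℚ ι
  have hbas : ∀ l : FreeMonoid ι, bas l = m l.toList := by
    intro l
    have h1 : FreeAlgebra.equivMonoidAlgebraFreeMonoid (R := ℚ) (m l.toList) =
        MonoidAlgebra.single l 1 := by
      change _ = MonoidAlgebra.of ℚ (FreeMonoid ι) l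
      induction l using FreeMonoid.inductionOn' with
      | one => exact map_one _
      | of_mul a l ih =>
        have h2 : m (FreeMonoid.of a * l).toList = FreeAlgebra.ι ℚ a * m l.toList := by simp [m]
        rw [h2, map_mul, ih, map_mul]
        simp [FreeAlgebra.equivMonoidAlgebraFreeMonoid]
    rw [← (FreeAlgebra.equivMonoidAlgebraFreeMonoid (R := ℚ) (X := ι)).symm_apply_eq.2 h1.symm]
    rfl
  let F : FreeAlgebra ℚ ι →ₗ[ℚ] W := bas.constr ℚ fun l => f l.toList
  have hF : ∀ l, F (m l) = f l := by
    intro l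
    have := bas.constr_basis ℚ (fun l => f l.toList) (FreeMonoid.ofList l)
    rw [hbas] at this
    exact this
  -- the largest two-sided ideal on which `F` vanishes; it contains the defining relations
  let J : Ideal (FreeAlgebra ℚ ι) :=
    { carrier := {y | ∀ p q, F (p * y * q) = 0}
      zero_mem' := fun p q => by simp
      add_mem' := fun {y z} hy hz p q => by
        rw [mul_add, add_mul, map_add, hy, hz, add_zero]
      smul_mem' := fun c y hy p q => by
        rw [smul_eq_mul, ← mul_assoc]; exact hy _ _ }
  have : J.IsTwoSided := ⟨fun {y} c hy p q => by
    rw [← mul_assoc, mul_assoc]; exact hy _ _⟩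
  have hrel : ∀ a b, FreeAlgebra.ι ℚ a * FreeAlgebra.ι ℚ b -
      (-1 : ℚ) ^ (w a * w b) • (FreeAlgebra.ι ℚ b * FreeAlgebra.ι ℚ a) ∈ J := by
    intro a b p q
    have key : ∀ l l' : List ι, F (m l * (FreeAlgebra.ι ℚ a * FreeAlgebra.ι ℚ b -
      (-1 : ℚ) ^ (w a * w b) • (FreeAlgebra.ι ℚ b * FreeAlgebra.ι ℚ a)) * m l') = 0 := by
      intro l l'
      have h1 : m l * (FreeAlgebra.ι ℚ a * FreeAlgebra.ι ℚ b -
          (-1 : ℚ) ^ (w a * w b) • (FreeAlgebra.ι ℚ b * FreeAlgebra.ι ℚ a)) * m l' =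
          m (l ++ a :: b :: l') - (-1 : ℚ) ^ (w a * w b) • m (l ++ b :: a :: l') := by
        simp [m, mul_sub, sub_mul, mul_assoc]
      rw [h1, map_sub, map_smul, hF, hF, hf l l' a b, sub_self]
    have hspan : ∀ p, p ∈ Submodule.span ℚ (Set.range m) := fun p => by
      have h2 := bas.span_eq
      rw [show Set.range bas = Set.range m from by
        rw [show (bas : FreeMonoid ι → _) = m ∘ FreeMonoid.toList from funext hbas]
        exact FreeMonoid.toList.surjective.range_comp _] at h2
      rw [h2]; trivial
    induction hspan p, hspan q using Submodule.span_induction₂ with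
    | mem_mem p q hp hq =>
      obtain ⟨l, rfl⟩ := hp
      obtain ⟨l', rfl⟩ := hq
      exact key l l'
    | zero_left => simp
    | zero_right => simp
    | add_left p p' q _ _ _ h1 h2 => rw [add_mul, add_mul, map_add, h1, h2, add_zero]
    | add_right p q q' _ _ _ h1 h2 => rw [mul_add, map_add, h1, h2, add_zero]
    | smul_left c p q _ _ h => rw [smul_mul_assoc, smul_mul_assoc, map_smul, h, smul_zero]
    | smul_right c p q _ _ h => rw [mul_smul_comm, map_smul, h, smul_zero]
  let g : FreeGC w →ₐ[ℚ] FreeAlgebra ℚ ι ⧸ J :=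
    lift w (fun a => Ideal.Quotient.mkₐ ℚ J (FreeAlgebra.ι ℚ a)) fun a b => by
      rw [← map_mul, ← map_mul, ← map_smul, ← sub_eq_zero, ← map_sub]
      exact Ideal.Quotient.eq_zero_iff_mem.2 (hrel a b)
  have hg : g.comp (RingQuot.mkAlgHom ℚ (FreeGCRel w)) = Ideal.Quotient.mkₐ ℚ J := by
    apply FreeAlgebra.hom_ext
    funext a
    exact lift_gen w _ _ a
  have hker : ∀ y, RingQuot.mkAlgHom ℚ (FreeGCRel w) y = 0 → F y = 0 := by
    intro y hy
    have h1 : Ideal.Quotient.mkₐ ℚ J y = 0 := by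
      rw [← hg, AlgHom.comp_apply, hy, map_zero]
    have h2 : y ∈ J := Ideal.Quotient.eq_zero_iff_mem.1 h1
    simpa using h2 1 1
  obtain ⟨s, hs⟩ := (RingQuot.mkAlgHom ℚ (FreeGCRel w)).toLinearMap.exists_rightInverse_of_surjective
    (LinearMap.range_eq_top.2 (RingQuot.mkAlgHom_surjective ℚ _))
  refine ⟨F ∘ₗ s, fun l => ?_⟩
  have h1 : RingQuot.mkAlgHom ℚ (FreeGCRel w) (m l) = mon w l := by
    rw [map_list_prod, List.map_map]; rfl
  have h2 := hker (s (mon w l) - m l) (by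
    rw [map_sub, h1, sub_eq_zero]
    exact LinearMap.congr_fun hs _)
  rw [map_sub, sub_eq_zero, hF] at h2
  exact h2

end FreeGC

/-! ### Differentials and homomorphisms of free algebras -/

namespace FreeGC

section Subalgebras

variable {ι : Type u} {w : ι → ℕ}

theorem deg_zero (hw : ∀ a, 1 ≤ w a) : deg w 0 = Submodule.span ℚ {1} := by
  refine le_antisymm (Submodule.span_le.2 ?_) (Submodule.span_le.2 ?_)
  · rintro _ ⟨l, hl, rfl⟩
    cases l with
    | nil => exact Submodule.mem_span_singleton_self _
    | cons a l =>
      have := hw a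
      simp only [List.map_cons, List.sum_cons] at hl
      omega
  · rintro _ rfl
    exact mon_mem w []

theorem deg_eq_bot {n k : ℕ} (hw : ∀ a, n ≤ w a) (h0 : k ≠ 0) (hk : k < n) : deg w k = ⊥ := by
  refine le_bot_iff.1 (Submodule.span_le.2 ?_)
  rintro _ ⟨l, hl, rfl⟩
  cases l with
  | nil => exact absurd hl.symm h0
  | cons a l =>
    have := hw a
    simp only [List.map_cons, List.sum_cons] at hl
    omega

theorem exists_smul_one (hw : ∀ a, 1 ≤ w a) {x : FreeGC w} (hx : x ∈ deg w 0) :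
    ∃ c : ℚ, x = c • 1 := by
  rw [deg_zero hw, Submodule.mem_span_singleton] at hx
  obtain ⟨c, rfl⟩ := hx
  exact ⟨c, rfl⟩

theorem der_gen_mul (D : ∀ a, deg w (w a + 1)) (a : ι) (x : FreeGC w) :
    der D (gen w a * x) = (-1 : ℚ) ^ w a • (gen w a * der D x) + (D a : FreeGC w) * x := by
  have h := der_mul D (gen w a) x
  rw [(alg w).sgn_of_mem (gen_mem w a), der_gen] at h
  refine h.trans ?_
  rw [smul_mul_assoc]

variable {D D' : ∀ a, deg w (w a + 1)} {T : Set ι}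

theorem der_congr (h : ∀ a ∈ T, D a = D' a) {x : FreeGC w}
    (hx : x ∈ Algebra.adjoin ℚ (gen w '' T)) : der D x = der D' x := by
  refine GCAlg.adjoin_induction_left (H := alg w) (x := gen w) (p := fun x => der D x = der D' x)
    ?_ (fun a ha y _ ih => ?_) (fun y z hy hz => ?_) (fun c y hy => ?_) hx
  · rw [der_one, der_one]
  · refine (der_gen_mul D a y).trans (Eq.trans ?_ (der_gen_mul D' a y).symm)
    rw [ih, h a ha]
  · rw [map_add, map_add, hy, hz]
  · rw [map_smul, map_smul, hy]

variable {A : DGA.{v}} {f : ∀ a, A.deg (w a)}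

/-- The homomorphism from `ΛV` with values `f` on the generators. -/
abbrev ev (A : DGA.{v}) (f : ∀ a, A.deg (w a)) : FreeGC w →ₐ[ℚ] A.carrier :=
  A.freeLift w (fun a => (f a : A.carrier)) fun a => (f a).2

theorem ev_mem {k : ℕ} {x : FreeGC w} (hx : x ∈ deg w k) : ev A f x ∈ A.deg k :=
  A.freeLift_mem _ _ (fun a => (f a).2) hx

theorem ev_gen (a : ι) : ev A f (gen w a) = f a := A.freeLift_gen _ _ (fun a => (f a).2) a

theorem ev_congr {f' : ∀ a, A.deg (w a)} (h : ∀ a ∈ T, f a = f' a) {x : FreeGC w}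
    (hx : x ∈ Algebra.adjoin ℚ (gen w '' T)) : ev A f x = ev A f' x := by
  refine GCAlg.adjoin_induction_left (H := alg w) (x := gen w)
    (p := fun x => ev A f x = ev A f' x)
    ?_ (fun a ha y hy ih => ?_) (fun y z hy hz => ?_) (fun c y hy => ?_) hx
  · exact (map_one _).trans (map_one _).symm
  · refine (map_mul _ (gen w a) y).trans (Eq.trans ?_ (map_mul _ (gen w a) y).symm)
    rw [ih, ev_gen, ev_gen, h a ha]
  · refine (map_add _ y z).trans (Eq.trans ?_ (map_add _ y z).symm)
    rw [hy, hz]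
  · refine (map_smul _ c y).trans (Eq.trans ?_ (map_smul _ c y).symm)
    rw [hy]

theorem ev_der_of_mem (h : ∀ a ∈ T, ev A f (D a) = A.d (f a)) {x : FreeGC w}
    (hx : x ∈ Algebra.adjoin ℚ (gen w '' T)) : ev A f (der D x) = A.d (ev A f x) := by
  refine GCAlg.adjoin_induction_left (H := alg w) (x := gen w)
    (p := fun x => ev A f (der D x) = A.d (ev A f x))
    ?_ (fun a ha y hy ih => ?_) (fun y z hy hz => ?_) (fun c y hy => ?_) hx
  · rw [der_one]
    exact (map_zero (ev A f)).trans (((congrArg A.d (map_one (ev A f))).trans A.d_one).symm)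
  · refine (congrArg (ev A f) (der_gen_mul D a y)).trans
      (Eq.trans ?_ (congrArg A.d (map_mul (ev A f) (gen w a) y)).symm)
    rw [map_add, map_smul, map_mul, map_mul, ih, ev_gen, h a ha, A.leibniz _ (f a).2, add_comm]
  · exact (congrArg (ev A f) (map_add (der D) y z)).trans ((map_add _ _ _).trans
      ((congrArg₂ (· + ·) hy hz).trans ((map_add A.d _ _).symm.trans
        (congrArg A.d (map_add (ev A f) y z).symm))))
  · exact (congrArg (ev A f) (map_smul (der D) c y)).trans ((map_smul (ev A f) _ _).trans
      ((congrArg (c • ·) hy).trans ((map_smul A.d _ _).symm.trans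
        (congrArg A.d (map_smul (ev A f) c y).symm))))

theorem mem_adjoin_image_univ (x : FreeGC w) : x ∈ Algebra.adjoin ℚ (gen w '' Set.univ) := by
  rw [Set.image_univ, adjoin_range_gen]; trivial

/-- The DGA homomorphism with values `f` on the generators. -/
noncomputable def dgaHom (hD : ∀ a, der D (D a : FreeGC w) = 0)
    (hf : ∀ a, ev A f (D a) = A.d (f a)) : DGA.Hom (dga D hD) A where
  toAlgHom := ev A f
  map_deg := fun hx => ev_mem hx
  map_d := fun x => ev_der_of_mem (T := Set.univ) (fun a _ => hf a) (mem_adjoin_image_univ x)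

end Subalgebras

end FreeGC

/-! ### Existence of minimal models -/

/-- Dependent choice for families indexed by a type with a rank function, chosen rank by rank. -/
theorem exists_of_rank_steps {ι : Type u} (r : ι → ℕ) {X : ι → Type v} [∀ a, Nonempty (X a)]
    (P : ℕ → (∀ a, X a) → Prop)
    (local_of : ∀ k σ σ', (∀ a, r a < k → σ a = σ' a) → P k σ → P k σ')
    (zero : ∀ σ, P 0 σ)
    (step : ∀ k σ, P k σ → ∃ σ', (∀ a, r a < k → σ' a = σ a) ∧ P (k + 1) σ') :
    ∃ σ, ∀ k, P k σ := by
  choose! next hnext1 hnext2 using step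
  let s : ℕ → ∀ a, X a := fun k => Nat.rec (fun a => Classical.arbitrary _) (fun k σ => next k σ) k
  have hs : ∀ k, P k (s k) := by
    intro k
    induction k with
    | zero => exact zero _
    | succ k ih => exact hnext2 k _ ih
  have hst : ∀ k l a, r a < k → k ≤ l → s l a = s k a := by
    intro k l a ha hkl
    induction l, hkl using Nat.le_induction with
    | base => rfl
    | succ l hl ih => exact (hnext1 l _ (hs l) a (by omega)).trans ih
  refine ⟨fun a => s (r a + 1) a, fun k => local_of k (s k) _ (fun a ha => ?_) (hs k)⟩
  exact hst (r a + 1) k a (by omega) ha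

/-- Representatives in `Z` of a basis of `Z / (Z ∩ B)`, indexed by a subset of a countable set. The
map `g` bounds the dimension. -/
theorem exists_complement_family {ι V U : Type u} [AddCommGroup V] [Module ℚ V] [AddCommGroup U]
    [Module ℚ U] (e : ℕ → ι) (he : Function.Injective e) (Z B : Submodule ℚ V) (g : V →ₗ[ℚ] U)
    (hU : Module.rank ℚ U ≤ Cardinal.aleph0) (hg : ∀ z ∈ Z, g z = 0 → z ∈ B) :
    ∃ (I : Set ι) (v : ι → V), I ⊆ Set.range e ∧ (∀ a, v a ∈ Z) ∧ (∀ a, a ∉ I → v a = 0) ∧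
      (∀ z ∈ Z, ∃ c : ι →₀ ℚ, (∀ a, a ∉ I → c a = 0) ∧ z - Finsupp.linearCombination ℚ v c ∈ B) ∧
      ∀ c : ι →₀ ℚ, Finsupp.linearCombination ℚ v c ∈ B → ∀ a ∈ I, c a = 0 := by
  classical
  let Q : Submodule ℚ (V ⧸ B) := Z.map B.mkQ
  let b := Module.Basis.ofVectorSpace ℚ Q
  have hlift : ∀ i, ∃ z ∈ Z, B.mkQ z = (b i : V ⧸ B) := fun i => (b i).2
  choose v hvZ hv using hlift
  have hcomb : ∀ c : _ →₀ ℚ, B.mkQ (Finsupp.linearCombination ℚ v c) =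
      (Finsupp.linearCombination ℚ b c : Q) := by
    intro c
    rw [Finsupp.linearCombination_apply, Finsupp.linearCombination_apply, map_finsuppSum,
      Finsupp.sum, Finsupp.sum, AddSubmonoidClass.coe_finsetSum]
    refine Finset.sum_congr rfl fun i _ => ?_
    rw [map_smul, hv]; rfl
  have hind : ∀ c : _ →₀ ℚ, Finsupp.linearCombination ℚ v c ∈ B → c = 0 := by
    intro c hc
    refine (linearIndependent_iff.1 b.linearIndependent) c (Subtype.ext ?_)
    rw [← hcomb]
    exact (Submodule.Quotient.mk_eq_zero B).2 hc
  have hli : LinearIndependent ℚ (g ∘ v) := by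
    rw [linearIndependent_iff]
    intro c hc
    refine hind c (hg _ ?_ ?_)
    · rw [Finsupp.linearCombination_apply]
      exact Submodule.sum_mem _ fun i _ => Submodule.smul_mem _ _ (hvZ i)
    · rw [← hc, Finsupp.linearCombination_apply, Finsupp.linearCombination_apply, map_finsuppSum]
      simp
  have hcount : Countable (Module.Basis.ofVectorSpaceIndex ℚ Q) :=
    Cardinal.mk_le_aleph0_iff.1 (hli.cardinal_le_rank.trans hU)
  obtain ⟨emb, hemb⟩ := exists_injective_nat (Module.Basis.ofVectorSpaceIndex ℚ Q)
  have hinj : Function.Injective (e ∘ emb) := he.comp hemb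
  let k : Module.Basis.ofVectorSpaceIndex ℚ Q ↪ ι := ⟨e ∘ emb, hinj⟩
  let v' : ι → V := Function.extend k v 0
  have hv' : ∀ i, v' (k i) = v i := fun i => hinj.extend_apply v 0 i
  have hv0 : ∀ a, a ∉ Set.range k → v' a = 0 := fun a ha =>
    Function.extend_apply' _ _ _ fun ⟨i, hi⟩ => ha ⟨i, hi⟩
  refine ⟨Set.range k, v', ?_, fun a => ?_, hv0, fun z hz => ?_, fun c hc => ?_⟩
  · rintro _ ⟨i, rfl⟩
    exact ⟨emb i, rfl⟩
  · by_cases ha : a ∈ Set.range k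
    · obtain ⟨i, rfl⟩ := ha
      rw [hv']; exact hvZ i
    · rw [hv0 a ha]; exact Submodule.zero_mem _
  · have hq : B.mkQ z ∈ Q := ⟨z, hz, rfl⟩
    refine ⟨(b.repr ⟨_, hq⟩).mapDomain k, fun a ha => Finsupp.mapDomain_of_notMem_range _ _ ha, ?_⟩
    rw [Finsupp.linearCombination_mapDomain, show v' ∘ k = v from funext hv',
      ← Submodule.Quotient.mk_eq_zero B, Submodule.Quotient.mk_sub, sub_eq_zero]
    have := hcomb (b.repr ⟨_, hq⟩)
    rw [b.linearCombination_repr] at this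
    exact this.symm
  · have h1 : Finsupp.linearCombination ℚ v' c =
        Finsupp.linearCombination ℚ v (c.comapDomain k hinj.injOn) := by
      rw [Finsupp.linearCombination_apply, Finsupp.linearCombination_apply, Finsupp.sum, Finsupp.sum]
      rw [Finsupp.comapDomain_support, ← Finset.sum_preimage k c.support hinj.injOn]
      · refine Finset.sum_congr rfl fun i _ => ?_
        rw [hv']; rfl
      · intro a _ ha
        rw [hv0 a ha, smul_zero]
    rw [h1] at hc
    have h2 := hind _ hc
    rintro _ ⟨i, rfl⟩
    exact DFunLike.congr_fun h2 i

namespace DGA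

/-- A linear map on all of `A` that sends closed elements to their cohomology classes. -/
theorem exists_classMap (A : DGA.{u}) : ∃ g : A.carrier →ₗ[ℚ] A.cohomology.carrier,
    ∀ z : A.closed, g z = A.toCoh z := by
  obtain ⟨g, hg⟩ := LinearMap.exists_extend (p := Subalgebra.toSubmodule A.closed)
    A.toCoh.toLinearMap
  exact ⟨g, fun z => LinearMap.congr_fun hg z⟩

/-- The labels of possible generators of a minimal model: the type of the generator (`true` for
generators that kill cohomology, `false` for closed ones), its level and a number. -/
abbrev Label : Type u := ULift.{u} (Bool × ℕ × ℕ)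

/-- The level of a label; generators of level `j` have degree `n + j`. -/
abbrev Label.lvl (a : Label.{u}) : ℕ := a.down.2.1

/-- The degree of the generator with a given label. -/
abbrev Label.wt (n : ℕ) (a : Label.{u}) : ℕ := n + a.lvl

open FreeGC Label

section Stage

variable {A : DGA.{u}} {n : ℕ}

variable (A n) in
/-- For each label, the data of a stage of the construction of a minimal model of `A`: whether the
generator occurs, its differential and its image in `A`. -/
abbrev Datum (a : Label.{u}) : Type u :=
  ULift.{u} Prop × deg (wt.{u} n) (wt n a + 1) × A.deg (wt n a)

variable (σ : ∀ a, Datum A n a)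

/-- The generators that occur in levels below `j`. -/
abbrev actGens (j : ℕ) : Set Label.{u} := {a | (σ a).1.down ∧ a.lvl < j}

/-- The subalgebra generated by the generators that occur in levels below `j`. -/
abbrev stage (j : ℕ) : Subalgebra ℚ (alg (wt.{u} n)).carrier :=
  Algebra.adjoin ℚ (gen (wt n) '' actGens σ j)

/-- The differential of a stage. -/
noncomputable abbrev stD : (alg (wt.{u} n)).carrier →ₗ[ℚ] (alg (wt.{u} n)).carrier :=
  der fun a => (σ a).2.1

/-- The map of a stage to `A`. -/
noncomputable abbrev stEv : (alg (wt.{u} n)).carrier →ₐ[ℚ] A.carrier := ev A fun a => (σ a).2.2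

/-- The properties of the `j`-th stage: it is a minimal Sullivan algebra over `A`, and the map to
`A` is surjective on cohomology below degree `n + j` and injective up to degree `n + j`. -/
structure StageInv (j : ℕ) (σ : ∀ a, Datum A n a) : Prop where
  D_mem : ∀ a ∈ actGens σ j, ((σ a).2.1 : FreeGC (wt n)) ∈ stage σ a.lvl
  d_D : ∀ a ∈ actGens σ j, stD σ ((σ a).2.1 : FreeGC (wt n)) = 0
  ev_D : ∀ a ∈ actGens σ j, stEv σ ((σ a).2.1 : FreeGC (wt n)) = A.d ((σ a).2.2 : A.carrier)
  surj : ∀ i < n + j, ∀ z ∈ A.deg i, A.d z = 0 → ∃ s ∈ stage σ j,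
    s ∈ (alg (wt n)).deg i ∧ stD σ s = 0 ∧ ∃ y, z = stEv σ s + A.d y
  inj : ∀ i ≤ n + j, ∀ s ∈ stage σ j, s ∈ (alg (wt n)).deg i → stD σ s = 0 →
    (∃ y, stEv σ s = A.d y) → ∃ t ∈ stage σ j, stD σ t = s
  D_zero : ∀ a ∈ actGens σ j, a.down.1 = false → ((σ a).2.1 : FreeGC (wt n)) = 0
  indep : ∀ i < j, ∀ c : Label.{u} →₀ ℚ,
    (∀ a, c a ≠ 0 → a ∈ actGens σ j ∧ a.down.1 = true ∧ a.lvl = i) →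
    Finsupp.linearCombination ℚ (fun a => ((σ a).2.1 : (alg (wt n)).carrier)) c = 0 → c = 0

variable {σ} {σ' : ∀ a, Datum A n a} {k : ℕ}

theorem actGens_congr (h : ∀ a, a.lvl < k → σ a = σ' a) {j : ℕ} (hj : j ≤ k) :
    actGens σ j = actGens σ' j := by
  ext a
  constructor <;> rintro ⟨h1, h2⟩
  · exact ⟨by rw [← h a (h2.trans_le hj)]; exact h1, h2⟩
  · exact ⟨by rw [h a (h2.trans_le hj)]; exact h1, h2⟩

theorem stage_congr (h : ∀ a, a.lvl < k → σ a = σ' a) {j : ℕ} (hj : j ≤ k) :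
    stage σ j = stage σ' j := by
  rw [stage, actGens_congr h hj]

theorem stage_mono (σ : ∀ a, Datum A n a) {i j : ℕ} (h : i ≤ j) : stage σ i ≤ stage σ j :=
  Algebra.adjoin_mono (Set.image_mono fun _ ha => ⟨ha.1, ha.2.trans_le h⟩)

theorem stD_congr (h : ∀ a, a.lvl < k → σ a = σ' a) {j : ℕ} (hj : j ≤ k)
    {x : (alg (wt n)).carrier} (hx : x ∈ stage σ j) : stD σ x = stD σ' x :=
  der_congr (T := actGens σ j) (fun a ha => by rw [h a (ha.2.trans_le hj)]) hx

theorem stEv_congr (h : ∀ a, a.lvl < k → σ a = σ' a) {j : ℕ} (hj : j ≤ k)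
    {x : (alg (wt n)).carrier} (hx : x ∈ stage σ j) : stEv σ x = stEv σ' x :=
  ev_congr (T := actGens σ j) (fun a ha => by rw [h a (ha.2.trans_le hj)]) hx

/-- A stage only depends on the data of the levels below it. -/
theorem StageInv.congr (h : ∀ a, a.lvl < k → σ a = σ' a) (H : StageInv k σ) : StageInv k σ' := by
  have hS := stage_congr h le_rfl
  have hG := actGens_congr h le_rfl
  have hd : ∀ x ∈ stage σ k, stD σ x = stD σ' x := fun x hx => stD_congr h le_rfl hx
  have he : ∀ x ∈ stage σ k, stEv σ x = stEv σ' x := fun x hx => stEv_congr h le_rfl hx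
  constructor
  · intro a ha
    rw [← hG] at ha
    rw [← h a ha.2, ← stage_congr h ha.2.le]
    exact H.D_mem a ha
  · intro a ha
    rw [← hG] at ha
    rw [← h a ha.2, ← hd _ (stage_mono σ ha.2.le (H.D_mem a ha))]
    exact H.d_D a ha
  · intro a ha
    rw [← hG] at ha
    rw [← h a ha.2, ← he _ (stage_mono σ ha.2.le (H.D_mem a ha))]
    exact H.ev_D a ha
  · intro i hi z hz hdz
    obtain ⟨s, hs, hsi, hds, y, hy⟩ := H.surj i hi z hz hdz
    exact ⟨s, hS ▸ hs, hsi, hd s hs ▸ hds, y, he s hs ▸ hy⟩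
  · intro i hi s hs hsi hds hy
    rw [← hS] at hs
    rw [← hd s hs] at hds
    rw [← he s hs] at hy
    obtain ⟨t, ht, hts⟩ := H.inj i hi s hs hsi hds hy
    exact ⟨t, hS ▸ ht, hd t ht ▸ hts⟩
  · intro a ha
    rw [← hG] at ha
    rw [← h a ha.2]
    exact H.D_zero a ha
  · intro i hi c hc hc0
    rw [← hG] at hc
    refine H.indep i hi c hc ?_
    rw [← hc0, Finsupp.linearCombination_apply, Finsupp.linearCombination_apply]
    refine Finset.sum_congr rfl fun a ha => ?_
    have h1 := (hc a (Finsupp.mem_support_iff.1 ha)).1.2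
    simp only [h a h1]

/-- The initial stage is `ℚ`, by connectedness of the cohomology. -/
theorem StageInv.zero (hA : A.cohomology.IsConnected (n - 1)) (σ : ∀ a, Datum A n a) :
    StageInv 0 σ := by
  have h0 : ∀ j, ¬ j < 0 := fun j => Nat.not_lt_zero j
  have hnt : Nontrivial A.cohomology.carrier := hA.1
  constructor
  · exact fun a ha => absurd ha.2 (h0 _)
  · exact fun a ha => absurd ha.2 (h0 _)
  · exact fun a ha => absurd ha.2 (h0 _)
  · intro i hi z hz hdz
    have hcls : A.toCoh ⟨z, hdz⟩ ∈ A.cohomology.deg i := A.mem_cohomology_deg.2 ⟨⟨z, hdz⟩, hz, rfl⟩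
    rcases Nat.eq_zero_or_pos i with rfl | hi0
    · rw [hA.2.1, Submodule.mem_span_singleton] at hcls
      obtain ⟨c, hc⟩ := hcls
      have h1 : A.toCoh (⟨z, hdz⟩ - c • 1) = 0 := by
        rw [map_sub, map_smul, map_one, hc, sub_self]
      obtain ⟨y, hy⟩ := A.toCoh_eq_zero.1 h1
      refine ⟨c • 1, Subalgebra.smul_mem _ (one_mem _) c,
        Submodule.smul_mem _ c (SetLike.one_mem_graded _), ?_, y, ?_⟩
      · rw [map_smul, der_one, smul_zero]
      · rw [hy, map_smul, map_one]
        change z = c • (1 : A.carrier) + (z - c • 1)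
        abel
    · rw [hA.2.2 i hi0 (by omega), Submodule.mem_bot] at hcls
      obtain ⟨y, hy⟩ := A.toCoh_eq_zero.1 hcls
      exact ⟨0, zero_mem _, Submodule.zero_mem _, map_zero _, y, by
        rw [map_zero, zero_add, hy]⟩
  · rintro i - s hs - - ⟨y, hy⟩
    have hempty : actGens σ 0 = ∅ := Set.eq_empty_of_forall_notMem fun a ha => h0 _ ha.2
    rw [stage, hempty, Set.image_empty, Algebra.adjoin_empty] at hs
    obtain ⟨c, rfl⟩ := Algebra.mem_bot.1 hs
    refine ⟨0, zero_mem _, ?_⟩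
    have h1 : A.toCoh (c • 1) = 0 := A.toCoh_eq_zero.2 ⟨y, by
      rw [← hy, AlgHom.commutes, Algebra.algebraMap_eq_smul_one]; rfl⟩
    rw [map_smul, map_one, smul_eq_zero] at h1
    rcases h1 with rfl | h1
    · rw [map_zero, map_zero]
    · exact absurd h1 one_ne_zero
  · exact fun a ha => absurd ha.2 (h0 _)
  · exact fun i hi => absurd hi (h0 _)

theorem rank_freeGC_le : Module.rank ℚ (alg (wt.{u} n)).carrier ≤ Cardinal.aleph0 := by
  have h1 := Algebra.rank_adjoin_le (R := ℚ) (S := FreeGC (wt.{u} n)) (Set.range (gen (wt.{u} n)))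
  rw [adjoin_range_gen] at h1
  have h2 : Module.rank ℚ (alg (wt.{u} n)).carrier =
      Module.rank ℚ (⊤ : Subalgebra ℚ (FreeGC (wt.{u} n))) := by
    exact (Subalgebra.topEquiv (R := ℚ) (A := FreeGC (wt.{u} n))).toLinearEquiv.symm.rank_eq
  rw [h2]
  refine h1.trans (max_le ?_ ?_)
  · exact Cardinal.mk_le_aleph0_iff.2 (Set.countable_range _).to_subtype
  · simp

variable {j : ℕ}

/-- A stage is extended by closed generators for a complement of the image on cohomology in degree
`n + j`, and by generators of the same degree whose differentials span a complement of the exact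
elements among the elements of degree `n + j + 1` that become exact in `A`. -/
theorem StageInv.step (hn : 2 ≤ n) [FiniteDimensional ℚ A.cohomology.carrier]
    (H : StageInv j σ) :
    ∃ σ' : ∀ a, Datum A n a, (∀ a, a.lvl < j → σ' a = σ a) ∧ StageInv (j + 1) σ' := by
  classical
  have hw1 : ∀ a : Label.{u}, 1 ≤ wt n a := fun a => by simp only [wt]; omega
  have hwn : ∀ a : Label.{u}, n ≤ wt n a := fun a => by simp only [wt]; omega
  obtain ⟨T, hT, hT0, hTs⟩ := A.exists_primitive
  obtain ⟨cl, hcl⟩ := A.exists_classMap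
  let lab : Bool → ℕ → Label.{u} := fun b k => ⟨(b, j, k)⟩
  have hlab : ∀ b, Function.Injective (lab b) := fun b k k' h => by
    simpa [lab] using h
  -- generators that kill classes in degree `n + j + 1`
  let Z₁ : Submodule ℚ (alg (wt.{u} n)).carrier := Subalgebra.toSubmodule (stage σ j) ⊓
    (alg (wt n)).deg (n + j + 1) ⊓ LinearMap.ker (stD σ) ⊓
    (LinearMap.range A.d).comap (stEv σ).toLinearMap
  let B₁ : Submodule ℚ (alg (wt.{u} n)).carrier :=
    (Subalgebra.toSubmodule (stage σ j)).map (stD σ)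
  obtain ⟨I₁, v₁, hI₁, hv₁, hv₁0, hspan₁, hind₁⟩ := exists_complement_family (lab true)
    (hlab true) Z₁ B₁ LinearMap.id rank_freeGC_le (fun z _ hz => by
      rw [show z = 0 from hz]; exact zero_mem _)
  -- generators that represent classes in degree `n + j`
  let Z₂ : Submodule ℚ A.carrier := A.deg (n + j) ⊓ LinearMap.ker A.d
  let B₂ : Submodule ℚ A.carrier := (Subalgebra.toSubmodule (stage σ j) ⊓
    (alg (wt n)).deg (n + j) ⊓ LinearMap.ker (stD σ)).map (stEv σ).toLinearMap ⊔
      LinearMap.range A.d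
  obtain ⟨I₂, v₂, hI₂, hv₂, hv₂0, hspan₂, hind₂⟩ := exists_complement_family (lab false)
    (hlab false) Z₂ B₂ cl (Module.rank_lt_aleph0 ℚ _).le (fun z hz hz0 => by
      have h1 : A.toCoh ⟨z, hz.2⟩ = 0 := (hcl _).symm.trans hz0
      obtain ⟨y, hy⟩ := A.toCoh_eq_zero.1 h1
      exact Submodule.mem_sup_right ⟨y, hy⟩)
  let σ' : ∀ a, Datum A n a := fun a => if h : a.lvl = j then
      (⟨a ∈ I₁ ∪ I₂⟩, ⟨v₁ a, by
        have := (hv₁ a).1.1.2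
        rwa [← h] at this⟩,
        ⟨T (stEv σ (v₁ a)) + v₂ a, by
          have h1 := hTs (n + j) _ (ev_mem (A := A) (f := fun a => (σ a).2.2) (hv₁ a).1.1.2)
          have h2 := (hv₂ a).1
          rw [← h] at h1 h2
          exact Submodule.add_mem _ h1 h2⟩)
    else σ a
  have hσ : ∀ a, a.lvl < j → σ a = σ' a := fun a ha => by
    simp only [σ', dif_neg ha.ne]
  have hact : ∀ a, a.lvl = j → ((σ' a).1.down ↔ a ∈ I₁ ∪ I₂) := fun a ha => by
    simp only [σ', dif_pos ha]
  have hD : ∀ a, a.lvl = j → ((σ' a).2.1 : (alg (wt n)).carrier) = v₁ a := fun a ha => by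
    simp only [σ', dif_pos ha]
  have hf : ∀ a, a.lvl = j → ((σ' a).2.2 : A.carrier) = T (stEv σ (v₁ a)) + v₂ a := fun a ha => by
    simp only [σ', dif_pos ha]
  have hl₁ : ∀ a ∈ I₁, a.lvl = j ∧ a.down.1 = true := fun a ha => by
    obtain ⟨k, rfl⟩ := hI₁ ha; exact ⟨rfl, rfl⟩
  have hl₂ : ∀ a ∈ I₂, a.lvl = j ∧ a.down.1 = false := fun a ha => by
    obtain ⟨k, rfl⟩ := hI₂ ha; exact ⟨rfl, rfl⟩
  have hgens : actGens σ' (j + 1) = actGens σ j ∪ (I₁ ∪ I₂) := by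
    ext a
    constructor
    · rintro ⟨h1, h2⟩
      rcases Nat.lt_succ_iff_lt_or_eq.1 h2 with h3 | h3
      · exact Or.inl ⟨by rw [hσ a h3]; exact h1, h3⟩
      · exact Or.inr ((hact a h3).1 h1)
    · rintro (h | h)
      · exact ⟨by rw [← hσ a h.2]; exact h.1, h.2.trans (Nat.lt_succ_self j)⟩
      · have hl : a.lvl = j := h.elim (fun h => (hl₁ a h).1) fun h => (hl₂ a h).1
        exact ⟨(hact a hl).2 h, by rw [hl]; exact Nat.lt_succ_self j⟩
  have hq : ∀ a ∈ I₁ ∪ I₂, n + j ≤ wt n a := by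
    rintro a (h | h)
    · simp only [wt, (hl₁ a h).1, le_refl]
    · simp only [wt, (hl₂ a h).1, le_refl]
  have hqq : ∀ a ∈ I₁ ∪ I₂, a.lvl = j := by
    rintro a (h | h)
    · exact (hl₁ a h).1
    · exact (hl₂ a h).1
  have hS : ∀ {i}, i ≤ j → stage σ i = stage σ' i := fun h => stage_congr hσ h
  have hSj : stage σ j ≤ stage σ' (j + 1) := (hS le_rfl).le.trans (stage_mono σ' (Nat.le_succ j))
  have hd : ∀ x ∈ stage σ j, stD σ x = stD σ' x := fun x hx => stD_congr hσ le_rfl hx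
  have he : ∀ x ∈ stage σ j, stEv σ x = stEv σ' x := fun x hx => stEv_congr hσ le_rfl hx
  have hcases : ∀ a ∈ actGens σ' (j + 1), (a ∈ actGens σ j ∧ σ a = σ' a) ∨ a ∈ I₁ ∪ I₂ := by
    intro a ha
    rw [hgens] at ha
    exact ha.imp_left fun h => ⟨h, hσ a h.2⟩
  -- up to degree `n + j + 1`, the new generators matter only in degree `n + j`: the complementary
  -- degree `1` of the old stage vanishes
  have hlow : ∀ i ≤ n + j + 1, ∀ s ∈ stage σ' (j + 1), s ∈ (alg (wt n)).deg i →
      i ≠ n + j → s ∈ stage σ j := by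
    intro i hi s hs hsi hne
    rw [stage, hgens] at hs
    rcases Nat.lt_or_ge i (n + j) with h | h
    · exact GCAlg.mem_adjoin_of_lt (H := alg (wt n)) (gen_mem (wt n)) hq h hs hsi
    · obtain ⟨z, hz, -, p, -, hp2, hp3, rfl⟩ :=
        GCAlg.exists_decomp_linear (H := alg (wt n)) (gen_mem (wt n)) hq (by omega) hs hsi
      have hp : p = 0 := Finsupp.ext fun a => by
        by_cases ha : a ∈ I₁ ∪ I₂ ∧ wt n a ≤ i
        · have h1 := hp2 a
          have hwa : wt n a = n + j := by simp only [wt, hqq a ha.1]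
          have h2 : (alg (wt.{u} n)).deg (i - wt n a) = ⊥ :=
            deg_eq_bot hwn (by omega) (by omega)
          rw [h2] at h1
          exact h1
        · exact hp3 a ha
      rw [hp, Finsupp.sum_zero_index, add_zero]
      exact hz
  have hmid : ∀ s ∈ stage σ' (j + 1), s ∈ (alg (wt n)).deg (n + j) → ∃ z ∈ stage σ j,
      z ∈ (alg (wt n)).deg (n + j) ∧ ∃ c : Label.{u} →₀ ℚ, (∀ a, a ∉ I₁ ∪ I₂ → c a = 0) ∧
        s = z + Finsupp.linearCombination ℚ (fun a => (gen (wt n) a : (alg (wt n)).carrier)) c := by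
    intro s hs hsi
    rw [stage, hgens] at hs
    obtain ⟨z, hz, hzi, p, -, hp2, hp3, rfl⟩ :=
      GCAlg.exists_decomp_linear (H := alg (wt n)) (gen_mem (wt n)) hq (by omega) hs hsi
    have hc : ∀ a, ∃ c : ℚ, p a = c • (1 : (alg (wt.{u} n)).carrier) := fun a => by
      by_cases ha : a ∈ I₁ ∪ I₂ ∧ wt n a ≤ n + j
      · have h1 := hp2 a
        have hwa : wt n a = n + j := by simp only [wt, hqq a ha.1]
        rw [hwa, Nat.sub_self] at h1
        exact exists_smul_one hw1 h1
      · exact ⟨0, by rw [hp3 a ha, zero_smul]⟩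
    choose c hc using hc
    have hsup : ∀ a, a ∉ p.support → (if p a = 0 then 0 else c a) = 0 := fun a ha => by
      rw [if_pos (Finsupp.notMem_support_iff.1 ha)]
    refine ⟨z, hz, hzi, Finsupp.onFinset p.support (fun a => if p a = 0 then 0 else c a)
      (fun a ha => by_contra fun h => ha (hsup a h)), fun a ha => ?_, ?_⟩
    · rw [Finsupp.onFinset_apply, if_pos (hp3 a fun h => ha h.1)]
    · congr 1
      rw [Finsupp.linearCombination_apply]
      refine Eq.trans ?_ (Finsupp.onFinset_sum (g := fun a (r : ℚ) =>
        r • (gen (wt n) a : (alg (wt n)).carrier)) _ (fun a => zero_smul ℚ _)).symm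
      refine Finset.sum_congr rfl fun a ha => ?_
      rw [if_neg (Finsupp.mem_support_iff.1 ha)]
      change gen (wt n) a * p a = _
      rw [hc a]
      exact (mul_smul_comm (c a) (gen (wt n) a) (1 : FreeGC (wt n))).trans
        (congrArg (c a • ·) (mul_one _))
  have hDcomb : ∀ c : Label.{u} →₀ ℚ, (∀ a, a ∉ I₁ ∪ I₂ → c a = 0) →
      stD σ' (Finsupp.linearCombination ℚ (fun a => (gen (wt n) a : (alg (wt n)).carrier)) c) =
        Finsupp.linearCombination ℚ v₁ c := by
    intro c hc
    rw [Finsupp.linearCombination_apply, Finsupp.linearCombination_apply, map_finsuppSum]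
    refine Finset.sum_congr rfl fun a ha => ?_
    have ha' : a ∈ I₁ ∪ I₂ := by_contra fun h => Finsupp.mem_support_iff.1 ha (hc a h)
    refine ((stD σ').map_smul _ _).trans ?_
    exact congrArg (c a • ·) ((der_gen _ a).trans (hD a (hqq a ha')))
  have hEcomb : ∀ c : Label.{u} →₀ ℚ, (∀ a, a ∉ I₁ ∪ I₂ → c a = 0) →
      stEv σ' (Finsupp.linearCombination ℚ (fun a => (gen (wt n) a : (alg (wt n)).carrier)) c) =
        T (stEv σ (Finsupp.linearCombination ℚ v₁ c)) + Finsupp.linearCombination ℚ v₂ c := by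
    intro c hc
    simp only [Finsupp.linearCombination_apply]
    rw [map_finsuppSum, map_finsuppSum, map_finsuppSum, ← Finsupp.sum_add]
    refine Finset.sum_congr rfl fun a ha => ?_
    have ha' : a ∈ I₁ ∪ I₂ := by_contra fun h => Finsupp.mem_support_iff.1 ha (hc a h)
    change stEv σ' (c a • _) = T (stEv σ (c a • v₁ a)) + c a • v₂ a
    rw [map_smul, map_smul, map_smul, ← smul_add]
    exact congrArg (c a • ·) ((ev_gen (A := A) a).trans (hf a (hqq a ha')))
  refine ⟨σ', fun a ha => (hσ a ha).symm, ?_, ?_, ?_, ?_, ?_, ?_, ?_⟩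
  · intro a ha
    rcases hcases a ha with ⟨h1, h2⟩ | h
    · rw [← h2, ← hS h1.2.le]; exact H.D_mem a h1
    · rw [hD a (hqq a h), hqq a h, ← hS le_rfl]; exact (hv₁ a).1.1.1
  · intro a ha
    rcases hcases a ha with ⟨h1, h2⟩ | h
    · rw [← h2, ← hd _ (stage_mono σ h1.2.le (H.D_mem a h1))]; exact H.d_D a h1
    · rw [hD a (hqq a h), ← hd _ (hv₁ a).1.1.1]; exact (hv₁ a).1.2
  · intro a ha
    rcases hcases a ha with ⟨h1, h2⟩ | h
    · rw [← h2, ← he _ (stage_mono σ h1.2.le (H.D_mem a h1))]; exact H.ev_D a h1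
    · rw [hD a (hqq a h), hf a (hqq a h), ← he _ (hv₁ a).1.1.1, map_add, (hv₂ a).2, add_zero]
      obtain ⟨y, hy⟩ := (hv₁ a).2
      change A.d y = stEv σ (v₁ a) at hy
      rw [← hy, hT]
  · intro i hi z hz hdz
    rcases Nat.lt_or_ge i (n + j) with h | h
    · obtain ⟨s, hs, hsi, hds, y, hy⟩ := H.surj i h z hz hdz
      exact ⟨s, hSj hs, hsi, hd s hs ▸ hds, y, he s hs ▸ hy⟩
    · obtain rfl : i = n + j := by omega
      obtain ⟨c, hc, hzc⟩ := hspan₂ z ⟨hz, hdz⟩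
      obtain ⟨_, ⟨s, ⟨⟨hs, hsi⟩, hds⟩, rfl⟩, _, ⟨y, rfl⟩, hy⟩ := Submodule.mem_sup.1 hzc
      have hc' : ∀ a, a ∉ I₁ ∪ I₂ → c a = 0 := fun a ha => hc a fun h => ha (Or.inr h)
      have hcv : Finsupp.linearCombination ℚ v₁ c = 0 := by
        rw [Finsupp.linearCombination_apply]
        refine Finset.sum_eq_zero fun a ha => ?_
        have ha' : a ∈ I₂ := by_contra fun h => Finsupp.mem_support_iff.1 ha (hc a h)
        refine (congrArg (c a • ·) (hv₁0 a fun h => ?_)).trans (smul_zero _)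
        have := (hl₁ a h).2.symm.trans (hl₂ a ha').2
        exact Bool.noConfusion this
      refine ⟨s + Finsupp.linearCombination ℚ (fun a => (gen (wt n) a : (alg (wt n)).carrier)) c,
        add_mem (hSj hs) ?_, Submodule.add_mem _ hsi ?_, ?_, y, ?_⟩
      · rw [Finsupp.linearCombination_apply]
        refine sum_mem fun a ha => Subalgebra.smul_mem _ (Algebra.subset_adjoin
          (Set.mem_image_of_mem _ ?_)) _
        rw [hgens]
        exact Or.inr (by_contra fun h => Finsupp.mem_support_iff.1 ha (hc' a h))
      · rw [Finsupp.linearCombination_apply]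
        refine Submodule.sum_mem _ fun a ha => Submodule.smul_mem _ _ ?_
        have ha' := hqq a (by_contra fun h => Finsupp.mem_support_iff.1 ha (hc' a h))
        have := gen_mem (wt n) a
        rw [show wt n a = n + j by simp only [wt, ha']] at this
        exact this
      · rw [map_add, hDcomb c hc', hcv, add_zero, ← hd s hs]; exact hds
      · rw [map_add, hEcomb c hc', hcv, map_zero, map_zero, zero_add, ← he s hs]
        have h3 := sub_eq_iff_eq_add.1 hy.symm
        rw [h3]
        change stEv σ s + A.d y + _ = _
        abel
  · intro i hi s hs hsi hds hy
    rcases eq_or_ne i (n + j) with rfl | hne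
    · obtain ⟨z, hz, hzi, c, hc, rfl⟩ := hmid s hs hsi
      rw [map_add, hDcomb c hc, ← hd z hz] at hds
      -- the differentials of the new generators are independent modulo exact elements
      have hc1 : ∀ a ∈ I₁, c a = 0 := hind₁ c ⟨-z, neg_mem hz, by
        rw [map_neg]; exact (neg_eq_iff_add_eq_zero.2 hds)⟩
      have hcv : Finsupp.linearCombination ℚ v₁ c = 0 := by
        rw [Finsupp.linearCombination_apply]
        refine Finset.sum_eq_zero fun a ha => ?_
        exact (congrArg (c a • ·) (hv₁0 a fun h => Finsupp.mem_support_iff.1 ha (hc1 a h))).trans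
          (smul_zero _)
      rw [hcv, add_zero] at hds
      obtain ⟨y, hy⟩ := hy
      rw [map_add, hEcomb c hc, hcv, map_zero, map_zero, zero_add, ← he z hz] at hy
      -- the new closed generators are independent modulo the image of the old stage
      have hc2 : ∀ a ∈ I₂, c a = 0 := hind₂ c (Submodule.mem_sup.2
        ⟨_, ⟨-z, ⟨⟨neg_mem hz, Submodule.neg_mem _ hzi⟩, by
          rw [SetLike.mem_coe, LinearMap.mem_ker, map_neg, hds, neg_zero]⟩, rfl⟩, A.d y, ⟨y, rfl⟩, by
          rw [← hy]
          change stEv σ (-z) + _ = _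
          rw [map_neg, neg_add_cancel_left]⟩)
      have hc0 : c = 0 := Finsupp.ext fun a => by
        by_cases ha : a ∈ I₁ ∪ I₂
        · exact ha.elim (hc1 a) (hc2 a)
        · exact hc a ha
      rw [hc0, map_zero, add_zero] at hy
      obtain ⟨t, ht, hts⟩ := H.inj _ le_rfl z hz hzi hds ⟨y, hy⟩
      refine ⟨t, hSj ht, ?_⟩
      rw [hc0, map_zero, add_zero, ← hd t ht, hts]
    · have hs' := hlow i (by omega) s hs hsi hne
      rw [← hd s hs'] at hds
      rw [← he s hs'] at hy
      rcases Nat.lt_or_ge (n + j) i with h | h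
      · obtain rfl : i = n + j + 1 := by omega
        obtain ⟨y, hy⟩ := hy
        obtain ⟨c, hc, t, ht, hts⟩ := hspan₁ s ⟨⟨⟨hs', hsi⟩, hds⟩, ⟨y, hy.symm⟩⟩
        have hc' : ∀ a, a ∉ I₁ ∪ I₂ → c a = 0 := fun a ha => hc a fun h => ha (Or.inl h)
        refine ⟨t + Finsupp.linearCombination ℚ
          (fun a => (gen (wt n) a : (alg (wt n)).carrier)) c, add_mem (hSj ht) ?_, ?_⟩
        · rw [Finsupp.linearCombination_apply]
          refine sum_mem fun a ha => Subalgebra.smul_mem _ (Algebra.subset_adjoin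
            (Set.mem_image_of_mem _ ?_)) _
          rw [hgens]
          exact Or.inr (by_contra fun h => Finsupp.mem_support_iff.1 ha (hc' a h))
        · rw [map_add, hDcomb c hc', ← hd t ht, hts, sub_add_cancel]
      · obtain ⟨t, ht, hts⟩ := H.inj i h s hs' hsi hds hy
        exact ⟨t, hSj ht, hd t ht ▸ hts⟩
  · intro a ha hfl
    rcases hcases a ha with ⟨h1, h2⟩ | h
    · rw [← h2]; exact H.D_zero a h1 hfl
    · rw [hD a (hqq a h)]
      refine hv₁0 a fun h' => ?_
      have := (hl₁ a h').2.symm.trans hfl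
      exact Bool.noConfusion this
  · intro i hi c hc hc0
    rcases Nat.lt_or_ge i j with h | h
    · have hc' : ∀ a, c a ≠ 0 → a ∈ actGens σ j ∧ σ a = σ' a := fun a ha => by
        obtain ⟨h1, -, h3⟩ := hc a ha
        rcases hcases a h1 with h4 | h4
        · exact h4
        · have := hqq a h4; omega
      refine H.indep i h c (fun a ha => ⟨(hc' a ha).1, (hc a ha).2⟩) ?_
      rw [← hc0, Finsupp.linearCombination_apply, Finsupp.linearCombination_apply]
      refine Finset.sum_congr rfl fun a ha => ?_
      simp only [(hc' a (Finsupp.mem_support_iff.1 ha)).2]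
    · have h1 : Finsupp.linearCombination ℚ v₁ c = 0 := by
        rw [← hc0, Finsupp.linearCombination_apply, Finsupp.linearCombination_apply]
        refine Finset.sum_congr rfl fun a ha => ?_
        have h2 := (hc a (Finsupp.mem_support_iff.1 ha)).2.2
        exact congrArg (c a • ·) (hD a (by omega)).symm
      have h2 := hind₁ c (by rw [h1]; exact zero_mem _)
      ext a
      by_contra h3
      obtain ⟨h4, h5, h6⟩ := hc a h3
      have h7 : a ∈ I₁ ∪ I₂ := by
        rcases hcases a h4 with h8 | h8
        · have := h8.1.2; omega
        · exact h8
      rcases h7 with h7 | h7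
      · exact h3 (h2 a h7)
      · have := h5.symm.trans (hl₂ a h7).2
        exact Bool.noConfusion this

end Stage

end DGA

namespace GCAlg

theorem Hom.pr_comm {H : GCAlg.{u}} {K : GCAlg.{v}} (f : Hom H K) (k : ℕ) (x : H.carrier) :
    K.pr k (f.toAlgHom x) = f.toAlgHom (H.pr k x) := by
  induction x using DirectSum.Decomposition.inductionOn H.deg with
  | zero => simp
  | @homogeneous i x =>
    have h1 : f.toAlgHom (x : H.carrier) ∈ K.deg i := f.map_deg x.2
    by_cases h : i = k
    · subst h; rw [pr_of_mem h1, pr_of_mem x.2]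
    · rw [pr_of_mem_ne h1 h, pr_of_mem_ne x.2 h, map_zero]
  | add a b ha hb => simp only [map_add, ha, hb]

theorem eq_zero_of_pr {H : GCAlg.{u}} {x : H.carrier} (h : ∀ k, H.pr k x = 0) : x = 0 := by
  classical
  rw [← DirectSum.sum_support_decompose H.deg x]
  exact Finset.sum_eq_zero fun k _ => h k

theorem Hom.injective_of_deg {H : GCAlg.{u}} {K : GCAlg.{v}} (f : Hom H K)
    (h : ∀ k, ∀ x ∈ H.deg k, f.toAlgHom x = 0 → x = 0) : Function.Injective f.toAlgHom := by
  rw [injective_iff_map_eq_zero]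
  intro x hx
  refine eq_zero_of_pr fun k => h k _ (pr_mem k x) ?_
  rw [← f.pr_comm, hx, map_zero]

theorem Hom.surjective_of_deg {H : GCAlg.{u}} {K : GCAlg.{v}} (f : Hom H K)
    (h : ∀ k, ∀ y ∈ K.deg k, ∃ x, f.toAlgHom x = y) : Function.Surjective f.toAlgHom := by
  intro y
  induction y using DirectSum.Decomposition.inductionOn K.deg with
  | zero => exact ⟨0, map_zero _⟩
  | @homogeneous i y => exact h i y y.2
  | add a b ha hb =>
    obtain ⟨x, rfl⟩ := ha
    obtain ⟨x', rfl⟩ := hb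
    exact ⟨x + x', map_add _ _ _⟩

/-- A bijective homomorphism of graded algebras is an isomorphism. -/
noncomputable def Iso.ofBijective {H : GCAlg.{u}} {K : GCAlg.{v}} (f : Hom H K)
    (hf : Function.Bijective f.toAlgHom) : Iso H K where
  toAlgEquiv := AlgEquiv.ofBijective f.toAlgHom hf
  map_deg_iff := by
    intro i x
    change f.toAlgHom x ∈ K.deg i ↔ _
    refine ⟨fun h => ?_, fun h => f.map_deg h⟩
    have h1 : x = H.pr i x := hf.1 (by rw [← f.pr_comm, pr_of_mem h])
    rw [h1]
    exact pr_mem i x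

/-- The inverse of an isomorphism. -/
def Iso.symm {H : GCAlg.{u}} {K : GCAlg.{v}} (f : Iso H K) : Iso K H where
  toAlgEquiv := f.toAlgEquiv.symm
  map_deg_iff := by
    intro i x
    change f.toAlgEquiv.symm x ∈ H.deg i ↔ _
    rw [← f.map_deg_iff]
    change f.toAlgEquiv (f.toAlgEquiv.symm x) ∈ _ ↔ _
    rw [AlgEquiv.apply_symm_apply]

/-- Composition of isomorphisms. -/
def Iso.trans {H : GCAlg.{u}} {K : GCAlg.{v}} {L : GCAlg.{w}} (f : Iso H K) (g : Iso K L) :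
    Iso H L where
  toAlgEquiv := f.toAlgEquiv.trans g.toAlgEquiv
  map_deg_iff := by
    intro i x
    change g.toAlgEquiv (f.toAlgEquiv x) ∈ L.deg i ↔ _
    exact g.map_deg_iff.trans f.map_deg_iff

end GCAlg

namespace DGA

/-- A homomorphism of DGAs that is bijective on cohomology. -/
def Hom.IsQuasiIso {A : DGA.{u}} {B : DGA.{v}} (f : Hom A B) : Prop :=
  Function.Bijective f.cohMap.toAlgHom

theorem Hom.map_d' {A : DGA.{u}} {B : DGA.{v}} (f : Hom A B) (x : A.carrier) :
    f.toAlgHom (A.d x) = B.d (f.toAlgHom x) := f.map_d x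

theorem Hom.isQuasiIso_of_deg {A : DGA.{u}} {B : DGA.{v}} (f : Hom A B)
    (hs : ∀ i, ∀ z ∈ B.deg i, B.d z = 0 → ∃ s, A.d s = 0 ∧ ∃ y, z = f.toAlgHom s + B.d y)
    (hi : ∀ i, ∀ s ∈ A.deg i, A.d s = 0 → (∃ y, f.toAlgHom s = B.d y) → ∃ t, A.d t = s) :
    f.IsQuasiIso := by
  refine ⟨f.cohMap.injective_of_deg ?_, f.cohMap.surjective_of_deg ?_⟩
  · rintro k _ ⟨z, hz, rfl⟩ h0
    have h1 := (f.cohMap_toCoh z).symm.trans h0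
    obtain ⟨y, hy⟩ := B.toCoh_eq_zero.1 h1
    obtain ⟨t, ht⟩ := hi k z hz z.2 ⟨y, hy.symm⟩
    exact A.toCoh_eq_zero.2 ⟨t, ht⟩
  · rintro k _ ⟨z, hz, rfl⟩
    obtain ⟨s, hds, y, hy⟩ := hs k z hz z.2
    refine ⟨A.toCoh ⟨s, hds⟩, (f.cohMap_toCoh _).trans ?_⟩
    have h1 : B.toCoh (z - f.closedMap ⟨s, hds⟩) = 0 := B.toCoh_eq_zero.2 ⟨y, by
      change _ = (z : B.carrier) - f.toAlgHom s
      rw [hy]; abel⟩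
    rw [map_sub, sub_eq_zero] at h1
    exact h1.symm

/-- A primitive of an exact element of degree `i + 1` can be chosen of degree `i`. -/
theorem exists_primitive_mem {A : DGA.{u}} {i : ℕ} {x : A.carrier} (hx : x ∈ A.deg (i + 1))
    (h : ∃ y, A.d y = x) : ∃ y ∈ A.deg i, A.d y = x := by
  obtain ⟨y, rfl⟩ := h
  refine ⟨A.pr i y, GCAlg.pr_mem i y, ?_⟩
  rw [GCAlg.pr, ← A.proj_d]
  exact GCAlg.pr_of_mem hx

theorem Hom.IsQuasiIso.exists_exact {A : DGA.{u}} {B : DGA.{v}} {f : Hom A B} (hf : f.IsQuasiIso)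
    {s : A.carrier} (hds : A.d s = 0) (h : ∃ y, B.d y = f.toAlgHom s) : ∃ t, A.d t = s := by
  refine A.toCoh_eq_zero.1 (hf.1 (a₁ := A.toCoh ⟨s, hds⟩) (a₂ := 0) ?_)
  rw [map_zero]
  exact (f.cohMap_toCoh _).trans (B.toCoh_eq_zero.2 h)

theorem Hom.IsQuasiIso.exists_closed {A : DGA.{u}} {B : DGA.{v}} {f : Hom A B} (hf : f.IsQuasiIso)
    {i : ℕ} {z : B.carrier} (hz : z ∈ B.deg i) (hdz : B.d z = 0) :
    ∃ s ∈ A.deg i, A.d s = 0 ∧ ∃ y, z = f.toAlgHom s + B.d y := by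
  obtain ⟨x, hx⟩ := hf.2 (B.toCoh ⟨z, hdz⟩)
  have hx' : x ∈ A.cohomology.deg i := by
    refine ((GCAlg.Iso.ofBijective f.cohMap hf).map_deg_iff).1 ?_
    change f.cohMap.toAlgHom x ∈ _
    rw [hx]
    exact B.mem_cohomology_deg.2 ⟨_, hz, rfl⟩
  obtain ⟨s, hs, rfl⟩ := A.mem_cohomology_deg.1 hx'
  refine ⟨s, hs, s.2, ?_⟩
  have h1 : B.toCoh (⟨z, hdz⟩ - f.closedMap s) = 0 := by
    rw [map_sub, sub_eq_zero, ← hx]; exact f.cohMap_toCoh s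
  obtain ⟨y, hy⟩ := B.toCoh_eq_zero.1 h1
  refine ⟨y, ?_⟩
  rw [hy]
  change z = f.toAlgHom s + (z - f.toAlgHom s)
  abel

/-- A free DGA on generators of positive degree whose differentials lie in the subalgebra
generated by generators of smaller degree is a minimal Sullivan algebra. -/
theorem isMinimalSullivan_of_degrees (A : DGA.{u}) {ι : Type u} (w : ι → ℕ) (x : ι → A.carrier)
    (hx : ∀ a, x a ∈ A.deg (w a)) (hbij : Function.Bijective (A.freeLift w x hx))
    (hw : ∀ a, 1 ≤ w a) (hd : ∀ a, A.d (x a) ∈ Algebra.adjoin ℚ (x '' {b | w b < w a})) :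
    A.IsMinimalSullivan := by
  let key : ι → ℕ ×ₗ Ordinal.{u} := fun a => toLex (w a, Ordinal.typein WellOrderingRel a)
  have hkey : Function.Injective key := fun a b h =>
    Ordinal.typein_injective WellOrderingRel (congrArg (fun p => (ofLex p).2) h)
  let ord : LinearOrder ι := LinearOrder.lift' key hkey
  refine ⟨ι, ord, ⟨InvImage.wf key wellFounded_lt⟩, w, x, hx, hbij, hw, ?_, fun a => ?_⟩
  · intro a b hab
    have h : key a ≤ key b := hab
    rcases Prod.Lex.le_iff.1 h with h | h
    · exact h.le
    · exact h.1.le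
  · refine Algebra.adjoin_mono (Set.image_mono fun b hb => ?_) (hd a)
    change key b < key a
    exact Prod.Lex.lt_iff.2 (Or.inl hb)

open FreeGC

/-- A minimal model of `A` with generators of degree at least `n`, which are divided into closed
ones and a set `N` of generators whose differentials are linearly independent in each degree. -/
structure MinimalModel (n : ℕ) (A : DGA.{u}) where
  ι : Type u
  w : ι → ℕ
  D : ∀ a, deg w (w a + 1)
  hD : ∀ a, der D (D a : FreeGC w) = 0
  N : Set ι
  f : ∀ a, A.deg (w a)
  n_le : ∀ a, n ≤ w a
  D_mem : ∀ a, (D a : FreeGC w) ∈ Algebra.adjoin ℚ (gen w '' {b | w b < w a})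
  map_D : ∀ a, ev A f (D a) = A.d (f a : A.carrier)
  D_eq_zero : ∀ a, a ∉ N → (D a : FreeGC w) = 0
  indep : ∀ k (c : ι →₀ ℚ), (∀ a, c a ≠ 0 → a ∈ N ∧ w a = k) →
    Finsupp.linearCombination ℚ (fun a => (D a : FreeGC w)) c = 0 → c = 0
  quasiIso : (dgaHom hD map_D).IsQuasiIso

namespace MinimalModel

variable {n : ℕ} {A : DGA.{u}} (M : MinimalModel n A)

/-- The DGA of a minimal model. -/
noncomputable abbrev S : DGA.{u} := dga M.D M.hD

/-- The map of a minimal model to `A`. -/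
noncomputable abbrev φ : Hom M.S A := dgaHom M.hD M.map_D

theorem isMinimalSullivan (hn : 1 ≤ n) : M.S.IsMinimalSullivan := by
  refine M.S.isMinimalSullivan_of_degrees M.w (gen M.w) (gen_mem M.w) ?_
    (fun a => hn.trans (M.n_le a)) fun a => ?_
  · have h : M.S.freeLift M.w (gen M.w) (gen_mem M.w) = AlgHom.id ℚ (FreeGC M.w) :=
      algHom_ext fun a => GCAlg.freeLift_gen _ _ _ _ a
    rw [h]
    exact Function.bijective_id
  · change der M.D (gen M.w a) ∈ _
    rw [der_gen]
    exact M.D_mem a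

theorem isConnected (hn : 1 ≤ n) (hA : Nontrivial A.cohomology.carrier) :
    M.S.IsConnected (n - 1) := by
  refine ⟨?_, deg_zero fun a => hn.trans (M.n_le a), fun k h1 h2 =>
    deg_eq_bot M.n_le (by omega) (by omega)⟩
  by_contra h
  rw [not_nontrivial_iff_subsingleton] at h
  obtain ⟨x, hx⟩ := exists_ne (0 : A.cohomology.carrier)
  obtain ⟨y, rfl⟩ := M.quasiIso.2 x
  obtain ⟨z, rfl⟩ := M.S.toCoh_surjective y
  refine hx ?_
  rw [show z = 0 from Subtype.ext (Subsingleton.elim _ _), map_zero, map_zero]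

end MinimalModel

/-- Minimal models exist. -/
theorem exists_minimalModel {n : ℕ} (hn : 2 ≤ n) (A : DGA.{u})
    (hA : A.cohomology.IsConnected (n - 1)) [FiniteDimensional ℚ A.cohomology.carrier] :
    Nonempty (MinimalModel n A) := by
  classical
  obtain ⟨σ, hσ⟩ := exists_of_rank_steps Label.lvl (X := Datum A n)
    (fun k σ => StageInv k σ) (fun k σ σ' h H => H.congr h) (fun σ => StageInv.zero hA σ)
    (fun k σ H => StageInv.step hn H)
  let act : Set Label.{u} := {a | (σ a).1.down}
  let W : Label.{u} → ℕ := Label.wt n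
  have hgens : ∀ k, actGens σ k ⊆ act := fun k a ha => ha.1
  have hactlt : ∀ a ∈ act, a ∈ actGens σ (a.lvl + 1) := fun a ha => ⟨ha, Nat.lt_succ_self _⟩
  -- set the differentials of the generators that do not occur to zero
  let D₀ : ∀ a, deg W (W a + 1) := fun a => if a ∈ act then (σ a).2.1 else 0
  have hD₀ : ∀ a ∈ act, D₀ a = (σ a).2.1 := fun a ha => if_pos ha
  have hDmem : ∀ a ∈ act, ((σ a).2.1 : FreeGC W) ∈ stage σ a.lvl := fun a ha =>
    (hσ _).D_mem a (hactlt a ha)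
  have hst : ∀ k, stage σ k ≤ Algebra.adjoin ℚ (gen W '' act) := fun k =>
    Algebra.adjoin_mono (Set.image_mono (hgens k))
  have hder : ∀ x ∈ Algebra.adjoin ℚ (gen W '' act), der D₀ x = stD σ x := fun x hx =>
    der_congr hD₀ hx
  have hdd₀ : ∀ a, der D₀ (D₀ a : FreeGC W) = 0 := fun a => by
    by_cases ha : a ∈ act
    · rw [hD₀ a ha, hder _ (hst _ (hDmem a ha))]
      exact (hσ _).d_D a (hactlt a ha)
    · rw [show D₀ a = 0 from if_neg ha]; exact map_zero _
  -- restrict to the generators that occur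
  let w : act → ℕ := fun a => W a
  let J : FreeGC w →ₐ[ℚ] FreeGC W := ev (dga D₀ hdd₀) fun a => ⟨gen W a, gen_mem W a⟩
  have hJ : ∀ a, J (gen w a) = gen W a := fun a => ev_gen (A := dga D₀ hdd₀) a
  let r : ∀ a, (alg w).carrier := fun a => if h : a ∈ act then gen w ⟨a, h⟩ else 0
  have hr : ∀ a, r a ∈ (alg w).deg (W a) := fun a => by
    by_cases h : a ∈ act
    · simp only [r, dif_pos h]; exact gen_mem w ⟨a, h⟩
    · simp only [r, dif_neg h]; exact Submodule.zero_mem _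
  let ρ : FreeGC W →ₐ[ℚ] FreeGC w := (alg w).freeLift W r hr
  have hρ : ∀ a : act, ρ (gen W a) = gen w a := fun a =>
    (GCAlg.freeLift_gen _ _ _ hr (a : Label.{u})).trans (dif_pos a.2)
  have hρJ : ∀ x, ρ (J x) = x := by
    intro x
    have : ρ.comp J = AlgHom.id ℚ (FreeGC w) := algHom_ext fun a => by
      rw [AlgHom.comp_apply, hJ]; exact hρ a
    exact DFunLike.congr_fun this x
  have hJρ : ∀ x ∈ Algebra.adjoin ℚ (gen W '' act), J (ρ x) = x := by
    have h1 : Algebra.adjoin ℚ (gen W '' act) ≤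
        AlgHom.equalizer (J.comp ρ) (AlgHom.id ℚ (FreeGC W)) := by
      refine Algebra.adjoin_le ?_
      rintro _ ⟨a, ha, rfl⟩
      change J (ρ (gen W a)) = gen W a
      rw [hρ ⟨a, ha⟩, hJ]
    exact fun x hx => h1 hx
  have hJmem : ∀ x, J x ∈ Algebra.adjoin ℚ (gen W '' act) := by
    intro x
    induction x using induction_left with
    | one => rw [map_one]; exact one_mem _
    | gen_mul a x hx =>
      rw [map_mul, hJ]; exact mul_mem (Algebra.subset_adjoin (Set.mem_image_of_mem _ a.2)) hx
    | add x y hx hy => rw [map_add]; exact add_mem hx hy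
    | smul c x hx => rw [map_smul]; exact Subalgebra.smul_mem _ hx c
  have hρmem : ∀ {k x}, x ∈ deg W k → ρ x ∈ deg w k := fun hx =>
    (alg w).freeLift_mem W r hr hx
  let D : ∀ a : act, deg w (w a + 1) := fun a => ⟨ρ (σ a).2.1, hρmem (σ a).2.1.2⟩
  have hJD : ∀ a : act, J (D a) = ((σ a).2.1 : FreeGC W) := fun a =>
    hJρ _ (hst _ (hDmem a a.2))
  have hJd : ∀ x, J (der D x) = stD σ (J x) := fun x =>
    (ev_der_of_mem (A := dga D₀ hdd₀) (T := Set.univ) (fun a _ => (hJD a).trans (by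
      change _ = der D₀ (gen W a)
      rw [der_gen, hD₀ a a.2])) (mem_adjoin_image_univ x)).trans (hder _ (hJmem x))
  have hJinj : ∀ x, J x = 0 → x = 0 := fun x hx => by rw [← hρJ x, hx, map_zero]
  let f : ∀ a : act, A.deg (w a) := fun a => (σ a).2.2
  have hfJ : ∀ x, ev A f x = stEv σ (J x) := by
    intro x
    have : ev A f = (stEv σ).comp J := algHom_ext fun a => by
      rw [AlgHom.comp_apply, hJ]
      exact (ev_gen (A := A) a).trans (ev_gen (A := A) (f := fun a => (σ a).2.2) a.1).symm
    exact DFunLike.congr_fun this x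
  have hDD : ∀ a, der D (D a : FreeGC w) = 0 := fun a => hJinj _ (by
    rw [hJd, hJD]
    exact (hσ _).d_D a (hactlt a a.2))
  have hmapD : ∀ a, ev A f (D a) = A.d (f a : A.carrier) := fun a => by
    rw [hfJ, hJD]
    exact (hσ _).ev_D a (hactlt a a.2)
  have hρd : ∀ t ∈ Algebra.adjoin ℚ (gen W '' act),
      stD σ t ∈ Algebra.adjoin ℚ (gen W '' act) → der D (ρ t) = ρ (stD σ t) := fun t ht ht' => by
    rw [← sub_eq_zero]
    refine hJinj _ ?_
    rw [map_sub]
    refine sub_eq_zero.2 ((hJd _).trans ?_)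
    rw [hJρ _ ht, hJρ _ ht']
  refine ⟨⟨act, w, D, hDD, {a | a.1.down.1 = true}, f, fun a => Nat.le_add_right _ _, fun a => ?_,
    hmapD, fun a ha => ?_, fun k c hc hc0 => ?_, Hom.isQuasiIso_of_deg _ (fun i z hz hdz => ?_)
    fun i s hs hds hy => ?_⟩⟩
  · have h1 : (ρ.comp (AlgHom.id ℚ (FreeGC W))) ((σ a).2.1 : FreeGC W) ∈
        (stage σ a.1.lvl).map ρ := ⟨_, hDmem a a.2, rfl⟩
    rw [stage, AlgHom.map_adjoin] at h1
    refine Algebra.adjoin_mono ?_ h1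
    rintro _ ⟨_, ⟨b, hb, rfl⟩, rfl⟩
    exact ⟨⟨b, hb.1⟩, Nat.add_lt_add_left hb.2 n, (hρ ⟨b, hb.1⟩).symm⟩
  · refine hJinj _ ?_
    rw [hJD]
    exact (hσ _).D_zero a (hactlt a a.2) (Bool.eq_false_of_not_eq_true ha)
  · rcases Nat.lt_or_ge k n with hk | hk
    · ext a
      by_contra h
      have h1 := (hc a h).2
      have h2 : W a = n + a.1.lvl := rfl
      simp only [w] at h1
      omega
    · obtain ⟨j, rfl⟩ := Nat.exists_eq_add_of_le hk
      have hinj : Function.Injective (Subtype.val : act → Label.{u}) := Subtype.val_injective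
      have h1 := (hσ (j + 1)).indep j (Nat.lt_succ_self j) (c.mapDomain Subtype.val)
        (fun a ha => ?_) ?_
      · exact Finsupp.mapDomain_injective hinj (h1.trans Finsupp.mapDomain_zero.symm)
      · by_cases hr : a ∈ Set.range (Subtype.val : act → Label.{u})
        · obtain ⟨b, rfl⟩ := hr
          rw [Finsupp.mapDomain_apply hinj] at ha
          obtain ⟨h2, h3⟩ := hc b ha
          have h4 : b.1.lvl = j := Nat.add_left_cancel h3
          exact ⟨⟨b.2, h4.trans_lt (Nat.lt_succ_self j)⟩, h2, h4⟩
        · exact absurd (Finsupp.mapDomain_of_notMem_range _ _ hr) ha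
      · rw [Finsupp.linearCombination_mapDomain]
        have h2 := congrArg J hc0
        rw [map_zero, ← AlgHom.toLinearMap_apply, Finsupp.apply_linearCombination] at h2
        refine Eq.trans ?_ h2
        congr 2
        funext a
        exact (hJD a).symm
  · obtain ⟨s, hs, hsi, hds, y, hy⟩ := (hσ (i + 1)).surj i (by omega) z hz hdz
    refine ⟨ρ s, ?_, y, ?_⟩
    · refine (hρd s (hst _ hs) ?_).trans ?_
      · rw [hds]; exact zero_mem _
      · rw [hds]; exact map_zero _
    · refine hy.trans (congrArg (· + A.d y) ?_)
      exact ((hfJ _).trans (by rw [hJρ _ (hst _ hs)])).symm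
  · have hJs : J s ∈ stage σ (i + 1) := by
      have h1 := hJmem s
      have h2 : act = actGens σ (i + 1) ∪ {a | a ∈ act ∧ i + 1 ≤ a.lvl} := by
        ext a
        constructor
        · intro ha
          rcases Nat.lt_or_ge a.lvl (i + 1) with h | h
          · exact Or.inl ⟨ha, h⟩
          · exact Or.inr ⟨ha, h⟩
        · rintro (h | h)
          · exact h.1
          · exact h.1
      have h3 : J s ∈ Algebra.adjoin ℚ (gen W '' (actGens σ (i + 1) ∪
          {a | a ∈ act ∧ i + 1 ≤ a.lvl})) := by rw [← h2]; exact h1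
      refine GCAlg.mem_adjoin_of_lt (H := alg W) (gen_mem W) (q := i + 1) (fun a ha => ?_)
        (Nat.lt_succ_self i) h3 (ev_mem (A := dga D₀ hdd₀) hs)
      have := ha.2
      simp only [W, Label.wt]
      omega
    obtain ⟨t, ht, hts⟩ := (hσ (i + 1)).inj i (by omega) (J s) hJs (ev_mem (A := dga D₀ hdd₀) hs) (by
      rw [← hJd]
      exact (congrArg J hds).trans (map_zero J)) (by
      obtain ⟨y, hy⟩ := hy
      exact ⟨y, (hfJ s).symm.trans hy⟩)
    refine ⟨ρ t, (hρd t (hst _ ht) ?_).trans ?_⟩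
    · rw [hts]; exact hJmem s
    · rw [hts]; exact hρJ s

end DGA

/-! ### Quasi-isomorphisms between minimal Sullivan algebras -/

namespace DGA

open FreeGC

variable {A : DGA.{u}} {ι : Type v} {w : ι → ℕ} {x : ι → A.carrier}

theorem d_mem_adjoin {T : Set ι} (h : ∀ a ∈ T, A.d (x a) ∈ Algebra.adjoin ℚ (x '' T))
    (hx : ∀ a, x a ∈ A.deg (w a)) {y : A.carrier} (hy : y ∈ Algebra.adjoin ℚ (x '' T)) :
    A.d y ∈ Algebra.adjoin ℚ (x '' T) := by
  refine GCAlg.adjoin_induction_left (p := fun y => A.d y ∈ Algebra.adjoin ℚ (x '' T))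
    ?_ (fun a ha y hy ih => ?_) (fun y z hy hz => ?_) (fun c y hy => ?_) hy
  · rw [A.d_one]; exact zero_mem _
  · rw [A.leibniz _ (hx a)]
    exact add_mem (mul_mem (h a ha) hy) (Subalgebra.smul_mem _
      (mul_mem (Algebra.subset_adjoin (Set.mem_image_of_mem _ ha)) ih) _)
  · rw [map_add]; exact add_mem hy hz
  · rw [map_smul]; exact Subalgebra.smul_mem _ hy _

/-- Free generators of a DGA with differentials in the subalgebra
generated by generators of smaller degree. -/
structure SullivanBasis (A : DGA.{u}) where
  ι : Type u
  w : ι → ℕ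
  x : ι → A.carrier
  hx : ∀ a, x a ∈ A.deg (w a)
  bij : Function.Bijective (A.freeLift w x hx)
  d_mem : ∀ a, A.d (x a) ∈ Algebra.adjoin ℚ (x '' {b | w b < w a})

/-- In a simply connected minimal Sullivan algebra, the differential of a generator involves no
generators of the same degree: these would occur with a factor of degree one. -/
theorem IsMinimalSullivan.nonempty_sullivanBasis (h : A.IsMinimalSullivan) {j : ℕ} (hj : 1 ≤ j)
    (hA : A.IsConnected j) : Nonempty (SullivanBasis A) := by
  obtain ⟨ι, _, _, w, x, hx, hbij, hw, hmon, hd⟩ := h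
  have hnt : Nontrivial A.carrier := hA.1
  have hnt' : Nontrivial (FreeGC w) := hbij.2.nontrivial
  have h1 : A.deg 1 = ⊥ := hA.2.2 1 le_rfl hj
  have h2 : ∀ a, 2 ≤ w a := by
    intro a
    by_contra h
    have hwa : w a = 1 := by have := hw a; omega
    have hxa : x a = 0 := by
      have := hx a
      rw [hwa, h1] at this
      exact this
    have hgen : gen w a = 0 := hbij.1 (by rw [map_zero, GCAlg.freeLift_gen, hxa])
    have h3 := eq_zero_of_sum_gen_mul (w := w) (T := ∅) (z := 0) (zero_mem _)
      (Finsupp.single a 1) (fun b => by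
        rw [Finsupp.single_apply]; split_ifs
        · exact one_mem _
        · exact zero_mem _) (fun b hb => absurd hb (Set.notMem_empty b)) (by
        rw [Finsupp.sum_single_index (mul_zero _), hgen, zero_mul, add_zero])
    exact one_ne_zero (Finsupp.single_eq_zero.1 h3)
  refine ⟨⟨ι, w, x, hx, hbij, fun a => ?_⟩⟩
  have hmem : A.d (x a) ∈ Algebra.adjoin ℚ (x '' ({b | w b < w a} ∪ {b | w b = w a})) := by
    refine Algebra.adjoin_mono (Set.image_mono fun b hb => ?_) (hd a)
    exact lt_or_eq_of_le (hmon (le_of_lt hb))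
  have h2a := h2 a
  obtain ⟨z, hz, -, p, -, hp2, hp3, hzp⟩ := GCAlg.exists_decomp_linear hx (q := w a)
    (fun b hb => (show w b = w a from hb).ge) (by omega) hmem (A.d_mem (hx a))
  have hp : p = 0 := Finsupp.ext fun b => by
    by_cases hb : w b = w a
    · have := hp2 b
      rw [hb, Nat.add_sub_cancel_left, h1] at this
      exact this
    · exact hp3 b fun h => hb h.1
  rw [hzp, hp, Finsupp.sum_zero_index, add_zero]
  exact hz

namespace SullivanBasis

variable (b : SullivanBasis A)

/-- The subalgebra generated by the generators of degree at most `k`. -/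
abbrev low (k : ℕ) : Subalgebra ℚ A.carrier := Algebra.adjoin ℚ (b.x '' {a | b.w a ≤ k})

theorem mem_adjoin (y : A.carrier) : y ∈ Algebra.adjoin ℚ (b.x '' Set.univ) := by
  obtain ⟨y, rfl⟩ := b.bij.2 y
  have h := (AlgHom.map_adjoin (A.freeLift b.w b.x b.hx) (Set.range (gen b.w)))
  rw [adjoin_range_gen, ← Set.range_comp] at h
  have h2 : (A.freeLift b.w b.x b.hx) ∘ gen b.w = b.x :=
    funext fun a => GCAlg.freeLift_gen _ _ _ b.hx a
  rw [h2] at h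
  rw [Set.image_univ, ← h]
  exact ⟨y, trivial, rfl⟩

theorem mem_low {i k : ℕ} (hik : i ≤ k) {y : A.carrier} (hy : y ∈ A.deg i) : y ∈ b.low k := by
  refine GCAlg.mem_adjoin_of_lt b.hx (T' := {a | k < b.w a}) (q := k + 1) (fun a ha => ha)
    (by omega) ?_ hy
  have : ({a | b.w a ≤ k} ∪ {a | k < b.w a} : Set b.ι) = Set.univ :=
    Set.eq_univ_of_forall fun a => le_or_gt (b.w a) k
  rw [this]
  exact b.mem_adjoin y

theorem d_mem_low {k : ℕ} {y : A.carrier} (hy : y ∈ b.low k) : A.d y ∈ b.low k :=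
  A.d_mem_adjoin (fun a ha => Algebra.adjoin_mono (Set.image_mono fun c hc =>
    ((show b.w c < b.w a from hc).le.trans ha)) (b.d_mem a)) b.hx hy

theorem d_mem_low_succ (h0 : A.deg 0 = Submodule.span ℚ {1}) {k : ℕ} {y : A.carrier}
    (hy : y ∈ A.deg (k + 1)) : A.d y ∈ b.low k := by
  have h1 := b.mem_low le_rfl hy
  have h2 : y ∈ Algebra.adjoin ℚ (b.x '' ({a | b.w a ≤ k} ∪ {a | b.w a = k + 1})) := by
    refine Algebra.adjoin_mono (Set.image_mono fun a (ha : b.w a ≤ k + 1) => ?_) h1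
    exact (Nat.le_succ_iff.1 ha)
  obtain ⟨z, hz, -, p, -, hp2, hp3, rfl⟩ := GCAlg.exists_decomp_linear b.hx (q := k + 1)
    (fun a ha => (show b.w a = k + 1 from ha).ge) (by omega) h2 hy
  rw [map_add, map_finsuppSum]
  refine add_mem (b.d_mem_low hz) (sum_mem fun a ha => ?_)
  have hwa : b.w a = k + 1 := by
    by_contra h
    exact Finsupp.mem_support_iff.1 ha (hp3 a fun h' => h h'.1)
  have h3 := hp2 a
  rw [hwa, Nat.sub_self, h0, Submodule.mem_span_singleton] at h3
  obtain ⟨c, hc⟩ := h3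
  change A.d (b.x a * p a) ∈ _
  rw [← hc, mul_smul_comm, mul_one, map_smul]
  refine Subalgebra.smul_mem _ (Algebra.adjoin_mono (Set.image_mono fun e he => ?_) (b.d_mem a)) c
  have : b.w e < b.w a := he
  change b.w e ≤ k
  omega

end SullivanBasis

/-- A quasi-isomorphism between simply connected minimal Sullivan algebras is an isomorphism. -/
theorem Hom.IsQuasiIso.bijective {A : DGA.{u}} {B : DGA.{v}} {f : Hom A B} (hf : f.IsQuasiIso)
    {j : ℕ} (hj : 1 ≤ j) (hA : A.IsConnected j) (hB : B.IsConnected j)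
    (hA' : A.IsMinimalSullivan) (hB' : B.IsMinimalSullivan) :
    Function.Bijective f.toAlgHom := by
  classical
  obtain ⟨bA⟩ := hA'.nonempty_sullivanBasis hj hA
  obtain ⟨bB⟩ := hB'.nonempty_sullivanBasis hj hB
  have hntB : Nontrivial B.carrier := hB.1
  have key : ∀ k, 1 ≤ k → (∀ i ≤ k, ∀ y ∈ A.deg i, f.toAlgHom y = 0 → y = 0) ∧
      ∀ i ≤ k, ∀ y ∈ B.deg i, ∃ z ∈ A.deg i, f.toAlgHom z = y := by
    intro k hk
    induction k, hk using Nat.le_induction with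
    | base =>
      refine ⟨fun i hi y hy hy0 => ?_, fun i hi y hy => ?_⟩
      · rcases Nat.le_one_iff_eq_zero_or_eq_one.1 hi with rfl | rfl
        · rw [hA.2.1, Submodule.mem_span_singleton] at hy
          obtain ⟨c, rfl⟩ := hy
          rw [map_smul, map_one, smul_eq_zero] at hy0
          rcases hy0 with rfl | h
          · rw [zero_smul]
          · exact absurd h one_ne_zero
        · rw [hA.2.2 1 le_rfl hj] at hy
          exact hy
      · rcases Nat.le_one_iff_eq_zero_or_eq_one.1 hi with rfl | rfl
        · rw [hB.2.1, Submodule.mem_span_singleton] at hy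
          obtain ⟨c, rfl⟩ := hy
          exact ⟨c • 1, Submodule.smul_mem _ _ (SetLike.one_mem_graded _), by
            rw [map_smul, map_one]⟩
        · rw [hB.2.2 1 le_rfl hj, Submodule.mem_bot] at hy
          exact ⟨0, Submodule.zero_mem _, by rw [map_zero, hy]⟩
    | succ k hk ih =>
      obtain ⟨inj, sur⟩ := ih
      -- the inverse on the subalgebras generated in degrees at most `k`
      have hinv : ∀ a, ∃ z ∈ A.deg (bB.w a), bB.w a ≤ k → f.toAlgHom z = bB.x a := fun a => by
        by_cases h : bB.w a ≤ k
        · obtain ⟨z, hz, hzx⟩ := sur _ h _ (bB.hx a)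
          exact ⟨z, hz, fun _ => hzx⟩
        · exact ⟨0, Submodule.zero_mem _, fun h' => absurd h' h⟩
      choose r hr hrx using hinv
      let e := AlgEquiv.ofBijective (B.freeLift bB.w bB.x bB.hx) bB.bij
      let ψ : B.carrier →ₐ[ℚ] A.carrier := (A.freeLift bB.w r hr).comp e.symm.toAlgHom
      have hψ : ∀ a, ψ (bB.x a) = r a := by
        intro a
        have h1 : e (gen bB.w a) = bB.x a := GCAlg.freeLift_gen _ _ _ bB.hx a
        change A.freeLift bB.w r hr (e.symm (bB.x a)) = r a
        rw [← h1, AlgEquiv.symm_apply_apply]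
        exact GCAlg.freeLift_gen _ _ _ hr a
      have hψdeg : ∀ i, ∀ y ∈ B.deg i, ψ y ∈ A.deg i := by
        intro i y hy
        let g : GCAlg.Hom (alg bB.w) B.toGCAlg :=
          { toAlgHom := B.freeLift bB.w bB.x bB.hx
            map_deg := fun h => GCAlg.freeLift_mem _ _ _ bB.hx h }
        have h2 : (GCAlg.Iso.ofBijective g bB.bij).toFun (e.symm y) ∈ B.deg i := by
          change e (e.symm y) ∈ _
          rwa [AlgEquiv.apply_symm_apply]
        exact GCAlg.freeLift_mem _ _ _ hr ((GCAlg.Iso.ofBijective g bB.bij).map_deg_iff.1 h2)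
      have hfψ : ∀ y ∈ bB.low k, f.toAlgHom (ψ y) = y := by
        have h1 : bB.low k ≤ AlgHom.equalizer (f.toAlgHom.comp ψ) (AlgHom.id ℚ B.carrier) := by
          refine Algebra.adjoin_le ?_
          rintro _ ⟨a, ha, rfl⟩
          change f.toAlgHom (ψ (bB.x a)) = bB.x a
          rw [hψ, hrx a ha]
        exact fun y hy => h1 hy
      have hψf : ∀ y ∈ bA.low k, ψ (f.toAlgHom y) = y := by
        have h1 : bA.low k ≤ AlgHom.equalizer (ψ.comp f.toAlgHom) (AlgHom.id ℚ A.carrier) := by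
          refine Algebra.adjoin_le ?_
          rintro _ ⟨a, ha, rfl⟩
          change ψ (f.toAlgHom (bA.x a)) = bA.x a
          have h2 : f.toAlgHom (bA.x a) ∈ B.deg (bA.w a) := f.map_deg (bA.hx a)
          rw [← sub_eq_zero]
          refine inj _ ha _ (Submodule.sub_mem _ (hψdeg _ _ h2) (bA.hx a)) ?_
          rw [map_sub, hfψ _ (bB.mem_low ha h2), sub_self]
        exact fun y hy => h1 hy
      have hinjlow : ∀ y ∈ bA.low k, f.toAlgHom y = 0 → y = 0 := fun y hy hy0 => by
        rw [← hψf y hy, hy0, map_zero]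
      have hψlow : ∀ y ∈ bB.low k, ψ y ∈ bA.low k := by
        have h1 : bB.low k ≤ (bA.low k).comap ψ := by
          refine Algebra.adjoin_le ?_
          rintro _ ⟨a, ha, rfl⟩
          change ψ (bB.x a) ∈ bA.low k
          rw [hψ]
          exact bA.mem_low ha (hr a)
        exact fun y hy => h1 hy
      have hclosed : ∀ i ≤ k + 1, ∀ z ∈ B.deg i, B.d z = 0 →
          ∃ s ∈ A.deg i, A.d s = 0 ∧ z = f.toAlgHom s := by
        intro i hi z hz hdz
        obtain ⟨s, hs, hds, y, rfl⟩ := hf.exists_closed hz hdz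
        have h1 : B.d y ∈ B.deg i := by
          have := Submodule.sub_mem _ hz (f.map_deg hs)
          change f.toAlgHom s + B.d y - f.toAlgHom s ∈ _ at this
          rwa [add_sub_cancel_left] at this
        cases i with
        | zero =>
          have h2 : B.d y = 0 := by
            rw [← GCAlg.pr_of_mem h1]; exact B.proj_zero_d y
          exact ⟨s, hs, hds, by rw [h2, add_zero]⟩
        | succ i =>
          obtain ⟨y', hy', hyy⟩ := exists_primitive_mem h1 ⟨y, rfl⟩
          obtain ⟨t, ht, rfl⟩ := sur i (by omega) y' hy'
          refine ⟨s + A.d t, Submodule.add_mem _ hs (A.d_mem ht), ?_, ?_⟩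
          · rw [map_add, hds, A.d_d, add_zero]
          · rw [map_add, f.map_d', hyy]
      constructor
      · intro i hi y hy hy0
        rcases Nat.lt_or_ge k i with h | h
        · obtain rfl : i = k + 1 := by omega
          have h1 : A.d y = 0 := hinjlow _ (bA.d_mem_low_succ hA.2.1 hy) (by
            rw [f.map_d', hy0, map_zero])
          obtain ⟨u, hu, rfl⟩ := exists_primitive_mem hy (hf.exists_exact h1 ⟨0, by
            rw [hy0, map_zero]⟩)
          obtain ⟨s, hs, hds, hus⟩ := hclosed k (by omega) (f.toAlgHom u) (f.map_deg hu) (by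
            rw [← f.map_d', hy0])
          have h2 : u - s = 0 := inj k le_rfl _ (Submodule.sub_mem _ hu hs) (by
            rw [map_sub, hus, sub_self])
          rw [sub_eq_zero.1 h2, hds]
        · exact inj i h y hy hy0
      · intro i hi y hy
        rcases Nat.lt_or_ge k i with h | h
        · obtain rfl : i = k + 1 := by omega
          have h1 := bB.d_mem_low_succ hB.2.1 hy
          have h2 : A.d (ψ (B.d y)) = 0 := hinjlow _ (bA.d_mem_low (hψlow _ h1)) (by
            rw [f.map_d', hfψ _ h1, B.d_d])
          obtain ⟨u, hu, hdu⟩ := exists_primitive_mem (hψdeg _ _ (B.d_mem hy))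
            (hf.exists_exact h2 ⟨y, (hfψ _ h1).symm⟩)
          obtain ⟨s, hs, hds, hys⟩ := hclosed (k + 1) le_rfl (y - f.toAlgHom u)
            (Submodule.sub_mem _ hy (f.map_deg hu)) (by
              rw [map_sub, ← f.map_d', hdu, hfψ _ h1, sub_self])
          exact ⟨u + s, Submodule.add_mem _ hu hs, by rw [map_add, ← hys]; abel⟩
        · exact sur i h y hy
  refine ⟨f.toHom.injective_of_deg fun k y hy hy0 => ?_,
    f.toHom.surjective_of_deg fun k y hy => ?_⟩
  · exact (key (k + 1) (by omega)).1 k (by omega) y hy hy0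
  · obtain ⟨z, -, hz⟩ := (key (k + 1) (by omega)).2 k (by omega) y hy
    exact ⟨z, hz⟩

end DGA

/-! ### An extension of a Poincaré algebra by an acyclic pair -/

theorem isInternal_of_projections {V : Type u} [AddCommGroup V] [Module ℚ V]
    (𝒱 : ℕ → Submodule ℚ V) (π : ℕ → V →ₗ[ℚ] V) (h1 : ∀ i, ∀ x ∈ 𝒱 i, π i x = x)
    (h2 : ∀ i j, i ≠ j → ∀ x ∈ 𝒱 i, π j x = 0) (hs : ⨆ i, 𝒱 i = ⊤) : DirectSum.IsInternal 𝒱 := by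
  classical
  refine DirectSum.isInternal_submodule_of_iSupIndep_of_iSup_eq_top ?_ hs
  rw [iSupIndep_iff_finsetSum_eq_zero_imp_eq_zero]
  intro s x hx hsum i hi
  have h := congrArg (π i) hsum
  rw [map_sum, map_zero, Finset.sum_eq_single i] at h
  · rw [← h, h1 i _ (hx i hi)]
  · exact fun j hj hji => h2 j i hji _ (hx j hj)
  · exact fun h => absurd hi h

/-- The structure maps of an extension of a graded algebra `H` with top degree `m` to a DGA with
underlying graded vector space `H ⊕ W ⊕ W[-1]`, where the differential maps `W[-1]`
identically to `W`. Here `s` is the deviation of the product of elements of `H` from the product of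
`H`, `h` and `hr` are the components in `H` of products of `H` and `W[-1]`, and `θ` gives the
product of `W[-1]` and `W`, as a multiple of `ω ∈ Hᵐ`. The submodule `K` is annihilated by the
other structure maps. -/
structure BMExt (H : GCAlg.{u}) (m : ℕ) where
  W : Type u
  [acg : AddCommGroup W]
  [mod : Module ℚ W]
  wdeg : ℕ → Submodule ℚ W
  wpr : ℕ → W →ₗ[ℚ] W
  wpr_of_mem : ∀ i, ∀ x ∈ wdeg i, wpr i x = x
  wpr_of_mem_ne : ∀ i j, i ≠ j → ∀ x ∈ wdeg i, wpr j x = 0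
  iSup_wdeg : ⨆ i, wdeg i = ⊤
  wdeg_zero : wdeg 0 = ⊥
  σ : W →ₗ[ℚ] W
  σ_of_mem : ∀ {i w}, w ∈ wdeg i → σ w = (-1 : ℚ) ^ i • w
  ε : H.carrier →ₐ[ℚ] ℚ
  ε_of_mem : ∀ {i x}, i ≠ 0 → x ∈ H.deg i → ε x = 0
  ω : H.carrier
  ω_mem : ω ∈ H.deg m
  s : H.carrier →ₗ[ℚ] H.carrier →ₗ[ℚ] W
  θ : W →ₗ[ℚ] W →ₗ[ℚ] ℚ
  h : H.carrier →ₗ[ℚ] W →ₗ[ℚ] H.carrier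
  hr : W →ₗ[ℚ] H.carrier →ₗ[ℚ] H.carrier
  s_mem : ∀ {i j x y}, x ∈ H.deg i → y ∈ H.deg j → s x y ∈ wdeg (i + j)
  s_comm : ∀ {i j x y}, x ∈ H.deg i → y ∈ H.deg j → s x y = (-1 : ℚ) ^ (i * j) • s y x
  θ_of_mem : ∀ {p q w w'}, w ∈ wdeg p → w' ∈ wdeg q → p + q ≠ m + 1 → θ w w' = 0
  θ_comm : ∀ {p q w w'}, w ∈ wdeg p → w' ∈ wdeg q → θ w w' = (-1 : ℚ) ^ (p * q) * θ w' w
  h_mem : ∀ {i j x g}, x ∈ H.deg i → g ∈ wdeg (j + 1) → h x g ∈ H.deg (i + j)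
  h_comm : ∀ {i j x g}, x ∈ H.deg i → g ∈ wdeg (j + 1) → h x g = (-1 : ℚ) ^ (i * j) • hr g x
  K : Submodule ℚ H.carrier
  ε_K : ∀ x ∈ K, ε x = 0
  s_K_left : ∀ x ∈ K, ∀ y, s x y = 0
  s_K_right : ∀ x ∈ K, ∀ y, s y x = 0
  h_K : ∀ x ∈ K, ∀ g, h x g = 0
  hr_K : ∀ x ∈ K, ∀ g, hr g x = 0
  h_mem_K : ∀ x g, h x g ∈ K
  hr_mem_K : ∀ g x, hr g x ∈ K
  θ_smul_mem_K : ∀ g w, θ g w • ω ∈ K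
  s_mul_left : ∀ x y z, s (x * y) z = ε x • s y z + ε y • s x z
  s_mul_right : ∀ x y z, s x (y * z) = ε y • s x z + ε z • s x y
  h_mul : ∀ x y g, h (x * y) g = ε x • h y g + ε y • h x g
  hr_mul : ∀ x y g, hr g (x * y) = ε x • hr g y + ε y • hr g x
  mul_h : ∀ x y g, x * h y g = ε x • h y g + θ (σ (s x y)) g • ω
  hr_mul_right : ∀ g x y, hr g x * y = ε y • hr g x + θ g (s x y) • ω
  h_mul_right : ∀ x g y, h x g * y = x * hr g y + ε y • h x g - ε x • hr g y
  mul_ω : ∀ x, x * ω = ε x • ω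
  ω_mul : ∀ x, ω * x = ε x • ω

attribute [instance] BMExt.acg BMExt.mod

namespace BMExt

variable {H : GCAlg.{u}} {m : ℕ} (X : BMExt H m)

/-- The underlying vector space `H ⊕ W ⊕ W[-1]`. -/
def Carrier : Type u := H.carrier × X.W × X.W

instance addCommGroup : AddCommGroup X.Carrier := inferInstanceAs (AddCommGroup (H.carrier × X.W × X.W))
instance : Module ℚ X.Carrier := inferInstanceAs (Module ℚ (H.carrier × X.W × X.W))

variable {X}

/-- The element with given components. -/
def el (x : H.carrier) (w g : X.W) : X.Carrier := (x, w, g)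

theorem el_add (x x' : H.carrier) (w w' g g' : X.W) :
    el x w g + el x' w' g' = el (x + x') (w + w') (g + g') := rfl

theorem smul_el (c : ℚ) (x : H.carrier) (w g : X.W) :
    c • el x w g = el (c • x) (c • w) (c • g) := rfl

theorem el_zero : (el 0 0 0 : X.Carrier) = 0 := rfl

theorem exists_el (a : X.Carrier) : ∃ x w g, a = el x w g := ⟨a.1, a.2.1, a.2.2, rfl⟩

theorem el_inj {x x' : H.carrier} {w w' g g' : X.W} :
    el x w g = el x' w' g' ↔ x = x' ∧ w = w' ∧ g = g' := by
  constructor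
  · intro h
    exact ⟨congrArg Prod.fst h, congrArg (fun a : H.carrier × X.W × X.W => a.2.1) h,
      congrArg (fun a : H.carrier × X.W × X.W => a.2.2) h⟩
  · rintro ⟨rfl, rfl, rfl⟩; rfl

instance : Mul X.Carrier := ⟨fun a b =>
  el (a.1 * b.1 + X.h a.1 b.2.2 + X.hr a.2.2 b.1 +
      (X.θ a.2.2 b.2.1 + X.θ (X.σ a.2.1) b.2.2) • X.ω)
    (X.s a.1 b.1 + X.ε a.1 • b.2.1 + X.ε b.1 • a.2.1) (X.ε a.1 • b.2.2 + X.ε b.1 • a.2.2)⟩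

instance : One X.Carrier := ⟨el 1 0 0⟩

theorem el_mul (x x' : H.carrier) (w w' g g' : X.W) :
    el x w g * el x' w' g' = el (x * x' + X.h x g' + X.hr g x' +
      (X.θ g w' + X.θ (X.σ w) g') • X.ω) (X.s x x' + X.ε x • w' + X.ε x' • w)
      (X.ε x • g' + X.ε x' • g) := rfl

theorem one_def : (1 : X.Carrier) = el 1 0 0 := rfl

variable (X) in
theorem s_one_left (y : H.carrier) : X.s 1 y = 0 := by
  have h := X.s_mul_left 1 1 y
  rw [mul_one, map_one X.ε, one_smul] at h
  exact (left_eq_add).1 h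

variable (X) in
theorem s_one_right (y : H.carrier) : X.s y 1 = 0 := by
  have h := X.s_mul_right y 1 1
  rw [mul_one, map_one X.ε, one_smul] at h
  exact (left_eq_add).1 h

variable (X) in
theorem h_one (g : X.W) : X.h 1 g = 0 := by
  have h := X.h_mul 1 1 g
  rw [mul_one, map_one X.ε, one_smul] at h
  exact (left_eq_add).1 h

variable (X) in
theorem hr_one (g : X.W) : X.hr g 1 = 0 := by
  have h := X.hr_mul 1 1 g
  rw [mul_one, map_one X.ε, one_smul] at h
  exact (left_eq_add).1 h

theorem mul_assoc' (a b c : X.Carrier) : a * b * c = a * (b * c) := by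
  obtain ⟨x, w, g, rfl⟩ := exists_el a
  obtain ⟨x', w', g', rfl⟩ := exists_el b
  obtain ⟨x'', w'', g'', rfl⟩ := exists_el c
  have e1 : ∀ g w, X.θ g w * X.ε X.ω = 0 := fun g w => by
    have := X.ε_K _ (X.θ_smul_mem_K g w)
    rwa [map_smul] at this
  have e2 : ∀ g w y, X.θ g w • X.s X.ω y = 0 := fun g w y => by
    have := X.s_K_left _ (X.θ_smul_mem_K g w) y
    rwa [map_smul] at this
  have e3 : ∀ g w y, X.θ g w • X.s y X.ω = 0 := fun g w y => by
    have := X.s_K_right _ (X.θ_smul_mem_K g w) y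
    rwa [map_smul] at this
  have e4 : ∀ g w y, X.θ g w • X.h X.ω y = 0 := fun g w y => by
    have := X.h_K _ (X.θ_smul_mem_K g w) y
    rwa [map_smul] at this
  have e5 : ∀ g w y, X.θ g w • X.hr y X.ω = 0 := fun g w y => by
    have := X.hr_K _ (X.θ_smul_mem_K g w) y
    rwa [map_smul] at this
  have f1 : ∀ x g, X.ε (X.h x g) = 0 := fun x g => X.ε_K _ (X.h_mem_K x g)
  have f2 : ∀ x g, X.ε (X.hr g x) = 0 := fun x g => X.ε_K _ (X.hr_mem_K g x)
  have f3 : ∀ x g y, X.s (X.h x g) y = 0 := fun x g => X.s_K_left _ (X.h_mem_K x g)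
  have f4 : ∀ x g y, X.s (X.hr g x) y = 0 := fun x g => X.s_K_left _ (X.hr_mem_K g x)
  have f5 : ∀ x g y, X.s y (X.h x g) = 0 := fun x g => X.s_K_right _ (X.h_mem_K x g)
  have f6 : ∀ x g y, X.s y (X.hr g x) = 0 := fun x g => X.s_K_right _ (X.hr_mem_K g x)
  have f7 : ∀ x g y, X.h (X.h x g) y = 0 := fun x g => X.h_K _ (X.h_mem_K x g)
  have f8 : ∀ x g y, X.h (X.hr g x) y = 0 := fun x g => X.h_K _ (X.hr_mem_K g x)
  have f9 : ∀ x g y, X.hr y (X.h x g) = 0 := fun x g => X.hr_K _ (X.h_mem_K x g)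
  have f10 : ∀ x g y, X.hr y (X.hr g x) = 0 := fun x g => X.hr_K _ (X.hr_mem_K g x)
  simp only [el_mul, el_inj, map_add, map_smul, map_mul, LinearMap.add_apply, LinearMap.smul_apply,
    smul_eq_mul, e1, e2, e3, e4, e5, f1, f2, f3, f4, f5, f6, f7, f8, f9, f10, add_mul, mul_add,
    X.mul_h, X.hr_mul_right, X.h_mul_right, X.h_mul, X.hr_mul, X.s_mul_left, X.s_mul_right,
    smul_mul_assoc, mul_smul_comm, X.mul_ω, X.ω_mul, add_smul, smul_add, mul_assoc, add_zero]
  refine ⟨?_, ?_, ?_⟩ <;> module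

instance : Ring X.Carrier where
  __ := X.addCommGroup
  left_distrib a b c := by
    obtain ⟨x, w, g, rfl⟩ := exists_el a
    obtain ⟨x', w', g', rfl⟩ := exists_el b
    obtain ⟨x'', w'', g'', rfl⟩ := exists_el c
    simp only [el_mul, el_add, el_inj, map_add, mul_add]
    refine ⟨?_, ?_, ?_⟩ <;> module
  right_distrib a b c := by
    obtain ⟨x, w, g, rfl⟩ := exists_el a
    obtain ⟨x', w', g', rfl⟩ := exists_el b
    obtain ⟨x'', w'', g'', rfl⟩ := exists_el c
    simp only [el_mul, el_add, el_inj, map_add, add_mul, LinearMap.add_apply]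
    refine ⟨?_, ?_, ?_⟩ <;> module
  zero_mul a := by
    obtain ⟨x, w, g, rfl⟩ := exists_el a
    rw [← el_zero, el_mul, el_inj]; simp
  mul_zero a := by
    obtain ⟨x, w, g, rfl⟩ := exists_el a
    rw [← el_zero, el_mul, el_inj]; simp
  mul_assoc := mul_assoc'
  one_mul a := by
    obtain ⟨x, w, g, rfl⟩ := exists_el a
    rw [one_def, el_mul, el_inj]; simp [X.s_one_left, X.h_one]
  mul_one a := by
    obtain ⟨x, w, g, rfl⟩ := exists_el a
    rw [one_def, el_mul, el_inj]; simp [X.s_one_right, X.hr_one]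

instance : Algebra ℚ X.Carrier := Algebra.ofModule
  (fun c a b => by
    obtain ⟨x, w, g, rfl⟩ := exists_el a
    obtain ⟨x', w', g', rfl⟩ := exists_el b
    simp only [el_mul, smul_el, el_inj, map_smul, LinearMap.smul_apply, smul_mul_assoc, smul_eq_mul]
    refine ⟨?_, ?_, ?_⟩ <;> module)
  (fun c a b => by
    obtain ⟨x, w, g, rfl⟩ := exists_el a
    obtain ⟨x', w', g', rfl⟩ := exists_el b
    simp only [el_mul, smul_el, el_inj, map_smul, mul_smul_comm, smul_eq_mul]
    refine ⟨?_, ?_, ?_⟩ <;> module)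

variable (X) in
/-- The grading of `H ⊕ W ⊕ W[-1]`. -/
def deg (k : ℕ) : Submodule ℚ X.Carrier where
  carrier := {a | a.1 ∈ H.deg k ∧ a.2.1 ∈ X.wdeg k ∧ a.2.2 ∈ X.wdeg (k + 1)}
  zero_mem' := ⟨zero_mem _, zero_mem _, zero_mem _⟩
  add_mem' ha hb := ⟨add_mem ha.1 hb.1, add_mem ha.2.1 hb.2.1, add_mem ha.2.2 hb.2.2⟩
  smul_mem' c _ ha := ⟨Submodule.smul_mem _ c ha.1, Submodule.smul_mem _ c ha.2.1,
    Submodule.smul_mem _ c ha.2.2⟩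

theorem el_mem_deg {k : ℕ} {x : H.carrier} {w g : X.W} :
    (el x w g : X.Carrier) ∈ X.deg k ↔ x ∈ H.deg k ∧ w ∈ X.wdeg k ∧ g ∈ X.wdeg (k + 1) := Iff.rfl

theorem deg_isInternal : DirectSum.IsInternal X.deg := by
  let π : ℕ → X.Carrier →ₗ[ℚ] X.Carrier := fun k =>
    (H.pr k).prodMap ((X.wpr k).prodMap (X.wpr (k + 1)))
  refine isInternal_of_projections X.deg π (fun i a ha => ?_) (fun i j hij a ha => ?_) ?_
  · obtain ⟨x, w, g, rfl⟩ := exists_el a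
    obtain ⟨h1, h2, h3⟩ := ha
    exact el_inj.2 ⟨GCAlg.pr_of_mem h1, X.wpr_of_mem _ _ h2, X.wpr_of_mem _ _ h3⟩
  · obtain ⟨x, w, g, rfl⟩ := exists_el a
    obtain ⟨h1, h2, h3⟩ := ha
    exact el_inj.2 ⟨GCAlg.pr_of_mem_ne h1 hij, X.wpr_of_mem_ne _ _ hij _ h2,
      X.wpr_of_mem_ne _ _ (by omega) _ h3⟩
  · rw [eq_top_iff]
    rintro a -
    obtain ⟨x, w, g, rfl⟩ := exists_el a
    have e : (el x w g : X.Carrier) = el x 0 0 + el 0 w 0 + el 0 0 g := by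
      simp only [el_add, add_zero, zero_add]
    let i1 : H.carrier →ₗ[ℚ] X.Carrier := LinearMap.inl ℚ H.carrier (X.W × X.W)
    let i2 : X.W →ₗ[ℚ] X.Carrier := LinearMap.inr ℚ H.carrier (X.W × X.W) ∘ₗ LinearMap.inl ℚ X.W X.W
    let i3 : X.W →ₗ[ℚ] X.Carrier := LinearMap.inr ℚ H.carrier (X.W × X.W) ∘ₗ LinearMap.inr ℚ X.W X.W
    have hH : (⊤ : Submodule ℚ H.carrier) ≤ (⨆ i, X.deg i).comap i1 := by
      rw [← (DirectSum.Decomposition.isInternal H.deg).submodule_iSup_eq_top]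
      exact iSup_le fun k x hx => Submodule.mem_iSup_of_mem k
        (show i1 x ∈ X.deg k from ⟨hx, zero_mem _, zero_mem _⟩)
    have hW : (⊤ : Submodule ℚ X.W) ≤ (⨆ i, X.deg i).comap i2 := by
      rw [← X.iSup_wdeg]
      exact iSup_le fun k x hx => Submodule.mem_iSup_of_mem k
        (show i2 x ∈ X.deg k from ⟨zero_mem _, hx, zero_mem _⟩)
    have hG : (⊤ : Submodule ℚ X.W) ≤ (⨆ i, X.deg i).comap i3 := by
      rw [← X.iSup_wdeg]
      refine iSup_le fun k x hx => ?_
      cases k with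
      | zero =>
        rw [X.wdeg_zero, Submodule.mem_bot] at hx
        rw [hx]; exact zero_mem _
      | succ k =>
        exact Submodule.mem_iSup_of_mem k
          (show i3 x ∈ X.deg k from ⟨zero_mem _, zero_mem _, hx⟩)
    rw [e]
    exact add_mem (add_mem (hH (x := x) trivial) (hW (x := w) trivial)) (hG (x := g) trivial)

theorem ε_smul_mem {V : Type v} [AddCommGroup V] [Module ℚ V] (𝒱 : ℕ → Submodule ℚ V) {i j : ℕ}
    {x : H.carrier} {v : V} (hx : x ∈ H.deg i) (hv : v ∈ 𝒱 j) : X.ε x • v ∈ 𝒱 (i + j) := by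
  rcases eq_or_ne i 0 with rfl | h
  · rw [zero_add]; exact Submodule.smul_mem _ _ hv
  · rw [X.ε_of_mem h hx, zero_smul]; exact zero_mem _

theorem ε_smul_mem' {V : Type v} [AddCommGroup V] [Module ℚ V] (𝒱 : ℕ → Submodule ℚ V) {i j k : ℕ}
    {x : H.carrier} {v : V} (hx : x ∈ H.deg i) (hv : v ∈ 𝒱 j) (hk : i + j = k) :
    X.ε x • v ∈ 𝒱 k := hk ▸ X.ε_smul_mem 𝒱 hx hv

theorem ε_smul_comm {V : Type v} [AddCommGroup V] [Module ℚ V] {i : ℕ} (j : ℕ) {x : H.carrier}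
    {v : V} (hx : x ∈ H.deg i) : X.ε x • v = (-1 : ℚ) ^ (i * j) • X.ε x • v := by
  rcases eq_or_ne i 0 with rfl | h
  · rw [zero_mul, pow_zero, one_smul]
  · rw [X.ε_of_mem h hx, zero_smul, smul_zero]

theorem θ_smul_mem {p q k : ℕ} {g w : X.W} (hg : g ∈ X.wdeg p) (hw : w ∈ X.wdeg q)
    (hk : p + q = k + 1) : X.θ g w • X.ω ∈ H.deg k := by
  by_cases h : p + q = m + 1
  · rw [show k = m by omega]; exact Submodule.smul_mem _ _ X.ω_mem
  · rw [X.θ_of_mem hg hw h, zero_smul]; exact zero_mem _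

theorem σ_mem {p : ℕ} {w : X.W} (hw : w ∈ X.wdeg p) : X.σ w ∈ X.wdeg p := by
  rw [X.σ_of_mem hw]; exact Submodule.smul_mem _ _ hw

theorem hr_mem {i j : ℕ} {x : H.carrier} {g : X.W} (hx : x ∈ H.deg i) (hg : g ∈ X.wdeg (j + 1)) :
    X.hr g x ∈ H.deg (i + j) := by
  have h := X.h_mem hx hg
  rw [X.h_comm hx hg] at h
  have h2 := Submodule.smul_mem _ ((-1 : ℚ) ^ (i * j)) h
  rwa [smul_smul, ← mul_pow, neg_one_mul, neg_neg, one_pow, one_smul] at h2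

instance : SetLike.GradedMonoid X.deg where
  one_mem := ⟨SetLike.one_mem_graded _, zero_mem _, zero_mem _⟩
  mul_mem := by
    intro i j a b ha hb
    obtain ⟨x, w, g, rfl⟩ := exists_el a
    obtain ⟨x', w', g', rfl⟩ := exists_el b
    obtain ⟨h1, h2, h3⟩ := el_mem_deg.1 ha
    obtain ⟨h1', h2', h3'⟩ := el_mem_deg.1 hb
    rw [el_mul, el_mem_deg, add_smul]
    refine ⟨add_mem (add_mem (add_mem (SetLike.mul_mem_graded h1 h1') (X.h_mem h1 h3')) ?_)
      (add_mem (X.θ_smul_mem h3 h2' (by omega)) (X.θ_smul_mem (σ_mem h2) h3' (by omega))),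
      add_mem (add_mem (X.s_mem h1 h1') (X.ε_smul_mem _ h1 h2'))
        (X.ε_smul_mem' _ h1' h2 (add_comm _ _)),
      add_mem (X.ε_smul_mem' _ h1 h3' (by omega)) (X.ε_smul_mem' _ h1' h3 (by omega))⟩
    rw [add_comm i j]
    exact hr_mem h1' h3

theorem mul_comm' {i j : ℕ} {a b : X.Carrier} (ha : a ∈ X.deg i) (hb : b ∈ X.deg j) :
    a * b = (-1 : ℚ) ^ (i * j) • (b * a) := by
  obtain ⟨x, w, g, rfl⟩ := exists_el a
  obtain ⟨x', w', g', rfl⟩ := exists_el b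
  obtain ⟨h1, h2, h3⟩ := el_mem_deg.1 ha
  obtain ⟨h1', h2', h3'⟩ := el_mem_deg.1 hb
  have sq : ∀ k : ℕ, (-1 : ℚ) ^ k * (-1 : ℚ) ^ k = 1 := fun k => by rw [← mul_pow]; simp
  have e1 : X.h x' g = (-1 : ℚ) ^ (i * j) • X.hr g x' := by
    rw [X.h_comm h1' h3, mul_comm j i]
  have e2 : X.θ g w' = (-1 : ℚ) ^ (i * j) * X.θ (X.σ w') g := by
    rw [X.σ_of_mem h2', map_smul, LinearMap.smul_apply, smul_eq_mul, X.θ_comm h3 h2',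
      ← mul_assoc, ← pow_add]
    congr 2
    ring
  have e3 : X.θ g' w = (-1 : ℚ) ^ (i * j) * X.θ (X.σ w) g' := by
    rw [X.σ_of_mem h2, map_smul, LinearMap.smul_apply, smul_eq_mul, X.θ_comm h3' h2,
      ← mul_assoc, ← pow_add]
    congr 2
    ring
  rw [el_mul, el_mul, smul_el, el_inj]
  refine ⟨?_, ?_, ?_⟩
  · rw [H.comm h1 h1', X.h_comm h1 h3', e1, e2, e3, smul_add, smul_add, smul_add, smul_smul,
      sq, one_smul, smul_smul, mul_add, ← mul_assoc, sq, one_mul]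
    module
  · have f1 := X.ε_smul_comm j (v := w') h1
    have f2 := X.ε_smul_comm i (v := w) h1'
    rw [mul_comm j i] at f2
    rw [X.s_comm h1 h1', smul_add, smul_add, ← f1, ← f2]
    abel
  · have f1 := X.ε_smul_comm j (v := g') h1
    have f2 := X.ε_smul_comm i (v := g) h1'
    rw [mul_comm j i] at f2
    rw [smul_add, ← f1, ← f2]
    abel

variable (X) in
/-- The underlying graded commutative algebra. -/
noncomputable abbrev alg : GCAlg.{u} where
  carrier := X.Carrier
  deg := X.deg
  graded := deg_isInternal.gradedAlgebra
  comm := mul_comm'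

variable (X) in
/-- The DGA `H ⊕ W ⊕ W[-1]`. -/
noncomputable abbrev dga : DGA.{u} where
  toGCAlg := X.alg
  d := { toFun := fun a => (el 0 a.2.2 0 : X.Carrier)
         map_add' := fun a b => by
          rw [el_add, add_zero, add_zero]; rfl
         map_smul' := fun c a => by
          rw [RingHom.id_apply, smul_el, smul_zero, smul_zero]; rfl }
  d_mem ha := ⟨zero_mem _, ha.2.2, zero_mem _⟩
  d_d _ := rfl
  leibniz := by
    intro i a b ha
    obtain ⟨x, w, g, rfl⟩ := exists_el a
    obtain ⟨x', w', g', rfl⟩ := exists_el b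
    obtain ⟨h1, h2, h3⟩ := el_mem_deg.1 ha
    change (el 0 (X.ε x • g' + X.ε x' • g) 0 : X.Carrier) =
      el 0 g 0 * el x' w' g' + (-1 : ℚ) ^ i • (el x w g * el 0 g' 0)
    have e : (-1 : ℚ) ^ (i + 1) = - (-1 : ℚ) ^ i := by rw [pow_succ, mul_neg_one]
    have e2 := X.ε_smul_comm 1 (v := g') h1
    rw [mul_one] at e2
    simp only [el_mul, smul_el, el_add, el_inj, map_zero, LinearMap.zero_apply, zero_mul, mul_zero,
      zero_smul, smul_zero, add_zero, zero_add, X.σ_of_mem h3, map_smul, LinearMap.smul_apply, e]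
    refine ⟨?_, ?_, trivial⟩
    · module
    · rw [add_comm, ← e2]

theorem mem_closed_iff {a : X.Carrier} : X.dga.d a = 0 ↔ a.2.2 = 0 := by
  constructor
  · intro h
    exact (el_inj.1 (h.trans el_zero.symm)).2.1
  · intro h
    change (el 0 a.2.2 0 : X.Carrier) = 0
    rw [h, el_zero]

variable (X) in
/-- The inclusion of `H` in the closed elements. -/
def incl : H.carrier →ₗ[ℚ] X.dga.closed where
  toFun x := ⟨(el x 0 0 : X.Carrier), mem_closed_iff.2 rfl⟩
  map_add' x y := Subtype.ext (by
    change (el (x + y) 0 0 : X.Carrier) = el x 0 0 + el y 0 0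
    rw [el_add, add_zero])
  map_smul' c x := Subtype.ext (by
    change (el (c • x) 0 0 : X.Carrier) = c • el x 0 0
    rw [smul_el, smul_zero])

variable (X) in
/-- The cohomology of the extension is `H`. -/
noncomputable def cohHom : GCAlg.Hom H X.dga.cohomology where
  toAlgHom := AlgHom.ofLinearMap (X.dga.toCoh.toLinearMap ∘ₗ X.incl)
    ((congrArg X.dga.toCoh (show X.incl 1 = 1 from rfl)).trans (map_one _)) (by
      intro x y
      change X.dga.toCoh (X.incl (x * y)) = X.dga.toCoh (X.incl x) * X.dga.toCoh (X.incl y)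
      rw [← map_mul, ← sub_eq_zero, ← map_sub, X.dga.toCoh_eq_zero]
      refine ⟨el 0 0 (-X.s x y), ?_⟩
      change (el 0 (-X.s x y) 0 : X.Carrier) = el (x * y) 0 0 - el x 0 0 * el y 0 0
      rw [eq_sub_iff_add_eq, el_mul, el_add, el_inj]
      simp)
  map_deg {i x} hx := X.dga.mem_cohomology_deg.2 ⟨X.incl x, ⟨hx, zero_mem _, zero_mem _⟩, rfl⟩

theorem cohHom_apply (x : H.carrier) : X.cohHom.toAlgHom x = X.dga.toCoh (X.incl x) := rfl

theorem cohHom_bijective : Function.Bijective X.cohHom.toAlgHom := by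
  constructor
  · rw [injective_iff_map_eq_zero]
    intro x hx
    obtain ⟨y, hy⟩ := X.dga.toCoh_eq_zero.1 (show X.dga.toCoh (X.incl x) = 0 from hx)
    exact (el_inj.1 (show (el 0 y.2.2 0 : X.Carrier) = el x 0 0 from hy)).1.symm
  · intro y
    obtain ⟨z, rfl⟩ := X.dga.toCoh_surjective y
    obtain ⟨x, w, g, hz⟩ := exists_el (z : X.Carrier)
    have hg : g = 0 := by
      have := mem_closed_iff.1 z.2
      rw [hz] at this
      exact this
    refine ⟨x, ?_⟩
    rw [cohHom_apply, ← sub_eq_zero, ← map_sub, X.dga.toCoh_eq_zero]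
    refine ⟨el 0 0 (-w), ?_⟩
    change (el 0 (-w) 0 : X.Carrier) = el x 0 0 - (z : X.Carrier)
    rw [eq_sub_iff_add_eq, hz, el_add, el_inj, hg]
    simp

variable (X) in
/-- The isomorphism of the cohomology of the extension with `H`. -/
noncomputable def cohIso : GCAlg.Iso X.dga.cohomology H :=
  (GCAlg.Iso.ofBijective X.cohHom X.cohHom_bijective).symm

theorem toCoh_incl_cohIso (y : X.dga.cohomology.carrier) :
    X.dga.toCoh (X.incl (X.cohIso.hom.toAlgHom y)) = y :=
  (AlgEquiv.ofBijective X.cohHom.toAlgHom X.cohHom_bijective).apply_symm_apply y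

theorem cohIso_toCoh_incl (x : H.carrier) :
    X.cohIso.hom.toAlgHom (X.dga.toCoh (X.incl x)) = x :=
  (AlgEquiv.ofBijective X.cohHom.toAlgHom X.cohHom_bijective).symm_apply_apply x

variable (X) in
/-- The linear map `𝒢²H → W` induced by `s`. -/
noncomputable def sG2 : G2 H.deg →ₗ[ℚ] X.W := G2.lift H.deg X.s fun _ _ _ hx _ hy => X.s_comm hx hy

theorem sG2_mem {k : ℕ} {t : G2 H.deg} (ht : t ∈ G2.deg H.deg k) : X.sG2 t ∈ X.wdeg k := by
  have : G2.deg H.deg k ≤ (X.wdeg k).comap X.sG2 := by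
    refine Submodule.span_le.2 ?_
    rintro _ ⟨i, j, rfl, x, hx, y, hy, rfl⟩
    exact X.s_mem hx hy
  exact this ht

variable (X) in
/-- The choice of representatives `x ↦ (x, 0, 0)`. -/
noncomputable def preChoice : DGA.PreChoice X.dga where
  α := X.incl ∘ₗ X.cohIso.hom.toAlgHom.toLinearMap
  α_mem hx := ⟨X.cohIso.hom.map_deg hx, zero_mem _, zero_mem _⟩
  toCoh_α := toCoh_incl_cohIso

theorem coe_sq (t : G2 X.dga.cohomology.deg) : ((X.preChoice.sq t : X.dga.closed) : X.Carrier) =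
    el (H.cup (X.cohIso.hom.g2 t)) (X.sG2 (X.cohIso.hom.g2 t)) 0 := by
  let L : G2 X.dga.cohomology.deg →ₗ[ℚ] X.Carrier :=
    (H.cup.prod (X.sG2.prod 0)) ∘ₗ X.cohIso.hom.g2
  refine LinearMap.congr_fun (f := X.dga.closed.val.toLinearMap ∘ₗ X.preChoice.sq) (g := L)
    (G2.hom_ext _ fun x y => ?_) t
  change (el (X.cohIso.hom.toAlgHom x) 0 0 * el (X.cohIso.hom.toAlgHom y) 0 0 : X.Carrier) =
    el (X.cohIso.hom.toAlgHom x * X.cohIso.hom.toAlgHom y)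
      (X.s (X.cohIso.hom.toAlgHom x) (X.cohIso.hom.toAlgHom y)) 0
  rw [el_mul, el_inj]
  simp

variable (X) in
/-- The map `E → W` given by `s`. -/
noncomputable def sE : X.dga.cohomology.E →ₗ[ℚ] X.W :=
  X.sG2 ∘ₗ H.E.subtype ∘ₗ X.cohIso.hom.eMap

theorem coe_sq_E (e : X.dga.cohomology.E) :
    ((X.preChoice.sq (e : G2 X.dga.cohomology.deg) : X.dga.closed) : X.Carrier) =
      el 0 (X.sE e) 0 := by
  rw [coe_sq, el_inj]
  exact ⟨(X.cohIso.hom.eMap e).2, rfl, rfl⟩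

variable (X) in
/-- The choice of primitives `e ↦ (0, 0, s e)`. -/
noncomputable def choice : DGA.BMChoice X.dga where
  toPreChoice := X.preChoice
  γ := (LinearMap.inr ℚ H.carrier (X.W × X.W) ∘ₗ LinearMap.inr ℚ X.W X.W) ∘ₗ X.sE
  γ_zero {e} he := by
    have h : X.sE e ∈ X.wdeg 0 := sG2_mem (X := X) (X.cohIso.hom.eMap_mem 0 e he)
    rw [X.wdeg_zero, Submodule.mem_bot] at h
    change (el 0 0 (X.sE e) : X.Carrier) = 0
    rw [h]; rfl
  γ_mem {k e} he :=
    ⟨zero_mem _, zero_mem _, sG2_mem (X := X) (X.cohIso.hom.eMap_mem (k + 1) e he)⟩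
  d_γ e := (coe_sq_E e).symm

theorem choice_γ (e : X.dga.cohomology.E) : X.choice.γ e = (el 0 0 (X.sE e) : X.Carrier) := rfl

theorem choice_sqE (e : X.dga.cohomology.E) :
    X.choice.sqE e = (el 0 (X.sE e) 0 : X.Carrier) := coe_sq_E e

variable (X) in
/-- The form `(e, e') ↦ θ (s e, s e')` on `𝒢²E`. -/
noncomputable def θG2 : G2 H.eDeg →ₗ[ℚ] ℚ :=
  G2.lift H.eDeg (X.θ.compl₁₂ (X.sG2 ∘ₗ H.E.subtype) (X.sG2 ∘ₗ H.E.subtype))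
    fun _ _ _ he _ he' => X.θ_comm (sG2_mem he) (sG2_mem he')

theorem θG2_mk (e e' : H.E) :
    X.θG2 (G2.mk H.eDeg e e') = X.θ (X.sG2 (e : G2 H.deg)) (X.sG2 (e' : G2 H.deg)) := rfl

theorem sgn_el (w : X.W) : X.dga.sgn (el 0 w 0 : X.Carrier) = (el 0 (X.σ w) 0 : X.Carrier) := by
  have h : w ∈ ⨆ i, X.wdeg i := by rw [X.iSup_wdeg]; trivial
  induction h using Submodule.iSup_induction' with
  | mem i w hw =>
    have h3 : (el 0 w 0 : X.Carrier) ∈ X.dga.deg i := ⟨zero_mem _, hw, zero_mem _⟩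
    rw [X.dga.sgn_of_mem h3, X.σ_of_mem hw]
    change (-1 : ℚ) ^ i • (el 0 w 0 : X.Carrier) = _
    rw [smul_el, smul_zero, smul_zero]
  | zero => rw [map_zero]; exact map_zero X.dga.sgn
  | add w w' _ _ hw hw' =>
    have h4 : (el 0 (w + w') 0 : X.Carrier) = el 0 w 0 + el 0 w' 0 := by
      rw [el_add, add_zero, add_zero]
    rw [map_add, h4]
    refine (map_add X.dga.sgn _ _).trans ((congrArg₂ (· + ·) hw hw').trans ?_)
    rw [el_add, add_zero, add_zero]

theorem σ_σ (w : X.W) : X.σ (X.σ w) = w := by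
  have h : w ∈ ⨆ i, X.wdeg i := by rw [X.iSup_wdeg]; trivial
  induction h using Submodule.iSup_induction' with
  | mem i w hw =>
    rw [X.σ_of_mem hw, map_smul, X.σ_of_mem hw, smul_smul, ← mul_pow]; simp
  | zero => rw [map_zero, map_zero]
  | add w w' _ _ hw hw' => rw [map_add, map_add, hw, hw']

theorem choice_form (t : G2 X.dga.cohomology.eDeg) :
    X.choice.form t = (el (X.θG2 (X.cohIso.hom.g2eMap t) • X.ω) 0 0 : X.Carrier) := by
  let L : G2 X.dga.cohomology.eDeg →ₗ[ℚ] X.Carrier :=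
    LinearMap.inl ℚ H.carrier (X.W × X.W) ∘ₗ LinearMap.toSpanSingleton ℚ H.carrier X.ω ∘ₗ X.θG2 ∘ₗ
      X.cohIso.hom.g2eMap
  refine LinearMap.congr_fun (f := X.choice.form) (g := L) (G2.hom_ext _ fun e e' => ?_) t
  change X.choice.bilin e e' = (el (X.θ (X.sE e) (X.sE e') • X.ω) 0 0 : X.Carrier)
  have h1 : X.dga.sgn (X.choice.sqE e) = (el 0 (X.σ (X.sE e)) 0 : X.Carrier) := by
    rw [choice_sqE]; exact sgn_el _
  rw [DGA.BMChoice.bilin_apply, h1, choice_γ, choice_γ, choice_sqE]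
  change (1 / 2 : ℚ) • (el 0 0 (X.sE e) * el 0 (X.sE e') 0 +
    el 0 (X.σ (X.sE e)) 0 * el 0 0 (X.sE e')) = (el (X.θ (X.sE e) (X.sE e') • X.ω) 0 0 : X.Carrier)
  rw [el_mul, el_mul, el_add, smul_el, el_inj, σ_σ]
  simp only [map_zero, LinearMap.zero_apply, mul_zero, zero_smul, add_zero, zero_add, smul_zero,
    and_true]
  module

theorem cohIso_tensor (k : ℕ) (t : X.dga.cohomology.bDeg (k + 1)) :
    (X.cohIso.hom.degMap k (X.choice.tensor k t) : H.carrier) =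
      X.θG2 (X.cohIso.hom.bMap (k + 1) t : G2 H.eDeg) • X.ω := by
  refine Eq.trans ?_ (cohIso_toCoh_incl (X := X) _)
  change X.cohIso.hom.toAlgHom (X.dga.toCoh ⟨X.choice.form t, _⟩) = _
  congr 2
  exact Subtype.ext (choice_form _)

end BMExt

/-! ### Poincaré duality -/

namespace GCAlg

variable {H : GCAlg.{u}} {m : ℕ}

theorem pr_mul_of_le' {k i : ℕ} {a : H.carrier} (ha : a ∈ H.deg i) (y : H.carrier) (h : i ≤ k) :
    H.pr k (y * a) = H.pr (k - i) y * a := by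
  rw [pr, pr, GradedAlgebra.proj_apply, GradedAlgebra.proj_apply,
    DirectSum.coe_decompose_mul_of_right_mem_of_le _ ha h]

variable (H m) in
/-- A Poincaré class, extended by zero to a functional on all of `H`. -/
structure Duality where
  J : H.carrier →ₗ[ℚ] ℚ
  J_of_ne : ∀ {i x}, x ∈ H.deg i → i ≠ m → J x = 0
  nondeg : ∀ x, (∀ y, J (y * x) = 0) → x = 0
  nondeg' : ∀ x, (∀ y, J (x * y) = 0) → x = 0
  deg_gt : ∀ i, m < i → H.deg i = ⊥

theorem IsPoincare.nonempty_duality (h : H.IsPoincare m) : Nonempty (Duality H m) := by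
  obtain ⟨-, α, hα, hgt⟩ := h
  let J : H.carrier →ₗ[ℚ] ℚ := α ∘ₗ (H.pr m).codRestrict (H.deg m) (pr_mem m)
  have hJ : ∀ {x} (hx : x ∈ H.deg m), J x = α ⟨x, hx⟩ := fun {x} hx => by
    change α ⟨H.pr m x, _⟩ = _
    congr 1
    exact Subtype.ext (pr_of_mem hx)
  have hJ0 : ∀ {i x}, x ∈ H.deg i → i ≠ m → J x = 0 := fun {i x} hx hi => by
    change α ⟨H.pr m x, _⟩ = _
    rw [← map_zero α]
    congr 1
    exact Subtype.ext (pr_of_mem_ne hx hi)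
  have hpr : ∀ x, J (H.pr m x) = J x := fun x => by
    change α ⟨H.pr m (H.pr m x), _⟩ = α ⟨H.pr m x, _⟩
    congr 1
    exact Subtype.ext (pr_of_mem (pr_mem m x))
  have key : ∀ i x, x ∈ H.deg i → (∀ j, i + j = m → ∀ y ∈ H.deg j, J (x * y) = 0) → x = 0 := by
    intro i x hx hxy
    rcases Nat.lt_or_ge m i with h | h
    · rw [hgt i h] at hx; exact hx
    · have hinj := (hα i (m - i) (by omega)).1
      have h1 : H.cap α (show i + (m - i) = m by omega) ⟨x, hx⟩ = 0 := by
        ext y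
        have h2 := hxy (m - i) (by omega) y y.2
        have h3 : x * (y : H.carrier) ∈ H.deg m := by
          have := SetLike.mul_mem_graded hx y.2
          rwa [show i + (m - i) = m by omega] at this
        rw [hJ h3] at h2
        exact h2
      exact congrArg Subtype.val (hinj (h1.trans (map_zero _).symm))
  refine ⟨⟨J, hJ0, fun x hx => eq_zero_of_pr fun k => key k _ (pr_mem k x) ?_,
    fun x hx => eq_zero_of_pr fun k => key k _ (pr_mem k x) ?_, hgt⟩⟩
  · intro j hj y hy
    have h1 := hx y
    rw [← hpr, pr_mul_of_le hy x (by omega), show m - j = k by omega] at h1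
    rw [H.comm (pr_mem k x) hy, map_smul, h1, smul_zero]
  · intro j hj y hy
    have h1 := hx y
    rwa [← hpr, pr_mul_of_le' hy x (by omega), show m - j = k by omega] at h1

namespace Duality

variable (P : Duality H m)

theorem J_comm {i j : ℕ} {x y : H.carrier} (hx : x ∈ H.deg i) (hy : y ∈ H.deg j) :
    P.J (x * y) = (-1 : ℚ) ^ (i * j) * P.J (y * x) := by
  rw [H.comm hx hy, map_smul, smul_eq_mul]

theorem J_pr (x : H.carrier) : P.J (H.pr m x) = P.J x := by
  induction x using DirectSum.Decomposition.inductionOn H.deg with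
  | zero => simp
  | @homogeneous i x =>
    by_cases h : i = m
    · subst h; rw [pr_of_mem x.2]
    · rw [pr_of_mem_ne x.2 h, map_zero, P.J_of_ne x.2 h]
  | add a b ha hb => simp only [map_add, ha, hb]

theorem ext_left {x y : H.carrier} (h : ∀ i, ∀ z ∈ H.deg i, P.J (z * x) = P.J (z * y)) : x = y := by
  rw [← sub_eq_zero]
  refine P.nondeg _ fun z => ?_
  induction z using DirectSum.Decomposition.inductionOn H.deg with
  | zero => simp
  | homogeneous z => rw [mul_sub, map_sub, h _ z z.2, sub_self]
  | add a b ha hb => rw [add_mul, map_add, ha, hb, add_zero]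

theorem ext_right {x y : H.carrier} (h : ∀ i, ∀ z ∈ H.deg i, P.J (x * z) = P.J (y * z)) :
    x = y := by
  rw [← sub_eq_zero]
  refine P.nondeg' _ fun z => ?_
  induction z using DirectSum.Decomposition.inductionOn H.deg with
  | zero => simp
  | homogeneous z => rw [sub_mul, map_sub, h _ z z.2, sub_self]
  | add a b ha hb => rw [mul_add, map_add, ha, hb, add_zero]

theorem mem_deg_of_left {k : ℕ} {x : H.carrier}
    (h : ∀ l, l + k ≠ m → ∀ y ∈ H.deg l, P.J (y * x) = 0) : x ∈ H.deg k := by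
  have : x = H.pr k x := by
    refine P.ext_left fun l y hy => ?_
    by_cases hl : l + k = m
    · rw [← P.J_pr (y * x), pr_mul_of_le hy x (by omega), show m - l = k by omega]
    · rw [h l hl y hy, P.J_of_ne (SetLike.mul_mem_graded hy (pr_mem k x)) hl]
  rw [this]
  exact pr_mem k x

theorem mem_deg_of_right {k : ℕ} {x : H.carrier}
    (h : ∀ l, l + k ≠ m → ∀ y ∈ H.deg l, P.J (x * y) = 0) : x ∈ H.deg k := by
  have : x = H.pr k x := by
    refine P.ext_right fun l y hy => ?_
    by_cases hl : l + k = m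
    · rw [← P.J_pr (x * y), pr_mul_of_le' hy x (by omega), show m - l = k by omega]
    · rw [h l hl y hy, P.J_of_ne (SetLike.mul_mem_graded (pr_mem k x) hy) (by omega)]
  rw [this]
  exact pr_mem k x

variable [FiniteDimensional ℚ H.carrier]

/-- Every functional has the form `y ↦ J (y z)`. -/
theorem exists_left : ∃ Ψ : Module.Dual ℚ H.carrier →ₗ[ℚ] H.carrier,
    ∀ ℓ y, P.J (y * Ψ ℓ) = ℓ y := by
  let Φ : H.carrier →ₗ[ℚ] Module.Dual ℚ H.carrier :=
    ((LinearMap.mul ℚ H.carrier).compr₂ P.J).flip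
  have hΦ : Function.Injective Φ := by
    rw [injective_iff_map_eq_zero]
    exact fun x hx => P.nondeg x fun y => LinearMap.congr_fun hx y
  let e := LinearEquiv.ofInjectiveOfFinrankEq Φ hΦ (Subspace.dual_finrank_eq).symm
  refine ⟨e.symm.toLinearMap, fun ℓ y => ?_⟩
  exact LinearMap.congr_fun (e.apply_symm_apply ℓ) y

theorem exists_right : ∃ Ψ : Module.Dual ℚ H.carrier →ₗ[ℚ] H.carrier,
    ∀ ℓ y, P.J (Ψ ℓ * y) = ℓ y := by
  let Φ : H.carrier →ₗ[ℚ] Module.Dual ℚ H.carrier :=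
    (LinearMap.mul ℚ H.carrier).compr₂ P.J
  have hΦ : Function.Injective Φ := by
    rw [injective_iff_map_eq_zero]
    exact fun x hx => P.nondeg' x fun y => LinearMap.congr_fun hx y
  let e := LinearEquiv.ofInjectiveOfFinrankEq Φ hΦ (Subspace.dual_finrank_eq).symm
  refine ⟨e.symm.toLinearMap, fun ℓ y => ?_⟩
  exact LinearMap.congr_fun (e.apply_symm_apply ℓ) y

end Duality

/-- The augmentation of a connected algebra. -/
theorem IsConnected.exists_augmentation {j : ℕ} (h : H.IsConnected j) :
    ∃ ε : H.carrier →ₐ[ℚ] ℚ, (∀ {i x}, i ≠ 0 → x ∈ H.deg i → ε x = 0) ∧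
      ∀ x ∈ H.deg 0, x = ε x • 1 := by
  have hnt : Nontrivial H.carrier := h.1
  obtain ⟨ℓ, hℓ⟩ := (LinearMap.toSpanSingleton ℚ H.carrier 1).exists_leftInverse_of_injective
    (LinearMap.ker_toSpanSingleton ℚ one_ne_zero)
  have hℓ' : ∀ c : ℚ, ℓ (c • 1) = c := fun c => LinearMap.congr_fun hℓ c
  have h0 : ∀ x ∈ H.deg 0, x = ℓ x • 1 := by
    intro x hx
    rw [h.2.1, Submodule.mem_span_singleton] at hx
    obtain ⟨c, rfl⟩ := hx
    rw [hℓ']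
  have hpr1 : H.pr 0 1 = 1 := pr_of_mem (SetLike.one_mem_graded _)
  have hprm : ∀ x y, H.pr 0 (x * y) = H.pr 0 x * H.pr 0 y := fun x y =>
    map_mul (GradedRing.projZeroRingHom H.deg) x y
  refine ⟨AlgHom.ofLinearMap (ℓ ∘ₗ H.pr 0) ?_ fun x y => ?_, fun {i x} hi hx => ?_,
    fun x hx => ?_⟩
  · have := hℓ' 1
    rw [one_smul] at this
    rw [LinearMap.comp_apply, hpr1, this]
  · rw [LinearMap.comp_apply, LinearMap.comp_apply, LinearMap.comp_apply, hprm,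
      h0 _ (pr_mem 0 x), h0 _ (pr_mem 0 y), smul_mul_smul_comm, mul_one, hℓ', hℓ', hℓ']
  · change ℓ (H.pr 0 x) = 0
    rw [pr_of_mem_ne hx hi, map_zero]
  · change x = ℓ (H.pr 0 x) • 1
    rw [pr_of_mem hx]
    exact h0 x hx

/-- A connected Poincaré algebra has a fundamental element in top degree. -/
theorem Duality.exists_top (P : Duality H m) {ε : H.carrier →ₐ[ℚ] ℚ}
    (hε : ∀ {i x}, i ≠ 0 → x ∈ H.deg i → ε x = 0) (hε0 : ∀ x ∈ H.deg 0, x = ε x • 1)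
    [FiniteDimensional ℚ H.carrier] :
    ∃ ω ∈ H.deg m, P.J ω = 1 ∧ (∀ x ∈ H.deg m, x = P.J x • ω) ∧
      (∀ x, x * ω = ε x • ω) ∧ ∀ x, ω * x = ε x • ω := by
  obtain ⟨Ψ, hΨ⟩ := P.exists_left
  set ω := Ψ ε.toLinearMap with hω
  have h1 : ∀ y, P.J (y * ω) = ε y := fun y => hΨ _ y
  have hmem : ω ∈ H.deg m := P.mem_deg_of_left fun l hl y hy => by
    rw [h1]; exact hε (by omega) hy
  have hJω : P.J ω = 1 := by rw [← one_mul ω, h1, map_one]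
  refine ⟨ω, hmem, hJω, fun x hx => ?_, fun x => ?_, fun x => ?_⟩
  · refine P.ext_left fun i z hz => ?_
    rw [mul_smul_comm, map_smul, h1, smul_eq_mul]
    rcases eq_or_ne i 0 with rfl | hi
    · rw [hε0 z hz]
      simp [mul_comm]
    · rw [hε hi hz, mul_zero, P.J_of_ne (SetLike.mul_mem_graded hz hx) (by omega)]
  · refine P.ext_left fun i z hz => ?_
    rw [← mul_assoc, h1, mul_smul_comm, map_smul, h1, map_mul, smul_eq_mul, mul_comm]
  · induction x using DirectSum.Decomposition.inductionOn H.deg with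
    | zero => simp
    | @homogeneous i x =>
      rcases eq_or_ne i 0 with rfl | hi
      · conv_lhs => rw [hε0 x x.2]
        rw [mul_smul_comm, mul_one]
      · have h2 : ω * (x : H.carrier) ∈ H.deg (m + i) := SetLike.mul_mem_graded hmem x.2
        rw [P.deg_gt (m + i) (by omega), Submodule.mem_bot] at h2
        rw [h2, hε hi x.2, zero_smul]
    | add a b ha hb => rw [mul_add, map_add, ha, hb, add_smul]

end GCAlg

/-! ### Realisation of a functional on `ℬ(H)` -/

section ShiftedFinsupp

variable {V : Type u} [AddCommGroup V] [Module ℚ V] (N : ℕ)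

variable (V) in
/-- The grading of `ℕ →₀ V` that places the component with index `p` in degree `N + p`. -/
def Finsupp.shiftedDeg (k : ℕ) : Submodule ℚ (ℕ →₀ V) where
  carrier := {w | ∀ p, w p ≠ 0 → N + p = k}
  add_mem' {a b} ha hb p hp := by
    by_cases h : a p = 0
    · refine hb p fun h' => hp ?_
      rw [Finsupp.add_apply, h, h', add_zero]
    · exact ha p h
  zero_mem' p hp := absurd rfl hp
  smul_mem' c a ha p hp := ha p fun h => hp (by rw [Finsupp.smul_apply, h, smul_zero])

theorem Finsupp.single_mem_shiftedDeg {p k : ℕ} (e : V) (h : N + p = k) :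
    Finsupp.single p e ∈ Finsupp.shiftedDeg V N k := by
  classical
  intro p' hp'
  rw [Finsupp.single_apply] at hp'
  split_ifs at hp' with h'
  · rw [← h', h]
  · exact absurd rfl hp'

theorem Finsupp.eq_zero_or_single_of_mem_shiftedDeg {k : ℕ} {w : ℕ →₀ V}
    (hw : w ∈ Finsupp.shiftedDeg V N k) :
    w = 0 ∨ ∃ p e, N + p = k ∧ w = Finsupp.single p e := by
  classical
  by_cases h : N ≤ k
  · refine Or.inr ⟨k - N, w (k - N), by omega, Finsupp.ext fun p => ?_⟩
    rw [Finsupp.single_apply]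
    split_ifs with h'
    · rw [h']
    · by_contra hp
      have := hw p hp
      omega
  · refine Or.inl (Finsupp.ext fun p => ?_)
    by_contra hp
    have := hw p hp
    omega

variable (V) in
/-- The projection of `ℕ →₀ V` to its component of degree `k`. -/
noncomputable def Finsupp.shiftedProj (k : ℕ) : (ℕ →₀ V) →ₗ[ℚ] (ℕ →₀ V) :=
  if N ≤ k then Finsupp.lsingle (k - N) ∘ₗ Finsupp.lapply (k - N) else 0

theorem Finsupp.shiftedProj_single (k p : ℕ) (e : V) :
    Finsupp.shiftedProj V N k (Finsupp.single p e) =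
      if N + p = k then Finsupp.single p e else 0 := by
  classical
  unfold Finsupp.shiftedProj
  split_ifs with h h' h'
  · obtain rfl : p = k - N := by omega
    simp
  · simp only [LinearMap.comp_apply, Finsupp.lapply_apply, Finsupp.lsingle_apply]
    rw [Finsupp.single_eq_of_ne (by omega), Finsupp.single_zero]
  · omega
  · rfl

variable (V) in
/-- The sign involution of `ℕ →₀ V`. -/
noncomputable def Finsupp.shiftedSgn : (ℕ →₀ V) →ₗ[ℚ] (ℕ →₀ V) :=
  Finsupp.lsum ℚ fun p => (-1 : ℚ) ^ (N + p) • Finsupp.lsingle p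

theorem Finsupp.shiftedSgn_of_mem {k : ℕ} {w : ℕ →₀ V} (hw : w ∈ Finsupp.shiftedDeg V N k) :
    Finsupp.shiftedSgn V N w = (-1 : ℚ) ^ k • w := by
  rcases Finsupp.eq_zero_or_single_of_mem_shiftedDeg N hw with rfl | ⟨p, e, rfl, rfl⟩
  · rw [map_zero, smul_zero]
  · unfold Finsupp.shiftedSgn
    simp

theorem Finsupp.iSup_shiftedDeg : ⨆ i, Finsupp.shiftedDeg V N i = ⊤ := by
  rw [eq_top_iff]
  intro w _
  induction w using Finsupp.induction_linear with
  | zero => exact zero_mem _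
  | add a b ha hb => exact add_mem (ha trivial) (hb trivial)
  | single p e =>
    exact Submodule.mem_iSup_of_mem (N + p) (Finsupp.single_mem_shiftedDeg N e rfl)

/-- A bilinear form on `V` induces a graded symmetric form of degree `M` on `ℕ →₀ V`. -/
theorem exists_shifted_form (M : ℕ) (β : V →ₗ[ℚ] V →ₗ[ℚ] ℚ) :
    ∃ θ : (ℕ →₀ V) →ₗ[ℚ] (ℕ →₀ V) →ₗ[ℚ] ℚ, ∀ p q e e',
      θ (Finsupp.single p e) (Finsupp.single q e') = if N + p + (N + q) = M then
        (1 / 2 : ℚ) * (β e e' + (-1 : ℚ) ^ ((N + p) * (N + q)) * β e' e) else 0 := by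
  let b (p q : ℕ) : V →ₗ[ℚ] V →ₗ[ℚ] ℚ := if N + p + (N + q) = M then
    (1 / 2 : ℚ) • (β + (-1 : ℚ) ^ ((N + p) * (N + q)) • β.flip) else 0
  refine ⟨Finsupp.lsum ℚ fun p => (Finsupp.lsum ℚ fun q => (b p q).flip).flip,
    fun p q e e' => ?_⟩
  rw [Finsupp.lsum_single, LinearMap.flip_apply, Finsupp.lsum_single, LinearMap.flip_apply]
  change (if N + p + (N + q) = M then
    (1 / 2 : ℚ) • (β + (-1 : ℚ) ^ ((N + p) * (N + q)) • β.flip) else 0 : V →ₗ[ℚ] V →ₗ[ℚ] ℚ) e e' = _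
  split_ifs
  · simp [mul_add]
  · rfl

end ShiftedFinsupp

namespace GCAlg

variable {H : GCAlg.{u}}

/-- The projection of `𝒢²H` to `E` along the products with the unit. -/
theorem exists_retraction_E (H : GCAlg.{u}) : ∃ R : G2 H.deg →ₗ[ℚ] H.E,
    (∀ e : H.E, R e = e) ∧ (∀ x, R (G2.mk H.deg 1 x) = 0) ∧ ∀ x, R (G2.mk H.deg x 1) = 0 := by
  let L : G2 H.deg →ₗ[ℚ] G2 H.deg := LinearMap.id - G2.mk H.deg 1 ∘ₗ H.cup
  have hL : ∀ t, L t = t - G2.mk H.deg 1 (H.cup t) := fun t => rfl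
  have h1 : ∀ x y, H.cup (G2.mk H.deg x y) = x * y := fun x y => rfl
  have hcup : ∀ t, L t ∈ H.E := fun t => by
    change H.cup (L t) = 0
    rw [hL, map_sub, h1, one_mul, sub_self]
  have h1x : ∀ x, L.codRestrict H.E hcup (G2.mk H.deg 1 x) = 0 := fun x => Subtype.ext (by
    rw [LinearMap.codRestrict_apply, hL, h1, one_mul, sub_self]; rfl)
  refine ⟨L.codRestrict H.E hcup, fun e => Subtype.ext ?_, h1x, fun x => ?_⟩
  · have he : H.cup (e : G2 H.deg) = 0 := e.2
    rw [LinearMap.codRestrict_apply, hL, he, map_zero, sub_zero]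
  · induction x using DirectSum.Decomposition.inductionOn H.deg with
    | zero => rw [map_zero, LinearMap.zero_apply, map_zero]
    | @homogeneous i x =>
      rw [G2.mk_comm H.deg x.2 (SetLike.one_mem_graded H.deg), map_smul, h1x, smul_zero]
    | add a b ha hb => rw [map_add, LinearMap.add_apply, map_add, ha, hb, add_zero]

/-- In an `(n-1)`-connected algebra, elements of degree `< 2n` behave like derivations under the
augmentation: there are no non-trivial products. -/
theorem IsConnected.pr_mul {n : ℕ} (hn : 1 ≤ n) (hH : H.IsConnected (n - 1))
    {ε : H.carrier →ₐ[ℚ] ℚ} (hε : ∀ {i x}, i ≠ 0 → x ∈ H.deg i → ε x = 0)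
    (hε0 : ∀ x ∈ H.deg 0, x = ε x • 1) {k : ℕ} (hk : n ≤ k) (hk' : k < 2 * n) (x y : H.carrier) :
    H.pr k (x * y) = ε x • H.pr k y + ε y • H.pr k x := by
  have hone : H.pr k 1 = 0 := pr_of_mem_ne (SetLike.one_mem_graded H.deg) (by omega)
  induction x using DirectSum.Decomposition.inductionOn H.deg with
  | zero => simp
  | add a b ha hb => simp only [add_mul, map_add, ha, hb]; module
  | @homogeneous i x =>
    rcases eq_or_ne i 0 with rfl | hi
    · rw [hε0 x x.2]
      simp [hone]
    induction y using DirectSum.Decomposition.inductionOn H.deg with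
    | zero => simp
    | add a b ha hb => simp only [mul_add, map_add, ha, hb]; module
    | @homogeneous j y =>
      rcases eq_or_ne j 0 with rfl | hj
      · rw [hε0 y y.2]
        simp [hone]
      rw [hε hi x.2, hε hj y.2, zero_smul, zero_smul, add_zero]
      rcases Nat.lt_or_ge i n with hin | hin
      · have this : (x : H.carrier) ∈ H.deg i := x.2
        have h0 : (x : H.carrier) = 0 := by
          have h1 := hH.2.2 i (by omega) (by omega)
          exact (Submodule.mem_bot ℚ).1 (h1.le this)
        rw [h0, zero_mul, map_zero]
      rcases Nat.lt_or_ge j n with hjn | hjn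
      · have this : (y : H.carrier) ∈ H.deg j := y.2
        have h0 : (y : H.carrier) = 0 := by
          have h1 := hH.2.2 j (by omega) (by omega)
          exact (Submodule.mem_bot ℚ).1 (h1.le this)
        rw [h0, mul_zero, map_zero]
      exact pr_of_mem_ne (SetLike.mul_mem_graded x.2 y.2) (by omega)

/-- The deviation map of the extension: `s x y` is the class of `x y` in `E`, for `x` and `y` of
degrees between `n` and `2n - 1`. -/
theorem exists_deviation {n : ℕ} (hn : 1 ≤ n) (hH : H.IsConnected (n - 1))
    {ε : H.carrier →ₐ[ℚ] ℚ} (hε : ∀ {i x}, i ≠ 0 → x ∈ H.deg i → ε x = 0)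
    (hε0 : ∀ x ∈ H.deg 0, x = ε x • 1) :
    ∃ s : H.carrier →ₗ[ℚ] H.carrier →ₗ[ℚ] (ℕ →₀ H.E),
      (∀ {i j x y}, x ∈ H.deg i → y ∈ H.deg j →
        s x y ∈ Finsupp.shiftedDeg H.E (2 * n) (i + j)) ∧
      (∀ {i j x y}, x ∈ H.deg i → y ∈ H.deg j → s x y = (-1 : ℚ) ^ (i * j) • s y x) ∧
      (∀ x, (∀ i, n ≤ i → i < 2 * n → H.pr i x = 0) → ∀ y, s x y = 0 ∧ s y x = 0) ∧
      (∀ x y z, s (x * y) z = ε x • s y z + ε y • s x z) ∧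
      (∀ x y z, s x (y * z) = ε y • s x z + ε z • s x y) ∧
      (∀ p, p < 2 * n → ∀ e ∈ H.eDeg p, e = 0) ∧
      ∀ hs, ∀ p, p < 3 * n → ∀ e ∈ H.eDeg p,
        G2.lift H.deg s hs (e : G2 H.deg) = Finsupp.single (p - 2 * n) e := by
  classical
  obtain ⟨R, hRE, hR1, hR1'⟩ := exists_retraction_E H
  let c (i j : ℕ) : H.carrier →ₗ[ℚ] H.carrier →ₗ[ℚ] (ℕ →₀ H.E) :=
    (G2.mk H.deg).compr₂ (Finsupp.lsingle (i + j - 2 * n) ∘ₗ R)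
  let s : H.carrier →ₗ[ℚ] H.carrier →ₗ[ℚ] (ℕ →₀ H.E) := ∑ i ∈ Finset.Ico n (2 * n),
    ∑ j ∈ Finset.Ico n (2 * n), (c i j).compl₁₂ (H.pr i) (H.pr j)
  have hs : ∀ x y, s x y = ∑ i ∈ Finset.Ico n (2 * n), ∑ j ∈ Finset.Ico n (2 * n),
      c i j (H.pr i x) (H.pr j y) := fun x y => by
    simp only [s, LinearMap.sum_apply, LinearMap.compl₁₂_apply]
  have hK : ∀ x, (∀ i, n ≤ i → i < 2 * n → H.pr i x = 0) → ∀ y, s x y = 0 ∧ s y x = 0 := by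
    refine fun x hx y => ⟨?_, ?_⟩ <;>
    · rw [hs]
      refine Finset.sum_eq_zero fun i hi => Finset.sum_eq_zero fun j hj => ?_
      rw [Finset.mem_Ico] at hi hj
      first
      | rw [hx i hi.1 hi.2, map_zero, LinearMap.zero_apply]
      | rw [hx j hj.1 hj.2, map_zero]
  have hout : ∀ {i x}, x ∈ H.deg i → ¬ (n ≤ i ∧ i < 2 * n) →
      ∀ k, n ≤ k → k < 2 * n → H.pr k x = 0 := fun {i x} hx hi k hk hk' =>
    pr_of_mem_ne hx fun h => hi (h ▸ ⟨hk, hk'⟩)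
  have hin : ∀ {i j x y}, x ∈ H.deg i → y ∈ H.deg j → (n ≤ i ∧ i < 2 * n) →
      (n ≤ j ∧ j < 2 * n) → s x y = Finsupp.single (i + j - 2 * n) (R (G2.mk H.deg x y)) := by
    intro i j x y hx hy hi hj
    rw [hs, Finset.sum_eq_single_of_mem i (Finset.mem_Ico.2 hi),
      Finset.sum_eq_single_of_mem j (Finset.mem_Ico.2 hj), pr_of_mem hx, pr_of_mem hy]
    · rfl
    · intro k _ hk
      rw [pr_of_mem_ne hy hk.symm, map_zero]
    · intro k _ hk
      refine Finset.sum_eq_zero fun l _ => ?_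
      rw [pr_of_mem_ne hx hk.symm, map_zero, LinearMap.zero_apply]
  have hlow : ∀ p, p < 3 * n → ∀ hs', ∀ t ∈ G2.deg H.deg p,
      G2.lift H.deg s hs' t = Finsupp.single (p - 2 * n) (R t) ∧ (p < 2 * n → R t = 0) := by
    intro p hp hs' t ht
    induction ht using Submodule.span_induction with
    | zero => simp
    | add a b _ _ ha hb =>
      refine ⟨?_, fun h => ?_⟩
      · rw [map_add, ha.1, hb.1, map_add, Finsupp.single_add]
      · rw [map_add, ha.2 h, hb.2 h, add_zero]
    | smul r a _ ha =>
      refine ⟨?_, fun h => ?_⟩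
      · rw [map_smul, ha.1, map_smul, Finsupp.smul_single]
      · rw [map_smul, ha.2 h, smul_zero]
    | mem t ht =>
      obtain ⟨i, j, rfl, x, hx, y, hy, rfl⟩ := ht
      rw [G2.lift_mk]
      rcases Nat.eq_zero_or_pos i with rfl | hi
      · have h1 : R (G2.mk H.deg x y) = 0 := by
          rw [hε0 x hx, map_smul, LinearMap.smul_apply, map_smul, hR1, smul_zero]
        rw [h1, Finsupp.single_zero]
        exact ⟨(hK x (hout hx (by omega)) y).1, fun _ => rfl⟩
      rcases Nat.eq_zero_or_pos j with rfl | hj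
      · have h1 : R (G2.mk H.deg x y) = 0 := by
          rw [hε0 y hy, map_smul, map_smul, hR1', smul_zero]
        rw [h1, Finsupp.single_zero]
        exact ⟨(hK y (hout hy (by omega)) x).2, fun _ => rfl⟩
      rcases Nat.lt_or_ge i n with hin' | hin'
      · rw [hH.2.2 i hi (by omega), Submodule.mem_bot] at hx
        simp [hx]
      rcases Nat.lt_or_ge j n with hjn | hjn
      · rw [hH.2.2 j hj (by omega), Submodule.mem_bot] at hy
        simp [hy]
      exact ⟨hin hx hy (by omega) (by omega), fun h => by omega⟩
  have hsc : ∀ {i j x y}, x ∈ H.deg i → y ∈ H.deg j → s x y = (-1 : ℚ) ^ (i * j) • s y x := by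
    intro i j x y hx hy
    by_cases hi : n ≤ i ∧ i < 2 * n
    · by_cases hj : n ≤ j ∧ j < 2 * n
      · rw [hin hx hy hi hj, hin hy hx hj hi, G2.mk_comm H.deg hx hy, map_smul,
          Finsupp.smul_single, add_comm i j]
      · rw [(hK y (hout hy hj) x).1, (hK y (hout hy hj) x).2, smul_zero]
    · rw [(hK x (hout hx hi) y).1, (hK x (hout hx hi) y).2, smul_zero]
  refine ⟨s, ?_, hsc, hK, ?_, ?_, ?_, ?_⟩
  · intro i j x y hx hy
    by_cases hi : n ≤ i ∧ i < 2 * n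
    · by_cases hj : n ≤ j ∧ j < 2 * n
      · rw [hin hx hy hi hj]
        exact Finsupp.single_mem_shiftedDeg _ _ (by omega)
      · rw [(hK y (hout hy hj) x).2]; exact zero_mem _
    · rw [(hK x (hout hx hi) y).1]; exact zero_mem _
  · intro x y z
    rw [hs, hs, hs, Finset.smul_sum, Finset.smul_sum, ← Finset.sum_add_distrib]
    refine Finset.sum_congr rfl fun i hi => ?_
    rw [Finset.smul_sum, Finset.smul_sum, ← Finset.sum_add_distrib]
    rw [Finset.mem_Ico] at hi
    refine Finset.sum_congr rfl fun j _ => ?_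
    rw [hH.pr_mul hn hε hε0 hi.1 hi.2, map_add, map_smul, map_smul, LinearMap.add_apply,
      LinearMap.smul_apply, LinearMap.smul_apply]
  · intro x y z
    rw [hs, hs, hs, Finset.smul_sum, Finset.smul_sum, ← Finset.sum_add_distrib]
    refine Finset.sum_congr rfl fun i _ => ?_
    rw [Finset.smul_sum, Finset.smul_sum, ← Finset.sum_add_distrib]
    refine Finset.sum_congr rfl fun j hj => ?_
    rw [Finset.mem_Ico] at hj
    rw [hH.pr_mul hn hε hε0 hj.1 hj.2, map_add, map_smul, map_smul]
  · intro p hp e he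
    rw [← hRE e]
    exact (hlow p (by omega) (fun _ _ _ hx _ hy => hsc hx hy) e he).2 hp
  · intro hs' p hp e he
    rw [(hlow p hp hs' e he).1, hRE]

end GCAlg

namespace GCAlg

variable {H : GCAlg.{u}}

namespace Duality

variable {m : ℕ} (P : Duality H m) {W : Type u} [AddCommGroup W] [Module ℚ W]
  {wdeg : ℕ → Submodule ℚ W} {ε : H.carrier →ₐ[ℚ] ℚ} {ω : H.carrier}
  {s : H.carrier →ₗ[ℚ] H.carrier →ₗ[ℚ] W} {θ : W →ₗ[ℚ] W →ₗ[ℚ] ℚ} {σ : W →ₗ[ℚ] W}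
  {h : H.carrier →ₗ[ℚ] W →ₗ[ℚ] H.carrier} {hr : W →ₗ[ℚ] H.carrier →ₗ[ℚ] H.carrier}

variable (s θ σ) in
/-- The actions of `W` on `H` that are dual to `s` with respect to `θ`. -/
theorem exists_dual_actions [FiniteDimensional ℚ H.carrier] :
    ∃ (h : H.carrier →ₗ[ℚ] W →ₗ[ℚ] H.carrier) (hr : W →ₗ[ℚ] H.carrier →ₗ[ℚ] H.carrier),
      (∀ y x g, P.J (y * h x g) = θ (σ (s y x)) g) ∧ ∀ g x y, P.J (hr g x * y) = θ g (s x y) := by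
  obtain ⟨Ψ, hΨ⟩ := P.exists_left
  obtain ⟨Ψ', hΨ'⟩ := P.exists_right
  refine ⟨LinearMap.mk₂ ℚ (fun x g => Ψ ((θ ∘ₗ σ ∘ₗ s.flip x).flip g))
    (fun x x' g => by rw [← map_add]; congr 1; ext y; simp)
    (fun c x g => by rw [← map_smul]; congr 1; ext y; simp)
    (fun x g g' => by rw [← map_add]; congr 1; ext y; simp)
    (fun c x g => by rw [← map_smul]; congr 1; ext y; simp),
    LinearMap.mk₂ ℚ (fun g x => Ψ' (θ g ∘ₗ s x))
    (fun g g' x => by rw [← map_add]; congr 1; ext y; simp)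
    (fun c g x => by rw [← map_smul]; congr 1; ext y; simp)
    (fun g x x' => by rw [← map_add]; congr 1; ext y; simp)
    (fun c g x => by rw [← map_smul]; congr 1; ext y; simp),
    fun y x g => hΨ _ y, fun g x y => hΨ' _ y⟩

theorem left_action_mem (hh : ∀ y x g, P.J (y * h x g) = θ (σ (s y x)) g)
    (σ_of_mem : ∀ {i w}, w ∈ wdeg i → σ w = (-1 : ℚ) ^ i • w)
    (s_mem : ∀ {i j x y}, x ∈ H.deg i → y ∈ H.deg j → s x y ∈ wdeg (i + j))
    (θ_of_mem : ∀ {p q w w'}, w ∈ wdeg p → w' ∈ wdeg q → p + q ≠ m + 1 → θ w w' = 0)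
    {i j x g} (hx : x ∈ H.deg i) (hg : g ∈ wdeg (j + 1)) : h x g ∈ H.deg (i + j) := by
  refine P.mem_deg_of_left fun l hl y hy => ?_
  rw [hh, σ_of_mem (s_mem hy hx), map_smul, LinearMap.smul_apply,
    θ_of_mem (s_mem hy hx) hg (by omega), smul_zero]

theorem right_action_mem (hhr : ∀ g x y, P.J (hr g x * y) = θ g (s x y))
    (s_mem : ∀ {i j x y}, x ∈ H.deg i → y ∈ H.deg j → s x y ∈ wdeg (i + j))
    (θ_of_mem : ∀ {p q w w'}, w ∈ wdeg p → w' ∈ wdeg q → p + q ≠ m + 1 → θ w w' = 0)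
    {i j x g} (hx : x ∈ H.deg i) (hg : g ∈ wdeg (j + 1)) : hr g x ∈ H.deg (i + j) := by
  refine P.mem_deg_of_right fun l hl y hy => ?_
  rw [hhr, θ_of_mem hg (s_mem hx hy) (by omega)]

theorem left_action_comm (hh : ∀ y x g, P.J (y * h x g) = θ (σ (s y x)) g)
    (hhr : ∀ g x y, P.J (hr g x * y) = θ g (s x y))
    (σ_of_mem : ∀ {i w}, w ∈ wdeg i → σ w = (-1 : ℚ) ^ i • w)
    (s_mem : ∀ {i j x y}, x ∈ H.deg i → y ∈ H.deg j → s x y ∈ wdeg (i + j))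
    (s_comm : ∀ {i j x y}, x ∈ H.deg i → y ∈ H.deg j → s x y = (-1 : ℚ) ^ (i * j) • s y x)
    (θ_of_mem : ∀ {p q w w'}, w ∈ wdeg p → w' ∈ wdeg q → p + q ≠ m + 1 → θ w w' = 0)
    (θ_comm : ∀ {p q w w'}, w ∈ wdeg p → w' ∈ wdeg q → θ w w' = (-1 : ℚ) ^ (p * q) * θ w' w)
    {i j x g} (hx : x ∈ H.deg i) (hg : g ∈ wdeg (j + 1)) :
    h x g = (-1 : ℚ) ^ (i * j) • hr g x := by
  refine P.ext_left fun l z hz => ?_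
  rw [hh, mul_smul_comm, map_smul, P.J_comm hz (P.right_action_mem hhr s_mem θ_of_mem hx hg), hhr,
    σ_of_mem (s_mem hz hx), θ_comm hg (s_mem hx hz), s_comm hx hz, map_smul, map_smul,
    LinearMap.smul_apply, LinearMap.smul_apply]
  simp only [smul_eq_mul, ← mul_assoc, ← pow_add]
  congr 1
  rw [show i * j + (l * (i + j) + ((j + 1) * (i + l) + i * l)) =
    2 * (i * j + l * i + l * j) + (l + i) by ring, pow_add _ (2 * _), pow_mul]
  simp

theorem left_action_mul (hh : ∀ y x g, P.J (y * h x g) = θ (σ (s y x)) g)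
    (s_mul_right : ∀ x y z, s x (y * z) = ε y • s x z + ε z • s x y) (x y : H.carrier) (g : W) :
    h (x * y) g = ε x • h y g + ε y • h x g :=
  P.ext_left fun l z hz => by
    rw [hh, s_mul_right, mul_add, mul_smul_comm, mul_smul_comm]
    simp only [map_add, map_smul, LinearMap.add_apply, LinearMap.smul_apply, hh]

theorem right_action_mul (hhr : ∀ g x y, P.J (hr g x * y) = θ g (s x y))
    (s_mul_left : ∀ x y z, s (x * y) z = ε x • s y z + ε y • s x z) (x y : H.carrier) (g : W) :
    hr g (x * y) = ε x • hr g y + ε y • hr g x :=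
  P.ext_right fun l z hz => by
    rw [hhr, s_mul_left, add_mul, smul_mul_assoc, smul_mul_assoc]
    simp only [map_add, map_smul, hhr]

theorem mul_left_action (hh : ∀ y x g, P.J (y * h x g) = θ (σ (s y x)) g)
    (s_mul_left : ∀ x y z, s (x * y) z = ε x • s y z + ε y • s x z)
    (hJω : P.J ω = 1) (hmulω : ∀ x, x * ω = ε x • ω) (x y : H.carrier) (g : W) :
    x * h y g = ε x • h y g + θ (σ (s x y)) g • ω :=
  P.ext_left fun l z hz => by
    rw [← mul_assoc, hh, s_mul_left, mul_add, mul_smul_comm, mul_smul_comm, hmulω]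
    simp only [map_add, map_smul, LinearMap.add_apply, LinearMap.smul_apply, hh, hJω, smul_eq_mul]
    ring

theorem right_action_mul_right (hhr : ∀ g x y, P.J (hr g x * y) = θ g (s x y))
    (s_mul_right : ∀ x y z, s x (y * z) = ε y • s x z + ε z • s x y)
    (hJω : P.J ω = 1) (hωmul : ∀ x, ω * x = ε x • ω) (g : W) (x y : H.carrier) :
    hr g x * y = ε y • hr g x + θ g (s x y) • ω :=
  P.ext_right fun l z hz => by
    rw [mul_assoc, hhr, s_mul_right, add_mul, smul_mul_assoc, smul_mul_assoc, hωmul]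
    simp only [map_add, map_smul, hhr, hJω, smul_eq_mul]
    ring

end Duality

/-- The compatibility of the two actions needed for associativity follows from the other
relations by graded commutativity. -/
theorem left_action_mul_right {W : Type u} [AddCommGroup W] [Module ℚ W]
    {wdeg : ℕ → Submodule ℚ W} {ε : H.carrier →ₐ[ℚ] ℚ} {ω : H.carrier}
    {s : H.carrier →ₗ[ℚ] H.carrier →ₗ[ℚ] W} {θ : W →ₗ[ℚ] W →ₗ[ℚ] ℚ} {σ : W →ₗ[ℚ] W}
    {h : H.carrier →ₗ[ℚ] W →ₗ[ℚ] H.carrier} {hr : W →ₗ[ℚ] H.carrier →ₗ[ℚ] H.carrier}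
    (iSup_wdeg : ⨆ i, wdeg i = ⊤) (wdeg_zero : wdeg 0 = ⊥)
    (σ_of_mem : ∀ {i w}, w ∈ wdeg i → σ w = (-1 : ℚ) ^ i • w)
    (s_mem : ∀ {i j x y}, x ∈ H.deg i → y ∈ H.deg j → s x y ∈ wdeg (i + j))
    (θ_comm : ∀ {p q w w'}, w ∈ wdeg p → w' ∈ wdeg q → θ w w' = (-1 : ℚ) ^ (p * q) * θ w' w)
    (h_comm : ∀ {i j x g}, x ∈ H.deg i → g ∈ wdeg (j + 1) → h x g = (-1 : ℚ) ^ (i * j) • hr g x)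
    (mul_h : ∀ x y g, x * h y g = ε x • h y g + θ (σ (s x y)) g • ω)
    (hr_mul_right : ∀ g x y, hr g x * y = ε y • hr g x + θ g (s x y) • ω)
    (x : H.carrier) (g : W) (y : H.carrier) :
    h x g * y = x * hr g y + ε y • h x g - ε x • hr g y := by
  have hg : g ∈ ⨆ i, wdeg i := by rw [iSup_wdeg]; trivial
  induction hg using Submodule.iSup_induction' with
  | zero => simp
  | add g g' _ _ ha hb =>
    simp only [map_add, LinearMap.add_apply, add_mul, mul_add, ha, hb, smul_add]; abel
  | mem k g hg =>
  rcases k with _ | j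
  · rw [wdeg_zero, Submodule.mem_bot] at hg
    simp [hg]
  induction x using DirectSum.Decomposition.inductionOn H.deg with
  | zero => simp
  | add a b ha hb => simp only [map_add, LinearMap.add_apply, add_mul, ha, hb]; module
  | @homogeneous i x =>
  induction y using DirectSum.Decomposition.inductionOn H.deg with
  | zero => simp
  | add a b ha hb => simp only [map_add, mul_add, ha, hb]; module
  | @homogeneous l y =>
    have e1 := h_comm x.2 hg
    have e2 := h_comm y.2 hg
    have e3 : hr g y = (-1 : ℚ) ^ (l * j) • h y g := by
      rw [e2, smul_smul, ← mul_pow]; simp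
    have e4 : θ (σ (s x y)) g = (-1 : ℚ) ^ (i * j + l * j) * θ g (s x y) := by
      rw [σ_of_mem (s_mem x.2 y.2), map_smul, LinearMap.smul_apply, smul_eq_mul,
        θ_comm (s_mem x.2 y.2) hg, ← mul_assoc, ← pow_add]
      congr 1
      rw [show i + l + (i + l) * (j + 1) = 2 * (i + l) + (i * j + l * j) by ring,
        pow_add _ (2 * _), pow_mul]
      simp
    have e5 : (x : H.carrier) * hr g y =
        (-1 : ℚ) ^ (l * j) • (ε x • h y g + θ (σ (s x y)) g • ω) := by
      rw [e3, mul_smul_comm, mul_h]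
    rw [e5, e4, e3, e1, smul_mul_assoc, hr_mul_right, pow_add]
    rcases neg_one_pow_eq_or ℚ (i * j) with h1 | h1 <;>
    rcases neg_one_pow_eq_or ℚ (l * j) with h2 | h2 <;> rw [h1, h2] <;> module

set_option maxHeartbeats 1000000 in
/-- Every functional on `ℬ^{m+1}(H)` is realised by an extension of `H`: take `W` to be a copy of
`E`, `s x y` the class of `x y` in `E`, `θ` the form on `E` given by an extension of the functional
to `𝒢²E`, and the actions `h` and `hr` dual to `s`. -/
theorem exists_bmExt {n m : ℕ} (hn : 2 ≤ n) (hm : m ≤ 5 * n - 2) (hH : H.IsConnected (n - 1))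
    (hP : H.IsPoincare m) (F : H.bDeg (m + 1) →ₗ[ℚ] H.deg m) :
    ∃ X : BMExt H m, ∀ t : H.bDeg (m + 1), X.θG2 (t : G2 H.eDeg) • X.ω = (F t : H.carrier) := by
  classical
  have hfin : FiniteDimensional ℚ H.carrier := hP.1
  obtain ⟨P⟩ := hP.nonempty_duality
  obtain ⟨ε, hε, hε0⟩ := hH.exists_augmentation
  obtain ⟨ω, hω, hJω, htop, hmulω, hωmul⟩ := P.exists_top hε hε0
  obtain ⟨s, s_mem, s_comm, s_K, s_mul_left, s_mul_right, hE0, hsE⟩ :=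
    exists_deviation (by omega) hH hε hε0
  obtain ⟨F', hF'⟩ := ((H.deg m).subtype ∘ₗ F).exists_extend
  let β : H.E →ₗ[ℚ] H.E →ₗ[ℚ] ℚ := (G2.mk H.eDeg).compr₂ (P.J ∘ₗ F')
  obtain ⟨θ, hθ⟩ := exists_shifted_form (2 * n) (m + 1) β
  let W := ℕ →₀ H.E
  let wdeg := Finsupp.shiftedDeg H.E (2 * n)
  let σ := Finsupp.shiftedSgn H.E (2 * n)
  have σ_of_mem : ∀ {i w}, w ∈ wdeg i → σ w = (-1 : ℚ) ^ i • w := fun hw =>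
    Finsupp.shiftedSgn_of_mem _ hw
  have hcases : ∀ {k w}, w ∈ wdeg k → w = 0 ∨ ∃ p e, 2 * n + p = k ∧ w = Finsupp.single p e :=
    fun hw => Finsupp.eq_zero_or_single_of_mem_shiftedDeg _ hw
  have θ_of_mem : ∀ {p q w w'}, w ∈ wdeg p → w' ∈ wdeg q → p + q ≠ m + 1 → θ w w' = 0 := by
    intro p q w w' hw hw' hpq
    rcases hcases hw with rfl | ⟨p, e, rfl, rfl⟩
    · simp
    rcases hcases hw' with rfl | ⟨q, e', rfl, rfl⟩
    · simp
    rw [hθ, if_neg hpq]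
  have θ_comm : ∀ {p q w w'}, w ∈ wdeg p → w' ∈ wdeg q →
      θ w w' = (-1 : ℚ) ^ (p * q) * θ w' w := by
    intro p q w w' hw hw'
    rcases hcases hw with rfl | ⟨p, e, rfl, rfl⟩
    · simp
    rcases hcases hw' with rfl | ⟨q, e', rfl, rfl⟩
    · simp
    rw [hθ, hθ, add_comm (2 * n + q), mul_comm (2 * n + q)]
    split_ifs
    · rcases neg_one_pow_eq_or ℚ ((2 * n + p) * (2 * n + q)) with h | h <;> rw [h] <;> ring
    · rw [mul_zero]
  obtain ⟨h, hr, hh, hhr⟩ := P.exists_dual_actions s θ σ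
  have h_mem : ∀ {i j x g}, x ∈ H.deg i → g ∈ wdeg (j + 1) → h x g ∈ H.deg (i + j) :=
    P.left_action_mem hh σ_of_mem s_mem θ_of_mem
  have h_comm : ∀ {i j x g}, x ∈ H.deg i → g ∈ wdeg (j + 1) →
      h x g = (-1 : ℚ) ^ (i * j) • hr g x :=
    P.left_action_comm hh hhr σ_of_mem s_mem s_comm θ_of_mem θ_comm
  have mul_h := P.mul_left_action hh s_mul_left hJω hmulω
  have hr_mul_right := P.right_action_mul_right hhr s_mul_right hJω hωmul
  have iSup_wdeg : ⨆ i, wdeg i = ⊤ := Finsupp.iSup_shiftedDeg _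
  have wdeg_zero : wdeg 0 = ⊥ := by
    rw [eq_bot_iff]
    intro w hw
    rcases hcases hw with rfl | ⟨p, e, hp, -⟩
    · exact zero_mem _
    · omega
  -- the elements without components of degree less than `2n`
  let K : Submodule ℚ H.carrier :=
    LinearMap.ker ε.toLinearMap ⊓ ⨅ i ∈ Set.Ico n (2 * n), LinearMap.ker (H.pr i)
  have hKmem : ∀ {x}, x ∈ K ↔ ε x = 0 ∧ ∀ i, n ≤ i → i < 2 * n → H.pr i x = 0 := by
    intro x
    simp only [K, Submodule.mem_inf, Submodule.mem_iInf, LinearMap.mem_ker, Set.mem_Ico, and_imp,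
      AlgHom.toLinearMap_apply]
  have hKdeg : ∀ {k x}, 2 * n ≤ k → x ∈ H.deg k → x ∈ K := fun {k x} hk hx =>
    hKmem.2 ⟨hε (by omega) hx, fun i _ hi => pr_of_mem_ne hx (by omega)⟩
  have h_mem_K : ∀ x g, h x g ∈ K := by
    intro x g
    have hg : g ∈ ⨆ i, wdeg i := by rw [iSup_wdeg]; trivial
    induction hg using Submodule.iSup_induction' with
    | zero => rw [map_zero]; exact zero_mem _
    | add g g' _ _ ha hb => rw [map_add]; exact add_mem ha hb
    | mem k g hg =>
    induction x using DirectSum.Decomposition.inductionOn H.deg with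
    | zero => rw [map_zero]; exact zero_mem _
    | add a b ha hb => rw [map_add]; exact add_mem ha hb
    | @homogeneous i x =>
      rcases hcases hg with rfl | ⟨p, e, rfl, rfl⟩
      · rw [map_zero]; exact zero_mem _
      by_cases hi : n ≤ i ∧ i < 2 * n
      · exact hKdeg (k := i + (2 * n + p - 1)) (by omega)
          (h_mem x.2 (by rwa [show 2 * n + p - 1 + 1 = 2 * n + p by omega]))
      · have h0 : ∀ y, s y x = 0 := fun y =>
          (s_K x (fun k hk hk' => pr_of_mem_ne x.2 fun h => hi (h ▸ ⟨hk, hk'⟩)) y).2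
        have h1 : h x (Finsupp.single p e) = 0 := P.ext_left fun l z hz => by
          rw [hh, h0]; simp
        rw [h1]; exact zero_mem _
  have hr_mem_K : ∀ g x, hr g x ∈ K := by
    intro g x
    have hg : g ∈ ⨆ i, wdeg i := by rw [iSup_wdeg]; trivial
    induction hg using Submodule.iSup_induction' with
    | zero => rw [map_zero]; exact zero_mem _
    | add g g' _ _ ha hb => rw [map_add]; exact add_mem ha hb
    | mem k g hg =>
    induction x using DirectSum.Decomposition.inductionOn H.deg with
    | zero => rw [map_zero]; exact zero_mem _
    | add a b ha hb => rw [map_add]; exact add_mem ha hb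
    | @homogeneous i x =>
      rcases k with _ | j
      · rw [wdeg_zero, Submodule.mem_bot] at hg
        rw [hg, map_zero]; exact zero_mem _
      have h1 : hr g x = (-1 : ℚ) ^ (i * j) • h x g := by
        rw [h_comm x.2 hg, smul_smul, ← mul_pow]; simp
      rw [h1]
      exact Submodule.smul_mem _ _ (h_mem_K _ _)
  have θ_smul_mem_K : ∀ g w, θ g w • ω ∈ K := by
    intro g w
    by_cases hmn : 2 * n ≤ m
    · exact Submodule.smul_mem _ _ (hKdeg hmn hω)
    · have h0 : θ = 0 := by
        ext p e q e'
        change θ (Finsupp.single p e) (Finsupp.single q e') = 0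
        rw [hθ, if_neg (by omega)]
      rw [h0, LinearMap.zero_apply, LinearMap.zero_apply, zero_smul]
      exact zero_mem _
  let X : BMExt H m :=
    { W := W
      wdeg := wdeg
      wpr := Finsupp.shiftedProj H.E (2 * n)
      wpr_of_mem := fun i x hx => by
        rcases hcases hx with rfl | ⟨p, e, hp, rfl⟩
        · exact map_zero _
        · rw [Finsupp.shiftedProj_single, if_pos hp]
      wpr_of_mem_ne := fun i j hij x hx => by
        rcases hcases hx with rfl | ⟨p, e, hp, rfl⟩
        · exact map_zero _
        · rw [Finsupp.shiftedProj_single, if_neg (by omega)]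
      iSup_wdeg := iSup_wdeg
      wdeg_zero := wdeg_zero
      σ := σ
      σ_of_mem := σ_of_mem
      ε := ε
      ε_of_mem := hε
      ω := ω
      ω_mem := hω
      s := s
      θ := θ
      h := h
      hr := hr
      s_mem := s_mem
      s_comm := s_comm
      θ_of_mem := θ_of_mem
      θ_comm := θ_comm
      h_mem := h_mem
      h_comm := h_comm
      K := K
      ε_K := fun x hx => (hKmem.1 hx).1
      s_K_left := fun x hx y => (s_K x (hKmem.1 hx).2 y).1
      s_K_right := fun x hx y => (s_K x (hKmem.1 hx).2 y).2
      h_K := fun x hx g => P.ext_left fun l z hz => by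
        rw [hh, (s_K x (hKmem.1 hx).2 z).2]; simp
      hr_K := fun x hx g => P.ext_right fun l z hz => by
        rw [hhr, (s_K x (hKmem.1 hx).2 z).1]; simp
      h_mem_K := h_mem_K
      hr_mem_K := hr_mem_K
      θ_smul_mem_K := θ_smul_mem_K
      s_mul_left := s_mul_left
      s_mul_right := s_mul_right
      h_mul := P.left_action_mul hh s_mul_right
      hr_mul := P.right_action_mul hhr s_mul_left
      mul_h := mul_h
      hr_mul_right := hr_mul_right
      h_mul_right := left_action_mul_right iSup_wdeg wdeg_zero σ_of_mem s_mem θ_comm h_comm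
        mul_h hr_mul_right
      mul_ω := hmulω
      ω_mul := hωmul }
  -- `E` vanishes in degrees below `2n` and `m + 1 ≤ 5n - 1`, so that in products of degree `m + 1`
  -- both factors have degree below `3n`, where `s` determines the class in `E`
  have hθF : ∀ t ∈ G2.deg H.eDeg (m + 1), X.θG2 t = P.J (F' t) := by
    intro t ht
    induction ht using Submodule.span_induction with
    | zero => simp
    | add a b _ _ ha hb => rw [map_add, ha, hb, map_add, map_add]
    | smul r a _ ha => rw [map_smul, ha, map_smul, map_smul]
    | mem t ht =>
      obtain ⟨p, q, hpq, e, he, e', he', rfl⟩ := ht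
      rcases Nat.lt_or_ge p (2 * n) with hp | hp
      · rw [hE0 p hp e he]; simp
      rcases Nat.lt_or_ge q (2 * n) with hq | hq
      · rw [hE0 q hq e' he']; simp
      have h1 : X.sG2 (e : G2 H.deg) = (Finsupp.single (p - 2 * n) e : W) :=
        hsE _ p (by omega) e he
      have h2 : X.sG2 (e' : G2 H.deg) = (Finsupp.single (q - 2 * n) e' : W) :=
        hsE _ q (by omega) e' he'
      rw [X.θG2_mk, h1, h2]
      change θ _ _ = _
      rw [hθ, if_pos (by omega), show 2 * n + (p - 2 * n) = p by omega,
        show 2 * n + (q - 2 * n) = q by omega]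
      change (1 / 2 : ℚ) * (P.J (F' (G2.mk H.eDeg e e')) + (-1) ^ (p * q) *
        P.J (F' (G2.mk H.eDeg e' e))) = _
      rw [G2.mk_comm H.eDeg he he', map_smul, map_smul, smul_eq_mul]
      ring
  refine ⟨X, fun t => ?_⟩
  rw [hθF _ t.2.2]
  have h1 : F' (t : G2 H.eDeg) = (F t : H.carrier) := LinearMap.congr_fun hF' t
  rw [h1]
  exact (htop _ (F t).2).symm

end GCAlg

namespace GCAlg

theorem Hom.eMap_comp {H : GCAlg.{u}} {K : GCAlg.{v}} {L : GCAlg.{w}} {f : Hom H K} {g : Hom K L}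
    {k : Hom H L} (h : ∀ x, k.toAlgHom x = g.toAlgHom (f.toAlgHom x)) (e : H.E) :
    k.eMap e = g.eMap (f.eMap e) := by
  refine Subtype.ext (LinearMap.congr_fun (f := k.g2) (g := g.g2 ∘ₗ f.g2)
    (G2.hom_ext _ fun x y => ?_) e)
  change G2.mk L.deg (k.toAlgHom x) (k.toAlgHom y) =
    G2.mk L.deg (g.toAlgHom (f.toAlgHom x)) (g.toAlgHom (f.toAlgHom y))
  rw [h, h]

theorem Hom.g2eMap_comp {H : GCAlg.{u}} {K : GCAlg.{v}} {L : GCAlg.{w}} {f : Hom H K}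
    {g : Hom K L} {k : Hom H L} (h : ∀ x, k.toAlgHom x = g.toAlgHom (f.toAlgHom x))
    (t : G2 H.eDeg) : k.g2eMap t = g.g2eMap (f.g2eMap t) := by
  refine LinearMap.congr_fun (f := k.g2eMap) (g := g.g2eMap ∘ₗ f.g2eMap)
    (G2.hom_ext _ fun e e' => ?_) t
  change G2.mk L.eDeg (k.eMap e) (k.eMap e') =
    G2.mk L.eDeg (g.eMap (f.eMap e)) (g.eMap (f.eMap e'))
  rw [Hom.eMap_comp h, Hom.eMap_comp h]

theorem Hom.bMap_comp {H : GCAlg.{u}} {K : GCAlg.{v}} {L : GCAlg.{w}} {f : Hom H K}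
    {g : Hom K L} {k : Hom H L} (h : ∀ x, k.toAlgHom x = g.toAlgHom (f.toAlgHom x)) {i : ℕ}
    (t : H.bDeg i) : k.bMap i t = g.bMap i (f.bMap i t) :=
  Subtype.ext (Hom.g2eMap_comp h t.1)

theorem IsConnected.of_iso {H : GCAlg.{u}} {K : GCAlg.{v}} {j : ℕ} (f : Iso H K)
    (hK : K.IsConnected j) : H.IsConnected j := by
  obtain ⟨h1, h2, h3⟩ := hK
  refine ⟨f.toAlgEquiv.toEquiv.nontrivial, le_antisymm (fun x hx => ?_) ?_, fun k hk hk' => ?_⟩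
  · have hx' : f.toAlgEquiv x ∈ K.deg 0 := f.map_deg_iff.2 hx
    rw [h2, Submodule.mem_span_singleton] at hx'
    obtain ⟨c, hc⟩ := hx'
    rw [Submodule.mem_span_singleton]
    refine ⟨c, f.toAlgEquiv.injective ?_⟩
    rw [map_smul, map_one, hc]
  · rw [Submodule.span_le, Set.singleton_subset_iff]
    exact SetLike.one_mem_graded H.deg
  · rw [eq_bot_iff]
    intro x hx
    have hx' : f.toAlgEquiv x ∈ K.deg k := f.map_deg_iff.2 hx
    rw [h3 k hk hk', Submodule.mem_bot] at hx'
    exact (map_eq_zero_iff f.toAlgEquiv f.toAlgEquiv.injective).1 hx'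

end GCAlg

namespace DGA

/-- Every linear functional on `ℬ^{m+1}(H)` is the Bianchi–Massey tensor of a minimal Sullivan
algebra. -/
theorem exists_minimalSullivan_realisation {n m : ℕ} (hn : 2 ≤ n) (hm : m ≤ 5 * n - 2)
    (H : GCAlg.{u}) (hH : H.IsConnected (n - 1)) (hP : H.IsPoincare m)
    (F : H.bDeg (m + 1) →ₗ[ℚ] H.deg m) :
    ∃ (M : DGA.{u}) (e : GCAlg.Iso M.cohomology H),
      M.IsConnected (n - 1) ∧ M.IsMinimalSullivan ∧
        e.hom.degMap m ∘ₗ M.bianchiMassey m = F ∘ₗ e.hom.bMap (m + 1) := by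
  obtain ⟨X, hX⟩ := GCAlg.exists_bmExt hn hm hH hP F
  have hA : X.dga.cohomology.IsConnected (n - 1) := hH.of_iso X.cohIso
  have hfin : FiniteDimensional ℚ H.carrier := hP.1
  have hfin' : FiniteDimensional ℚ X.dga.cohomology.carrier :=
    Module.Finite.equiv X.cohIso.toAlgEquiv.symm.toLinearEquiv
  obtain ⟨M⟩ := exists_minimalModel hn X.dga hA
  let q := GCAlg.Iso.ofBijective M.φ.cohMap M.quasiIso
  have hcomp : ∀ x, (q.trans X.cohIso).hom.toAlgHom x =
      X.cohIso.hom.toAlgHom (M.φ.cohMap.toAlgHom x) := fun x => rfl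
  refine ⟨M.S, q.trans X.cohIso, M.isConnected (by omega) hA.1, M.isMinimalSullivan (by omega),
    LinearMap.ext fun t => Subtype.ext ?_⟩
  have h1 := LinearMap.congr_fun
    (BMChoice.tensor_natural M.φ (Classical.choice (nonempty_bmChoice M.S)) X.choice m) t
  have h2 := X.cohIso_tensor m (M.φ.cohMap.bMap (m + 1) t)
  rw [← GCAlg.Hom.bMap_comp hcomp, hX] at h2
  refine Eq.trans ?_ h2
  exact congrArg (fun y => (X.cohIso.hom.degMap m y : H.carrier)) h1

end DGA

/-! ### Low degrees of a minimal model -/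

namespace DGA

open FreeGC

/-- Free generators of a minimal Sullivan algebra `S` in degrees at least `n`, which are divided
into closed ones and a set `N` of generators whose differentials are linearly independent in each
degree. Freeness is recorded by `free`, `words` and `ev`: independence over the subalgebra of other
generators, linear maps out of `S`, and homomorphisms out of `S`. -/
structure ModelGens (n : ℕ) (S : DGA.{u}) where
  ι : Type u
  w : ι → ℕ
  x : ι → S.carrier
  x_mem : ∀ a, x a ∈ S.deg (w a)
  N : Set ι
  n_le : ∀ a, n ≤ w a
  d_mem : ∀ a, S.d (x a) ∈ Algebra.adjoin ℚ (x '' {b | w b < w a})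
  d_eq_zero : ∀ a, a ∉ N → S.d (x a) = 0
  indep : ∀ k (c : ι →₀ ℚ), (∀ a, c a ≠ 0 → a ∈ N ∧ w a = k) →
    (c.sum fun a r => r • S.d (x a)) = 0 → c = 0
  mem_adjoin : ∀ y, y ∈ Algebra.adjoin ℚ (x '' Set.univ)
  free : ∀ {T : Set ι} {z}, z ∈ Algebra.adjoin ℚ (x '' T) → ∀ p : ι →₀ S.carrier,
    (∀ a, p a ∈ Algebra.adjoin ℚ (x '' T)) → (∀ a ∈ T, p a = 0) →
    z + (p.sum fun a b => x a * b) = 0 → p = 0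
  words : ∀ {W : Type u} [AddCommGroup W] [Module ℚ W] (f : List ι → W),
    (∀ l l' a b, f (l ++ a :: b :: l') = (-1 : ℚ) ^ (w a * w b) • f (l ++ b :: a :: l')) →
    ∃ L : S.carrier →ₗ[ℚ] W, ∀ l : List ι, L (l.map x).prod = f l
  ev : ∀ (T : DGA.{v}) (_ : ∀ a, T.deg (w a)), S.carrier →ₐ[ℚ] T.carrier
  ev_x : ∀ {T : DGA.{v}} (f : ∀ a, T.deg (w a)) a, ev T f (x a) = f a
  ev_mem : ∀ {T : DGA.{v}} (f : ∀ a, T.deg (w a)) {k y}, y ∈ S.deg k → ev T f y ∈ T.deg k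

/-- The generators of a minimal model. -/
noncomputable def MinimalModel.gens {n : ℕ} {A : DGA.{u}} (M : MinimalModel n A) :
    ModelGens.{u, v} n M.S where
  ι := M.ι
  w := M.w
  x := gen M.w
  x_mem := gen_mem M.w
  N := M.N
  n_le := M.n_le
  d_mem a := (congrArg (· ∈ Algebra.adjoin ℚ (gen M.w '' {b | M.w b < M.w a}))
    (der_gen M.D a)).mpr (M.D_mem a)
  d_eq_zero a ha := (der_gen M.D a).trans (M.D_eq_zero a ha)
  indep k c hc h := by
    refine M.indep k c hc (Eq.trans ?_ h)
    rw [Finsupp.linearCombination_apply]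
    exact Finsupp.sum_congr fun a _ => congrArg (c a • ·) (der_gen M.D a).symm
  mem_adjoin := mem_adjoin_image_univ
  free hz p hp hpT h := eq_zero_of_sum_gen_mul hz p hp hpT h
  words f hf := exists_linearMap_of_words f hf
  ev T f := FreeGC.ev T f
  ev_x f a := FreeGC.ev_gen a
  ev_mem f _ _ hy := FreeGC.ev_mem hy

namespace ModelGens

variable {n : ℕ} {S : DGA.{u}} (B : ModelGens.{u, v} n S)

/-- The closed generators of degree at most `3n - 3`. -/
abbrev C : Set B.ι := {b | b ∉ B.N ∧ B.w b + 3 ≤ 3 * n}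

/-- The generators in `N` of degree at most `3n - 3`. -/
abbrev L : Set B.ι := {b | b ∈ B.N ∧ B.w b + 3 ≤ 3 * n}

/-- The subalgebra generated by generators with index in `T`. -/
abbrev alg (T : Set B.ι) : Subalgebra ℚ S.carrier := Algebra.adjoin ℚ (B.x '' T)

theorem alg_mono {T T' : Set B.ι} (h : T ⊆ T') : B.alg T ≤ B.alg T' :=
  Algebra.adjoin_mono (Set.image_mono h)

theorem x_mem_alg {T : Set B.ι} {a : B.ι} (ha : a ∈ T) : B.x a ∈ B.alg T :=
  Algebra.subset_adjoin (Set.mem_image_of_mem B.x ha)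

theorem exists_smul_one_of_mem_alg_empty {y : S.carrier} (hy : y ∈ B.alg ∅) :
    ∃ c : ℚ, y = c • 1 := by
  rw [alg, Set.image_empty, Algebra.adjoin_empty, Algebra.mem_bot] at hy
  obtain ⟨c, rfl⟩ := hy
  exact ⟨c, Algebra.algebraMap_eq_smul_one c⟩

theorem smul_one_eq_zero {i : ℕ} {c : ℚ} (h : c • (1 : S.carrier) ∈ S.deg i) (hi : i ≠ 0) :
    c • (1 : S.carrier) = 0 :=
  GCAlg.eq_zero_of_mem_of_mem h (Submodule.smul_mem _ c (SetLike.one_mem_graded S.deg)) hi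

theorem mem_alg_le {i : ℕ} {y : S.carrier} (hy : y ∈ S.deg i) : y ∈ B.alg {b | B.w b ≤ i} := by
  refine GCAlg.mem_adjoin_of_lt B.x_mem (T' := {b | i < B.w b}) (q := i + 1) (fun a ha => ha)
    (Nat.lt_succ_self i) (B.alg_mono (fun a _ => ?_) (B.mem_adjoin y)) hy
  exact le_or_gt (B.w a) i

theorem exists_smul_one (B : ModelGens.{u, v} n S) {i : ℕ} (hi : i < n) {y : S.carrier} (hy : y ∈ S.deg i) :
    ∃ c : ℚ, y = c • 1 := by
  refine B.exists_smul_one_of_mem_alg_empty (B.alg_mono (fun a ha => ?_) (B.mem_alg_le hy))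
  have h1 : B.w a ≤ i := ha
  have h2 := B.n_le a
  omega

theorem exists_scalars {κ : Type u} (p : κ →₀ S.carrier) (h : ∀ c, ∃ s : ℚ, p c = s • 1) :
    ∃ q : κ →₀ ℚ, (∀ c, p c = q c • 1) ∧ ∀ c, p c = 0 → q c = 0 := by
  classical
  choose s hs using h
  refine ⟨Finsupp.onFinset p.support (fun c => if p c = 0 then 0 else s c) fun c hc => ?_,
    fun c => ?_, fun c hc => ?_⟩
  · rw [Finsupp.mem_support_iff]
    intro h
    exact hc (if_pos h)
  · rw [Finsupp.onFinset_apply]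
    split_ifs with h
    · rw [h, zero_smul]
    · exact hs c
  · rw [Finsupp.onFinset_apply, if_pos hc]

theorem sum_scalars {κ : Type u} {V : Type u} [AddCommGroup V] [Module ℚ V] (p : κ →₀ S.carrier)
    (q : κ →₀ ℚ) (h : ∀ c, p c = q c • 1) (h' : ∀ c, p c = 0 → q c = 0)
    (F : κ → S.carrier →ₗ[ℚ] V) :
    (p.sum fun c b => F c b) = q.sum fun c r => r • F c 1 := by
  have hsub : q.support ⊆ p.support := fun c hc => by
    rw [Finsupp.mem_support_iff] at hc ⊢
    exact fun h0 => hc (h' c h0)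
  rw [Finsupp.sum_of_support_subset q hsub (fun c r => r • F c 1) (fun c _ => zero_smul ℚ (F c 1)),
    Finsupp.sum]
  refine Finset.sum_congr rfl fun c _ => ?_
  rw [h c, map_smul]

/-- Differentials of generators of degree below `3n - 1` are purely quadratic. -/
theorem exists_quadratic {a : B.ι} (ha : B.w a + 1 < 3 * n) :
    ∃ q : B.ι × B.ι →₀ ℚ, (∀ c, q c ≠ 0 → B.w c.1 + B.w c.2 = B.w a + 1) ∧
      S.d (B.x a) = q.sum fun c r => r • (B.x c.1 * B.x c.2) := by
  have h0 := B.d_mem a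
  rw [show B.x '' {b | B.w b < B.w a} = B.x '' (∅ ∪ {b | B.w b < B.w a}) by
    rw [Set.empty_union]] at h0
  obtain ⟨z, hz, hzi, p, p1, p2, p3, r, r1, r2, r3, h⟩ :=
    GCAlg.exists_decomp_quadratic B.x_mem (fun b _ => B.n_le b) ha h0 (S.d_mem (B.x_mem a))
  have hz0 : z = 0 := by
    obtain ⟨c, rfl⟩ := B.exists_smul_one_of_mem_alg_empty hz
    exact smul_one_eq_zero hzi (by omega)
  have hp0 : p = 0 := Finsupp.ext fun b => by
    obtain ⟨c, hc⟩ := B.exists_smul_one_of_mem_alg_empty (p1 b)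
    by_cases hb : B.w b < B.w a
    · have h2 := p2 b
      rw [hc] at h2
      exact hc.trans (smul_one_eq_zero h2 (by omega))
    · exact p3 b fun hb' => hb hb'.1
  obtain ⟨q, hq, hq'⟩ := exists_scalars r fun c => B.exists_smul_one_of_mem_alg_empty (r1 c)
  refine ⟨q, fun c hc => ?_, ?_⟩
  · by_contra hne
    by_cases hle : B.w c.1 + B.w c.2 ≤ B.w a + 1
    · refine hc (hq' c ?_)
      have h2 := r2 c
      rw [hq c] at h2 ⊢
      exact smul_one_eq_zero h2 (by omega)
    · exact hc (hq' c (r3 c fun h => hle h.2.2))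
  · rw [h, hz0, hp0, Finsupp.sum_zero_index, zero_add, zero_add]
    refine (sum_scalars r q hq hq' fun c => LinearMap.mulLeft ℚ (B.x c.1 * B.x c.2)).trans ?_
    exact Finsupp.sum_congr fun c _ => by rw [LinearMap.mulLeft_apply, mul_one]

/-- The generators in `N` have degree at least `2n - 1`, since their differentials are decomposable
and non-zero. -/
theorem two_mul_le {a : B.ι} (ha : a ∈ B.N) : 2 * n ≤ B.w a + 1 := by
  classical
  by_contra hlt
  obtain ⟨q, hq, h⟩ := B.exists_quadratic (a := a) (by omega)
  have hq0 : q = 0 := Finsupp.ext fun c => by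
    by_contra hc
    have h1 := hq c hc
    have h2 := B.n_le c.1
    have h3 := B.n_le c.2
    omega
  rw [hq0, Finsupp.sum_zero_index] at h
  have h4 := B.indep (B.w a) (Finsupp.single a 1) (fun b hb => ?_) ?_
  · exact one_ne_zero (Finsupp.single_eq_zero.1 h4)
  · have hab : a = b := by
      by_contra hne
      exact hb (Finsupp.single_eq_of_ne (Ne.symm hne))
    exact hab ▸ ⟨ha, rfl⟩
  · exact (Finsupp.sum_single_index (h := fun b r => r • S.d (B.x b)) (zero_smul ℚ _)).trans
      (by rw [h, smul_zero])

theorem mem_C_of_add {a : B.ι} (ha : B.w a + 3 ≤ 3 * n) {c : B.ι × B.ι}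
    (h : B.w c.1 + B.w c.2 = B.w a + 1) :
    (c.1 ∈ B.C ∧ B.w c.1 + 2 ≤ 2 * n) ∧ c.2 ∈ B.C ∧ B.w c.2 + 2 ≤ 2 * n := by
  have h2 := B.n_le c.1
  have h3 := B.n_le c.2
  refine ⟨⟨⟨fun h4 => ?_, by omega⟩, by omega⟩, ⟨fun h4 => ?_, by omega⟩, by omega⟩ <;>
  · have := B.two_mul_le h4
    omega

theorem d_mem_alg_C {a : B.ι} (ha : B.w a + 3 ≤ 3 * n) : S.d (B.x a) ∈ B.alg B.C := by
  obtain ⟨q, hq, h⟩ := B.exists_quadratic (a := a) (by omega)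
  rw [h]
  refine Subalgebra.sum_mem _ fun c hc => Subalgebra.smul_mem _ (mul_mem ?_ ?_) _
  · exact B.x_mem_alg (B.mem_C_of_add ha (hq c (Finsupp.mem_support_iff.1 hc))).1.1
  · exact B.x_mem_alg (B.mem_C_of_add ha (hq c (Finsupp.mem_support_iff.1 hc))).2.1

theorem d_eq_zero_of_mem_alg_C {y : S.carrier} (hy : y ∈ B.alg B.C) : S.d y = 0 := by
  have h : B.alg B.C ≤ S.closed := Algebra.adjoin_le (by
    rintro _ ⟨a, ha, rfl⟩
    exact B.d_eq_zero a ha.1)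
  exact h hy

theorem C_union_L : {b | B.w b + 3 ≤ 3 * n} = B.C ∪ B.L := by
  ext b
  simp only [Set.mem_union, Set.mem_ofPred_eq]
  tauto

theorem mem_alg_C_of_lt {i : ℕ} (hi : i + 2 ≤ 2 * n) {y : S.carrier}
    (hy : y ∈ S.deg i) : y ∈ B.alg B.C := by
  refine B.alg_mono (fun a ha => ?_) (B.mem_alg_le hy)
  have h1 : B.w a ≤ i := ha
  refine ⟨fun h => ?_, by omega⟩
  have := B.two_mul_le h
  omega

theorem d_eq_zero_of_lt (B : ModelGens.{u, v} n S) {i : ℕ} (hi : i + 2 ≤ 2 * n) {y : S.carrier}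
    (hy : y ∈ S.deg i) : S.d y = 0 :=
  B.d_eq_zero_of_mem_alg_C (B.mem_alg_C_of_lt hi hy)

/-- In degrees at most `3n - 3`, elements are linear combinations of generators in `N` and elements
of the algebra of closed generators. -/
theorem exists_decomp_low {i : ℕ} (hi : i + 3 ≤ 3 * n) {y : S.carrier} (hy : y ∈ S.deg i) :
    ∃ z ∈ B.alg B.C, ∃ q : B.ι →₀ ℚ, (∀ b, q b ≠ 0 → b ∈ B.L ∧ B.w b = i) ∧
      y = z + q.sum fun b r => r • B.x b := by
  have h1 : y ∈ B.alg (B.C ∪ B.L) := by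
    rw [← C_union_L]
    refine B.alg_mono (fun a ha => ?_) (B.mem_alg_le hy)
    have h1 : B.w a ≤ i := ha
    change B.w a + 3 ≤ 3 * n
    omega
  obtain ⟨z, hz, -, p, -, p2, p3, h⟩ := GCAlg.exists_decomp_linear B.x_mem
    (q := 2 * n - 1) (fun b hb => by have := B.two_mul_le hb.1; omega) (by omega) h1 hy
  have hs : ∀ b, ∃ c : ℚ, p b = c • 1 := fun b => by
    by_cases hb : b ∈ B.L ∧ B.w b ≤ i
    · have := B.two_mul_le hb.1.1
      exact B.exists_smul_one (by omega) (p2 b)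
    · exact ⟨0, by rw [p3 b hb, zero_smul]⟩
  obtain ⟨q, hq, hq'⟩ := exists_scalars p hs
  refine ⟨z, hz, q, fun b hb => ?_, ?_⟩
  · by_cases hb' : b ∈ B.L ∧ B.w b ≤ i
    · refine ⟨hb'.1, ?_⟩
      by_contra hne
      refine hb (hq' b ?_)
      have h2 := p2 b
      rw [hq b] at h2 ⊢
      exact smul_one_eq_zero h2 (by omega)
    · exact absurd (hq' b (p3 b hb')) hb
  · rw [h]
    refine congrArg (z + ·) ((sum_scalars p q hq hq' fun b => LinearMap.mulLeft ℚ (B.x b)).trans ?_)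
    exact Finsupp.sum_congr fun c _ => by rw [LinearMap.mulLeft_apply, mul_one]

theorem d_sum (q : B.ι →₀ ℚ) :
    S.d (q.sum fun b r => r • B.x b) = q.sum fun b r => r • S.d (B.x b) := by
  rw [map_finsuppSum]
  exact Finsupp.sum_congr fun b _ => map_smul _ _ _

theorem mem_alg_C_of_closed {i : ℕ} (hi : i + 3 ≤ 3 * n) {y : S.carrier} (hy : y ∈ S.deg i)
    (hdy : S.d y = 0) : y ∈ B.alg B.C := by
  obtain ⟨z, hz, q, hq, rfl⟩ := B.exists_decomp_low hi hy
  rw [map_add, B.d_eq_zero_of_mem_alg_C hz, zero_add, d_sum] at hdy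
  rw [B.indep i q (fun a ha => ⟨(hq a ha).1.1, (hq a ha).2⟩) hdy, Finsupp.sum_zero_index, add_zero]
  exact hz

theorem exists_sum_of_exact {i : ℕ} (hi : i + 3 ≤ 3 * n) {r : S.carrier} (hr : r ∈ S.deg i) :
    ∃ q : B.ι →₀ ℚ, (∀ b, q b ≠ 0 → b ∈ B.L ∧ B.w b = i) ∧
      S.d r = q.sum fun b r => r • S.d (B.x b) := by
  obtain ⟨z, hz, q, hq, rfl⟩ := B.exists_decomp_low hi hr
  exact ⟨q, hq, by rw [map_add, B.d_eq_zero_of_mem_alg_C hz, zero_add, d_sum]⟩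

end ModelGens

end DGA

namespace DGA

namespace ModelGens

variable {n : ℕ} {S : DGA.{u}} (B : ModelGens.{u, v} n S)

/-- A quadratic expression in the generators in `N` vanishes if its differential lies in the algebra
of closed generators. -/
theorem quadratic_eq_zero {m : ℕ} {R : B.ι × B.ι →₀ ℚ}
    (hR : ∀ c, R c ≠ 0 → (c.1 ∈ B.L ∧ c.2 ∈ B.L) ∧ B.w c.1 + B.w c.2 = m) {z : S.carrier}
    (hz : z ∈ B.alg B.C)
    (h : z + S.d (R.sum fun c r => r • (B.x c.1 * B.x c.2)) = 0) :
    R.sum (fun c r => r • (B.x c.1 * B.x c.2)) = 0 := by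
  classical
  let sg (c : B.ι × B.ι) : ℚ := (-1 : ℚ) ^ (B.w c.1 * B.w c.2)
  let R' : B.ι × B.ι →₀ ℚ := R.sum fun c r => Finsupp.single c.swap (sg c * r)
  have hR'0 : ∀ c, R' c ≠ 0 → R c.swap ≠ 0 := by
    intro c hc h0
    refine hc ?_
    rw [Finsupp.sum_apply]
    refine Finset.sum_eq_zero fun c' hc' => Finsupp.single_eq_of_ne ?_
    rintro rfl
    rw [Prod.swap_swap] at h0
    exact (Finsupp.mem_support_iff.1 hc') h0
  have hsum : ∀ G : B.ι × B.ι → S.carrier, (R + R').sum (fun c r => r • G c) =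
      R.sum fun c r => r • (G c + sg c • G c.swap) := by
    intro G
    rw [← Finsupp.linearCombination_apply, map_add, map_finsuppSum,
      Finsupp.linearCombination_apply, ← Finsupp.sum_add]
    refine Finsupp.sum_congr fun c _ => ?_
    rw [Finsupp.linearCombination_single, smul_add, smul_smul, mul_comm]
  -- `Q` is the graded symmetrisation of `R`
  set Q : B.ι × B.ι →₀ ℚ := R + R' with hQ
  have hQ0 : ∀ c, Q c ≠ 0 → (c.1 ∈ B.L ∧ c.2 ∈ B.L) ∧ B.w c.1 + B.w c.2 = m := by
    intro c hc
    by_cases h1 : R c = 0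
    · have h2 : R' c ≠ 0 := fun h2 => hc (by rw [hQ, Finsupp.add_apply, h1, h2, add_zero])
      obtain ⟨⟨h3, h4⟩, h5⟩ := hR _ (hR'0 c h2)
      exact ⟨⟨h4, h3⟩, by rw [← h5, add_comm]; rfl⟩
    · exact hR c h1
  let G (c : B.ι × B.ι) : S.carrier := (-1 : ℚ) ^ B.w c.1 • (B.x c.1 * S.d (B.x c.2))
  have hG : Q.sum (fun c r => r • G c) = S.d (R.sum fun c r => r • (B.x c.1 * B.x c.2)) := by
    rw [hsum, map_finsuppSum]
    refine Finsupp.sum_congr fun c _ => ?_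
    rw [map_smul, S.leibniz _ (B.x_mem c.1), S.comm (S.d_mem (B.x_mem c.1)) (B.x_mem c.2)]
    congr 1
    rw [add_comm]
    congr 1
    change sg c • ((-1 : ℚ) ^ B.w c.2 • (B.x c.2 * S.d (B.x c.1))) = _
    rw [smul_smul, ← pow_add, add_mul, one_mul]
  have hx2 : Q.sum (fun c r => r • (B.x c.1 * B.x c.2)) =
      (2 : ℚ) • R.sum fun c r => r • (B.x c.1 * B.x c.2) := by
    rw [hsum, Finsupp.smul_sum]
    refine Finsupp.sum_congr fun c _ => ?_
    have h1 : B.x c.1 * B.x c.2 = sg c • (B.x c.2 * B.x c.1) := S.comm (B.x_mem c.1) (B.x_mem c.2)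
    change R c • (B.x c.1 * B.x c.2 + sg c • (B.x c.2 * B.x c.1)) = _
    rw [← h1]
    module
  let F (b : B.ι) : S.carrier :=
    (-1 : ℚ) ^ B.w b • (Q.curry b).sum fun a r => r • S.d (B.x a)
  have hF0 : ∀ b, Q.curry b = 0 → F b = 0 := fun b hb => by
    change (-1 : ℚ) ^ B.w b • (Q.curry b).sum _ = 0
    rw [hb, Finsupp.sum_zero_index, smul_zero]
  let P : B.ι →₀ S.carrier := Finsupp.onFinset Q.curry.support F fun b hb => by
    rw [Finsupp.mem_support_iff]
    exact fun h0 => hb (hF0 b h0)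
  have hL : ∀ b, Q.curry b ≠ 0 → b ∈ B.L := fun b hb => by
    obtain ⟨a, ha⟩ := Finsupp.ne_iff.1 hb
    exact (hQ0 (b, a) ha).1.1
  have hPsum : (P.sum fun b y => B.x b * y) = Q.sum fun c r => r • G c := by
    rw [Finsupp.onFinset_sum _ fun b => mul_zero _, ← Finsupp.sum_curry_index Q
      fun b a r => r • G (b, a)]
    refine Finset.sum_congr rfl fun b _ => ?_
    change B.x b * ((-1 : ℚ) ^ B.w b • (Q.curry b).sum fun a r => r • S.d (B.x a)) = _
    rw [mul_smul_comm, Finsupp.mul_sum, Finsupp.smul_sum]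
    refine Finsupp.sum_congr fun a _ => ?_
    rw [mul_smul_comm, smul_comm]
  have hP : P = 0 := B.free hz P (fun b => ?_) (fun b hb => ?_) (by rw [hPsum, hG, h])
  · have hQ : Q = 0 := Finsupp.ext fun c => by
      have h1 : F c.1 = 0 := DFunLike.congr_fun hP c.1
      have h2 : ((Q.curry c.1).sum fun a r => r • S.d (B.x a)) = 0 :=
        (smul_eq_zero.1 h1).resolve_left (pow_ne_zero _ (by norm_num))
      have h3 := B.indep (m - B.w c.1) (Q.curry c.1) (fun a ha => ?_) h2
      · exact DFunLike.congr_fun h3 c.2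
      · have h4 := hQ0 (c.1, a) ha
        exact ⟨h4.1.2.1, by have h5 : B.w c.1 + B.w a = m := h4.2
                            omega⟩
    rw [hQ, Finsupp.sum_zero_index] at hx2
    exact (smul_eq_zero.1 hx2.symm).resolve_left two_ne_zero
  · refine Subalgebra.smul_mem _ (Subalgebra.sum_mem _ fun a ha => Subalgebra.smul_mem _ ?_ _) _
    have ha' : Q.curry b a ≠ 0 := Finsupp.mem_support_iff.1 ha
    exact B.d_mem_alg_C (hQ0 (b, a) ha').1.2.2
  · refine hF0 b ?_
    by_contra h0
    exact hb.1 (hL b h0).1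

/-- Closed elements of degree at most `5n - 3` in the algebra of generators of degree at most
`3n - 3` are at most linear in the generators in `N`. -/
theorem exists_decomp_closed {m : ℕ} (hn : 1 ≤ n) (hm : m + 3 ≤ 5 * n) {y : S.carrier}
    (hy : y ∈ B.alg {b | B.w b + 3 ≤ 3 * n}) (hym : y ∈ S.deg m) (hdy : S.d y = 0) :
    ∃ z ∈ B.alg B.C, z ∈ S.deg m ∧ ∃ p : B.ι →₀ S.carrier, (∀ b, p b ∈ B.alg B.C) ∧
      (∀ b, p b ∈ S.deg (m - B.w b)) ∧ (∀ b, ¬ (b ∈ B.L ∧ B.w b ≤ m) → p b = 0) ∧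
      (y = z + p.sum fun b y => B.x b * y) ∧ (p.sum fun b y => S.d (B.x b) * y) = 0 := by
  rw [B.C_union_L] at hy
  obtain ⟨z, hz, hzm, p, p1, p2, p3, r, r1, r2, r3, h⟩ := GCAlg.exists_decomp_quadratic B.x_mem
    (q := 2 * n - 1) (fun b hb => by have := B.two_mul_le hb.1; omega) (by omega) hy hym
  have hs : ∀ c, ∃ s : ℚ, r c = s • 1 := fun c => by
    by_cases hc : c.1 ∈ B.L ∧ c.2 ∈ B.L ∧ B.w c.1 + B.w c.2 ≤ m
    · have h1 := B.two_mul_le hc.1.1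
      have h2 := B.two_mul_le hc.2.1.1
      exact B.exists_smul_one (by omega) (r2 c)
    · exact ⟨0, by rw [r3 c hc, zero_smul]⟩
  obtain ⟨R, hR, hR'⟩ := exists_scalars r hs
  have hRsum : (r.sum fun c b => B.x c.1 * B.x c.2 * b) =
      R.sum fun c r => r • (B.x c.1 * B.x c.2) :=
    (sum_scalars r R hR hR' fun c => LinearMap.mulLeft ℚ (B.x c.1 * B.x c.2)).trans
      (Finsupp.sum_congr fun c _ => by rw [LinearMap.mulLeft_apply, mul_one])
  rw [hRsum] at h
  have hR0 : ∀ c, R c ≠ 0 → (c.1 ∈ B.L ∧ c.2 ∈ B.L) ∧ B.w c.1 + B.w c.2 = m := by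
    intro c hc
    by_cases hc' : c.1 ∈ B.L ∧ c.2 ∈ B.L ∧ B.w c.1 + B.w c.2 ≤ m
    · refine ⟨⟨hc'.1, hc'.2.1⟩, ?_⟩
      by_contra hne
      refine hc (hR' c ?_)
      have h2 := r2 c
      rw [hR c] at h2 ⊢
      exact smul_one_eq_zero h2 (by omega)
    · exact absurd (hR' c (r3 c hc')) hc
  have hdp : S.d (p.sum fun b y => B.x b * y) = p.sum fun b y => S.d (B.x b) * y := by
    rw [map_finsuppSum]
    refine Finsupp.sum_congr fun b _ => ?_
    rw [S.leibniz _ (B.x_mem b), B.d_eq_zero_of_mem_alg_C (p1 b), mul_zero, smul_zero, add_zero]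
  have hz' : (p.sum fun b y => S.d (B.x b) * y) ∈ B.alg B.C := by
    refine Subalgebra.sum_mem _ fun b hb => mul_mem ?_ (p1 b)
    refine B.d_mem_alg_C (by_contra fun hb' => ?_)
    exact (Finsupp.mem_support_iff.1 hb) (p3 b fun h => hb' h.1.2)
  have hd0 : (p.sum fun b y => S.d (B.x b) * y) +
      S.d (R.sum fun c r => r • (B.x c.1 * B.x c.2)) = 0 := by
    rw [← hdp, ← map_add]
    rw [h, add_assoc, map_add, B.d_eq_zero_of_mem_alg_C hz, zero_add] at hdy
    exact hdy
  have hQ := B.quadratic_eq_zero hR0 hz' hd0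
  rw [hQ, map_zero, add_zero] at hd0
  rw [hQ, add_zero] at h
  exact ⟨z, hz, hzm, p, p1, p2, p3, h, hd0⟩

end ModelGens

end DGA

namespace DGA

/-- A linear map on all of `A` that sends closed elements to their cohomology classes. -/
noncomputable def classMap (A : DGA.{u}) : A.carrier →ₗ[ℚ] A.cohomology.carrier :=
  A.exists_classMap.choose

section ClassMap

variable {A : DGA.{u}}

theorem classMap_apply (z : A.closed) : A.classMap z = A.toCoh z := A.exists_classMap.choose_spec z

theorem classMap_of_closed {z : A.carrier} (hz : A.d z = 0) : A.classMap z = A.toCoh ⟨z, hz⟩ :=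
  classMap_apply ⟨z, hz⟩

theorem classMap_d (y : A.carrier) : A.classMap (A.d y) = 0 :=
  (classMap_of_closed (A.d_d y)).trans (A.toCoh_eq_zero.2 ⟨y, rfl⟩)

theorem classMap_eq_zero {z : A.carrier} (hz : A.d z = 0) : A.classMap z = 0 ↔ ∃ y, A.d y = z := by
  rw [classMap_of_closed hz, A.toCoh_eq_zero]

theorem classMap_mul {y z : A.carrier} (hy : A.d y = 0) (hz : A.d z = 0) :
    A.classMap (y * z) = A.classMap y * A.classMap z := by
  rw [classMap_of_closed hy, classMap_of_closed hz, ← map_mul, ← classMap_apply]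
  rfl

theorem classMap_one : A.classMap 1 = 1 :=
  (classMap_of_closed A.d_one).trans (map_one A.toCoh)

theorem d_mul_of_closed {y z : A.carrier} (hy : A.d y = 0) (hz : A.d z = 0) : A.d (y * z) = 0 := by
  rw [A.leibniz_sgn, hy, hz, zero_mul, mul_zero, add_zero]

theorem classMap_mem {k : ℕ} {z : A.carrier} (hz : A.d z = 0) (hzk : z ∈ A.deg k) :
    A.classMap z ∈ A.cohomology.deg k := by
  rw [classMap_of_closed hz]
  exact A.mem_cohomology_deg.2 ⟨⟨z, hz⟩, hzk, rfl⟩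

theorem exists_classMap_eq {k : ℕ} {y : A.cohomology.carrier} (hy : y ∈ A.cohomology.deg k) :
    ∃ z ∈ A.deg k, A.d z = 0 ∧ A.classMap z = y := by
  obtain ⟨z, hz, rfl⟩ := A.mem_cohomology_deg.1 hy
  exact ⟨z, hz, z.2, classMap_apply z⟩

end ClassMap

namespace ModelGens

variable {n : ℕ} {S : DGA.{u}} (B : ModelGens.{u, v} n S)

open Classical in
/-- The cohomology class of a generator, or zero for generators in `N`. -/
noncomputable def cl (a : B.ι) : S.cohomology.carrier := if a ∈ B.N then 0 else S.classMap (B.x a)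

theorem cl_of_notMem {a : B.ι} (ha : a ∉ B.N) : B.cl a = S.classMap (B.x a) := if_neg ha

theorem cl_mem (a : B.ι) : B.cl a ∈ S.cohomology.deg (B.w a) := by
  unfold cl
  split_ifs with h
  · exact zero_mem _
  · exact classMap_mem (B.d_eq_zero a h) (B.x_mem a)

/-- The differentials of the generators in degrees at most `3n - 3` as elements of `E`. -/
theorem exists_relations : ∃ (t : B.ι → S.cohomology.E) (q : B.ι → (B.ι × B.ι →₀ ℚ)), ∀ a,
    B.w a + 3 ≤ 3 * n → t a ∈ S.cohomology.eDeg (B.w a + 1) ∧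
      (∀ c, q a c ≠ 0 →
        (c.1 ∈ B.C ∧ B.w c.1 + 2 ≤ 2 * n) ∧ c.2 ∈ B.C ∧ B.w c.2 + 2 ≤ 2 * n) ∧
      S.d (B.x a) = (q a).sum (fun c r => r • (B.x c.1 * B.x c.2)) ∧
      (t a : G2 S.cohomology.deg) =
        (q a).sum fun c r => r • G2.mk S.cohomology.deg (B.cl c.1) (B.cl c.2) := by
  have key : ∀ a, ∃ (t : S.cohomology.E) (q : B.ι × B.ι →₀ ℚ),
      B.w a + 3 ≤ 3 * n → t ∈ S.cohomology.eDeg (B.w a + 1) ∧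
      (∀ c, q c ≠ 0 →
        (c.1 ∈ B.C ∧ B.w c.1 + 2 ≤ 2 * n) ∧ c.2 ∈ B.C ∧ B.w c.2 + 2 ≤ 2 * n) ∧
      S.d (B.x a) = q.sum (fun c r => r • (B.x c.1 * B.x c.2)) ∧
      (t : G2 S.cohomology.deg) =
        q.sum fun c r => r • G2.mk S.cohomology.deg (B.cl c.1) (B.cl c.2) := by
    intro a
    by_cases ha : B.w a + 3 ≤ 3 * n
    · obtain ⟨q, hq, h⟩ := B.exists_quadratic (a := a) (by omega)
      have hC := fun c hc => B.mem_C_of_add ha (hq c hc)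
      have hcup : ∀ y z, S.cohomology.cup (G2.mk S.cohomology.deg y z) = y * z := fun y z => rfl
      refine ⟨⟨q.sum fun c r => r • G2.mk S.cohomology.deg (B.cl c.1) (B.cl c.2), ?_⟩, q,
        fun _ => ⟨?_, hC, h, rfl⟩⟩
      · change S.cohomology.cup _ = 0
        rw [map_finsuppSum, ← classMap_d (B.x a), h, map_finsuppSum]
        refine Finsupp.sum_congr fun c hc => ?_
        have h1 := hC c (Finsupp.mem_support_iff.1 hc)
        rw [map_smul, map_smul, hcup, B.cl_of_notMem h1.1.1.1, B.cl_of_notMem h1.2.1.1,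
          classMap_mul (B.d_eq_zero _ h1.1.1.1) (B.d_eq_zero _ h1.2.1.1)]
      · change (q.sum fun c r => r • G2.mk S.cohomology.deg (B.cl c.1) (B.cl c.2)) ∈
          G2.deg S.cohomology.deg (B.w a + 1)
        refine Submodule.sum_mem _ fun c hc => Submodule.smul_mem _ _ (Submodule.subset_span ?_)
        exact ⟨_, _, hq c (Finsupp.mem_support_iff.1 hc), _, B.cl_mem _, _, B.cl_mem _, rfl⟩
    · exact ⟨0, 0, fun h => absurd h ha⟩
  choose t q htq using key
  exact ⟨t, q, htq⟩

/-- Relations between the products of the differentials of generators give elements of `ℬ`: since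
the closed generators are free, such a relation holds in `𝒢⁴` of the cohomology. -/
theorem symmetrise_eq_zero {t : B.ι → S.cohomology.E} {q : B.ι → (B.ι × B.ι →₀ ℚ)}
    {P : B.ι → Prop}
    (htq : ∀ a, P a → S.d (B.x a) = (q a).sum (fun c r => r • (B.x c.1 * B.x c.2)) ∧
      (t a : G2 S.cohomology.deg) =
        (q a).sum fun c r => r • G2.mk S.cohomology.deg (B.cl c.1) (B.cl c.2))
    (Q : B.ι × B.ι →₀ ℚ) (hQ : ∀ c, Q c ≠ 0 → P c.1 ∧ P c.2)
    (h : (Q.sum fun c r => r • (S.d (B.x c.1) * S.d (B.x c.2))) = 0) :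
    symmetrise S.cohomology.deg (S.cohomology.g2E
      (Q.sum fun c r => r • G2.mk S.cohomology.eDeg (t c.1) (t c.2))) = 0 := by
  let f : List B.ι → G4 S.cohomology.deg
    | [i, j, k, l] => G4.mk S.cohomology.deg (B.cl i) (B.cl j) (B.cl k) (B.cl l)
    | _ => 0
  obtain ⟨L, hL⟩ := B.words f (by
    intro l l' a b
    rcases l with _ | ⟨i, _ | ⟨j, _ | ⟨k, l⟩⟩⟩
    · rcases l' with _ | ⟨c, _ | ⟨d, _ | ⟨e, l'⟩⟩⟩
      · simp [f]
      · simp [f]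
      · exact G4.swap12 _ (B.cl_mem a) (B.cl_mem b) _ _
      · simp [f]
    · rcases l' with _ | ⟨c, _ | ⟨d, l'⟩⟩
      · simp [f]
      · exact G4.swap23 _ (B.cl_mem a) (B.cl_mem b) _ _
      · simp [f]
    · rcases l' with _ | ⟨c, l'⟩
      · exact G4.swap34 _ (B.cl_mem a) (B.cl_mem b) _ _
      · simp [f]
    · rcases l with _ | ⟨d, l⟩ <;> simp [f])
  have hLmul : ∀ q q' : B.ι × B.ι →₀ ℚ,
      L (q.sum (fun c r => r • (B.x c.1 * B.x c.2)) * q'.sum fun c r => r • (B.x c.1 * B.x c.2)) =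
      G2.mulG4 S.cohomology.deg
        (q.sum fun c r => r • G2.mk S.cohomology.deg (B.cl c.1) (B.cl c.2))
        (q'.sum fun c r => r • G2.mk S.cohomology.deg (B.cl c.1) (B.cl c.2)) := by
    intro q q'
    simp only [Finsupp.sum, Finset.sum_mul_sum, map_sum, LinearMap.sum_apply]
    rw [Finset.sum_comm]
    refine Finset.sum_congr rfl fun c _ => Finset.sum_congr rfl fun c' _ => ?_
    have h4 := hL [c'.1, c'.2, c.1, c.2]
    simp only [List.map_cons, List.map_nil, List.prod_cons, List.prod_nil, mul_one] at h4
    rw [smul_mul_smul_comm, map_smul, mul_assoc, h4, map_smul, map_smul, LinearMap.smul_apply,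
      smul_smul, mul_comm]
    rfl
  rw [map_finsuppSum, map_finsuppSum, ← map_zero L, ← h, map_finsuppSum]
  refine Finsupp.sum_congr fun c hc => ?_
  obtain ⟨h1, h2⟩ := hQ c (Finsupp.mem_support_iff.1 hc)
  rw [map_smul, map_smul, map_smul, (htq _ h1).1, (htq _ h2).1, hLmul, ← (htq _ h1).2,
    ← (htq _ h2).2]
  rfl

end ModelGens

end DGA

/-! ### Correcting a map by closed elements -/

namespace GCAlg

/-- A functional on a space of families of elements of `H` that is determined by the family is given
by pairing with a family of elements of `H`. -/
theorem Duality.exists_pairing {H : GCAlg.{v}} {m : ℕ} (P : Duality H m)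
    [FiniteDimensional ℚ H.carrier] {ι : Type u} {Y : Type w} [AddCommGroup Y] [Module ℚ Y]
    (d : ι → ℕ) (e : Y →ₗ[ℚ] ι →₀ H.carrier) (δ : Y →ₗ[ℚ] ℚ)
    (he : ∀ y b, e y b ∈ H.deg (m - d b)) (he' : ∀ y b, m < d b → e y b = 0)
    (hker : ∀ y, e y = 0 → δ y = 0) :
    ∃ v : ι → H.carrier, (∀ b, v b ∈ H.deg (d b)) ∧
      ∀ y, ((e y).sum fun b z => P.J (v b * z)) = δ y := by
  have hδ : δ ∈ LinearMap.range e.dualMap := by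
    rw [LinearMap.range_dualMap_eq_dualAnnihilator_ker, Submodule.mem_dualAnnihilator]
    exact hker
  obtain ⟨l, rfl⟩ := hδ
  obtain ⟨Ψ, hΨ⟩ := P.exists_right
  refine ⟨fun b => H.pr (d b) (Ψ (l ∘ₗ Finsupp.lsingle b)), fun b => pr_mem _ _, fun y => ?_⟩
  have h1 : ∀ b, P.J (H.pr (d b) (Ψ (l ∘ₗ Finsupp.lsingle b)) * e y b) =
      l (Finsupp.single b (e y b)) := by
    intro b
    rcases le_or_gt (d b) m with h | h
    · have h2 := pr_mul_of_le' (he y b) (Ψ (l ∘ₗ Finsupp.lsingle b)) (Nat.sub_le m (d b))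
      rw [Nat.sub_sub_self h] at h2
      rw [← h2, P.J_pr, hΨ]
      rfl
    · rw [he' y b h, mul_zero, map_zero, Finsupp.single_zero, map_zero]
  change _ = l (e y)
  conv_rhs => rw [← Finsupp.sum_single (e y), map_finsuppSum]
  exact Finsupp.sum_congr fun b _ => h1 b

end GCAlg

namespace DGA

namespace BMChoice

variable {A : DGA.{u}} (c : BMChoice A)

/-- Up to exact elements, symmetrising `γ e · α² e'` has no effect. -/
theorem classMap_bilin (e e' : A.cohomology.E) :
    A.classMap (c.form (G2.mk A.cohomology.eDeg e e')) = A.classMap (c.γ e * c.sqE e') := by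
  have h1 : A.d (c.γ e) = c.sqE e := c.d_γ e
  have h2 : A.d (c.γ e') = c.sqE e' := c.d_γ e'
  have h3 : c.form (G2.mk A.cohomology.eDeg e e') =
      c.γ e * c.sqE e' - A.d ((1 / 2 : ℚ) • (A.sgn (c.γ e) * c.γ e')) := by
    change c.bilin e e' = _
    rw [bilin_apply, map_smul, A.leibniz_sgn, A.d_sgn, DGA.sgn_sgn, h1, h2, neg_mul]
    module
  rw [h3, map_sub, classMap_d, sub_zero]

theorem coe_tensor_eq (k : ℕ) (t : A.cohomology.bDeg (k + 1)) :
    (c.tensor k t : A.cohomology.carrier) = A.classMap (c.form t) := by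
  obtain ⟨h, h'⟩ := c.coe_tensor k t
  rw [h', classMap_of_closed]

theorem classMap_form_sum {κ : Type w} (Q : κ →₀ ℚ) (e e' : κ → A.cohomology.E) :
    A.classMap (c.form (Q.sum fun i r => r • G2.mk A.cohomology.eDeg (e i) (e' i))) =
      A.classMap (Q.sum fun i r => r • (c.γ (e i) * c.sqE (e' i))) := by
  rw [map_finsuppSum, map_finsuppSum, map_finsuppSum]
  exact Finsupp.sum_congr fun i _ => by rw [map_smul, map_smul, map_smul, classMap_bilin]

theorem d_α (x : A.cohomology.carrier) : A.d (c.α x) = 0 := (c.α x).2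

theorem classMap_α (x : A.cohomology.carrier) : A.classMap (c.α x) = x :=
  (classMap_apply _).trans (c.toCoh_α x)

theorem sqE_eq_sum {κ : Type w} {t : A.cohomology.E} {q : κ →₀ ℚ}
    {y z : κ → A.cohomology.carrier}
    (h : (t : G2 A.cohomology.deg) = q.sum fun i r => r • G2.mk A.cohomology.deg (y i) (z i)) :
    c.sqE t = q.sum fun i r => r • ((c.α (y i) : A.carrier) * c.α (z i)) := by
  change A.closed.val.toLinearMap (c.sq (t : G2 A.cohomology.deg)) = _
  rw [h, map_finsuppSum, map_finsuppSum]
  refine Finsupp.sum_congr fun i _ => ?_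
  rw [map_smul, map_smul]
  rfl

end BMChoice

namespace ModelGens

variable {n : ℕ} {S : DGA.{u}} (B : ModelGens.{u, v} n S)

/-- In low degrees, closed generators are the only representatives of their classes. -/
theorem α_cl (c : BMChoice S) {a : B.ι} (ha : a ∉ B.N) (ha' : B.w a + 2 ≤ 2 * n) :
    (c.α (B.cl a) : S.carrier) = B.x a := by
  have h1 : S.d ((c.α (B.cl a) : S.carrier) - B.x a) = 0 := by
    rw [map_sub, c.d_α, B.d_eq_zero a ha, sub_zero]
  have h2 : S.classMap ((c.α (B.cl a) : S.carrier) - B.x a) = 0 := by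
    rw [map_sub, c.classMap_α, B.cl_of_notMem ha, sub_self]
  have h3 : (c.α (B.cl a) : S.carrier) - B.x a ∈ S.deg (B.w a - 1 + 1) := by
    have := B.n_le a
    rw [Nat.sub_add_cancel (by omega)]
    exact sub_mem (c.α_mem (B.cl_mem a)) (B.x_mem a)
  obtain ⟨y, hy, hyd⟩ := exists_primitive_mem h3 ((classMap_eq_zero h1).1 h2)
  rw [B.d_eq_zero_of_lt (by omega) hy] at hyd
  exact sub_eq_zero.1 hyd.symm

end ModelGens

end DGA

/-! ### Realisation of an isomorphism in low degrees -/

namespace DGA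

/-- A minimal Sullivan algebra `S` with generators `B` and a DGA `T` whose cohomology algebras are
isomorphic, satisfy Poincaré duality and have corresponding Bianchi–Massey tensors. -/
structure Comparison (n m : ℕ) (S : DGA.{u}) (T : DGA.{v}) where
  B : ModelGens.{u, v} n S
  G : GCAlg.Hom S.cohomology T.cohomology
  bij : Function.Bijective G.toAlgHom
  P : T.cohomology.Duality m
  cS : BMChoice S
  cT : BMChoice T
  tensor : ∀ t : S.cohomology.bDeg (m + 1),
    G.toAlgHom (cS.tensor m t) = (cT.tensor m (G.bMap (m + 1) t) : T.cohomology.carrier)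

/-- The matrix with rows `Q b`, for rows that vanish outside the support of `p`. -/
theorem exists_matrix {ι : Type u} {M : Type w} [Zero M] (p : ι →₀ M) (Q : ι → ι →₀ ℚ)
    (h : ∀ b, p b = 0 → Q b = 0) : ∃ R : ι × ι →₀ ℚ, ∀ c, R c = Q c.1 c.2 := by
  classical
  exact ⟨(Finsupp.onFinset p.support Q fun b hb => by
    rw [Finsupp.mem_support_iff]
    exact fun h' => hb (h b h')).uncurry, fun c => rfl⟩

theorem sum_matrix {ι : Type u} {M : Type w} [Zero M] {V : Type v} [AddCommGroup V] [Module ℚ V]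
    {p : ι →₀ M} {Q : ι → ι →₀ ℚ} (h : ∀ b, p b = 0 → Q b = 0) {R : ι × ι →₀ ℚ}
    (hR : ∀ c, R c = Q c.1 c.2) (F : ι → ι → V) :
    (R.sum fun c r => r • F c.1 c.2) = p.sum fun b _ => (Q b).sum fun c r => r • F b c := by
  classical
  have h1 : R.curry = Finsupp.onFinset p.support Q (fun b hb => by
      rw [Finsupp.mem_support_iff]
      exact fun h' => hb (h b h')) := Finsupp.ext fun b => Finsupp.ext fun c => hR (b, c)
  rw [← Finsupp.sum_curry_index R fun b c r => r • F b c, h1]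
  exact Finsupp.onFinset_sum _ fun b => Finsupp.sum_zero_index

namespace Comparison

variable {n m : ℕ} {S : DGA.{u}} {T : DGA.{v}} (X : Comparison n m S T)

/-- The integral over the fundamental class of `T`. -/
noncomputable def intT : T.carrier →ₗ[ℚ] ℚ := X.P.J ∘ₗ T.classMap

/-- The integral over the fundamental class of `S`. -/
noncomputable def intS : S.carrier →ₗ[ℚ] ℚ := X.P.J ∘ₗ X.G.toAlgHom.toLinearMap ∘ₗ S.classMap

theorem intT_apply (y : T.carrier) : X.intT y = X.P.J (T.classMap y) := rfl

theorem intS_apply (y : S.carrier) : X.intS y = X.P.J (X.G.toAlgHom (S.classMap y)) := rfl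

theorem intT_d (y : T.carrier) : X.intT (T.d y) = 0 := by rw [intT_apply, classMap_d, map_zero]

theorem intS_d (y : S.carrier) : X.intS (S.d y) = 0 := by
  rw [intS_apply, classMap_d, map_zero, map_zero]

/-- The properties of a map defined on the generators of degree at most `j`: it is a chain map,
preserves integrals of closed elements, and induces `G` on cohomology in degrees at most
`3n - 3`. -/
structure Stage (j : ℕ) (f : ∀ a, T.deg (X.B.w a)) : Prop where
  chain : ∀ a, X.B.w a ≤ j → T.d (f a : T.carrier) = X.B.ev T f (S.d (X.B.x a))
  int : ∀ y ∈ X.B.alg {b | X.B.w b ≤ j}, y ∈ S.deg m → S.d y = 0 →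
    X.intT (X.B.ev T f y) = X.intS y
  low : ∀ {i y}, i + 3 ≤ 3 * n → y ∈ S.deg i → S.d y = 0 →
    T.classMap (X.B.ev T f y) = X.G.toAlgHom (S.classMap y)

theorem ev_congr {f f' : ∀ a, T.deg (X.B.w a)} {s : Set X.B.ι} (h : ∀ a ∈ s, f a = f' a)
    {y : S.carrier} (hy : y ∈ X.B.alg s) : X.B.ev T f y = X.B.ev T f' y := by
  have h1 : Set.EqOn (X.B.ev T f) (X.B.ev T f') (X.B.x '' s) := by
    rintro _ ⟨a, ha, rfl⟩
    rw [X.B.ev_x, X.B.ev_x, h a ha]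
  exact AlgHom.eqOn_adjoin_iff.2 h1 hy

/-- The integral form of the agreement of the Bianchi–Massey tensors. -/
theorem int_form {κ : Type u} (Q : κ →₀ ℚ) (e e' : κ → S.cohomology.E)
    (h1 : symmetrise S.cohomology.deg (S.cohomology.g2E
      (Q.sum fun i r => r • G2.mk S.cohomology.eDeg (e i) (e' i))) = 0)
    (h2 : (Q.sum fun i r => r • G2.mk S.cohomology.eDeg (e i) (e' i)) ∈
      G2.deg S.cohomology.eDeg (m + 1)) :
    X.intS (Q.sum fun i r => r • (X.cS.γ (e i) * X.cS.sqE (e' i))) =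
      X.intT (Q.sum fun i r => r •
        (X.cT.γ (X.G.eMap (e i)) * X.cT.sqE (X.G.eMap (e' i)))) := by
  have h := X.tensor ⟨_, h1, h2⟩
  rw [BMChoice.coe_tensor_eq, BMChoice.coe_tensor_eq, BMChoice.classMap_form_sum] at h
  rw [intS_apply, h, intT_apply, ← BMChoice.classMap_form_sum]
  congr 3
  change X.G.g2eMap (Q.sum fun i r => r • G2.mk S.cohomology.eDeg (e i) (e' i)) = _
  rw [map_finsuppSum]
  exact Finsupp.sum_congr fun i _ => by rw [map_smul]; rfl

/-- A map that represents `G` on the closed generators represents `G` on the algebra generated by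
them. -/
theorem classMap_ev_of_mem_alg_C {f : ∀ a, T.deg (X.B.w a)}
    (hf : ∀ a ∈ X.B.C, (f a : T.carrier) = X.cT.α (X.G.toAlgHom (X.B.cl a))) {y : S.carrier}
    (hy : y ∈ X.B.alg X.B.C) :
    T.d (X.B.ev T f y) = 0 ∧ T.classMap (X.B.ev T f y) = X.G.toAlgHom (S.classMap y) := by
  induction hy using Algebra.adjoin_induction with
  | mem y hy =>
    obtain ⟨a, ha, rfl⟩ := hy
    rw [X.B.ev_x, hf a ha, X.cT.d_α, X.cT.classMap_α, X.B.cl_of_notMem ha.1]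
    exact ⟨rfl, rfl⟩
  | algebraMap r =>
    rw [Algebra.algebraMap_eq_smul_one, map_smul, map_one, map_smul, map_smul, map_smul, map_smul,
      T.d_one, smul_zero, classMap_one, classMap_one, map_one]
    exact ⟨rfl, rfl⟩
  | add y z _ _ hy hz =>
    rw [map_add, map_add, map_add, map_add, map_add, hy.1, hz.1, hy.2, hz.2, add_zero]
    exact ⟨rfl, rfl⟩
  | mul y z hyC hzC hy hz =>
    rw [map_mul, d_mul_of_closed hy.1 hz.1, classMap_mul hy.1 hz.1, hy.2, hz.2, ← map_mul,
      classMap_mul (X.B.d_eq_zero_of_mem_alg_C hyC) (X.B.d_eq_zero_of_mem_alg_C hzC)]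
    exact ⟨rfl, rfl⟩

/-- The families `p` of elements of the algebra of closed generators for which `∑ x_b p_b` is
closed of degree `m`. -/
def syzygies : Submodule ℚ (X.B.ι →₀ S.carrier) where
  carrier := {p | (∀ b, p b ∈ X.B.alg X.B.C) ∧ (∀ b, p b ∈ S.deg (m - X.B.w b)) ∧
    (∀ b, ¬ (b ∈ X.B.L ∧ X.B.w b ≤ m) → p b = 0) ∧
    Finsupp.lsum ℚ (fun b => LinearMap.mulLeft ℚ (S.d (X.B.x b))) p = 0}
  add_mem' := by
    rintro p p' ⟨h1, h2, h3, h4⟩ ⟨h1', h2', h3', h4'⟩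
    exact ⟨fun b => add_mem (h1 b) (h1' b), fun b => add_mem (h2 b) (h2' b),
      fun b hb => by rw [Finsupp.add_apply, h3 b hb, h3' b hb, add_zero],
      by rw [map_add, h4, h4', add_zero]⟩
  zero_mem' := ⟨fun b => zero_mem _, fun b => zero_mem _, fun b _ => rfl, map_zero _⟩
  smul_mem' := by
    rintro c p ⟨h1, h2, h3, h4⟩
    exact ⟨fun b => Subalgebra.smul_mem _ (h1 b) c, fun b => Submodule.smul_mem _ c (h2 b),
      fun b hb => by rw [Finsupp.smul_apply, h3 b hb, smul_zero], by rw [map_smul, h4, smul_zero]⟩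

theorem sum_of_mem_syzygies {p : X.B.ι →₀ S.carrier} (hp : p ∈ X.syzygies) :
    (p.sum fun b y => S.d (X.B.x b) * y) = 0 := hp.2.2.2

/-- The defect of integrals vanishes on families of exact elements. This is where the
Bianchi–Massey tensors enter: an exact family is a combination of the differentials of generators,
so that the relation `∑ d x_b p_b = 0` gives an element of `ℬ`. -/
theorem defect_eq_zero (hm : m + 3 ≤ 5 * n) {t : X.B.ι → S.cohomology.E}
    {q : X.B.ι → (X.B.ι × X.B.ι →₀ ℚ)}
    (htq : ∀ a, X.B.w a + 3 ≤ 3 * n → t a ∈ S.cohomology.eDeg (X.B.w a + 1) ∧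
      (∀ c, q a c ≠ 0 →
        (c.1 ∈ X.B.C ∧ X.B.w c.1 + 2 ≤ 2 * n) ∧ c.2 ∈ X.B.C ∧ X.B.w c.2 + 2 ≤ 2 * n) ∧
      S.d (X.B.x a) = (q a).sum (fun c r => r • (X.B.x c.1 * X.B.x c.2)) ∧
      (t a : G2 S.cohomology.deg) =
        (q a).sum fun c r => r • G2.mk S.cohomology.deg (X.B.cl c.1) (X.B.cl c.2))
    (hsqS : ∀ a, X.B.w a + 3 ≤ 3 * n → X.cS.sqE (t a) = S.d (X.B.x a))
    {ψ : S.carrier →ₐ[ℚ] T.carrier}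
    (hsqT : ∀ a, X.B.w a + 3 ≤ 3 * n → X.cT.sqE (X.G.eMap (t a)) = ψ (S.d (X.B.x a)))
    {p : X.B.ι →₀ S.carrier} (hp : p ∈ X.syzygies) (hp0 : ∀ b, S.classMap (p b) = 0) :
    X.intS (p.sum fun b y => X.B.x b * y) =
      X.intT (p.sum fun b y => X.cT.γ (X.G.eMap (t b)) * ψ y) := by
  classical
  have hsum := X.sum_of_mem_syzygies hp
  obtain ⟨h1, h2, h3, -⟩ := hp
  -- each `p b` is a linear combination of differentials of generators
  have hex : ∀ b, ∃ Q : X.B.ι →₀ ℚ, (p b = 0 → Q = 0) ∧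
      (∀ c, Q c ≠ 0 → X.B.w c + 3 ≤ 3 * n ∧ X.B.w b + X.B.w c + 1 = m) ∧
      p b = Q.sum fun c r => r • S.d (X.B.x c) := by
    intro b
    by_cases hb : p b = 0
    · exact ⟨0, fun _ => rfl, fun c hc => absurd rfl hc, by rw [hb, Finsupp.sum_zero_index]⟩
    have hbL : b ∈ X.B.L ∧ X.B.w b ≤ m := by
      by_contra h
      exact hb (h3 b h)
    have hle := X.B.two_mul_le hbL.1.1
    have hd : S.d (p b) = 0 := X.B.d_eq_zero_of_mem_alg_C (h1 b)
    obtain ⟨y, hy⟩ := (classMap_eq_zero hd).1 (hp0 b)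
    have hdeg := h2 b
    cases hi : m - X.B.w b with
    | zero =>
      rw [hi] at hdeg
      refine absurd ?_ hb
      rw [← GCAlg.pr_of_mem hdeg, ← hy]
      exact S.proj_zero_d y
    | succ i =>
      rw [hi] at hdeg
      obtain ⟨r, hr, hrd⟩ := exists_primitive_mem hdeg ⟨y, hy⟩
      obtain ⟨Q, hQ, hQd⟩ := X.B.exists_sum_of_exact (by omega) hr
      refine ⟨Q, fun h => absurd h hb, fun c hc => ?_, by rw [← hrd, hQd]⟩
      obtain ⟨h4, h5⟩ := hQ c hc
      exact ⟨h4.2, by omega⟩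
  choose Q hQ0 hQ1 hQ2 using hex
  obtain ⟨R, hR⟩ := exists_matrix p Q hQ0
  have hsupp : ∀ c, R c ≠ 0 → (X.B.w c.1 + 3 ≤ 3 * n ∧ X.B.w c.2 + 3 ≤ 3 * n) ∧
      X.B.w c.1 + X.B.w c.2 + 1 = m := by
    intro c hc
    rw [hR] at hc
    obtain ⟨h4, h5⟩ := hQ1 c.1 c.2 hc
    refine ⟨⟨?_, h4⟩, h5⟩
    by_contra h6
    rw [hQ0 c.1 (h3 c.1 fun h => h6 h.1.2)] at hc
    exact hc rfl
  have hrel : (R.sum fun c r => r • (S.d (X.B.x c.1) * S.d (X.B.x c.2))) = 0 := by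
    rw [sum_matrix hQ0 hR fun b c => S.d (X.B.x b) * S.d (X.B.x c), ← hsum]
    refine Finsupp.sum_congr fun b _ => ?_
    conv_rhs => rw [hQ2 b, Finsupp.mul_sum]
    exact Finsupp.sum_congr fun c _ => (mul_smul_comm _ _ _).symm
  have hsym := X.B.symmetrise_eq_zero (t := t) (q := q) (P := fun a => X.B.w a + 3 ≤ 3 * n)
    (fun a ha => (htq a ha).2.2) R (fun c hc => (hsupp c hc).1) hrel
  have hdeg : (R.sum fun c r => r • G2.mk S.cohomology.eDeg (t c.1) (t c.2)) ∈
      G2.deg S.cohomology.eDeg (m + 1) := by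
    refine Submodule.sum_mem _ fun c hc => Submodule.smul_mem _ _ (Submodule.subset_span ?_)
    obtain ⟨⟨h4, h5⟩, h6⟩ := hsupp c (Finsupp.mem_support_iff.1 hc)
    exact ⟨X.B.w c.1 + 1, X.B.w c.2 + 1, by omega, _, (htq _ h4).1, _, (htq _ h5).1, rfl⟩
  have hint := X.int_form R (fun c => t c.1) (fun c => t c.2) hsym hdeg
  have hS : (R.sum fun c r => r • (X.cS.γ (t c.1) * X.cS.sqE (t c.2))) =
      p.sum fun b y => X.cS.γ (t b) * y := by
    rw [sum_matrix hQ0 hR fun b c => X.cS.γ (t b) * X.cS.sqE (t c)]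
    refine Finsupp.sum_congr fun b _ => ?_
    conv_rhs => rw [hQ2 b, Finsupp.mul_sum]
    refine Finsupp.sum_congr fun c hc => ?_
    rw [mul_smul_comm, hsqS c (hQ1 b c (Finsupp.mem_support_iff.1 hc)).1]
  have hT : (R.sum fun c r => r •
      (X.cT.γ (X.G.eMap (t c.1)) * X.cT.sqE (X.G.eMap (t c.2)))) =
      p.sum fun b y => X.cT.γ (X.G.eMap (t b)) * ψ y := by
    rw [sum_matrix hQ0 hR fun b c => X.cT.γ (X.G.eMap (t b)) * X.cT.sqE (X.G.eMap (t c))]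
    refine Finsupp.sum_congr fun b _ => ?_
    conv_rhs => rw [hQ2 b, map_finsuppSum, Finsupp.mul_sum]
    refine Finsupp.sum_congr fun c hc => ?_
    rw [map_smul, mul_smul_comm, hsqT c (hQ1 b c (Finsupp.mem_support_iff.1 hc)).1]
  rw [hS, hT] at hint
  rw [← hint, intS_apply, intS_apply]
  congr 2
  rw [map_finsuppSum, map_finsuppSum]
  refine Finsupp.sum_congr fun b hb => ?_
  have hbL : b ∈ X.B.L ∧ X.B.w b ≤ m := by
    by_contra h
    exact (Finsupp.mem_support_iff.1 hb) (h3 b h)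
  have hcl : S.d (X.B.x b - X.cS.γ (t b)) = 0 := by
    rw [map_sub, ← hsqS b hbL.1.2, sub_eq_zero]
    exact (X.cS.d_γ (t b)).symm
  have h5 := classMap_mul hcl (X.B.d_eq_zero_of_mem_alg_C (h1 b))
  rw [hp0 b, mul_zero, sub_mul, map_sub] at h5
  exact sub_eq_zero.1 h5

end Comparison

end DGA

namespace DGA

namespace Comparison

variable {n m : ℕ} {S : DGA.{u}} {T : DGA.{v}} (X : Comparison n m S T)

/-- In degrees at most `3n - 3`, a closed generator is mapped to a representative of the image of its
class, and a generator in `N` to the primitive chosen by the Bianchi–Massey data of `T`. The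
remaining defect of integrals is removed by adding closed elements to the images of the generators
in `N`, which Poincaré duality provides. -/
theorem exists_stage_low (hn : 2 ≤ n) (hm : m + 3 ≤ 5 * n)
    [FiniteDimensional ℚ T.cohomology.carrier] : ∃ f, X.Stage (3 * n - 3) f := by
  classical
  obtain ⟨t, q, htq⟩ := X.B.exists_relations
  have hsqS : ∀ a, X.B.w a + 3 ≤ 3 * n → X.cS.sqE (t a) = S.d (X.B.x a) := by
    intro a ha
    obtain ⟨-, h2, h3, h4⟩ := htq a ha
    rw [X.cS.sqE_eq_sum h4, h3]
    refine Finsupp.sum_congr fun c hc => ?_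
    obtain ⟨⟨h5, h6⟩, h7, h8⟩ := h2 c (Finsupp.mem_support_iff.1 hc)
    rw [X.B.α_cl X.cS h5.1 h6, X.B.α_cl X.cS h7.1 h8]
  -- the first approximation to the map
  let f₀ (a : X.B.ι) : T.deg (X.B.w a) :=
    if h : X.B.w a + 3 ≤ 3 * n then
      if a ∈ X.B.N then ⟨X.cT.γ (X.G.eMap (t a)), X.cT.γ_mem (X.G.eMap_mem _ _ (htq a h).1)⟩
      else ⟨X.cT.α (X.G.toAlgHom (X.B.cl a)), X.cT.α_mem (X.G.map_deg (X.B.cl_mem a))⟩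
    else 0
  have hf₀C : ∀ a ∈ X.B.C, (f₀ a : T.carrier) = X.cT.α (X.G.toAlgHom (X.B.cl a)) := by
    intro a ha
    simp only [f₀, dif_pos ha.2, if_neg ha.1]
  have hf₀L : ∀ a ∈ X.B.L, (f₀ a : T.carrier) = X.cT.γ (X.G.eMap (t a)) := by
    intro a ha
    simp only [f₀, dif_pos ha.2, if_pos ha.1]
  set ψ := X.B.ev T f₀ with hψ
  have hsqT : ∀ a, X.B.w a + 3 ≤ 3 * n → X.cT.sqE (X.G.eMap (t a)) = ψ (S.d (X.B.x a)) := by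
    intro a ha
    obtain ⟨-, h2, h3, h4⟩ := htq a ha
    have h5 : (X.G.eMap (t a) : G2 T.cohomology.deg) = (q a).sum fun c r => r •
        G2.mk T.cohomology.deg (X.G.toAlgHom (X.B.cl c.1)) (X.G.toAlgHom (X.B.cl c.2)) := by
      change X.G.g2 (t a : G2 S.cohomology.deg) = _
      rw [h4, map_finsuppSum]
      exact Finsupp.sum_congr fun c _ => by rw [map_smul]; rfl
    rw [X.cT.sqE_eq_sum h5, h3, map_finsuppSum]
    refine Finsupp.sum_congr fun c hc => ?_
    obtain ⟨⟨h5, -⟩, h7, -⟩ := h2 c (Finsupp.mem_support_iff.1 hc)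
    rw [map_smul, map_mul, hψ, X.B.ev_x, X.B.ev_x, hf₀C _ h5, hf₀C _ h7]
  -- the correction
  let e : X.syzygies →ₗ[ℚ] X.B.ι →₀ T.cohomology.carrier :=
    Finsupp.mapRange.linearMap (X.G.toAlgHom.toLinearMap ∘ₗ S.classMap) ∘ₗ X.syzygies.subtype
  let δ : X.syzygies →ₗ[ℚ] ℚ :=
    (X.intS ∘ₗ Finsupp.lsum ℚ (fun b => LinearMap.mulLeft ℚ (X.B.x b)) -
      X.intT ∘ₗ Finsupp.lsum ℚ
        (fun b => LinearMap.mulLeft ℚ (f₀ b : T.carrier) ∘ₗ ψ.toLinearMap)) ∘ₗ X.syzygies.subtype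
  have he : ∀ p b, e p b = X.G.toAlgHom (S.classMap ((p : X.B.ι →₀ S.carrier) b)) :=
    fun p b => rfl
  have hδ : ∀ p : X.syzygies, δ p = X.intS ((p : X.B.ι →₀ S.carrier).sum fun b y => X.B.x b * y) -
      X.intT ((p : X.B.ι →₀ S.carrier).sum fun b y => (f₀ b : T.carrier) * ψ y) := fun p => rfl
  have hclosed : ∀ (p : X.syzygies) b, S.d ((p : X.B.ι →₀ S.carrier) b) = 0 := fun p b =>
    X.B.d_eq_zero_of_mem_alg_C (p.2.1 b)
  have he1 : ∀ (p : X.syzygies) b, e p b ∈ T.cohomology.deg (m - X.B.w b) := fun p b => by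
    rw [he]
    exact X.G.map_deg (classMap_mem (hclosed p b) (p.2.2.1 b))
  have he2 : ∀ (p : X.syzygies) b, m < X.B.w b → e p b = 0 := fun p b hb => by
    rw [he, p.2.2.2.1 b fun h => absurd h.2 (by omega), map_zero, map_zero]
  have hker : ∀ p : X.syzygies, e p = 0 → δ p = 0 := fun p hp => by
    have hp0 : ∀ b, S.classMap ((p : X.B.ι →₀ S.carrier) b) = 0 := fun b => by
      refine X.bij.1 ?_
      rw [← he, hp, map_zero]
      rfl
    rw [hδ, X.defect_eq_zero hm htq hsqS hsqT p.2 hp0, sub_eq_zero]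
    congr 1
    refine Finsupp.sum_congr fun b hb => ?_
    rw [hf₀L b (by_contra fun h => (Finsupp.mem_support_iff.1 hb)
      (p.2.2.2.1 b fun h' => h h'.1))]
  obtain ⟨v, hv, hvδ⟩ := X.P.exists_pairing (Y := X.syzygies) X.B.w e δ he1 he2 hker
  choose u hu hdu hcu using fun b => exists_classMap_eq (hv b)
  let f (a : X.B.ι) : T.deg (X.B.w a) := if a ∈ X.B.N then f₀ a + ⟨u a, hu a⟩ else f₀ a
  have hfN : ∀ a ∈ X.B.N, (f a : T.carrier) = f₀ a + u a := fun a ha => by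
    simp only [f, if_pos ha]; rfl
  have hfC : ∀ a ∈ X.B.C, f a = f₀ a := fun a ha => if_neg ha.1
  have hcong : ∀ y ∈ X.B.alg X.B.C, X.B.ev T f y = ψ y := fun y hy => X.ev_congr hfC hy
  have hC : ∀ y ∈ X.B.alg X.B.C,
      T.d (ψ y) = 0 ∧ T.classMap (ψ y) = X.G.toAlgHom (S.classMap y) := fun y hy =>
    X.classMap_ev_of_mem_alg_C hf₀C hy
  refine ⟨f, ⟨fun a ha => ?_, fun y hy hym hdy => ?_, fun {i y} hi hy hdy => ?_⟩⟩
  · have ha' : X.B.w a + 3 ≤ 3 * n := by omega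
    rw [hcong _ (X.B.d_mem_alg_C ha')]
    by_cases haN : a ∈ X.B.N
    · rw [hfN a haN, map_add, hdu, add_zero, hf₀L a ⟨haN, ha'⟩, ← hsqT a ha']
      exact X.cT.d_γ _
    · rw [hfC a ⟨haN, ha'⟩, hf₀C a ⟨haN, ha'⟩, X.cT.d_α, X.B.d_eq_zero a haN, map_zero]
  · obtain ⟨z, hz, -, p, p1, p2, p3, hyz, hrel⟩ := X.B.exists_decomp_closed (by omega) hm
      (X.B.alg_mono (fun a ha => by
        have h1 : X.B.w a ≤ 3 * n - 3 := ha
        change X.B.w a + 3 ≤ 3 * n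
        omega) hy) hym hdy
    have hp : p ∈ X.syzygies := ⟨p1, p2, p3, hrel⟩
    have h1 := hvδ ⟨p, hp⟩
    rw [hδ] at h1
    have h2 : (e ⟨p, hp⟩).sum (fun b z => X.P.J (v b * z)) =
        X.intT (p.sum fun b y => u b * ψ y) := by
      rw [map_finsuppSum]
      refine (Finsupp.sum_mapRange_index
        (hf := map_zero (X.G.toAlgHom.toLinearMap ∘ₗ S.classMap))
        fun b => by rw [mul_zero, map_zero]).trans ?_
      refine Finsupp.sum_congr fun b _ => ?_
      change X.P.J (v b * X.G.toAlgHom (S.classMap (p b))) = X.P.J (T.classMap (u b * ψ (p b)))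
      rw [classMap_mul (hdu b) (hC _ (p1 b)).1, (hC _ (p1 b)).2, hcu]
    have h3 : X.B.ev T f y = ψ z +
        ((p.sum fun b y => (f₀ b : T.carrier) * ψ y) + p.sum fun b y => u b * ψ y) := by
      rw [hyz, map_add, hcong z hz, map_finsuppSum, ← Finsupp.sum_add]
      congr 1
      refine Finsupp.sum_congr fun b hb => ?_
      have hbL : b ∈ X.B.L := by_contra fun h => (Finsupp.mem_support_iff.1 hb)
        (p3 b fun h' => h h'.1)
      rw [map_mul, X.B.ev_x, hfN b hbL.1, hcong _ (p1 b), add_mul]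
    rw [h3, map_add, map_add, ← h2, h1, hyz, map_add, add_sub_cancel, intT_apply, (hC z hz).2]
    rfl
  · have hyC := X.B.mem_alg_C_of_closed hi hy hdy
    rw [hcong y hyC, (hC y hyC).2]

end Comparison

end DGA

/-! ### Realisation of an isomorphism in high degrees -/

namespace DGA

namespace Comparison

variable {n m : ℕ} {S : DGA.{u}} {T : DGA.{v}} (X : Comparison n m S T)

theorem exists_rep {l : ℕ} {y : T.cohomology.carrier} (hy : y ∈ T.cohomology.deg l) :
    ∃ s ∈ S.deg l, S.d s = 0 ∧ X.G.toAlgHom (S.classMap s) = y := by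
  obtain ⟨x, rfl⟩ := X.bij.2 y
  have hx : x ∈ S.cohomology.deg l := (GCAlg.Iso.ofBijective X.G X.bij).map_deg_iff.1 hy
  obtain ⟨s, hs, hds, rfl⟩ := exists_classMap_eq hx
  exact ⟨s, hs, hds, rfl⟩

theorem ev_d_of_chain {f : ∀ a, T.deg (X.B.w a)} {s : Set X.B.ι}
    (hf : ∀ a ∈ s, T.d (f a : T.carrier) = X.B.ev T f (S.d (X.B.x a))) {y : S.carrier}
    (hy : y ∈ X.B.alg s) : T.d (X.B.ev T f y) = X.B.ev T f (S.d y) := by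
  refine GCAlg.adjoin_induction_left (H := S.toGCAlg)
    (p := fun y => T.d (X.B.ev T f y) = X.B.ev T f (S.d y)) ?_ (fun a ha y _ ih => ?_)
    (fun y z hy hz => ?_) (fun c y hy => ?_) hy
  · rw [map_one, T.d_one, S.d_one, map_zero]
  · rw [map_mul, X.B.ev_x, T.leibniz _ (f a).2, S.leibniz _ (X.B.x_mem a), map_add, map_smul,
      map_mul, map_mul, X.B.ev_x, ih, hf a ha]
  · rw [map_add, map_add, map_add, map_add, hy, hz]
  · rw [map_smul, map_smul, map_smul, map_smul, hy]

theorem _root_.DGA.ModelGens.d_mem_alg_le {n : ℕ} {S : DGA.{u}} (B : ModelGens.{u, v} n S) {j : ℕ}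
    {y : S.carrier} (hy : y ∈ B.alg {b | B.w b ≤ j}) : S.d y ∈ B.alg {b | B.w b ≤ j} := by
  refine GCAlg.adjoin_induction_left (H := S.toGCAlg)
    (p := fun y => S.d y ∈ B.alg {b | B.w b ≤ j}) ?_ (fun a ha y hy ih => ?_)
    (fun y z hy hz => ?_) (fun c y hy => ?_) hy
  · rw [S.d_one]; exact zero_mem _
  · rw [S.leibniz _ (B.x_mem a)]
    refine add_mem (mul_mem (B.alg_mono (fun b hb => ?_) (B.d_mem a)) hy)
      (Subalgebra.smul_mem _ (mul_mem (B.x_mem_alg ha) ih) _)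
    have h1 : B.w b < B.w a := hb
    have h2 : B.w a ≤ j := ha
    change B.w b ≤ j
    omega
  · rw [map_add]; exact add_mem hy hz
  · rw [map_smul]; exact Subalgebra.smul_mem _ hy c

theorem _root_.DGA.ModelGens.d_x_mem_alg {n : ℕ} {S : DGA.{u}} (B : ModelGens.{u, v} n S) {j : ℕ}
    {a : B.ι} (ha : B.w a ≤ j + 1) : S.d (B.x a) ∈ B.alg {b | B.w b ≤ j} :=
  B.alg_mono (fun b hb => by
    have h1 : B.w b < B.w a := hb
    change B.w b ≤ j
    omega) (B.d_mem a)

variable {X} in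
theorem Stage.congr {j : ℕ} (hj : 3 * n - 3 ≤ j) {f f' : ∀ a, T.deg (X.B.w a)}
    (hf : X.Stage j f) (h : ∀ a, X.B.w a ≤ j → f a = f' a) : X.Stage j f' := by
  have hcong : ∀ y ∈ X.B.alg {b | X.B.w b ≤ j}, X.B.ev T f y = X.B.ev T f' y := fun y hy =>
    X.ev_congr (fun a ha => h a ha) hy
  refine ⟨fun a ha => ?_, fun y hy hym hdy => ?_, fun {i y} hi hy hdy => ?_⟩
  · rw [← h a ha, ← hcong _ (X.B.d_x_mem_alg (by omega)), hf.chain a ha]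
  · rw [← hcong y hy, hf.int y hy hym hdy]
  · rw [← hcong y (X.B.alg_mono (fun a ha => ?_) (X.B.mem_alg_le hy)), hf.low hi hy hdy]
    have h1 : X.B.w a ≤ i := ha
    change X.B.w a ≤ j
    omega

variable {X} in
/-- The obstruction to extending a map to a generator vanishes by Poincaré duality. -/
theorem Stage.exists_primitive (hn : 2 ≤ n) (hm : m + 3 ≤ 5 * n) {j : ℕ} (hj : 3 * n - 3 ≤ j)
    {f : ∀ a, T.deg (X.B.w a)} (hf : X.Stage j f) {a : X.B.ι} (ha : X.B.w a = j + 1) :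
    ∃ g ∈ T.deg (X.B.w a), T.d g = X.B.ev T f (S.d (X.B.x a)) := by
  have hmem := X.B.d_x_mem_alg ha.le
  have hdeg := S.d_mem (X.B.x_mem a)
  have hcl : T.d (X.B.ev T f (S.d (X.B.x a))) = 0 := by
    rw [X.ev_d_of_chain (s := {b | X.B.w b ≤ j}) (fun b hb => hf.chain b hb) hmem, S.d_d, map_zero]
  have h0 : T.classMap (X.B.ev T f (S.d (X.B.x a))) = 0 := by
    refine X.P.ext_left fun l z hz => ?_
    rw [mul_zero, map_zero]
    by_cases hl : l + (X.B.w a + 1) = m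
    · obtain ⟨s, hs, hds, rfl⟩ := X.exists_rep hz
      have hsA : s ∈ X.B.alg {b | X.B.w b ≤ j} := X.B.alg_mono (fun b hb => by
        have h1 : X.B.w b ≤ l := hb
        change X.B.w b ≤ j
        omega) (X.B.mem_alg_le hs)
      have hψs : T.d (X.B.ev T f s) = 0 := by
        rw [X.ev_d_of_chain (s := {b | X.B.w b ≤ j}) (fun b hb => hf.chain b hb) hsA, hds, map_zero]
      rw [← hf.low (by omega) hs hds, ← classMap_mul hψs hcl, ← map_mul]
      have h1 := hf.int (s * S.d (X.B.x a)) (mul_mem hsA hmem)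
        (by have h5 := SetLike.mul_mem_graded hs hdeg; rwa [hl] at h5) (d_mul_of_closed hds (S.d_d _))
      refine h1.trans ?_
      have h2 : S.d (s * X.B.x a) = (-1 : ℚ) ^ l • (s * S.d (X.B.x a)) := by
        rw [S.leibniz _ hs, hds, zero_mul, zero_add]
      have h3 := X.intS_d (s * X.B.x a)
      rw [h2, map_smul] at h3
      exact (smul_eq_zero.1 h3).resolve_left (pow_ne_zero _ (by norm_num))
    · refine X.P.J_of_ne (SetLike.mul_mem_graded hz (classMap_mem hcl ?_)) hl
      exact X.B.ev_mem f hdeg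
  exact exists_primitive_mem (X.B.ev_mem f hdeg) ((classMap_eq_zero hcl).1 h0)

/-- The closed elements of degree `m` in the algebra of generators of degree at most `j + 1`, in the
form `z + ∑ x_b p_b`. -/
def closedPairs (j : ℕ) : Submodule ℚ (S.carrier × (X.B.ι →₀ S.carrier)) where
  carrier := {y | (y.1 ∈ X.B.alg {b | X.B.w b ≤ j} ∧ y.1 ∈ S.deg m) ∧
    (∀ b, y.2 b ∈ X.B.alg {b | X.B.w b ≤ j} ∧ y.2 b ∈ S.deg (m - X.B.w b) ∧ S.d (y.2 b) = 0) ∧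
    (∀ b, ¬ (X.B.w b = j + 1 ∧ X.B.w b ≤ m) → y.2 b = 0) ∧
    S.d y.1 + Finsupp.lsum ℚ (fun b => LinearMap.mulLeft ℚ (S.d (X.B.x b))) y.2 = 0}
  add_mem' := by
    rintro p p' ⟨h1, h2, h3, h4⟩ ⟨h1', h2', h3', h4'⟩
    refine ⟨⟨add_mem h1.1 h1'.1, add_mem h1.2 h1'.2⟩, fun b => ⟨add_mem (h2 b).1 (h2' b).1,
      add_mem (h2 b).2.1 (h2' b).2.1, ?_⟩, fun b hb => ?_, ?_⟩
    · change S.d (p.2 b + p'.2 b) = 0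
      rw [map_add, (h2 b).2.2, (h2' b).2.2, add_zero]
    · change p.2 b + p'.2 b = 0
      rw [h3 b hb, h3' b hb, add_zero]
    · rw [Prod.fst_add, Prod.snd_add, map_add, map_add, add_add_add_comm, h4, h4', add_zero]
  zero_mem' := ⟨⟨zero_mem _, zero_mem _⟩, fun b => ⟨zero_mem _, zero_mem _, map_zero _⟩,
    fun b _ => rfl, by rw [Prod.fst_zero, Prod.snd_zero, map_zero, map_zero, add_zero]⟩
  smul_mem' := by
    rintro c p ⟨h1, h2, h3, h4⟩
    refine ⟨⟨Subalgebra.smul_mem _ h1.1 c, Submodule.smul_mem _ c h1.2⟩, fun b =>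
      ⟨Subalgebra.smul_mem _ (h2 b).1 c, Submodule.smul_mem _ c (h2 b).2.1, ?_⟩, fun b hb => ?_, ?_⟩
    · change S.d (c • p.2 b) = 0
      rw [map_smul, (h2 b).2.2, smul_zero]
    · change c • p.2 b = 0
      rw [h3 b hb, smul_zero]
    · rw [Prod.smul_fst, Prod.smul_snd, map_smul, map_smul, ← smul_add, h4, smul_zero]

/-- Closed elements of degree `m` are at most linear in the generators of degree `j + 1`, since
`m < 2 (j + 1)`, and freeness makes the coefficients closed. -/
theorem exists_closedPair (hn : 2 ≤ n) (hm : m + 3 ≤ 5 * n) {j : ℕ} (hj : 3 * n - 3 ≤ j)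
    {y : S.carrier} (hy : y ∈ X.B.alg {b | X.B.w b ≤ j + 1}) (hym : y ∈ S.deg m)
    (hdy : S.d y = 0) : ∃ q ∈ X.closedPairs j, y = q.1 + q.2.sum fun b y => X.B.x b * y := by
  have hT : {b | X.B.w b ≤ j + 1} = {b | X.B.w b ≤ j} ∪ {b | X.B.w b = j + 1} := by
    ext b
    simp only [Set.mem_union, Set.mem_ofPred_eq]
    omega
  rw [hT] at hy
  obtain ⟨z, hz, hzm, p, p1, p2, p3, h⟩ := GCAlg.exists_decomp_linear X.B.x_mem (q := j + 1)
    (fun b hb => hb.ge) (by omega) hy hym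
  have hpk : ∀ b ∈ p.support, X.B.w b = j + 1 := fun b hb => by
    by_contra h'
    exact (Finsupp.mem_support_iff.1 hb) (p3 b fun h'' => h' h''.1)
  have hd : S.d (p.sum fun b y => X.B.x b * y) = (p.sum fun b y => S.d (X.B.x b) * y) +
      (Finsupp.mapRange.linearMap ((-1 : ℚ) ^ (j + 1) • S.d) p).sum fun b y => X.B.x b * y := by
    rw [map_finsuppSum]
    refine Eq.trans ?_ (congrArg ((p.sum fun b y => S.d (X.B.x b) * y) + ·)
      (Finsupp.sum_mapRange_index (hf := map_zero ((-1 : ℚ) ^ (j + 1) • S.d))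
        fun b => mul_zero _).symm)
    rw [← Finsupp.sum_add]
    refine Finsupp.sum_congr fun b hb => ?_
    rw [S.leibniz _ (X.B.x_mem b), hpk b hb, LinearMap.smul_apply, mul_smul_comm]
  have hz' : S.d z + (p.sum fun b y => S.d (X.B.x b) * y) ∈ X.B.alg {b | X.B.w b ≤ j} :=
    add_mem (X.B.d_mem_alg_le hz) (Subalgebra.sum_mem _ fun b hb =>
      mul_mem (X.B.d_x_mem_alg (hpk b hb).le) (p1 b))
  have h0 : S.d z + (p.sum fun b y => S.d (X.B.x b) * y) +
      (Finsupp.mapRange.linearMap ((-1 : ℚ) ^ (j + 1) • S.d) p).sum (fun b y => X.B.x b * y) = 0 := by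
    rw [add_assoc, ← hd, ← map_add, ← h, hdy]
  have hP := X.B.free hz' _ (fun b => Subalgebra.smul_mem _ (X.B.d_mem_alg_le (p1 b)) _)
    (fun b hb => by
      have h1 : p b = 0 := p3 b fun h' => by
        have h2 : X.B.w b ≤ j := hb
        have h3 : X.B.w b = j + 1 := h'.1
        omega
      change ((-1 : ℚ) ^ (j + 1) • S.d) (p b) = 0
      rw [h1, map_zero]) h0
  rw [hP, Finsupp.sum_zero_index, add_zero] at h0
  refine ⟨(z, p), ⟨⟨hz, hzm⟩, fun b => ⟨p1 b, p2 b, ?_⟩, p3, h0⟩, h⟩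
  have h1 : (-1 : ℚ) ^ (j + 1) • S.d (p b) = 0 := DFunLike.congr_fun hP b
  exact (smul_eq_zero.1 h1).resolve_left (pow_ne_zero _ (by norm_num))

variable {X} in
/-- The defect of integrals vanishes on families of exact elements: up to an exact element,
`z + ∑ x_b d r_b` is then in the domain of the previous stage. -/
theorem Stage.defect_eq_zero {j : ℕ} (hj : 3 * n - 3 ≤ j) (hm : m + 3 ≤ 5 * n) (hn : 2 ≤ n)
    {f : ∀ a, T.deg (X.B.w a)} (hf : X.Stage j f) {g : X.B.ι → T.carrier}
    (hg : ∀ b, X.B.w b = j + 1 → g b ∈ T.deg (X.B.w b) ∧ T.d (g b) = X.B.ev T f (S.d (X.B.x b)))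
    {q : S.carrier × (X.B.ι →₀ S.carrier)} (hq : q ∈ X.closedPairs j)
    (hq0 : ∀ b, S.classMap (q.2 b) = 0) :
    X.intS (q.1 + q.2.sum fun b y => X.B.x b * y) =
      X.intT (X.B.ev T f q.1 + q.2.sum fun b y => g b * X.B.ev T f y) := by
  obtain ⟨z, p⟩ := q
  obtain ⟨⟨h1, h1'⟩, h2, h3, h4⟩ := hq
  set ψ := X.B.ev T f with hψ
  have hchain : ∀ y ∈ X.B.alg {b | X.B.w b ≤ j}, T.d (ψ y) = ψ (S.d y) := fun y hy =>
    X.ev_d_of_chain (s := {b | X.B.w b ≤ j}) (fun b hb => hf.chain b hb) hy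
  -- primitives of the coefficients
  have hex : ∀ b, ∃ r ∈ X.B.alg {b | X.B.w b ≤ j}, S.d r = p b ∧ S.d (X.B.x b) * r ∈ S.deg m := by
    intro b
    by_cases hb : p b = 0
    · exact ⟨0, zero_mem _, by rw [hb, map_zero], by rw [mul_zero]; exact zero_mem _⟩
    have hbk : X.B.w b = j + 1 ∧ X.B.w b ≤ m := by
      by_contra h
      exact hb (h3 b h)
    obtain ⟨y, hy⟩ := (classMap_eq_zero (h2 b).2.2).1 (hq0 b)
    have hdeg := (h2 b).2.1
    cases hi : m - X.B.w b with
    | zero =>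
      rw [hi] at hdeg
      refine absurd ?_ hb
      rw [← GCAlg.pr_of_mem hdeg]
      change S.toGCAlg.pr 0 (p b) = 0
      rw [← show S.d y = p b from hy]
      exact S.proj_zero_d y
    | succ i =>
      rw [hi] at hdeg
      obtain ⟨r, hr, hrd⟩ := exists_primitive_mem hdeg ⟨y, hy⟩
      refine ⟨r, X.B.alg_mono (fun a ha => ?_) (X.B.mem_alg_le hr), hrd, ?_⟩
      · have h5 : X.B.w a ≤ i := ha
        change X.B.w a ≤ j
        omega
      · have h5 := SetLike.mul_mem_graded (S.d_mem (X.B.x_mem b)) hr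
        rwa [show X.B.w b + 1 + i = m by omega] at h5
  choose r hrA hrd hrm using hex
  have hpk : ∀ b ∈ p.support, X.B.w b = j + 1 := fun b hb => by
    by_contra h'
    exact (Finsupp.mem_support_iff.1 hb) (h3 b fun h'' => h' h''.1)
  let c : ℚ := (-1 : ℚ) ^ (j + 1)
  have hc : c * c = 1 := by rw [← mul_pow]; simp
  let D : S.carrier := ∑ b ∈ p.support, S.d (X.B.x b) * r b
  have hDA : D ∈ X.B.alg {b | X.B.w b ≤ j} := Subalgebra.sum_mem _ fun b hb =>
    mul_mem (X.B.d_x_mem_alg (hpk b hb).le) (hrA b)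
  have hxr : (p.sum fun b y => X.B.x b * y) =
      c • (S.d (∑ b ∈ p.support, X.B.x b * r b) - D) := by
    rw [map_sum, ← Finset.sum_sub_distrib, Finset.smul_sum]
    refine Finset.sum_congr rfl fun b hb => ?_
    rw [S.leibniz _ (X.B.x_mem b), hrd, hpk b hb, add_sub_cancel_left, smul_smul, hc, one_smul]
  have hgr : (p.sum fun b y => g b * ψ y) =
      c • (T.d (∑ b ∈ p.support, g b * ψ (r b)) - ψ D) := by
    rw [map_sum, map_sum, ← Finset.sum_sub_distrib, Finset.smul_sum]
    refine Finset.sum_congr rfl fun b hb => ?_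
    obtain ⟨h5, h6⟩ := hg b (hpk b hb)
    rw [T.leibniz _ h5, h6, hchain _ (hrA b), hrd, map_mul, hpk b hb, add_sub_cancel_left,
      smul_smul, hc, one_smul]
  -- integration by parts replaces `z + ∑ x_b p_b` by the closed element `z - c D`
  have hcl : S.d (z - c • D) = 0 := by
    have h5 : (p.sum fun b y => S.d (X.B.x b) * y) = - c • S.d D := by
      rw [map_sum, Finset.smul_sum]
      refine Finset.sum_congr rfl fun b hb => ?_
      rw [S.leibniz _ (S.d_mem (X.B.x_mem b)), S.d_d, zero_mul, zero_add, hrd, hpk b hb, smul_smul,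
        pow_succ]
      change _ = (- c * (c * -1)) • _
      rw [show - c * (c * -1) = c * c by ring, hc, one_smul]
    have h6 : S.d z + (p.sum fun b y => S.d (X.B.x b) * y) = 0 := h4
    rw [h5, neg_smul, ← sub_eq_add_neg] at h6
    rw [map_sub, map_smul, h6]
  have hint := hf.int (z - c • D) (sub_mem h1 (Subalgebra.smul_mem _ hDA c))
    (sub_mem h1' (Submodule.smul_mem _ c (Submodule.sum_mem _ fun b _ => hrm b))) hcl
  change X.intS (z + p.sum fun b y => X.B.x b * y) = X.intT (ψ z + p.sum fun b y => g b * ψ y)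
  rw [hxr, hgr, map_add, map_add, map_smul, map_smul, map_sub, map_sub, X.intS_d, X.intT_d]
  rw [map_sub, map_smul, map_sub, map_sub, map_smul, map_smul] at hint
  rw [zero_sub, zero_sub, smul_neg, smul_neg, ← sub_eq_add_neg, ← sub_eq_add_neg]
  exact hint.symm

end Comparison

end DGA

namespace DGA

namespace Comparison

variable {n m : ℕ} {S : DGA.{u}} {T : DGA.{v}} {X : Comparison n m S T}

/-- A stage extends to the generators of the next degree: primitives of the images of their
differentials exist, and Poincaré duality provides closed corrections of these that make the defect
of integrals vanish. -/
theorem Stage.exists_succ (hn : 2 ≤ n) (hm : m + 3 ≤ 5 * n)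
    [FiniteDimensional ℚ T.cohomology.carrier] {j : ℕ} (hj : 3 * n - 3 ≤ j)
    {f : ∀ a, T.deg (X.B.w a)} (hf : X.Stage j f) :
    ∃ f', (∀ a, X.B.w a ≤ j → f' a = f a) ∧ X.Stage (j + 1) f' := by
  classical
  have hprim : ∀ b, ∃ g ∈ T.deg (X.B.w b), X.B.w b = j + 1 →
      T.d g = X.B.ev T f (S.d (X.B.x b)) := by
    intro b
    by_cases hb : X.B.w b = j + 1
    · obtain ⟨g, hg, hgd⟩ := hf.exists_primitive hn hm hj hb
      exact ⟨g, hg, fun _ => hgd⟩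
    · exact ⟨0, zero_mem _, fun h => absurd h hb⟩
  choose g hg hgd using hprim
  set ψ := X.B.ev T f with hψ
  have hchain : ∀ y ∈ X.B.alg {b | X.B.w b ≤ j}, T.d (ψ y) = ψ (S.d y) := fun y hy =>
    X.ev_d_of_chain (s := {b | X.B.w b ≤ j}) (fun b hb => hf.chain b hb) hy
  let e : X.closedPairs j →ₗ[ℚ] X.B.ι →₀ T.cohomology.carrier :=
    Finsupp.mapRange.linearMap (X.G.toAlgHom.toLinearMap ∘ₗ S.classMap) ∘ₗ
      LinearMap.snd ℚ _ _ ∘ₗ (X.closedPairs j).subtype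
  let δ : X.closedPairs j →ₗ[ℚ] ℚ :=
    (X.intS ∘ₗ (LinearMap.fst ℚ _ _ +
        Finsupp.lsum ℚ (fun b => LinearMap.mulLeft ℚ (X.B.x b)) ∘ₗ LinearMap.snd ℚ _ _) -
      X.intT ∘ₗ (ψ.toLinearMap ∘ₗ LinearMap.fst ℚ _ _ +
        Finsupp.lsum ℚ (fun b => LinearMap.mulLeft ℚ (g b) ∘ₗ ψ.toLinearMap) ∘ₗ
          LinearMap.snd ℚ _ _)) ∘ₗ (X.closedPairs j).subtype
  have he : ∀ (q : X.closedPairs j) b, e q b =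
      X.G.toAlgHom (S.classMap ((q : S.carrier × (X.B.ι →₀ S.carrier)).2 b)) := fun q b => rfl
  have hδ : ∀ q : X.closedPairs j, δ q =
      X.intS ((q : S.carrier × (X.B.ι →₀ S.carrier)).1 +
        (q : S.carrier × (X.B.ι →₀ S.carrier)).2.sum fun b y => X.B.x b * y) -
      X.intT (ψ (q : S.carrier × (X.B.ι →₀ S.carrier)).1 +
        (q : S.carrier × (X.B.ι →₀ S.carrier)).2.sum fun b y => g b * ψ y) := fun q => rfl
  have he1 : ∀ (q : X.closedPairs j) b, e q b ∈ T.cohomology.deg (m - X.B.w b) := fun q b => by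
    rw [he]
    exact X.G.map_deg (classMap_mem (q.2.2.1 b).2.2 (q.2.2.1 b).2.1)
  have he2 : ∀ (q : X.closedPairs j) b, m < X.B.w b → e q b = 0 := fun q b hb => by
    rw [he, q.2.2.2.1 b fun h => absurd h.2 (by omega), map_zero, map_zero]
  have hker : ∀ q : X.closedPairs j, e q = 0 → δ q = 0 := fun q hq => by
    rw [hδ, sub_eq_zero]
    refine hf.defect_eq_zero hj hm hn (fun b hb => ⟨hg b, hgd b hb⟩) q.2 fun b => X.bij.1 ?_
    rw [← he, hq, map_zero]
    rfl
  obtain ⟨v, hv, hvδ⟩ := X.P.exists_pairing (Y := X.closedPairs j) X.B.w e δ he1 he2 hker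
  choose u hu hdu hcu using fun b => exists_classMap_eq (hv b)
  let f' (a : X.B.ι) : T.deg (X.B.w a) :=
    if X.B.w a = j + 1 then ⟨g a + u a, add_mem (hg a) (hu a)⟩ else f a
  have hf'1 : ∀ a, X.B.w a = j + 1 → (f' a : T.carrier) = g a + u a := fun a ha => by
    simp only [f', if_pos ha]
  have hf'0 : ∀ a, X.B.w a ≤ j → f' a = f a := fun a ha => if_neg (by omega)
  have hcong : ∀ y ∈ X.B.alg {b | X.B.w b ≤ j}, X.B.ev T f' y = ψ y := fun y hy =>
    X.ev_congr (fun a ha => hf'0 a ha) hy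
  have hj' := hf.congr hj fun a ha => (hf'0 a ha).symm
  refine ⟨f', hf'0, ⟨fun a ha => ?_, fun y hy hym hdy => ?_, hj'.low⟩⟩
  · by_cases haj : X.B.w a = j + 1
    · rw [hcong _ (X.B.d_x_mem_alg ha), hf'1 a haj, map_add, hdu, add_zero, hgd a haj]
    · exact hj'.chain a (by omega)
  · obtain ⟨q, hq, hyq⟩ := X.exists_closedPair hn hm hj hy hym hdy
    obtain ⟨⟨h1, -⟩, h2, h3, -⟩ := id hq
    have h4 := hvδ ⟨q, hq⟩
    rw [hδ] at h4
    have hk : ∀ b ∈ q.2.support, X.B.w b = j + 1 := fun b hb => by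
      by_contra h
      exact (Finsupp.mem_support_iff.1 hb) (h3 b fun h' => h h'.1)
    have h5 : (e ⟨q, hq⟩).sum (fun b z => X.P.J (v b * z)) =
        X.intT (q.2.sum fun b y => u b * ψ y) := by
      rw [map_finsuppSum]
      refine (Finsupp.sum_mapRange_index
        (hf := map_zero (X.G.toAlgHom.toLinearMap ∘ₗ S.classMap))
        fun b => by rw [mul_zero, map_zero]).trans ?_
      refine Finsupp.sum_congr fun b hb => ?_
      have hbj := hk b hb
      change X.P.J (v b * X.G.toAlgHom (S.classMap (q.2 b))) =
        X.P.J (T.classMap (u b * ψ (q.2 b)))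
      have hcl : T.d (ψ (q.2 b)) = 0 := by
        rw [hchain _ (h2 b).1, (h2 b).2.2, map_zero]
      -- the complementary degree `m - w b` lies in the range where the map represents `G`
      rw [classMap_mul (hdu b) hcl, hcu, hf.low (by omega) (h2 b).2.1 (h2 b).2.2]
    have h6 : X.B.ev T f' y = (ψ q.1 + q.2.sum fun b y => g b * ψ y) +
        q.2.sum fun b y => u b * ψ y := by
      rw [hyq, map_add, hcong _ h1, map_finsuppSum, add_assoc, ← Finsupp.sum_add]
      congr 1
      refine Finsupp.sum_congr fun b hb => ?_
      rw [map_mul, X.B.ev_x, hf'1 b (hk b hb), hcong _ (h2 b).1, add_mul]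
    rw [h6, map_add, ← h5, h4, hyq, add_sub_cancel]

variable (X) in
/-- A single map that satisfies the conditions of all stages. -/
theorem exists_stage (hn : 2 ≤ n) (hm : m + 3 ≤ 5 * n)
    [FiniteDimensional ℚ T.cohomology.carrier] :
    ∃ f : ∀ a, T.deg (X.B.w a), ∀ j, 3 * n - 3 ≤ j → X.Stage j f := by
  obtain ⟨f, hf⟩ := exists_of_rank_steps (r := fun a => X.B.w a - (3 * n - 3))
    (X := fun a => T.deg (X.B.w a))
    (fun k f => ∀ i, k = i + 1 → X.Stage (3 * n - 3 + i) f)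
    (fun k f f' h hf i hi => (hf i hi).congr (by omega) fun a ha => h a (by omega))
    (fun f i hi => by omega)
    (fun k f hf => by
      cases k with
      | zero =>
        obtain ⟨f', hf'⟩ := X.exists_stage_low hn hm
        refine ⟨f', fun a ha => by omega, fun i hi => ?_⟩
        obtain rfl : i = 0 := by omega
        exact hf'
      | succ k =>
        obtain ⟨f', h, hf'⟩ := (hf k rfl).exists_succ hn hm (by omega)
        refine ⟨f', fun a ha => h a (by omega), fun i hi => ?_⟩
        obtain rfl : i = k + 1 := by omega
        exact hf')
  refine ⟨f, fun j hj => ?_⟩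
  have h := hf (j - (3 * n - 3) + 1) _ rfl
  rwa [show 3 * n - 3 + (j - (3 * n - 3)) = j by omega] at h

/-- The isomorphism of a comparison is induced by a DGA homomorphism. In degrees above `3n - 3` this
follows from the equality of integrals and Poincaré duality. -/
theorem exists_hom (X : Comparison n m S T) (hn : 2 ≤ n) (hm : m + 3 ≤ 5 * n)
    [FiniteDimensional ℚ T.cohomology.carrier] :
    ∃ ψ : DGA.Hom S T, ∀ x, ψ.cohMap.toAlgHom x = X.G.toAlgHom x := by
  obtain ⟨f, hf⟩ := X.exists_stage hn hm
  have hd : ∀ y, T.d (X.B.ev T f y) = X.B.ev T f (S.d y) := fun y =>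
    X.ev_d_of_chain (s := Set.univ)
      (fun a _ => (hf (3 * n - 3 + X.B.w a) (by omega)).chain a (by omega)) (X.B.mem_adjoin y)
  let ψ : DGA.Hom S T :=
    { toAlgHom := X.B.ev T f
      map_deg := fun hy => X.B.ev_mem f hy
      map_d := fun y => (hd y).symm }
  have hlow := @(hf (3 * n - 3) le_rfl).low
  have hclass : ∀ {i y}, y ∈ S.deg i → S.d y = 0 →
      T.classMap (X.B.ev T f y) = X.G.toAlgHom (S.classMap y) := by
    intro i y hy hdy
    by_cases hi : i + 3 ≤ 3 * n
    · exact hlow hi hy hdy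
    have hcl : T.d (X.B.ev T f y) = 0 := by rw [hd, hdy, map_zero]
    refine X.P.ext_left fun l z hz => ?_
    by_cases hl : l + i = m
    · obtain ⟨s, hs, hds, rfl⟩ := X.exists_rep hz
      have hcs : T.d (X.B.ev T f s) = 0 := by rw [hd, hds, map_zero]
      rw [← map_mul, ← classMap_mul hds hdy, ← hlow (by omega) hs hds, ← classMap_mul hcs hcl,
        ← map_mul]
      have h5 := SetLike.mul_mem_graded hs hy
      rw [hl] at h5
      exact (hf (3 * n - 3 + m) (by omega)).int (s * y)
        (X.B.alg_mono (fun b hb => by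
          have h6 : X.B.w b ≤ m := hb
          change X.B.w b ≤ 3 * n - 3 + m
          omega) (X.B.mem_alg_le h5)) h5 (d_mul_of_closed hds hdy)
    · exact (X.P.J_of_ne (SetLike.mul_mem_graded hz (classMap_mem hcl (X.B.ev_mem f hy))) hl).trans
        (X.P.J_of_ne (SetLike.mul_mem_graded hz (X.G.map_deg (classMap_mem hdy hy))) hl).symm
  refine ⟨ψ, fun x => ?_⟩
  induction x using DirectSum.Decomposition.inductionOn S.cohomology.deg with
  | zero => rw [map_zero, map_zero]
  | homogeneous x =>
    obtain ⟨z, hz, hdz, hzx⟩ := exists_classMap_eq x.2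
    rw [← hzx, ← hclass hz hdz, classMap_of_closed hdz, ψ.cohMap_toCoh,
      classMap_of_closed (A := T) (z := X.B.ev T f z) (by rw [hd, hdz, map_zero])]
    rfl
  | add a b ha hb => rw [map_add, map_add, ha, hb]

end Comparison

end DGA

/-! ### Classification of minimal Sullivan algebras -/

namespace DGA

theorem isConnected_cohomology {A : DGA.{u}} {j : ℕ} (hA : A.IsConnected j) :
    A.cohomology.IsConnected j := by
  obtain ⟨h1, h2, h3⟩ := hA
  refine ⟨⟨0, 1, fun h => ?_⟩, le_antisymm ?_ ?_, fun k hk hkj => ?_⟩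
  · obtain ⟨y, hy⟩ := A.toCoh_eq_zero.1 ((map_one A.toCoh).trans h.symm)
    have h4 := A.proj_zero_d y
    rw [hy] at h4
    have h5 : GradedAlgebra.proj A.deg 0 (1 : A.carrier) = 1 := by
      rw [GradedAlgebra.proj_apply,
        DirectSum.decompose_of_mem_same _ (SetLike.one_mem_graded A.deg)]
    exact one_ne_zero (h5.symm.trans h4)
  · intro x hx
    obtain ⟨z, hz, rfl⟩ := A.mem_cohomology_deg.1 hx
    rw [h2] at hz
    obtain ⟨c, hc⟩ := Submodule.mem_span_singleton.1 hz
    refine Submodule.mem_span_singleton.2 ⟨c, ?_⟩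
    rw [show z = c • 1 from Subtype.ext hc.symm, map_smul, map_one]
  · rw [Submodule.span_le, Set.singleton_subset_iff]
    exact SetLike.one_mem_graded A.cohomology.deg
  · rw [eq_bot_iff]
    intro x hx
    obtain ⟨z, hz, rfl⟩ := A.mem_cohomology_deg.1 hx
    rw [h3 k hk hkj, Submodule.mem_bot] at hz
    rw [show z = 0 from Subtype.ext hz, map_zero]
    exact zero_mem _

/-- A DGA isomorphism obtained from two bijective homomorphisms with the same source. -/
noncomputable def Iso.ofBijectives {A : DGA.{u}} {B : DGA.{v}} {C : DGA.{w}} (f : Hom A B)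
    (g : Hom A C) (hf : Function.Bijective f.toAlgHom) (hg : Function.Bijective g.toAlgHom) :
    Iso B C where
  toIso := (GCAlg.Iso.ofBijective f.toHom hf).symm.trans (GCAlg.Iso.ofBijective g.toHom hg)
  map_d x := by
    obtain ⟨y, rfl⟩ := hf.2 x
    have h : ∀ z, (AlgEquiv.ofBijective f.toAlgHom hf).symm (f.toAlgHom z) = z := fun z =>
      (AlgEquiv.ofBijective f.toAlgHom hf).symm_apply_apply z
    change g.toAlgHom ((AlgEquiv.ofBijective f.toAlgHom hf).symm (B.d (f.toAlgHom y))) =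
      C.d (g.toAlgHom ((AlgEquiv.ofBijective f.toAlgHom hf).symm (f.toAlgHom y)))
    rw [← f.map_d', h, h, g.map_d']

theorem Iso.ofBijectives_apply {A : DGA.{u}} {B : DGA.{v}} {C : DGA.{w}} {f : Hom A B}
    {g : Hom A C} (hf : Function.Bijective f.toAlgHom) (hg : Function.Bijective g.toAlgHom)
    (x : A.carrier) : (ofBijectives f g hf hg).hom.toAlgHom (f.toAlgHom x) = g.toAlgHom x :=
  congrArg g.toAlgHom ((AlgEquiv.ofBijective f.toAlgHom hf).symm_apply_apply x)

theorem bianchiMassey_comm_of_cohMap_eq {A : DGA.{u}} {B : DGA.{v}}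
    {G : GCAlg.Hom A.cohomology B.cohomology} (f : Hom A B)
    (h : ∀ x, f.cohMap.toAlgHom x = G.toAlgHom x) (m : ℕ) :
    G.degMap m ∘ₗ A.bianchiMassey m = B.bianchiMassey m ∘ₗ G.bMap (m + 1) := by
  have h1 : f.cohMap = G := by
    have h2 : f.cohMap.toAlgHom = G.toAlgHom := AlgHom.ext h
    cases hf : f.cohMap
    cases G
    rw [hf] at h2
    cases h2
    rfl
  exact h1 ▸ bianchiMassey_natural f m

/-- A minimal model of `M₁` maps to `M₂` realising `G`, and quasi-isomorphisms between minimal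
Sullivan algebras are isomorphisms. -/
theorem exists_iso_of_comm_bianchiMassey {n m : ℕ} (hn : 2 ≤ n) (hm : m ≤ 5 * n - 3) {M₁ : DGA.{u}}
    {M₂ : DGA.{v}} (h₁ : M₁.IsConnected (n - 1)) (h₁' : M₁.IsMinimalSullivan)
    (hP₁ : M₁.cohomology.IsPoincare m) (h₂ : M₂.IsConnected (n - 1)) (h₂' : M₂.IsMinimalSullivan)
    (hP₂ : M₂.cohomology.IsPoincare m) (G : GCAlg.Iso M₁.cohomology M₂.cohomology)
    (hG : G.hom.degMap m ∘ₗ M₁.bianchiMassey m = M₂.bianchiMassey m ∘ₗ G.hom.bMap (m + 1)) :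
    ∃ φ : DGA.Iso M₁ M₂, ∀ x, φ.hom.cohMap.toAlgHom x = G.hom.toAlgHom x := by
  have hfin₁ : FiniteDimensional ℚ M₁.cohomology.carrier := hP₁.1
  have hfin₂ : FiniteDimensional ℚ M₂.cohomology.carrier := hP₂.1
  obtain ⟨M⟩ := exists_minimalModel hn M₁ (isConnected_cohomology h₁)
  obtain ⟨P⟩ := hP₂.nonempty_duality
  let G' : GCAlg.Iso M.S.cohomology M₂.cohomology :=
    (GCAlg.Iso.ofBijective M.φ.cohMap M.quasiIso).trans G
  have hG' : ∀ x, G'.hom.toAlgHom x = G.hom.toAlgHom (M.φ.cohMap.toAlgHom x) := fun x => rfl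
  let X : Comparison n m M.S M₂ :=
    { B := M.gens
      G := G'.hom
      bij := G'.toAlgEquiv.bijective
      P := P
      cS := Classical.choice (nonempty_bmChoice M.S)
      cT := Classical.choice (nonempty_bmChoice M₂)
      tensor := fun t => by
        have h3 := LinearMap.congr_fun (bianchiMassey_natural M.φ m) t
        have h4 := LinearMap.congr_fun hG (M.φ.cohMap.bMap (m + 1) t)
        rw [GCAlg.Hom.bMap_comp hG']
        refine Eq.trans ?_ (congrArg Subtype.val h4)
        exact congrArg (fun y => (G.hom.degMap m y : M₂.cohomology.carrier)) h3 }
  obtain ⟨ψ, hψ⟩ := X.exists_hom hn (by omega)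
  have hψq : ψ.IsQuasiIso := by
    have h3 : ⇑ψ.cohMap.toAlgHom = ⇑G'.hom.toAlgHom := funext hψ
    rw [Hom.IsQuasiIso, h3]
    exact G'.toAlgEquiv.bijective
  have hS := M.isMinimalSullivan (by omega)
  have hS' := M.isConnected (by omega) (isConnected_cohomology h₁).1
  have hb₁ := M.quasiIso.bijective (by omega) hS' h₁ hS h₁'
  have hb₂ := hψq.bijective (by omega) hS' h₂ hS h₂'
  refine ⟨Iso.ofBijectives M.φ ψ hb₁ hb₂, fun x => ?_⟩
  obtain ⟨y, rfl⟩ := M.quasiIso.2 x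
  rw [← hG', ← hψ]
  obtain ⟨z, rfl⟩ := M.S.toCoh_surjective y
  rw [ψ.cohMap_toCoh, M.φ.cohMap_toCoh, Hom.cohMap_toCoh]
  exact congrArg M₂.toCoh (Subtype.ext (Iso.ofBijectives_apply hb₁ hb₂ z))

end DGA

theorem theorem3p1 (n : ℕ) (hn : 2 ≤ n) :
    (∀ m : ℕ, m ≤ 5 * n - 2 →
      ∀ H : GCAlg.{u}, H.IsConnected (n - 1) → H.IsPoincare m →
      ∀ F : H.bDeg (m + 1) →ₗ[ℚ] H.deg m,
        ∃ (M : DGA.{u}) (e : GCAlg.Iso M.cohomology H),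
          M.IsConnected (n - 1) ∧ M.IsMinimalSullivan ∧
          e.hom.degMap m ∘ₗ M.bianchiMassey m = F ∘ₗ e.hom.bMap (m + 1)) ∧
    (∀ m : ℕ, m ≤ 5 * n - 3 →
      ∀ (M₁ : DGA.{u}) (M₂ : DGA.{v}),
        M₁.IsConnected (n - 1) → M₁.IsMinimalSullivan → M₁.cohomology.IsPoincare m →
        M₂.IsConnected (n - 1) → M₂.IsMinimalSullivan → M₂.cohomology.IsPoincare m →
      ∀ G : GCAlg.Iso M₁.cohomology M₂.cohomology,
        (∃ φ : DGA.Iso M₁ M₂, ∀ x, φ.hom.cohMap.toAlgHom x = G.hom.toAlgHom x) ↔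
          G.hom.degMap m ∘ₗ M₁.bianchiMassey m =
            M₂.bianchiMassey m ∘ₗ G.hom.bMap (m + 1)) := by
  refine ⟨fun m hm H hH hP F => DGA.exists_minimalSullivan_realisation hn hm H hH hP F,
    fun m hm M₁ M₂ h₁ h₁' hP₁ h₂ h₂' hP₂ G => ⟨fun ⟨φ, hφ⟩ =>
      DGA.bianchiMassey_comm_of_cohMap_eq φ.hom hφ m, fun hG =>
      DGA.exists_iso_of_comm_bianchiMassey hn hm h₁ h₁' hP₁ h₂ h₂' hP₂ G hG⟩⟩
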